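/- **Setting.** Let $b\ge 2$ be an integer, $\beta,\lambda\ge 0$ and $h\in L^1([0,\beta])$ (real-valued). Let $\Sigma$ be the set of càdlàg functions $[0,\beta]\to\{\pm1\}$ with the $\sigma$-algebra generated by the evaluations, and write $f\bullet g=\int_0^\beta f(t)g(t)\,dt$. Let $\varphi$ be the probability measure on $\Sigma$ obtained by taking, with equal probability, one of the two functions that flip exactly at the points of a Poisson process of intensity $\lambda$ on $[0,\beta]$. For a finite graph $G=(V,E)$ and integrable fields $h_i$ ($i\in V$), let $\mu=\mu_{G,(h_i)}$ be the probability measure on $\Sigma^V$ with density proportional to $\exp\big(\sum_{\{i,j\}\in E}\sigma_i\bullet\sigma_j+\sum_i h_i\bullet\sigma_i\big)$ with respect to $\varphi^{\otimes V}$ (the path-integral quantum Ising model, with free boundary condition in imaginary time). For $x\in V$ and $\rho\in\Sigma^V$ let $\mu_x^\rho$ be the law of the configuration that equals $\rho$ off $x$ and whose spin at $x$ has density proportional to $\exp\big((h_x+\sum_{y\sim x}\rho_y)\bullet\sigma_x\big)$ with respect to $\varphi$, and put $(\mu_xf)(\rho)=\int f\,d\mu_x^\rho$. The heat-bath Glauber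 dynamics has generator $\mathcal L=\sum_{x\in V}(\mu_x-I)$ and semigroup $P_t=e^{t\mathcal L}$; $P_t^\rho$ is its law at time $t$ started from $\rho$. With variance and covariance under $\mu$, and $\|\cdot\|_{TV}$ the total variation distance $\sup_A|\cdot(A)|$, put $$\mathrm{gap}=\inf_{f\in L^2(\mu),\,\mathrm{Var}(f)>0}\frac{\mathrm{Cov}(f,-\mathcal Lf)}{\mathrm{Var}(f)},\qquad T_{\mathrm{mix}}=\inf\big\{t\ge0:\ \|P_t^\rho-P_t^\eta\|_{TV}\le e^{-1}\ \ \forall\rho,\eta\in\Sigma^V\big\}.$$ Let $\mathbb T_\infty$ be the infinite rooted tree in which every vertex has $b$ children, and $\mathbb T_l$ its subtree of vertices of depth at most $l$. For a finite $A\subset\mathbb T_\infty$ and $\tau\in\Sigma^{\mathbb T_\infty}$ let $\mu_A^\tau$ be the above measure on the subgraph induced on $A$, with field $h+\sum_{y\notin A,\,y\sim z}\tau_y$ at $z\in A$. Let $$\gamma=\sup\ \big\|\mu_A^{\eta}(\sigma_z\in\cdot)-\mu_A^{\bar\eta}(\sigma_z\in\cdot)\big\|_{TV},$$ the supremum being over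 all $l\ge 0$, all $A\subset\mathbb T_l$, all $y\in\mathbb T_\infty\setminus A$ adjacent to $A$, all neighbours $z\in A$ of $y$, and all $\eta,\bar\eta\in\Sigma^{\mathbb T_\infty}$ that differ only at $y$. Let $\kappa(\tau)$ be the infimum of the $\kappa\ge0$ for which there is $l_0\ge0$ such that, for every $x\in\mathbb T_\infty$ and $m\ge0$, with $T$ the tree of descendants of $x$ (including $x$) up to $m$ generations below $x$, and for every $z\in T$ at graph distance $|z-x|\ge l_0$ from $x$, $$\mu_T^\tau(\sigma_z\bullet 1\mid\sigma_x\equiv+1)-\mu_T^\tau(\sigma_z\bullet1\mid\sigma_x\equiv-1)\le\kappa^{|z-x|}.$$ **Theorem (fast mixing).** Fix $\tau\in\Sigma^{\mathbb T_\infty}$ and assume $\kappa(\tau)\,\gamma\,b<1$. Consider, for $l\ge0$, the Glauber dynamics on $\mathbb T_l$ with boundary condition $\tau$, i.e. reversible with respect to $\mu^\tau_{\mathbb T_l}$. Then: 1. there is a constant $c>0$, independent of $l$, such that the spectral gap of this dynamics is at least $c$ for every $l\ge0$; 2. there is a constant $C<\infty$, independent of $l$, such that the mixing time of this dynamics is at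 most $C\max(l,1)$ for every $l\ge0$ (so at most $Cl$ for every $l\ge1$). -/

import Mathlib

open MeasureTheory ProbabilityTheory Filter Topology
open scoped ENNReal NNReal

noncomputable section

namespace QuantumIsing

/-! ### Single spins -/

/-- Lebesgue measure on the imaginary-time interval `[0, β]`. -/
def timeMeasure (β : ℝ) : Measure (Set.Icc (0 : ℝ) β) :=
  (volume : Measure ℝ).comap Subtype.val

instance instFiniteTimeMeasure (β : ℝ) : IsFiniteMeasure (timeMeasure β) := by
  refine ⟨?_⟩
  rw [timeMeasure, (MeasurableEmbedding.subtype_coe measurableSet_Icc).comap_apply]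
  refine lt_of_le_of_lt (measure_mono (t := Set.Icc (0 : ℝ) β) ?_) (by simp)
  rintro _ ⟨x, -, rfl⟩
  exact x.2

/-- A single spin: a cadlag function `[0, β] → {±1}`. -/
def SpinPath (β : ℝ) : Type :=
  {σ : Set.Icc (0 : ℝ) β → ℝ //
    (∀ t, σ t = 1 ∨ σ t = -1) ∧
    (∀ t, ContinuousWithinAt σ (Set.Ici t) t) ∧
    (∀ t, ∃ a, Tendsto σ (𝓝[<] t) (𝓝 a))}

namespace SpinPath

variable {β : ℝ}

instance : CoeFun (SpinPath β) (fun _ => Set.Icc (0 : ℝ) β → ℝ) := ⟨fun σ => σ.1⟩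

/-- The σ-algebra generated by the evaluations `σ ↦ σ t`. -/
instance : MeasurableSpace (SpinPath β) :=
  inferInstanceAs (MeasurableSpace (Subtype _))

/-- The constant path. -/
def const (β : ℝ) (s : ℤˣ) : SpinPath β :=
  ⟨fun _ => ((s : ℤ) : ℝ), by
    refine ⟨fun _ => ?_, fun _ => continuousWithinAt_const, fun _ => ⟨_, tendsto_const_nhds⟩⟩
    rcases Int.units_eq_one_or s with rfl | rfl <;> simp⟩

/-- The path identically equal to `+1`. -/
def plus (β : ℝ) : SpinPath β := const β 1

/-- The path identically equal to `-1`. -/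
def minus (β : ℝ) : SpinPath β := const β (-1)

/-- The path with sign `s` that flips exactly at the points `u 0, …, u (n - 1)`. -/
def flipAt (s : ℤˣ) {n : ℕ} (u : Fin n → Set.Icc (0 : ℝ) β) : SpinPath β :=
  ⟨fun t => ((s : ℤ) : ℝ) * ∏ i, (if u i ≤ t then (-1 : ℝ) else 1), by
    refine ⟨fun t => ?_, fun t => ?_, fun t => ?_⟩
    · have h1 : ((s : ℤ) : ℝ) = 1 ∨ ((s : ℤ) : ℝ) = -1 := by
        rcases Int.units_eq_one_or s with rfl | rfl <;> simp
      have h2 : (∏ i, (if u i ≤ t then (-1 : ℝ) else 1)) = 1 ∨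
          (∏ i, (if u i ≤ t then (-1 : ℝ) else 1)) = -1 := by
        refine Finset.prod_induction _ (fun r : ℝ => r = 1 ∨ r = -1) ?_ (Or.inl rfl) ?_
        · rintro a c (rfl | rfl) (rfl | rfl) <;> norm_num
        · intro i _
          split_ifs <;> simp
      rcases h1 with h1 | h1 <;> rcases h2 with h2 | h2 <;> simp [h1, h2]
    · refine continuousWithinAt_const.mul ?_
      refine tendsto_finsetProd _ fun i _ => ?_
      refine tendsto_const_nhds.congr' ?_
      by_cases hi : u i ≤ t
      · filter_upwards [self_mem_nhdsWithin] with r hr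
        simp [hi, hi.trans hr]
      · filter_upwards [mem_nhdsWithin_of_mem_nhds (Iio_mem_nhds (not_le.1 hi))] with r hr
        simp [hi, not_le.2 (Set.mem_Iio.1 hr)]
    · refine ⟨((s : ℤ) : ℝ) * ∏ i, (if u i < t then (-1 : ℝ) else 1), ?_⟩
      refine tendsto_const_nhds.mul (tendsto_finsetProd _ fun i _ => ?_)
      refine tendsto_const_nhds.congr' ?_
      by_cases hi : u i < t
      · filter_upwards [mem_nhdsWithin_of_mem_nhds (Ioi_mem_nhds hi)] with r hr
        simp [hi, (Set.mem_Ioi.1 hr).le]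
      · filter_upwards [self_mem_nhdsWithin] with r hr
        simp [hi, (lt_of_lt_of_le (Set.mem_Iio.1 hr) (not_lt.1 hi))]⟩

theorem measurable_eval (t : Set.Icc (0 : ℝ) β) : Measurable (fun σ : SpinPath β => σ t) :=
  (measurable_pi_apply t).comp measurable_subtype_coe

/-- Joint measurability of `(σ, t) ↦ σ t`. -/
theorem measurable_uncurry :
    Measurable (fun p : SpinPath β × Set.Icc (0 : ℝ) β => p.1 p.2) := by
  by_cases hβ : 0 ≤ β
  swap
  · have : IsEmpty (Set.Icc (0 : ℝ) β) := by
      rw [Set.isEmpty_coe_sort, Set.Icc_eq_empty_iff]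
      exact hβ
    exact measurable_of_empty _
  let q : ℕ → ℝ → ℕ := fun n t => ⌊(n + 1 : ℝ) * t⌋₊
  let pt : ℕ → ℕ → Set.Icc (0 : ℝ) β := fun n k => Set.projIcc 0 β hβ ((k + 1 : ℝ) / (n + 1))
  have hconv : ∀ t : Set.Icc (0 : ℝ) β, Tendsto (fun n => pt n (q n t)) atTop (𝓝[≥] t) := by
    intro t
    refine tendsto_nhdsWithin_iff.2 ⟨?_, Eventually.of_forall fun n => ?_⟩
    · have h1 : Tendsto (fun n : ℕ => ((q n t : ℝ) + 1) / (n + 1)) atTop (𝓝 (t : ℝ)) := by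
        have h2 : Tendsto (fun n : ℕ => (t : ℝ) + 1 / ((n : ℝ) + 1)) atTop (𝓝 (t : ℝ)) := by
          simpa using (tendsto_const_nhds (x := (t : ℝ))).add
            (tendsto_one_div_add_atTop_nhds_zero_nat (𝕜 := ℝ))
        refine tendsto_of_tendsto_of_tendsto_of_le_of_le tendsto_const_nhds h2 ?_ ?_
        · intro n
          have hn : (0 : ℝ) < n + 1 := by positivity
          have := Nat.lt_floor_add_one ((n + 1 : ℝ) * (t : ℝ))
          simp only [q]
          rw [le_div_iff₀ hn]
          linarith
        · intro n
          have hn : (0 : ℝ) < n + 1 := by positivity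
          have := Nat.floor_le (mul_nonneg hn.le t.2.1)
          simp only [q]
          rw [div_le_iff₀ hn, add_mul (t : ℝ), one_div, inv_mul_cancel₀ hn.ne']
          linarith
      have := (continuous_projIcc (h := hβ)).tendsto (t : ℝ)
      rw [Set.projIcc_val] at this
      exact this.comp h1
    · have hn : (0 : ℝ) < n + 1 := by positivity
      have := Nat.lt_floor_add_one ((n + 1 : ℝ) * (t : ℝ))
      have h3 : (t : ℝ) ≤ ((q n t : ℝ) + 1) / (n + 1) := by
        simp only [q]
        rw [le_div_iff₀ hn]
        linarith
      have := Set.monotone_projIcc hβ h3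
      rw [Set.projIcc_val] at this
      exact this
  refine measurable_of_tendsto_metrizable
    (f := fun n (p : SpinPath β × Set.Icc (0 : ℝ) β) => p.1 (pt n (q n p.2))) (fun n => ?_) ?_
  · have h1 : Measurable (fun r : SpinPath β × ℕ => r.1 (pt n r.2)) :=
      measurable_from_prod_countable_left fun k => measurable_eval (pt n k)
    have h2 : Measurable (fun p : SpinPath β × Set.Icc (0 : ℝ) β => (p.1, q n p.2)) := by
      refine measurable_fst.prodMk (Nat.measurable_floor.comp ?_)
      fun_prop
    exact h1.comp h2
  · refine tendsto_pi_nhds.2 fun p => ?_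
    exact (p.1.2.2.1 p.2).tendsto.comp (hconv p.2)

end SpinPath

/-- The product `f • g = ∫₀^β f(t) g(t) dt`. -/
def dot {β : ℝ} (f g : Set.Icc (0 : ℝ) β → ℝ) : ℝ :=
  ∫ t, f t * g t ∂(timeMeasure β)

/-- The free single-spin measure: with equal probability one of the two paths flipping exactly at
the points of a Poisson point process of intensity `lam` on `[0, β]`. The process is realized by
its chaos expansion: it has `n` points with probability `e^{-lam β} (lam β)^n / n!`, and given this
the points are independent and uniform; the factor `β^n` is the mass of the product measure. -/
def freeSpin (β lam : ℝ) : Measure (SpinPath β) :=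
  Measure.sum fun n : ℕ =>
    ENNReal.ofReal (Real.exp (-(lam * β)) * lam ^ n / n.factorial) •
      ((2⁻¹ : ℝ≥0∞) •
        ((Measure.pi fun _ : Fin n => timeMeasure β).map (SpinPath.flipAt 1) +
         (Measure.pi fun _ : Fin n => timeMeasure β).map (SpinPath.flipAt (-1))))

instance instSFiniteFreeSpin (β lam : ℝ) : SFinite (freeSpin β lam) := by
  unfold freeSpin
  infer_instance

/-- The single-site Gibbs measure with longitudinal field `g`. -/
def siteGibbs (β lam : ℝ) (g : Set.Icc (0 : ℝ) β → ℝ) : Measure (SpinPath β) :=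
  (freeSpin β lam).tilted fun σ => dot σ g

/-! ### Total variation distance -/

/-- Total variation distance between probability measures. -/
def tvDist {Ω : Type*} [MeasurableSpace Ω] (μ ν : Measure Ω) : ℝ :=
  ⨆ A : {A : Set Ω // MeasurableSet A}, |μ.real A.1 - ν.real A.1|

/-! ### The quantum Ising model and its heat-bath dynamics on a finite graph -/

section Graph

variable {V : Type*} [Fintype V] {β : ℝ}

open Classical in
/-- `∑_{i ∼ j} σ_i • σ_j + ∑_i h_i • σ_i`; the first sum is over unordered pairs of neighbours,
hence the factor `1 / 2`. -/
def energy (G : SimpleGraph V) (h : V → Set.Icc (0 : ℝ) β → ℝ) (σ : V → SpinPath β) : ℝ :=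
  (1 / 2 : ℝ) * ∑ i, ∑ j, (if G.Adj i j then dot (σ i) (σ j) else 0) + ∑ i, dot (h i) (σ i)

/-- The path-integral Gibbs measure on the graph `G` with longitudinal field `h` (free boundary
condition in imaginary time): normalized density `exp (energy)` with respect to the product of the
free spin measures. -/
def gibbs (G : SimpleGraph V) (lam : ℝ) (h : V → Set.Icc (0 : ℝ) β → ℝ) :
    Measure (V → SpinPath β) :=
  (Measure.pi fun _ : V => freeSpin β lam).tilted (energy G h)

open Classical in
/-- The field `h_x + ∑_{y ∼ x} ρ_y` felt by the spin at `x`. -/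
def localField (G : SimpleGraph V) (h : V → Set.Icc (0 : ℝ) β → ℝ) (ρ : V → SpinPath β) (x : V) :
    Set.Icc (0 : ℝ) β → ℝ :=
  fun t => h x t + ∑ y, (if G.Adj x y then ρ y t else 0)

theorem measurable_dot_localField (G : SimpleGraph V) (h : V → Set.Icc (0 : ℝ) β → ℝ) (x : V) :
    Measurable (fun p : (V → SpinPath β) × SpinPath β => dot p.2 (localField G h p.1 x)) := by
  classical
  have hsum : Measurable (fun r : (V → SpinPath β) × Set.Icc (0 : ℝ) β =>
      ∑ y, (if G.Adj x y then r.1 y r.2 else 0)) := by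
    refine Finset.measurable_sum _ fun y _ => ?_
    split_ifs
    · have hy : Measurable (fun r : (V → SpinPath β) × Set.Icc (0 : ℝ) β => (r.1 y, r.2)) :=
        ((measurable_pi_apply y).comp measurable_fst).prodMk measurable_snd
      exact SpinPath.measurable_uncurry.comp hy
    · exact measurable_const
  by_cases hm : AEStronglyMeasurable (h x) (timeMeasure β)
  · have heq : (fun p : (V → SpinPath β) × SpinPath β => dot p.2 (localField G h p.1 x)) =
        fun p => ∫ t, p.2 t * (hm.mk (h x) t + ∑ y, (if G.Adj x y then p.1 y t else 0))
          ∂(timeMeasure β) := by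
      funext p
      refine integral_congr_ae ?_
      filter_upwards [hm.ae_eq_mk] with t ht
      simp only [localField]
      rw [ht]
    rw [heq]
    refine (StronglyMeasurable.integral_prod_right' (ν := timeMeasure β)
      (f := fun r : ((V → SpinPath β) × SpinPath β) × Set.Icc (0 : ℝ) β =>
        r.1.2 r.2 * (hm.mk (h x) r.2 + ∑ y, (if G.Adj x y then r.1.1 y r.2 else 0)))
      (Measurable.stronglyMeasurable ?_)).measurable
    refine (SpinPath.measurable_uncurry.comp
      ((measurable_snd.comp measurable_fst).prodMk measurable_snd)).mul ?_
    refine (hm.stronglyMeasurable_mk.measurable.comp measurable_snd).add ?_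
    exact hsum.comp ((measurable_fst.comp measurable_fst).prodMk measurable_snd)
  · have heq : (fun p : (V → SpinPath β) × SpinPath β => dot p.2 (localField G h p.1 x)) =
        fun _ => 0 := by
      funext p
      refine integral_non_aestronglyMeasurable fun hc => hm ?_
      have h1 : Measurable (fun t => p.2 t) :=
        SpinPath.measurable_uncurry.comp (measurable_const.prodMk measurable_id)
      have h2 : Measurable (fun t => ∑ y, (if G.Adj x y then p.1 y t else 0)) :=
        hsum.comp (measurable_const.prodMk measurable_id)
      refine ((h1.aestronglyMeasurable.mul hc).sub h2.aestronglyMeasurable).congr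
        (Eventually.of_forall fun t => ?_)
      have h3 : p.2 t * p.2 t = 1 := by rcases p.2.2.1 t with h | h <;> simp [h]
      simp only [Pi.sub_apply, Pi.mul_apply, localField]
      rw [← mul_assoc, h3, one_mul]
      rw [sub_eq_iff_eq_add]
    rw [heq]
    exact measurable_const

open Classical in
/-- The heat-bath kernel `ρ ↦ μ_x^ρ`: keep `ρ` off `x` and resample the spin at `x` from the
single-site Gibbs measure in the local field generated by `h` and the neighbours of `x`. -/
def heatBath (G : SimpleGraph V) (lam : ℝ) (h : V → Set.Icc (0 : ℝ) β → ℝ) (x : V) :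
    Kernel (V → SpinPath β) (V → SpinPath β) where
  toFun ρ := (siteGibbs β lam (localField G h ρ x)).map (Function.update ρ x)
  measurable' := by
    have hdot := measurable_dot_localField G h x
    have hexp : Measurable (fun p : (V → SpinPath β) × SpinPath β =>
        Real.exp (dot p.2 (localField G h p.1 x))) := Real.measurable_exp.comp hdot
    have hZ : Measurable (fun ρ : V → SpinPath β =>
        ∫ s, Real.exp (dot s (localField G h ρ x)) ∂(freeSpin β lam)) :=
      (StronglyMeasurable.integral_prod_right' (ν := freeSpin β lam)
        hexp.stronglyMeasurable).measurable
    have hupd : Measurable (fun p : (V → SpinPath β) × SpinPath β =>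
        Function.update p.1 x p.2) := by
      refine measurable_pi_lambda _ fun y => ?_
      by_cases hy : y = x
      · subst hy
        simpa using measurable_snd
      · simp only [Function.update_of_ne hy]
        exact (measurable_pi_apply y).comp measurable_fst
    refine Measure.measurable_of_measurable_coe _ fun B hB => ?_
    have hfib : ∀ ρ : V → SpinPath β, Measurable (fun s : SpinPath β => Function.update ρ x s) :=
      fun ρ => hupd.comp (measurable_const.prodMk measurable_id)
    have heq : ∀ ρ : V → SpinPath β,
        ((siteGibbs β lam (localField G h ρ x)).map (Function.update ρ x)) B =
        ∫⁻ s, Set.indicator {p : (V → SpinPath β) × SpinPath β | Function.update p.1 x p.2 ∈ B}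
          (fun p => ENNReal.ofReal (Real.exp (dot p.2 (localField G h p.1 x)) /
            ∫ s, Real.exp (dot s (localField G h p.1 x)) ∂(freeSpin β lam))) (ρ, s)
          ∂(freeSpin β lam) := by
      intro ρ
      rw [Measure.map_apply (hfib ρ) hB, siteGibbs, tilted_apply' _ _ (hfib ρ hB),
        ← lintegral_indicator (hfib ρ hB)]
      rfl
    simp_rw [heq]
    refine Measurable.lintegral_prod_right' (ν := freeSpin β lam) (Measurable.indicator ?_ (hupd hB))
    exact (hexp.div (hZ.comp measurable_fst)).ennreal_ofReal

/-- The generator `𝓛 f = ∑_x (μ_x f - f)`. -/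
def generator (G : SimpleGraph V) (lam : ℝ) (h : V → Set.Icc (0 : ℝ) β → ℝ)
    (f : (V → SpinPath β) → ℝ) : (V → SpinPath β) → ℝ :=
  fun ρ => ∑ x, ((∫ σ, f σ ∂(heatBath G lam h x ρ)) - f ρ)

/-- The spectral gap: the infimum of `Cov (f, -𝓛 f) / Var f` over `f ∈ L²(μ)` with `Var f > 0`. -/
def spectralGap (G : SimpleGraph V) (lam : ℝ) (h : V → Set.Icc (0 : ℝ) β → ℝ) : ℝ :=
  sInf {r : ℝ | ∃ f : (V → SpinPath β) → ℝ,
    MemLp f 2 (gibbs G lam h) ∧ 0 < variance f (gibbs G lam h) ∧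
    r = covariance f (-(generator G lam h f)) (gibbs G lam h) / variance f (gibbs G lam h)}

/-- The kernel `∑_{x₁, …, xₙ} μ_{x₁} ⋯ μ_{xₙ}`. -/
def resampleIter (G : SimpleGraph V) (lam : ℝ) (h : V → Set.Icc (0 : ℝ) β → ℝ) :
    ℕ → Kernel (V → SpinPath β) (V → SpinPath β)
  | 0 => Kernel.id
  | n + 1 => (∑ x, heatBath G lam h x) ∘ₖ resampleIter G lam h n

/-- The law `P_t^ρ` at time `t` of the dynamics started at `ρ`, where
`P_t = e^{t𝓛} = ∑ₙ e^{-t|V|} tⁿ / n! ∑_{x₁, …, xₙ} μ_{x₁} ⋯ μ_{xₙ}`. -/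
def glauberLaw (G : SimpleGraph V) (lam : ℝ) (h : V → Set.Icc (0 : ℝ) β → ℝ)
    (t : ℝ≥0) (ρ : V → SpinPath β) : Measure (V → SpinPath β) :=
  Measure.sum fun n : ℕ =>
    ENNReal.ofReal (Real.exp (-(t * Fintype.card V)) * (t : ℝ) ^ n / n.factorial) •
      resampleIter G lam h n ρ

/-- The mixing time `inf {t ≥ 0 : ∀ ρ η, ‖P_t^ρ - P_t^η‖_TV ≤ e⁻¹}` (`∞` if there is no such `t`). -/
def mixingTime (G : SimpleGraph V) (lam : ℝ) (h : V → Set.Icc (0 : ℝ) β → ℝ) : ℝ≥0∞ :=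
  ⨅ (t : ℝ≥0) (_ : ∀ ρ η : V → SpinPath β,
    tvDist (glauberLaw G lam h t ρ) (glauberLaw G lam h t η) ≤ Real.exp (-1)), (t : ℝ≥0∞)

end Graph

/-! ### Regular trees

The vertices of the infinite rooted `b`-ary tree are the finite words over `Fin b`. The root is the
empty word, the children of `z` are the words `c :: z`, and the depth of `z` is its length. -/

/-- The neighbours of `z`: its `b` children and, unless `z` is the root, its parent. -/
def nbrs (b : ℕ) (z : List (Fin b)) : Finset (List (Fin b)) :=
  (Finset.univ.image fun c => c :: z) ∪
    (match z with
      | [] => ∅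
      | _ :: p => {p})

theorem mem_nbrs {b : ℕ} {y z : List (Fin b)} :
    y ∈ nbrs b z ↔ (∃ c, y = c :: z) ∨ ∃ c, z = c :: y := by
  cases z with
  | nil => simp [nbrs, eq_comm]
  | cons a p => simp [nbrs, eq_comm, or_comm]

/-- The infinite rooted `b`-ary tree. -/
def regTree (b : ℕ) : SimpleGraph (List (Fin b)) where
  Adj z y := y ∈ nbrs b z
  symm := ⟨fun z y hzy => by
    rw [mem_nbrs] at hzy ⊢
    exact hzy.symm⟩
  loopless := ⟨fun z hz => by
    rw [mem_nbrs] at hz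
    rcases hz with ⟨c, hc⟩ | ⟨c, hc⟩ <;> simpa using congrArg List.length hc⟩

/-- The subgraph of the tree induced on a finite vertex set `A`. -/
def treeGraph (b : ℕ) (A : Finset (List (Fin b))) : SimpleGraph A :=
  (regTree b).comap Subtype.val

/-- The field on `A` made of the homogeneous field `h` and the boundary condition `τ`:
`h + ∑_{y ∉ A, y ∼ z} τ_y` at `z ∈ A`. -/
def treeField (b : ℕ) {β : ℝ} (h : Set.Icc (0 : ℝ) β → ℝ) (A : Finset (List (Fin b)))
    (τ : List (Fin b) → SpinPath β) : A → Set.Icc (0 : ℝ) β → ℝ :=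
  fun z t => h t + ∑ y ∈ nbrs b z.1 \ A, τ y t

/-- The Gibbs measure `μ_A^τ`. -/
def treeGibbs (b : ℕ) {β : ℝ} (lam : ℝ) (h : Set.Icc (0 : ℝ) β → ℝ) (A : Finset (List (Fin b)))
    (τ : List (Fin b) → SpinPath β) : Measure (A → SpinPath β) :=
  gibbs (treeGraph b A) lam (treeField b h A τ)

/-- The regular subtree with root `x` and depth `m`: the descendants `w ++ x` of `x` with
`w` of length at most `m`. -/
def subtree (b : ℕ) (x : List (Fin b)) (m : ℕ) : Finset (List (Fin b)) :=
  (List.finite_length_le (Fin b) m).toFinset.image fun w => w ++ x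

theorem root_mem_subtree (b : ℕ) (x : List (Fin b)) (m : ℕ) : x ∈ subtree b x m := by
  simp only [subtree, Finset.mem_image]
  exact ⟨[], by simp, by simp⟩

/-- The root `x` as a vertex of `subtree b x m`. -/
def subtreeRoot (b : ℕ) (x : List (Fin b)) (m : ℕ) : subtree b x m :=
  ⟨x, root_mem_subtree b x m⟩

/-- The rooted `b`-ary tree of depth `l`. -/
def tree (b l : ℕ) : Finset (List (Fin b)) := subtree b [] l

/-- The exponent `γ`: the supremum, over subsets `A` of finite-depth trees, vertices `y ∉ A`,
neighbours `z ∈ A` of `y` and boundary conditions `η, η'` differing only at `y`, of the total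
variation distance between the marginals of `μ_A^η` and `μ_A^η'` at `z`. -/
def gammaExp (b : ℕ) {β : ℝ} (lam : ℝ) (h : Set.Icc (0 : ℝ) β → ℝ) : ℝ :=
  sSup {r : ℝ | ∃ (l : ℕ) (A : Finset (List (Fin b))) (y : List (Fin b)) (z : A)
      (η η' : List (Fin b) → SpinPath β),
    A ⊆ tree b l ∧ y ∉ A ∧ (regTree b).Adj y z.1 ∧ (∀ v, v ≠ y → η v = η' v) ∧
    r = tvDist ((treeGibbs b lam h A η).map fun σ => σ z)
          ((treeGibbs b lam h A η').map fun σ => σ z)}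

/-- The exponent `κ(τ)`: the infimum of the `κ ≥ 0` for which there is `l₀` such that, on every
regular subtree `T` with root `x`, for every `z ∈ T` at distance at least `l₀` from `x`,
`μ_T^τ(σ_z • 1 | σ_x = +) - μ_T^τ(σ_z • 1 | σ_x = -) ≤ κ ^ |z - x|`. The distance `|z - x|` is the
difference of the depths, as `z` is a descendant of `x`. -/
def kappaExp (b : ℕ) {β : ℝ} (lam : ℝ) (h : Set.Icc (0 : ℝ) β → ℝ)
    (τ : List (Fin b) → SpinPath β) : ℝ :=
  sInf {κ : ℝ | 0 ≤ κ ∧ ∃ l₀ : ℕ, ∀ (x : List (Fin b)) (m : ℕ) (z : subtree b x m),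
    l₀ ≤ z.1.length - x.length →
      (∫ σ, dot (σ z) 1 ∂(ProbabilityTheory.cond (treeGibbs b lam h (subtree b x m) τ)
          {σ | σ (subtreeRoot b x m) = SpinPath.plus β})) -
        (∫ σ, dot (σ z) 1 ∂(ProbabilityTheory.cond (treeGibbs b lam h (subtree b x m) τ)
          {σ | σ (subtreeRoot b x m) = SpinPath.minus β})) ≤
      κ ^ (z.1.length - x.length)}

end QuantumIsing

end

/-!
The proof studies the conditional expectations of the Gibbs measure as operators on bounded
observables: `Spec.E A f` is the conditional expectation of `f` given the spins outside `A`, and the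
semigroup `Spec.P A t` of the dynamics in `A` is the exponential of a sum of such operators. The
measures, kernels and the semigroup in the statement act on observables through these operators
(`integral_treeGibbs`, `IsingData.integral_heatBath`, `IsingData.glauberLaw_real`).

*Contraction.* Let `x` be a vertex, and let a function of the spin at `x` be averaged over the block
of the `n + 1` generations that start at `x`. By the definition of `γ`, iterated along paths, the
result depends on the spins `n + 1` generations below `x` in a Lipschitz way, with a constant of order
`γ ^ n` (`IsingData.Mixing.exists_site`). The model is ferromagnetic: on a time grid it is an Ising
model on a finite graph, the FKG inequality passes to the limit (`fkg_freeConfig`), and conditional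
expectations preserve increasing observables (`Spec.Ferro.inc_E`). A Lipschitz observable becomes
increasing by adding a multiple of the total magnetization (`inc_of_lipschitz`), so the effect of the
spin at `x` on it is bounded by the effect on the magnetization, which is at most
`b ^ (n + 1) * κ ^ (n + 1)` by the definition of `κ`. Hence oscillations contract by a factor of order
`(b κ γ) ^ n` (`IsingData.Mixing.osc_E_E_site_le`). Since the operators are self-adjoint, the second
moments of the iterates are log-convex, and variances contract by the same factor
(`Spec.Var_E_le_of_osc_contract`). Spreading the variance over blocks, in which the measure is
comparable to a product measure, gives a Poincaré inequality on all subtrees, uniformly in their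
height and in the boundary condition (`IsingData.Mixing.poincare`).

*Spectral gap.* The Poincaré inequality extends from bounded functions to `L²` by truncation, because
Dirichlet forms decrease under contractions (`IsingData.le_spectralGap`).

*Mixing time.* The dynamics started from a constant configuration is treated by censoring
(`Spec.censoring`, `IsingData.P_le_of_const`): suppressing the updates at a vertex separates the
subtrees at its children. By induction on the height, each generation costs a bounded time, after
which the law is dominated, on monotone observables, by a law whose density has second moment at most
`2` (`exists_startDensity`). After another time linear in the depth the decay of the variance makes
the two extremal starting points agree on monotone observables (`P_const_sub_le`), up to an
error that is exponentially small in the depth. For arbitrary observables and starting points, the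
dynamics is first run until each vertex has been updated; this makes observables Lipschitz up to a
small error (`IsingData.P_sub_le`, `exists_lipschitz`), and Lipschitz observables are again compared
with the total magnetization (`IsingData.P_sub_le_of_const`). The number of vertices, exponential in
the depth, enters only through factors that a time linear in the depth compensates
(`exists_mixingTime_le`).
-/

noncomputable section

namespace QuantumIsing

set_option linter.unusedSectionVars false


/-! ### Bounded observables -/

/-- The bounded measurable functions, as a subalgebra of `ℓ^∞`. -/
def obsSubalgebra (Ω : Type*) [MeasurableSpace Ω] : Subalgebra ℝ (lp (fun _ : Ω => ℝ) ∞) where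
  carrier := {f | Measurable (f : Ω → ℝ)}
  mul_mem' {f g} hf hg := by
    simp only [Set.mem_ofPred_eq, lp.infty_coeFn_mul] at *
    exact hf.mul hg
  add_mem' {f g} hf hg := by
    simp only [Set.mem_ofPred_eq, lp.coeFn_add] at *
    exact hf.add hg
  algebraMap_mem' r := by
    change Measurable (fun _ : Ω => r)
    exact measurable_const

/-- The Banach algebra of bounded measurable real functions on `Ω` with the supremum norm. -/
def Obs (Ω : Type*) [MeasurableSpace Ω] : Type _ := ↥(obsSubalgebra Ω)

namespace Obs

variable {Ω : Type*} [MeasurableSpace Ω]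

instance : NormedCommRing (Obs Ω) := inferInstanceAs (NormedCommRing ↥(obsSubalgebra Ω))
instance : NormedAlgebra ℝ (Obs Ω) := inferInstanceAs (NormedAlgebra ℝ ↥(obsSubalgebra Ω))

instance : FunLike (Obs Ω) Ω ℝ where
  coe f := f.1.1
  coe_injective _ _ h := Subtype.ext (Subtype.ext h)

theorem isClosed_obsSubalgebra : IsClosed (obsSubalgebra Ω : Set (lp (fun _ : Ω => ℝ) ∞)) := by
  refine IsSeqClosed.isClosed fun f g hf hg => ?_
  refine measurable_of_tendsto_metrizable (f := fun n => (f n : Ω → ℝ)) hf ?_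
  refine tendsto_pi_nhds.2 fun x => ?_
  rw [tendsto_iff_norm_sub_tendsto_zero] at hg ⊢
  refine squeeze_zero (fun _ => norm_nonneg _) (fun n => ?_) hg
  exact lp.norm_apply_le_norm (by simp) (f n - g) x

instance : CompleteSpace (Obs Ω) := isClosed_obsSubalgebra.completeSpace_coe

theorem measurable (f : Obs Ω) : Measurable f := f.2

@[ext] theorem ext {f g : Obs Ω} (h : ∀ x, f x = g x) : f = g :=
  DFunLike.ext _ _ h

/-- A bounded measurable function as an observable. -/
def mk (f : Ω → ℝ) (hf : Measurable f) (C : ℝ) (hC : ∀ x, |f x| ≤ C) : Obs Ω :=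
  ⟨⟨f, memℓp_infty_iff.2 ⟨C, by rintro _ ⟨x, rfl⟩; exact hC x⟩⟩, hf⟩

@[simp] theorem mk_apply (f : Ω → ℝ) (hf : Measurable f) (C : ℝ) (hC : ∀ x, |f x| ≤ C) (x : Ω) :
    mk f hf C hC x = f x := rfl

@[simp] theorem add_apply (f g : Obs Ω) (x : Ω) : (f + g) x = f x + g x := rfl
@[simp] theorem sub_apply (f g : Obs Ω) (x : Ω) : (f - g) x = f x - g x := rfl
@[simp] theorem neg_apply (f : Obs Ω) (x : Ω) : (-f) x = -f x := rfl
@[simp] theorem mul_apply (f g : Obs Ω) (x : Ω) : (f * g) x = f x * g x := rfl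
@[simp] theorem smul_apply (c : ℝ) (f : Obs Ω) (x : Ω) : (c • f) x = c * f x := rfl
@[simp] theorem one_apply (x : Ω) : (1 : Obs Ω) x = 1 := rfl
@[simp] theorem zero_apply (x : Ω) : (0 : Obs Ω) x = 0 := rfl

theorem abs_le_norm (f : Obs Ω) (x : Ω) : |f x| ≤ ‖f‖ := lp.norm_apply_le_norm (by simp) f.1 x

theorem le_norm (f : Obs Ω) (x : Ω) : f x ≤ ‖f‖ := (le_abs_self _).trans (abs_le_norm f x)

theorem norm_le {f : Obs Ω} {C : ℝ} (hC : 0 ≤ C) (h : ∀ x, |f x| ≤ C) : ‖f‖ ≤ C :=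
  lp.norm_le_of_forall_le (f := f.1) hC h

/-- Evaluation at a point. -/
def ev (x : Ω) : Obs Ω →L[ℝ] ℝ :=
  LinearMap.mkContinuous
    { toFun := fun f => f x
      map_add' := fun _ _ => rfl
      map_smul' := fun _ _ => rfl } 1 fun f => by
    rw [one_mul]
    exact abs_le_norm f x

@[simp] theorem ev_apply (x : Ω) (f : Obs Ω) : ev x f = f x := rfl

@[simp] theorem sum_apply {ι : Type*} (s : Finset ι) (f : ι → Obs Ω) (x : Ω) :
    (∑ i ∈ s, f i) x = ∑ i ∈ s, f i x := by
  exact map_sum (ev x) f s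

@[simp] theorem prod_apply {ι : Type*} (s : Finset ι) (f : ι → Obs Ω) (x : Ω) :
    (∏ i ∈ s, f i) x = ∏ i ∈ s, f i x := by
  classical
  induction s using Finset.induction_on with
  | empty => simp
  | insert a s ha ih => rw [Finset.prod_insert ha, Finset.prod_insert ha, mul_apply, ih]

theorem continuous_apply (x : Ω) : Continuous fun f : Obs Ω => f x := (ev x).continuous

theorem integrable (f : Obs Ω) (μ : Measure Ω) [IsFiniteMeasure μ] : Integrable f μ :=
  Integrable.of_bound f.measurable.aestronglyMeasurable ‖f‖
    (Eventually.of_forall fun x => abs_le_norm f x)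

/-- Composition of an observable with a measurable map. -/
def comp {Ω' : Type*} [MeasurableSpace Ω'] (f : Obs Ω) (g : Ω' → Ω) (hg : Measurable g) : Obs Ω' :=
  mk (fun x => f (g x)) (f.measurable.comp hg) ‖f‖ fun x => abs_le_norm f (g x)

@[simp] theorem comp_apply {Ω' : Type*} [MeasurableSpace Ω'] (f : Obs Ω) (g : Ω' → Ω)
    (hg : Measurable g) (x : Ω') : f.comp g hg x = f (g x) := rfl

end Obs

/-! ### Conditional expectations of a Gibbs specification -/

/-- A Gibbs specification on `V → S`: a reference probability measure `m` on the spin space, and a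
Boltzmann weight `w`, a bounded measurable function that is bounded away from `0`. -/
structure Spec (V S : Type*) [MeasurableSpace S] where
  m : Measure S
  prob : IsProbabilityMeasure m
  w : Obs (V → S)
  pos : ∃ c > 0, ∀ ρ, c ≤ w ρ

namespace Spec

variable {V S : Type*} [Fintype V] [DecidableEq V] [MeasurableSpace S]

theorem measurable_piecewise (A : Finset V) :
    Measurable fun p : (V → S) × (V → S) => A.piecewise p.1 p.2 := by
  refine measurable_pi_lambda _ fun i => ?_
  by_cases hi : i ∈ A
  · simp only [hi, Finset.piecewise_eq_of_mem]
    fun_prop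
  · simp only [hi, not_false_eq_true, Finset.piecewise_eq_of_notMem]
    fun_prop

theorem measurable_piecewise_left (A : Finset V) (ρ : V → S) :
    Measurable fun σ : V → S => A.piecewise σ ρ :=
  (measurable_piecewise A).comp (measurable_id.prodMk measurable_const)

/-- `f` does not depend on the spins in `A`. -/
def FreeOf (A : Finset V) (f : Obs (V → S)) : Prop :=
  ∀ ρ σ : V → S, (∀ i ∉ A, ρ i = σ i) → f ρ = f σ

theorem FreeOf.mono {A B : Finset V} {f : Obs (V → S)} (h : FreeOf B f) (hAB : A ⊆ B) :
    FreeOf A f := fun ρ σ hρ => h ρ σ fun i hi => hρ i fun hA => hi (hAB hA)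

theorem FreeOf.piecewise {A : Finset V} {f : Obs (V → S)} (h : FreeOf A f) (σ ρ : V → S) :
    f (A.piecewise σ ρ) = f ρ := h _ _ fun i hi => by simp [hi]

theorem FreeOf.mul {A : Finset V} {f g : Obs (V → S)} (hf : FreeOf A f) (hg : FreeOf A g) :
    FreeOf A (f * g) := fun ρ σ h => by simp [hf ρ σ h, hg ρ σ h]

theorem FreeOf.add {A : Finset V} {f g : Obs (V → S)} (hf : FreeOf A f) (hg : FreeOf A g) :
    FreeOf A (f + g) := fun ρ σ h => by simp [hf ρ σ h, hg ρ σ h]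

theorem FreeOf.sub {A : Finset V} {f g : Obs (V → S)} (hf : FreeOf A f) (hg : FreeOf A g) :
    FreeOf A (f - g) := fun ρ σ h => by simp [hf ρ σ h, hg ρ σ h]

theorem FreeOf.smul {A : Finset V} {f : Obs (V → S)} (hf : FreeOf A f) (c : ℝ) :
    FreeOf A (c • f) := fun ρ σ h => by simp [hf ρ σ h]

theorem FreeOf.prod {ι : Type*} {A : Finset V} {s : Finset ι} {f : ι → Obs (V → S)}
    (hf : ∀ i ∈ s, FreeOf A (f i)) : FreeOf A (∏ i ∈ s, f i) := fun ρ σ h => by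
  rw [Obs.prod_apply, Obs.prod_apply]
  exact Finset.prod_congr rfl fun i hi => hf i hi ρ σ h

theorem freeOf_one {A : Finset V} : FreeOf A (1 : Obs (V → S)) := fun ρ σ h => by simp

theorem FreeOf.union {A B : Finset V} {f : Obs (V → S)} (hA : FreeOf A f) (hB : FreeOf B f) :
    FreeOf (A ∪ B) f := fun ρ σ h => by
  rw [← hA.piecewise σ ρ]
  refine hB _ _ fun i hi => ?_
  by_cases hiA : i ∈ A
  · simp [hiA]
  · simp only [hiA, not_false_eq_true, Finset.piecewise_eq_of_notMem]
    exact h i (by simp [hiA, hi])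

variable (M : Spec V S)

instance : IsProbabilityMeasure M.m := M.prob

/-- The product reference measure. -/
def ref : Measure (V → S) := Measure.pi fun _ => M.m

instance : IsProbabilityMeasure M.ref := by unfold ref; infer_instance

/-- Average over the spins in `A` with respect to the reference measure. -/
def avg (A : Finset V) : Obs (V → S) →L[ℝ] Obs (V → S) :=
  LinearMap.mkContinuous
    { toFun := fun f => Obs.mk (fun ρ => ∫ σ, f (A.piecewise σ ρ) ∂M.ref)
        ((f.measurable.comp ((measurable_piecewise A).comp
          measurable_swap)).stronglyMeasurable.integral_prod_right').measurable ‖f‖ fun ρ => by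
          refine (norm_integral_le_of_norm_le_const
            (Eventually.of_forall fun σ =>
              (Real.norm_eq_abs _).trans_le (f.abs_le_norm (A.piecewise σ ρ)))).trans ?_
          simp
      map_add' := fun f g => by
        ext ρ
        simp only [Obs.mk_apply, Obs.add_apply]
        exact integral_add ((f.comp _ (measurable_piecewise_left A ρ)).integrable _)
          ((g.comp _ (measurable_piecewise_left A ρ)).integrable _)
      map_smul' := fun c f => by
        ext ρ
        simp only [Obs.mk_apply, Obs.smul_apply, RingHom.id_apply]
        exact integral_const_mul _ _ } 1 fun f => by
    rw [one_mul]
    refine Obs.norm_le (norm_nonneg _) fun ρ => ?_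
    refine (norm_integral_le_of_norm_le_const
      (Eventually.of_forall fun σ =>
              (Real.norm_eq_abs _).trans_le (f.abs_le_norm (A.piecewise σ ρ)))).trans ?_
    simp

theorem avg_apply (A : Finset V) (f : Obs (V → S)) (ρ : V → S) :
    M.avg A f ρ = ∫ σ, f (A.piecewise σ ρ) ∂M.ref := rfl

theorem integrable_piecewise (A : Finset V) (f : Obs (V → S)) (ρ : V → S) :
    Integrable (fun σ => f (A.piecewise σ ρ)) M.ref :=
  (f.comp _ (measurable_piecewise_left A ρ)).integrable _

theorem avg_mono {A : Finset V} {f g : Obs (V → S)} {ρ : V → S}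
    (h : ∀ σ, f (A.piecewise σ ρ) ≤ g (A.piecewise σ ρ)) : M.avg A f ρ ≤ M.avg A g ρ :=
  integral_mono (M.integrable_piecewise A f ρ) (M.integrable_piecewise A g ρ) h

@[simp] theorem avg_one (A : Finset V) : M.avg A 1 = 1 := by
  ext ρ
  simp [avg_apply]

theorem avg_mul_left {A : Finset V} {g : Obs (V → S)} (hg : FreeOf A g) (f : Obs (V → S)) :
    M.avg A (g * f) = g * M.avg A f := by
  ext ρ
  simp only [avg_apply, Obs.mul_apply, hg.piecewise]
  exact integral_const_mul _ _

theorem freeOf_avg (A : Finset V) (f : Obs (V → S)) : FreeOf A (M.avg A f) := fun ρ σ h => by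
  simp only [avg_apply]
  refine integral_congr_ae (Eventually.of_forall fun ξ => congrArg f (funext fun i => ?_))
  by_cases hi : i ∈ A <;> simp [hi, h]

theorem FreeOf.avg {A B : Finset V} {f : Obs (V → S)} (hf : FreeOf B f) :
    FreeOf B (M.avg A f) := fun ρ σ h => by
  simp only [avg_apply]
  congr 1
  ext ξ
  refine hf _ _ fun i hi => ?_
  by_cases hA : i ∈ A <;> simp [hA, h i hi]

/-- Two independent samples of the reference measure, glued along `A`, give one sample. -/
theorem map_piecewise_ref (A : Finset V) :
    (M.ref.prod M.ref).map (fun p => A.piecewise p.1 p.2) = M.ref := by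
  symm
  unfold ref
  refine Measure.pi_eq fun s hs => ?_
  rw [Measure.map_apply (measurable_piecewise A) (MeasurableSet.univ_pi hs)]
  have : (fun p : (V → S) × (V → S) => A.piecewise p.1 p.2) ⁻¹' (Set.univ.pi s) =
      (Set.univ.pi fun i => if i ∈ A then s i else Set.univ) ×ˢ
        (Set.univ.pi fun i => if i ∈ A then Set.univ else s i) := by
    ext ⟨a, c⟩
    simp only [Set.mem_preimage, Set.mem_univ_pi, Set.mem_prod]
    rw [← forall_and]
    refine forall_congr' fun i => ?_
    by_cases hi : i ∈ A <;> simp [hi]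
  rw [this, Measure.prod_prod, Measure.pi_pi, Measure.pi_pi, ← Finset.prod_mul_distrib]
  refine Finset.prod_congr rfl fun i _ => ?_
  by_cases hi : i ∈ A <;> simp [hi]

theorem avg_avg (A B : Finset V) (f : Obs (V → S)) : M.avg B (M.avg A f) = M.avg (A ∪ B) f := by
  ext ρ
  simp only [avg_apply]
  have h1 := integral_map (μ := M.ref.prod M.ref) (φ := fun p => A.piecewise p.1 p.2)
    (measurable_piecewise A).aemeasurable
    (f := fun σ => f ((A ∪ B).piecewise σ ρ))
    (f.measurable.comp (measurable_piecewise_left (A ∪ B) ρ)).aestronglyMeasurable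
  rw [map_piecewise_ref] at h1
  rw [h1, integral_prod_symm]
  · refine integral_congr_ae (Eventually.of_forall fun σ => ?_)
    refine integral_congr_ae (Eventually.of_forall fun σ' => congrArg f (funext fun i => ?_))
    by_cases hA : i ∈ A <;> by_cases hB : i ∈ B <;> simp [hA, hB]
  · exact (f.comp _ ((measurable_piecewise_left (A ∪ B) ρ).comp (measurable_piecewise A))).integrable _

theorem w_pos (ρ : V → S) : 0 < M.w ρ := by
  obtain ⟨c, hc, h⟩ := M.pos
  exact hc.trans_le (h ρ)

theorem avg_pos {A : Finset V} {f : Obs (V → S)} (hf : ∃ c > 0, ∀ ρ, c ≤ f ρ) (ρ : V → S) :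
    0 < M.avg A f ρ := by
  obtain ⟨c, hc, h⟩ := hf
  refine hc.trans_le ?_
  have := M.avg_mono (A := A) (f := c • 1) (g := f) (ρ := ρ) fun σ => by simpa using h _
  simpa using this

theorem Z_pos (A : Finset V) (ρ : V → S) : 0 < M.avg A M.w ρ := M.avg_pos M.pos ρ

theorem abs_ratio_le (A : Finset V) (f : Obs (V → S)) (ρ : V → S) :
    |M.avg A (f * M.w) ρ / M.avg A M.w ρ| ≤ ‖f‖ := by
  rw [abs_div, abs_of_pos (M.Z_pos A ρ), div_le_iff₀ (M.Z_pos A ρ), abs_le]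
  have h1 := M.avg_mono (A := A) (f := f * M.w) (g := ‖f‖ • M.w) (ρ := ρ) fun σ => by
    simpa using mul_le_mul_of_nonneg_right (f.le_norm _) (M.w_pos _).le
  have h2 := M.avg_mono (A := A) (f := (-‖f‖) • M.w) (g := f * M.w) (ρ := ρ) fun σ => by
    have := (abs_le.1 (f.abs_le_norm (A.piecewise σ ρ))).1
    simpa using mul_le_mul_of_nonneg_right this (M.w_pos _).le
  simp only [map_smul, Obs.smul_apply] at h1 h2
  exact ⟨by linarith, h1⟩

/-- Conditional expectation given the spins outside `A`. -/
def E (A : Finset V) : Obs (V → S) →L[ℝ] Obs (V → S) :=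
  LinearMap.mkContinuous
    { toFun := fun f => Obs.mk (fun ρ => M.avg A (f * M.w) ρ / M.avg A M.w ρ)
        ((M.avg A (f * M.w)).measurable.div (M.avg A M.w).measurable) ‖f‖ (M.abs_ratio_le A f)
      map_add' := fun f g => by
        ext ρ
        simp [add_mul, add_div]
      map_smul' := fun c f => by
        ext ρ
        simp [mul_div_assoc] } 1 fun f => by
    rw [one_mul]
    exact Obs.norm_le (norm_nonneg _) (M.abs_ratio_le A f)

theorem E_apply (A : Finset V) (f : Obs (V → S)) (ρ : V → S) :
    M.E A f ρ = M.avg A (f * M.w) ρ / M.avg A M.w ρ := rfl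

theorem avg_mul_w (A : Finset V) (f : Obs (V → S)) : M.avg A (f * M.w) = M.E A f * M.avg A M.w := by
  ext ρ
  rw [Obs.mul_apply, E_apply, div_mul_cancel₀ _ (M.Z_pos A ρ).ne']

@[simp] theorem E_one (A : Finset V) : M.E A 1 = 1 := by
  ext ρ
  rw [E_apply, one_mul, div_self (M.Z_pos A ρ).ne', Obs.one_apply]

theorem E_mono {A : Finset V} {f g : Obs (V → S)} {ρ : V → S}
    (h : ∀ σ, f (A.piecewise σ ρ) ≤ g (A.piecewise σ ρ)) : M.E A f ρ ≤ M.E A g ρ := by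
  rw [E_apply, E_apply]
  refine div_le_div_of_nonneg_right (M.avg_mono fun σ => ?_) (M.Z_pos A ρ).le
  simpa using mul_le_mul_of_nonneg_right (h σ) (M.w_pos _).le

theorem E_congr {A : Finset V} {f g : Obs (V → S)} {ρ : V → S}
    (h : ∀ σ, f (A.piecewise σ ρ) = g (A.piecewise σ ρ)) : M.E A f ρ = M.E A g ρ :=
  le_antisymm (M.E_mono fun σ => (h σ).le) (M.E_mono fun σ => (h σ).ge)

theorem E_nonneg {A : Finset V} {f : Obs (V → S)} {ρ : V → S}
    (h : ∀ σ, 0 ≤ f (A.piecewise σ ρ)) : 0 ≤ M.E A f ρ := by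
  simpa using M.E_mono (f := 0) (g := f) h

theorem E_const {A : Finset V} {f : Obs (V → S)} {ρ : V → S} {c : ℝ}
    (h : ∀ σ, f (A.piecewise σ ρ) = c) : M.E A f ρ = c := by
  rw [M.E_congr (g := c • 1) (by simpa using h)]
  simp

theorem E_le_const {A : Finset V} {f : Obs (V → S)} {ρ : V → S} {c : ℝ}
    (h : ∀ σ, f (A.piecewise σ ρ) ≤ c) : M.E A f ρ ≤ c := by
  have := M.E_mono (f := f) (g := c • 1) (ρ := ρ) (A := A) (by simpa using h)
  simpa using this

theorem const_le_E {A : Finset V} {f : Obs (V → S)} {ρ : V → S} {c : ℝ}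
    (h : ∀ σ, c ≤ f (A.piecewise σ ρ)) : c ≤ M.E A f ρ := by
  have := M.E_mono (f := c • 1) (g := f) (ρ := ρ) (A := A) (by simpa using h)
  simpa using this

theorem freeOf_E (A : Finset V) (f : Obs (V → S)) : FreeOf A (M.E A f) := fun ρ σ h => by
  rw [E_apply, E_apply, M.freeOf_avg A _ ρ σ h, M.freeOf_avg A _ ρ σ h]

theorem E_mul_left {A : Finset V} {g : Obs (V → S)} (hg : FreeOf A g) (f : Obs (V → S)) :
    M.E A (g * f) = g * M.E A f := by
  ext ρ
  rw [E_apply, mul_assoc, M.avg_mul_left hg, Obs.mul_apply, Obs.mul_apply, E_apply, mul_div_assoc]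

theorem E_of_freeOf {A : Finset V} {g : Obs (V → S)} (hg : FreeOf A g) : M.E A g = g := by
  simpa using M.E_mul_left hg 1

/-- The tower property. -/
theorem E_E {A B : Finset V} (h : A ⊆ B) (f : Obs (V → S)) : M.E B (M.E A f) = M.E B f := by
  ext ρ
  have h1 : M.avg B (M.E A f * M.w) = M.avg B (f * M.w) := by
    have hu : A ∪ B = B := Finset.union_eq_right.2 h
    rw [← hu, ← M.avg_avg, ← M.avg_avg, M.avg_mul_left (M.freeOf_E A f), M.avg_mul_w]
  rw [E_apply, E_apply, h1]

theorem E_symm {A B : Finset V} (h : A ⊆ B) (f g : Obs (V → S)) :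
    M.E B (M.E A f * g) = M.E B (f * M.E A g) := by
  rw [← M.E_E h (M.E A f * g), M.E_mul_left (M.freeOf_E A f), ← M.E_E h (f * M.E A g),
    mul_comm f, M.E_mul_left (M.freeOf_E A g), mul_comm]

@[simp] theorem E_empty (f : Obs (V → S)) : M.E ∅ f = f :=
  M.E_of_freeOf fun ρ σ h => by rw [funext fun i => h i (by simp)]

/-! ### Separated sets -/

/-- `A` and `B` do not interact: the weight factorizes. -/
def Sep (A B : Finset V) : Prop :=
  Disjoint A B ∧ ∃ w₁ w₂ : Obs (V → S), M.w = w₁ * w₂ ∧ FreeOf A w₁ ∧ FreeOf B w₂ ∧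
    (∃ c > 0, ∀ ρ, c ≤ w₁ ρ) ∧ (∃ c > 0, ∀ ρ, c ≤ w₂ ρ)

variable {M}

theorem Sep.symm {A B : Finset V} (h : M.Sep A B) : M.Sep B A := by
  obtain ⟨hd, w₁, w₂, hw, h1, h2, p1, p2⟩ := h
  exact ⟨hd.symm, w₂, w₁, by rw [hw, mul_comm], h2, h1, p2, p1⟩

theorem Sep.mono {A B A' B' : Finset V} (h : M.Sep A B) (hA : A' ⊆ A) (hB : B' ⊆ B) :
    M.Sep A' B' := by
  obtain ⟨hd, w₁, w₂, hw, h1, h2, p1, p2⟩ := h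
  exact ⟨hd.mono hA hB, w₁, w₂, hw, h1.mono hA, h2.mono hB, p1, p2⟩

/-- The spins in `B` have no influence on those in `A`: their weight cancels in the ratio that
defines the conditional expectation. -/
theorem Sep.freeOf_E {A B : Finset V} (h : M.Sep A B) {f : Obs (V → S)} (hf : FreeOf B f) :
    FreeOf B (M.E A f) := fun ρ σ hρ => by
  obtain ⟨-, w₁, w₂, hw, h1, h2, p1, p2⟩ := h
  have key : ∀ ρ, M.E A f ρ = M.avg A (f * w₂) ρ / M.avg A w₂ ρ := fun ρ => by
    have e : f * (w₁ * w₂) = w₁ * (f * w₂) := by ring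
    have p : w₁ ρ ≠ 0 := by
      obtain ⟨c, hc, h⟩ := p1
      exact (hc.trans_le (h ρ)).ne'
    rw [E_apply, hw, e, M.avg_mul_left h1, M.avg_mul_left h1, Obs.mul_apply, Obs.mul_apply,
      mul_div_mul_left _ _ p]
  rw [key, key, (hf.mul h2).avg M ρ σ hρ, h2.avg M ρ σ hρ]

/-- Given the spins outside `A ∪ B`, those in `A` and in `B` are independent. -/
theorem Sep.E_E {A B : Finset V} (h : M.Sep A B) (f : Obs (V → S)) :
    M.E A (M.E B f) = M.E (A ∪ B) f := by
  ext ρ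
  have hsep := h
  obtain ⟨hd, w₁, w₂, hw, h1, h2, p1, p2⟩ := h
  have e1 : M.E A (M.E B f) * M.avg A w₂ = M.avg A (M.E B f * w₂) := by
    ext σ
    have p : w₁ σ ≠ 0 := by
      obtain ⟨c, hc, h⟩ := p1
      exact (hc.trans_le (h σ)).ne'
    have h3 := congrArg (fun g : Obs (V → S) => g σ) (M.avg_mul_w A (M.E B f))
    have e : M.E B f * (w₁ * w₂) = w₁ * (M.E B f * w₂) := by ring
    simp only [hw, e, M.avg_mul_left h1, Obs.mul_apply] at h3
    rw [Obs.mul_apply]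
    refine mul_left_cancel₀ p ?_
    rw [h3]
    ring
  have e2 : M.E B f * M.avg B w₁ = M.avg B (f * w₁) := by
    ext σ
    have p : w₂ σ ≠ 0 := by
      obtain ⟨c, hc, h⟩ := p2
      exact (hc.trans_le (h σ)).ne'
    have h3 := congrArg (fun g : Obs (V → S) => g σ) (M.avg_mul_w B f)
    have e : f * (w₁ * w₂) = w₂ * (f * w₁) := by ring
    simp only [hw, e] at h3
    simp only [mul_comm w₁ w₂, M.avg_mul_left h2, Obs.mul_apply] at h3
    rw [Obs.mul_apply]
    refine mul_left_cancel₀ p ?_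
    rw [h3]
    ring
  have e3 : ∀ g : Obs (V → S), M.avg (A ∪ B) (g * M.w) = M.avg A (M.avg B (g * w₁) * w₂) := by
    intro g
    have e : g * (w₁ * w₂) = w₂ * (g * w₁) := by ring
    rw [Finset.union_comm, ← M.avg_avg, hw, e, M.avg_mul_left h2, mul_comm]
  have hfree : FreeOf A (M.avg B w₁) := h1.avg M
  have e4 : M.avg (A ∪ B) (f * M.w) = M.E A (M.E B f) * M.avg (A ∪ B) M.w := by
    have h5 := e3 1
    rw [one_mul, one_mul, M.avg_mul_left hfree] at h5
    rw [e3, h5, ← e2]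
    have e : M.E B f * M.avg B w₁ * w₂ = M.avg B w₁ * (M.E B f * w₂) := by ring
    rw [e, M.avg_mul_left hfree, ← e1]
    ring
  rw [E_apply _ (A ∪ B), e4, Obs.mul_apply, mul_div_cancel_right₀ _ (M.Z_pos _ ρ).ne']

theorem Sep.comm {A B : Finset V} (h : M.Sep A B) (f : Obs (V → S)) :
    M.E A (M.E B f) = M.E B (M.E A f) := by
  rw [h.E_E, h.symm.E_E, Finset.union_comm]

variable (M)

/-! ### Conditional variances -/

/-- Conditional variance given the spins outside `A`. -/
def Var (A : Finset V) (f : Obs (V → S)) : Obs (V → S) := M.E A (f * f) - M.E A f * M.E A f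

theorem freeOf_Var (A : Finset V) (f : Obs (V → S)) : FreeOf A (M.Var A f) :=
  (M.freeOf_E A _).sub ((M.freeOf_E A _).mul (M.freeOf_E A _))

/-- The conditional second moment around a function of the outer spins. -/
theorem E_sub_sq {A : Finset V} (f : Obs (V → S)) {g : Obs (V → S)} (hg : FreeOf A g) :
    M.E A ((f - g) * (f - g)) = M.Var A f + (M.E A f - g) * (M.E A f - g) := by
  have e : (f - g) * (f - g) = f * f - (2 : ℝ) • (g * f) + g * (g * 1) := by
    ext ρ; simp; ring
  rw [e, map_add, map_sub, map_smul, M.E_mul_left hg, M.E_mul_left hg, M.E_mul_left hg, E_one, Var]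
  ext ρ; simp; ring

theorem Var_eq (A : Finset V) (f : Obs (V → S)) :
    M.Var A f = M.E A ((f - M.E A f) * (f - M.E A f)) := by
  rw [M.E_sub_sq f (M.freeOf_E A f), sub_self, zero_mul, add_zero]

theorem Var_nonneg (A : Finset V) (f : Obs (V → S)) (ρ : V → S) : 0 ≤ M.Var A f ρ := by
  rw [Var_eq]
  exact M.E_nonneg fun σ => by simpa using mul_self_nonneg _

theorem Var_le {A : Finset V} (f : Obs (V → S)) {g : Obs (V → S)} (hg : FreeOf A g) (ρ : V → S) :
    M.Var A f ρ ≤ M.E A ((f - g) * (f - g)) ρ := by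
  rw [M.E_sub_sq f hg]
  simpa using mul_self_nonneg _

theorem Var_of_freeOf {A : Finset V} {f : Obs (V → S)} (hf : FreeOf A f) : M.Var A f = 0 := by
  rw [Var, M.E_of_freeOf (hf.mul hf), M.E_of_freeOf hf, sub_self]

theorem E_sq_le (A : Finset V) (f : Obs (V → S)) (ρ : V → S) :
    (M.E A f * M.E A f) ρ ≤ M.E A (f * f) ρ := by
  have := M.Var_nonneg A f ρ
  rw [Var] at this
  simpa using this

theorem Var_add_le (A : Finset V) (f g : Obs (V → S)) (ρ : V → S) :
    M.Var A (f + g) ρ ≤ 2 * M.Var A f ρ + 2 * M.Var A g ρ := by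
  have : (2 : ℝ) • M.Var A f + (2 : ℝ) • M.Var A g - M.Var A (f + g) = M.Var A (f - g) := by
    have h1 : (f + g) * (f + g) = f * f + (2 : ℝ) • (f * g) + g * g := by ext; simp; ring
    have h2 : (f - g) * (f - g) = f * f - (2 : ℝ) • (f * g) + g * g := by ext; simp; ring
    simp only [Var, h1, h2, map_add, map_sub, map_smul]
    ext ρ; simp; ring
  have h2 := M.Var_nonneg A (f - g) ρ
  rw [← this] at h2
  simp only [Obs.sub_apply, Obs.add_apply, Obs.smul_apply] at h2
  linarith

theorem Var_decomp {A B : Finset V} (h : A ⊆ B) (f : Obs (V → S)) :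
    M.Var B f = M.E B (M.Var A f) + M.Var B (M.E A f) := by
  simp only [Var, map_sub, M.E_E h]
  ring

theorem Var_E_le {A B : Finset V} (h : A ⊆ B) (f : Obs (V → S)) (ρ : V → S) :
    M.Var B (M.E A f) ρ ≤ M.Var B f ρ := by
  have := M.E_nonneg (A := B) (f := M.Var A f) (ρ := ρ) fun σ => M.Var_nonneg _ _ _
  rw [M.Var_decomp h f]
  simpa using this

/-- Averaging over spins that do not interact with `A` decreases the variance over `A`, by
convexity. -/
theorem Sep.Var_E_le {A B : Finset V} (h : M.Sep A B) (f : Obs (V → S)) (ρ : V → S) :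
    M.Var A (M.E B f) ρ ≤ M.E B (M.Var A f) ρ := by
  rw [Var_eq, h.comm, ← map_sub, M.Var_eq A f, ← h.comm]
  exact M.E_mono fun σ => M.E_sq_le _ _ _

/-- Tensorization of the variance over two non-interacting sets. -/
theorem Sep.Var_union_le {A B : Finset V} (h : M.Sep A B) (f : Obs (V → S)) (ρ : V → S) :
    M.Var (A ∪ B) f ρ ≤ M.E (A ∪ B) (M.Var A f) ρ + M.E (A ∪ B) (M.Var B f) ρ := by
  rw [M.Var_decomp Finset.subset_union_left f, Obs.add_apply]
  refine add_le_add le_rfl ?_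
  have h1 : M.Var (A ∪ B) (M.E A f) = M.Var B (M.E A f) := by
    have hu : ∀ g, M.E (A ∪ B) g = M.E B (M.E A g) := fun g => by
      rw [← h.comm, h.E_E]
    have hs : M.E A (M.E A f * M.E A f) = M.E A f * M.E A f :=
      M.E_of_freeOf ((M.freeOf_E A f).mul (M.freeOf_E A f))
    simp only [Var, hu, hs, M.E_E subset_rfl]
  rw [h1, ← h.E_E, ← M.E_of_freeOf ((M.freeOf_Var B (M.E A f))), h.comm]
  exact M.E_mono fun σ => h.symm.Var_E_le M f _

/-! ### Restriction to a block, changing one configuration into another -/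

/-- The observable `f` with the spins outside `T` frozen to `ρ`. -/
def freeze (T : Finset V) (ρ : V → S) (f : Obs (V → S)) : Obs (V → S) :=
  f.comp (fun σ => T.piecewise σ ρ) (measurable_piecewise_left T ρ)

theorem freeze_apply (T : Finset V) (ρ σ : V → S) (f : Obs (V → S)) :
    freeze T ρ f σ = f (T.piecewise σ ρ) := rfl

end Spec

/-! ### Exponentials of bounded operators -/

section Exp

variable {F : Type*} [NormedAddCommGroup F] [NormedSpace ℝ F] [CompleteSpace F]

theorem exp_zero_smul (L : F →L[ℝ] F) : NormedSpace.exp ((0 : ℝ) • L) = 1 := by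
  rw [zero_smul, NormedSpace.exp_zero]

theorem exp_add_smul (L : F →L[ℝ] F) (s t : ℝ) (f : F) :
    NormedSpace.exp ((s + t) • L) f = NormedSpace.exp (s • L) (NormedSpace.exp (t • L) f) := by
  have hc : Commute (s • L) (t • L) := (Commute.refl L).smul_left s |>.smul_right t
  rw [add_smul, ← mul_apply_eq_comp]
  let _ : NormedAlgebra ℚ (F →L[ℝ] F) := NormedAlgebra.restrictScalars ℚ ℝ _
  rw [NormedSpace.exp_add_of_commute hc]

theorem exp_smul_add {L L' : F →L[ℝ] F} (h : Commute L L') (t : ℝ) (f : F) :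
    NormedSpace.exp (t • (L + L')) f = NormedSpace.exp (t • L) (NormedSpace.exp (t • L') f) := by
  have hc : Commute (t • L) (t • L') := h.smul_left t |>.smul_right t
  rw [smul_add, ← mul_apply_eq_comp]
  let _ : NormedAlgebra ℚ (F →L[ℝ] F) := NormedAlgebra.restrictScalars ℚ ℝ _
  rw [NormedSpace.exp_add_of_commute hc]

theorem exp_smul_sub_const (R : F →L[ℝ] F) (c t : ℝ) :
    NormedSpace.exp (t • (R - c • (1 : F →L[ℝ] F))) =
      Real.exp (-(t * c)) • NormedSpace.exp (t • R) := by
  have h1 : t • (R - c • (1 : F →L[ℝ] F)) = algebraMap ℝ (F →L[ℝ] F) (-(t * c)) + t • R := by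
    rw [Algebra.algebraMap_eq_smul_one, smul_sub, smul_smul, neg_smul]
    abel
  have h2 : NormedSpace.exp (algebraMap ℝ (F →L[ℝ] F) (-(t * c))) =
      algebraMap ℝ (F →L[ℝ] F) (Real.exp (-(t * c))) := by
    rw [← NormedSpace.algebraMap_exp_comm, ← Real.exp_eq_exp_ℝ]
  have h3 : Real.exp (-(t * c)) • NormedSpace.exp (t • R) =
      NormedSpace.exp (algebraMap ℝ (F →L[ℝ] F) (-(t * c))) * NormedSpace.exp (t • R) := by
    rw [h2, ← Algebra.smul_def]
  rw [h1, h3]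
  have hc : Commute (algebraMap ℝ (F →L[ℝ] F) (-(t * c))) (t • R) :=
    Algebra.commute_algebraMap_left _ _
  let _ : NormedAlgebra ℚ (F →L[ℝ] F) := NormedAlgebra.restrictScalars ℚ ℝ _
  exact NormedSpace.exp_add_of_commute hc

theorem hasSum_exp_smul {L R : F →L[ℝ] F} {c : ℝ} (hL : ∀ f, L f = R f - c • f) (t : ℝ) (f : F) :
    HasSum (fun k : ℕ => (Real.exp (-(t * c)) * t ^ k / k.factorial) • (R ^ k) f)
      (NormedSpace.exp (t • L) f) := by
  have h1 : L = R - c • (1 : F →L[ℝ] F) := by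
    ext f
    simp [hL]
  rw [h1, exp_smul_sub_const]
  have h3 := NormedSpace.exp_series_hasSum_exp' (𝕂 := ℝ) (t • R)
  have h4 := (h3.const_smul (Real.exp (-(t * c)))).mapL ((ContinuousLinearMap.apply ℝ F) f)
  have h5 : ∀ k : ℕ, (ContinuousLinearMap.apply ℝ F) f
      (Real.exp (-(t * c)) • (k.factorial : ℝ)⁻¹ • (t • R) ^ k) =
      (Real.exp (-(t * c)) * t ^ k / k.factorial) • (R ^ k) f := by
    intro k
    rw [smul_pow, smul_smul, smul_smul]
    change (_ : ℝ) • (R ^ k) f = _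
    congr 1
    ring
  rw [funext h5] at h4
  exact h4

theorem hasDerivAt_exp_smul (L : F →L[ℝ] F) (t : ℝ) (f : F) :
    HasDerivAt (fun u : ℝ => NormedSpace.exp (u • L) f) (L (NormedSpace.exp (t • L) f)) t := by
  have h := hasDerivAt_exp_smul_const' (𝕂 := ℝ) L t
  exact (h.clm_apply (hasDerivAt_const t f)).congr_deriv (by simp)

end Exp

namespace Spec

variable {V S : Type*} [Fintype V] [DecidableEq V] [MeasurableSpace S] (M : Spec V S)

/-! ### Poincaré inequalities on small blocks -/

/-- Tensorization of the variance over finitely many blocks, each of which does not interact with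
the union of the others. -/
theorem Var_biUnion_le {ι : Type*} [DecidableEq ι] (s : Finset ι) (T : ι → Finset V)
    (hsep : ∀ i ∈ s, ∀ s' ⊆ s, i ∉ s' → M.Sep (T i) (s'.biUnion T)) (f : Obs (V → S)) (ρ : V → S) :
    M.Var (s.biUnion T) f ρ ≤ ∑ i ∈ s, M.E (s.biUnion T) (M.Var (T i) f) ρ := by
  induction s using Finset.induction_on generalizing ρ with
  | empty =>
    have : FreeOf (∅ : Finset V) f := fun ρ σ h => by rw [funext fun i => h i (by simp)]
    simp [M.Var_of_freeOf this]
  | insert a s ha ih =>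
    have hs := hsep a (Finset.mem_insert_self a s) s (Finset.subset_insert a s) ha
    have ih' := ih fun i hi s' hs' his' =>
      hsep i (Finset.mem_insert_of_mem hi) s' (hs'.trans (Finset.subset_insert a s)) his'
    rw [Finset.biUnion_insert, Finset.sum_insert ha]
    refine (hs.Var_union_le M f ρ).trans (add_le_add le_rfl ?_)
    have h1 : M.E (T a ∪ s.biUnion T) (M.Var (s.biUnion T) f) ρ ≤
        M.E (T a ∪ s.biUnion T) (∑ i ∈ s, M.E (s.biUnion T) (M.Var (T i) f)) ρ :=
      M.E_mono fun σ => by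
        rw [Obs.sum_apply]
        exact ih' _
    refine h1.trans_eq ?_
    rw [map_sum, Obs.sum_apply]
    exact Finset.sum_congr rfl fun i _ => by rw [M.E_E Finset.subset_union_right]

/-- The non-interacting specification with the same reference measure. -/
def flat : Spec V S := ⟨M.m, M.prob, 1, 1, one_pos, fun _ => le_rfl⟩

theorem flat_E (A : Finset V) : M.flat.E A = M.avg A := by
  ext f ρ
  rw [E_apply]
  change M.avg A (f * 1) ρ / M.avg A 1 ρ = _
  simp

theorem flat_sep {A B : Finset V} (h : Disjoint A B) : M.flat.Sep A B :=
  ⟨h, 1, 1, by simp [flat], freeOf_one, freeOf_one, ⟨1, one_pos, fun _ => le_rfl⟩,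
    ⟨1, one_pos, fun _ => le_rfl⟩⟩

variable {M} {K : ℝ} (hK : ∀ (x : V) (ρ : V → S) (s : S),
  M.w (Function.update ρ x s) ≤ Real.exp K * M.w ρ)

include hK

theorem w_piecewise_le (A : Finset V) (σ ρ : V → S) :
    M.w (A.piecewise σ ρ) ≤ Real.exp (K * A.card) * M.w ρ := by
  induction A using Finset.induction_on with
  | empty => simp
  | insert a s ha ih =>
    rw [Finset.piecewise_insert, Finset.card_insert_of_notMem ha]
    refine (hK a _ _).trans ((mul_le_mul_of_nonneg_left ih (Real.exp_pos _).le).trans_eq ?_)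
    rw [← mul_assoc, ← Real.exp_add]
    push_cast
    ring_nf

theorem le_w_piecewise (A : Finset V) (σ ρ : V → S) :
    Real.exp (-(K * A.card)) * M.w ρ ≤ M.w (A.piecewise σ ρ) := by
  have h := w_piecewise_le hK A ρ (A.piecewise σ ρ)
  rw [Finset.piecewise_idem_right, Finset.piecewise_same] at h
  rw [Real.exp_neg, inv_mul_le_iff₀ (Real.exp_pos _)]
  exact h

/-- If one spin changes the weight at most by a factor `exp K`, the conditional measure on `A` has
a density at most `exp (2 K |A|)` with respect to the product measure. -/
theorem E_le_avg {A : Finset V} {f : Obs (V → S)} {ρ : V → S}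
    (hf : ∀ σ, 0 ≤ f (A.piecewise σ ρ)) :
    M.E A f ρ ≤ Real.exp (2 * K * A.card) * M.avg A f ρ := by
  have hw := M.w_pos ρ
  have h1 : M.avg A (f * M.w) ρ ≤ M.avg A ((Real.exp (K * A.card) * M.w ρ) • f) ρ :=
    M.avg_mono fun σ => by
      rw [Obs.mul_apply, Obs.smul_apply, mul_comm]
      exact mul_le_mul_of_nonneg_right (w_piecewise_le hK A σ ρ) (hf σ)
  have h2 : Real.exp (-(K * A.card)) * M.w ρ ≤ M.avg A M.w ρ := by
    have := M.avg_mono (A := A) (f := (Real.exp (-(K * A.card)) * M.w ρ) • 1) (g := M.w) (ρ := ρ)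
      fun σ => by simpa using le_w_piecewise hK A σ ρ
    simpa using this
  rw [map_smul, Obs.smul_apply] at h1
  have h0 : 0 ≤ M.avg A f ρ := by
    simpa using M.avg_mono (A := A) (f := 0) (g := f) (ρ := ρ) (by simpa using hf)
  rw [E_apply, div_le_iff₀ (M.Z_pos A ρ)]
  refine h1.trans ?_
  have h3 := mul_le_mul_of_nonneg_left h2 (mul_nonneg (Real.exp_pos (2 * K * A.card)).le h0)
  refine le_trans (le_of_eq ?_) h3
  have : Real.exp (2 * K * A.card) * Real.exp (-(K * A.card)) = Real.exp (K * A.card) := by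
    rw [← Real.exp_add]; ring_nf
  rw [← this]
  ring

/-- The product measure has a density at most `exp (2 K |A|)` with respect to the conditional
measure on `A`. -/
theorem avg_le_E {A : Finset V} {f : Obs (V → S)} {ρ : V → S}
    (hf : ∀ σ, 0 ≤ f (A.piecewise σ ρ)) :
    M.avg A f ρ ≤ Real.exp (2 * K * A.card) * M.E A f ρ := by
  have hw := M.w_pos ρ
  have h1 : M.avg A ((Real.exp (-(K * A.card)) * M.w ρ) • f) ρ ≤ M.avg A (f * M.w) ρ :=
    M.avg_mono fun σ => by
      rw [Obs.mul_apply, Obs.smul_apply, mul_comm (f _)]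
      exact mul_le_mul_of_nonneg_right (le_w_piecewise hK A σ ρ) (hf σ)
  have h2 : M.avg A M.w ρ ≤ Real.exp (K * A.card) * M.w ρ := by
    have := M.avg_mono (A := A) (g := (Real.exp (K * A.card) * M.w ρ) • 1) (f := M.w) (ρ := ρ)
      fun σ => by simpa using w_piecewise_le hK A σ ρ
    simpa using this
  rw [map_smul, Obs.smul_apply] at h1
  have h0 : 0 ≤ M.E A f ρ := M.E_nonneg hf
  have h3 : M.avg A (f * M.w) ρ = M.E A f ρ * M.avg A M.w ρ := by rw [avg_mul_w, Obs.mul_apply]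
  rw [h3] at h1
  have h4 := h1.trans (mul_le_mul_of_nonneg_left h2 h0)
  rw [Real.exp_neg] at h4
  have he := Real.exp_pos (K * A.card)
  have h5 : M.avg A f ρ ≤ Real.exp (K * A.card) * (M.E A f ρ * Real.exp (K * A.card)) := by
    rw [← inv_mul_le_iff₀ he]
    refine le_of_mul_le_mul_right ?_ hw
    linarith
  refine h5.trans_eq ?_
  have : Real.exp (2 * K * A.card) = Real.exp (K * A.card) * Real.exp (K * A.card) := by
    rw [← Real.exp_add]; ring_nf
  rw [this]
  ring

/-- Poincaré inequality on `A` by comparison with the product measure. The constant depends only on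
the cardinality of `A` and on the influence of single spins on the weight. -/
theorem Var_le_of_osc (A : Finset V) (f : Obs (V → S)) (ρ : V → S) :
    M.Var A f ρ ≤ Real.exp (2 * K * A.card) * Real.exp (2 * K * A.card) * Real.exp (2 * K) *
      ∑ y ∈ A, M.E A (M.Var {y} f) ρ := by
  have h1 : M.Var A f ρ ≤ Real.exp (2 * K * A.card) * M.flat.Var A f ρ := by
    refine (M.Var_le f (M.freeOf_avg A f) ρ).trans ?_
    refine (E_le_avg hK fun σ => ?_).trans_eq ?_
    · simpa using mul_self_nonneg _
    · rw [Var_eq, flat_E]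
  have h2 : M.flat.Var A f ρ ≤ ∑ y ∈ A, M.avg A (M.flat.Var {y} f) ρ := by
    have := M.flat.Var_biUnion_le A (fun y => {y}) (fun i _ s' _ hi => M.flat_sep (by simpa using hi))
      f ρ
    simpa [flat_E] using this
  have h3 : ∀ y ∈ A, M.avg A (M.flat.Var {y} f) ρ ≤
      Real.exp (2 * K * A.card) * (Real.exp (2 * K) * M.E A (M.Var {y} f) ρ) := by
    intro y _
    refine (avg_le_E hK fun σ => M.flat.Var_nonneg _ _ _).trans ?_
    refine mul_le_mul_of_nonneg_left ?_ (Real.exp_pos _).le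
    have : M.E A (M.flat.Var {y} f) ρ ≤ M.E A (Real.exp (2 * K) • M.Var {y} f) ρ :=
      M.E_mono fun σ => by
        refine (M.flat.Var_le f (M.freeOf_E {y} f) _).trans ?_
        rw [flat_E, Obs.smul_apply, M.Var_eq]
        refine (avg_le_E hK fun σ => ?_).trans_eq (by simp)
        simpa using mul_self_nonneg _
    simpa using this
  refine h1.trans ?_
  rw [mul_assoc (Real.exp _ * _), mul_assoc (Real.exp _)]
  refine mul_le_mul_of_nonneg_left ?_ (Real.exp_pos _).le
  refine h2.trans ((Finset.sum_le_sum h3).trans_eq ?_)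
  simp only [Finset.mul_sum]

omit hK

variable (M)

/-! ### The heat-bath semigroup -/

/-- The generator of the heat-bath dynamics in `A`. -/
def gen (A : Finset V) : Obs (V → S) →L[ℝ] Obs (V → S) := ∑ x ∈ A, (M.E {x} - 1)

/-- The sum of the single-site conditional expectations. -/
def resample (A : Finset V) : Obs (V → S) →L[ℝ] Obs (V → S) := ∑ x ∈ A, M.E {x}

/-- The semigroup of the heat-bath dynamics in `A`, with the spins outside `A` frozen. -/
def P (A : Finset V) (t : ℝ) : Obs (V → S) →L[ℝ] Obs (V → S) := NormedSpace.exp (t • M.gen A)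

theorem gen_apply (A : Finset V) (f : Obs (V → S)) : M.gen A f = ∑ x ∈ A, (M.E {x} f - f) := by
  simp [gen]

theorem resample_apply (A : Finset V) (f : Obs (V → S)) :
    M.resample A f = ∑ x ∈ A, M.E {x} f := by
  simp [resample]

theorem P_zero (A : Finset V) : M.P A 0 = 1 := exp_zero_smul _

theorem P_add (A : Finset V) (s t : ℝ) (f : Obs (V → S)) :
    M.P A (s + t) f = M.P A s (M.P A t f) := exp_add_smul _ _ _ _

theorem hasDerivAt_P (A : Finset V) (f : Obs (V → S)) (t : ℝ) :
    HasDerivAt (fun u => M.P A u f) (M.gen A (M.P A t f)) t := hasDerivAt_exp_smul _ _ _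

/-- Poissonization: the semigroup is a mixture of the powers of the resampling operator, with
Poisson weights of mean `t |A|`. -/
theorem hasSum_P (A : Finset V) (t : ℝ) (f : Obs (V → S)) :
    HasSum (fun k : ℕ => (Real.exp (-(t * A.card)) * t ^ k / k.factorial) •
      ((M.resample A) ^ k) f) (M.P A t f) :=
  hasSum_exp_smul (fun f => by
    rw [gen_apply, resample_apply, Finset.sum_sub_distrib, Finset.sum_const,
      ← Nat.cast_smul_eq_nsmul ℝ]) _ _

/-- Closed convex cones that are stable under all single-site conditional expectations are stable
under the semigroup. -/
theorem P_mem {A : Finset V} {C : Set (Obs (V → S))} (hcl : IsClosed C) (h0 : 0 ∈ C)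
    (hadd : ∀ f ∈ C, ∀ g ∈ C, f + g ∈ C) (hsmul : ∀ c : ℝ, 0 ≤ c → ∀ f ∈ C, c • f ∈ C)
    (hE : ∀ x ∈ A, ∀ f ∈ C, M.E {x} f ∈ C) {t : ℝ} (ht : 0 ≤ t) {f : Obs (V → S)} (hf : f ∈ C) :
    M.P A t f ∈ C := by
  have hsum : ∀ (s : Finset V) (g : V → Obs (V → S)), (∀ i ∈ s, g i ∈ C) →
      ∑ i ∈ s, g i ∈ C := fun s g hg =>
    Finset.sum_induction g (· ∈ C) (fun a c ha hc => hadd a ha c hc) h0 hg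
  have hsum' : ∀ (s : Finset ℕ) (g : ℕ → Obs (V → S)), (∀ i ∈ s, g i ∈ C) →
      ∑ i ∈ s, g i ∈ C := fun s g hg =>
    Finset.sum_induction g (· ∈ C) (fun a c ha hc => hadd a ha c hc) h0 hg
  have hpow : ∀ k : ℕ, ((M.resample A) ^ k) f ∈ C := by
    intro k
    induction k with
    | zero => simpa using hf
    | succ k ih =>
      rw [pow_succ', mul_apply_eq_comp, resample_apply]
      exact hsum _ _ fun x hx => hE x hx _ ih
  refine hcl.mem_of_tendsto (M.hasSum_P A t f) (Eventually.of_forall fun s => ?_)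
  exact hsum' _ _ fun k _ => hsmul _ (by positivity) (((M.resample A) ^ k) f) (hpow k)

theorem P_of_freeOf {A : Finset V} {f : Obs (V → S)} (hf : FreeOf A f) (t : ℝ) :
    M.P A t f = f := by
  have h0 : M.gen A f = 0 := by
    rw [gen_apply]
    exact Finset.sum_eq_zero fun x hx => by
      rw [M.E_of_freeOf (hf.mono (by simpa using hx)), sub_self]
  have h1 : ∀ k : ℕ, ((M.resample A) ^ k) f = ((A.card : ℝ) ^ k) • f := by
    intro k
    induction k with
    | zero => simp
    | succ k ih =>
      have : M.resample A f = (A.card : ℝ) • f := by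
        rw [gen_apply, Finset.sum_sub_distrib, Finset.sum_const, sub_eq_zero,
          ← Nat.cast_smul_eq_nsmul ℝ] at h0
        rw [resample_apply, h0]
      rw [pow_succ', mul_apply_eq_comp, ih, map_smul, this, smul_smul, pow_succ]
  have h2 := M.hasSum_P A t f
  simp only [h1, smul_smul] at h2
  refine h2.unique ?_
  have h3 : HasSum (fun k : ℕ => Real.exp (-(t * A.card)) * ((k.factorial : ℝ)⁻¹ * (t * A.card) ^ k))
      (Real.exp (-(t * A.card)) * Real.exp (t * A.card)) := by
    refine HasSum.mul_left _ ?_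
    have := NormedSpace.exp_series_hasSum_exp' (𝕂 := ℝ) (t * (A.card : ℝ))
    rw [← Real.exp_eq_exp_ℝ] at this
    simpa using this
  rw [← Real.exp_add, neg_add_cancel, Real.exp_zero] at h3
  have h4 := h3.smul_const f
  rw [one_smul] at h4
  convert h4 using 3
  rw [mul_pow]
  ring

@[simp] theorem P_one (A : Finset V) (t : ℝ) : M.P A t 1 = 1 := M.P_of_freeOf freeOf_one t

/-- Reversibility of the dynamics in `A` with respect to the conditional measure on any larger set.
-/
theorem P_symm {A B : Finset V} (h : A ⊆ B) (t : ℝ) (f g : Obs (V → S)) :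
    M.E B (M.P A t f * g) = M.E B (f * M.P A t g) := by
  have h1 : ∀ (k : ℕ) (f g : Obs (V → S)),
      M.E B (((M.resample A) ^ k) f * g) = M.E B (f * ((M.resample A) ^ k) g) := by
    intro k
    induction k with
    | zero => simp
    | succ k ih =>
      intro f g
      have h2 : ∀ f g : Obs (V → S),
          M.E B (M.resample A f * g) = M.E B (f * M.resample A g) := fun f g => by
        simp only [resample_apply, Finset.sum_mul, Finset.mul_sum, map_sum]
        exact Finset.sum_congr rfl fun x hx => M.E_symm (by simpa using h hx) f g
      rw [pow_succ', mul_apply_eq_comp, h2, ih, ← mul_apply_eq_comp,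
        ← pow_succ, pow_succ']
  have hl := (M.hasSum_P A t f).mapL ((M.E B).comp ((ContinuousLinearMap.mul ℝ _).flip g))
  have hr := (M.hasSum_P A t g).mapL ((M.E B).comp (ContinuousLinearMap.mul ℝ _ f))
  have key : ∀ k : ℕ, (M.E B).comp ((ContinuousLinearMap.mul ℝ _).flip g)
      ((Real.exp (-(t * A.card)) * t ^ k / k.factorial) • ((M.resample A) ^ k) f) =
      (M.E B).comp (ContinuousLinearMap.mul ℝ _ f)
      ((Real.exp (-(t * A.card)) * t ^ k / k.factorial) • ((M.resample A) ^ k) g) := by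
    intro k
    rw [map_smul, map_smul]
    exact congrArg _ (h1 k f g)
  rw [funext key] at hl
  exact hl.unique hr

theorem E_P {A B : Finset V} (h : A ⊆ B) (t : ℝ) (f : Obs (V → S)) :
    M.E B (M.P A t f) = M.E B f := by
  simpa using M.P_symm h t f 1

theorem P_nonneg {A : Finset V} {t : ℝ} (ht : 0 ≤ t) {f : Obs (V → S)} (hf : ∀ ρ, 0 ≤ f ρ)
    (ρ : V → S) : 0 ≤ M.P A t f ρ := by
  refine M.P_mem (C := {f | ∀ ρ, 0 ≤ f ρ}) ?_ (by simp) ?_ ?_ ?_ ht hf ρ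
  · simp only [Set.ofPred_forall]
    exact isClosed_iInter fun ρ => isClosed_le continuous_const (Obs.continuous_apply ρ)
  · exact fun f hf g hg ρ => add_nonneg (hf ρ) (hg ρ)
  · exact fun c hc f hf ρ => mul_nonneg hc (hf ρ)
  · exact fun x _ f hf ρ => M.E_nonneg fun σ => hf _

theorem P_mono {A : Finset V} {t : ℝ} (ht : 0 ≤ t) {f g : Obs (V → S)} (h : ∀ ρ, f ρ ≤ g ρ)
    (ρ : V → S) : M.P A t f ρ ≤ M.P A t g ρ := by
  have := M.P_nonneg (A := A) ht (f := g - f) (fun ρ => by simpa using h ρ) ρ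
  simpa using this

theorem freeOf_P {A B : Finset V} (h : ∀ x ∈ A, M.Sep {x} B) {t : ℝ} (ht : 0 ≤ t)
    {f : Obs (V → S)} (hf : FreeOf B f) : FreeOf B (M.P A t f) := by
  refine M.P_mem (C := {f | FreeOf B f}) ?_ ?_ ?_ ?_ ?_ ht hf
  · simp only [FreeOf, Set.ofPred_forall]
    exact isClosed_iInter fun ρ => isClosed_iInter fun σ => isClosed_iInter fun _ =>
      isClosed_eq (Obs.continuous_apply ρ) (Obs.continuous_apply σ)
  · exact fun ρ σ _ => by simp
  · exact fun f hf g hg => hf.add hg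
  · exact fun c _ f hf => hf.smul c
  · exact fun x hx f hf => (h x hx).freeOf_E hf

/-- Dynamics in two sets that do not interact commute and run independently. -/
theorem P_union {A B : Finset V} (hd : Disjoint A B) (h : ∀ x ∈ A, ∀ y ∈ B, M.Sep {x} {y}) (t : ℝ)
    (f : Obs (V → S)) : M.P (A ∪ B) t f = M.P A t (M.P B t f) := by
  have hc : Commute (M.gen A) (M.gen B) := by
    refine Commute.sum_left _ _ _ fun x hx => Commute.sum_right _ _ _ fun y hy => ?_
    have : Commute (M.E {x}) (M.E {y}) := by
      ext1 f
      exact (h x hx y hy).comm f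
    exact (this.sub_left (Commute.one_left _)).sub_right (Commute.one_right _)
  rw [P, gen, Finset.sum_union hd]
  exact exp_smul_add hc t f

theorem E_mul_gen {A B : Finset V} (h : A ⊆ B) (f g : Obs (V → S)) :
    M.E B (f * M.gen A g) = ∑ x ∈ A, M.E B (M.E {x} f * M.E {x} g - M.E {x} (f * g)) := by
  rw [gen_apply, Finset.mul_sum, map_sum]
  refine Finset.sum_congr rfl fun x hx => ?_
  have hx' : {x} ⊆ B := by simpa using h hx
  rw [mul_sub, map_sub, map_sub, M.E_E hx', M.E_symm hx', M.E_E subset_rfl]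

/-- A Poincaré inequality gives exponential decay of the variance. -/
theorem Var_P_le {B : Finset V} {ρ : V → S} {C : ℝ} (hC : 0 < C)
    (hgap : ∀ f, M.Var B f ρ ≤ C * ∑ x ∈ B, M.E B (M.Var {x} f) ρ) {t : ℝ} (ht : 0 ≤ t)
    (f : Obs (V → S)) : M.Var B (M.P B t f) ρ ≤ Real.exp (-(2 * t / C)) * M.Var B f ρ := by
  have hd : ∀ u, HasDerivAt (fun u => M.Var B (M.P B u f) ρ)
      (-(2 * ∑ x ∈ B, M.E B (M.Var {x} (M.P B u f)) ρ)) u := by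
    intro u
    have h1 : HasDerivAt (fun u => M.P B u f * M.P B u f) _ u :=
      (M.hasDerivAt_P B f u).mul (M.hasDerivAt_P B f u)
    have h2 := (((Obs.ev ρ).comp (M.E B)).hasFDerivAt.comp_hasDerivAt u h1).sub_const
      ((M.E B f * M.E B f) ρ)
    refine (h2.congr_deriv ?_).congr_of_eventuallyEq (Eventually.of_forall fun v => ?_)
    · have h3 := M.E_mul_gen subset_rfl (B := B) (M.P B u f) (M.P B u f)
      have h4 : M.E B (M.P B u f * M.gen B (M.P B u f)) =
          - ∑ x ∈ B, M.E B (M.Var {x} (M.P B u f)) := by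
        rw [h3, ← Finset.sum_neg_distrib]
        refine Finset.sum_congr rfl fun x _ => ?_
        rw [← map_neg, Var, neg_sub]
      rw [mul_comm (M.gen B _), map_add, ContinuousLinearMap.comp_apply, h4]
      simp only [Obs.ev_apply, Obs.neg_apply, Obs.sum_apply]
      ring
    · simp only [Var, M.E_P subset_rfl]
      rfl
  -- The derivative of the variance is minus twice the Dirichlet form, so that the variance
  -- multiplied by `exp (2 u / C)` decreases.
  have hanti : Antitone fun u => Real.exp (2 * u / C) * M.Var B (M.P B u f) ρ := by
    have hd2 : ∀ u, HasDerivAt (fun u => Real.exp (2 * u / C) * M.Var B (M.P B u f) ρ)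
        (Real.exp (2 * u / C) * (2 / C) * M.Var B (M.P B u f) ρ + Real.exp (2 * u / C) *
          (-(2 * ∑ x ∈ B, M.E B (M.Var {x} (M.P B u f)) ρ))) u := by
      intro u
      refine HasDerivAt.mul ?_ (hd u)
      have : HasDerivAt (fun u : ℝ => 2 * u / C) (2 / C) u := by
        simpa using ((hasDerivAt_id u).const_mul 2).div_const C
      exact this.exp
    refine antitone_of_deriv_nonpos (fun u => (hd2 u).differentiableAt) fun u => ?_
    rw [(hd2 u).deriv]
    have h5 := hgap (M.P B u f)
    have h6 : (2 / C) * M.Var B (M.P B u f) ρ ≤ 2 * ∑ x ∈ B, M.E B (M.Var {x} (M.P B u f)) ρ := by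
      rw [div_mul_eq_mul_div, div_le_iff₀ hC]
      linarith
    have h7 := mul_le_mul_of_nonneg_left h6 (Real.exp_pos (2 * u / C)).le
    linarith
  have h := hanti ht
  simp only [mul_zero, zero_div, Real.exp_zero, one_mul, P_zero, one_apply_eq_self] at h
  rw [Real.exp_neg, ← div_eq_inv_mul, le_div_iff₀ (Real.exp_pos _), mul_comm]
  exact h

/-- Censoring: for a stable cone `C` of positively correlated observables, the dynamics started
from a density in `C` increases expectations in `C` when updates are suppressed. -/
theorem censoring {R T : Finset V} (hRT : R ⊆ T) {C : Set (Obs (V → S))}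
    (hP : ∀ A : Finset V, ∀ t : ℝ, 0 ≤ t → ∀ f ∈ C, M.P A t f ∈ C)
    (hcov : ∀ (x : V), ∀ f ∈ C, ∀ g ∈ C, ∀ σ, (M.E {x} f * M.E {x} g) σ ≤ M.E {x} (f * g) σ)
    {t : ℝ} (ht : 0 ≤ t) {k g : Obs (V → S)} (hk : k ∈ C) (hg : g ∈ C) (ρ : V → S) :
    M.E T (k * M.P T t g) ρ ≤ M.E T (k * M.P R t g) ρ := by
  -- Interpolation between the two dynamics. The derivative is a sum over the suppressed updates
  -- of minus the conditional covariances of two functions in the cone.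
  have hd : ∀ u, HasDerivAt (fun u => M.E T (M.P T u k * M.P R (t - u) g) ρ)
      (∑ x ∈ T \ R, M.E T (M.E {x} (M.P T u k) * M.E {x} (M.P R (t - u) g) -
        M.E {x} (M.P T u k * M.P R (t - u) g)) ρ) u := by
    intro u
    have h0 : HasDerivAt (fun u => M.P R (t - u) g) ((-1 : ℝ) • M.gen R (M.P R (t - u) g)) u :=
      (M.hasDerivAt_P R g (t - u)).scomp u ((hasDerivAt_id u).const_sub t)
    have h1 := (M.hasDerivAt_P T k u).mul h0
    have h2 := ((Obs.ev ρ).comp (M.E T)).hasFDerivAt.comp_hasDerivAt u h1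
    refine h2.congr_deriv ?_
    have h3 : M.E T (M.gen T (M.P T u k) * M.P R (t - u) g) =
        M.E T (M.P T u k * M.gen T (M.P R (t - u) g)) := by
      rw [mul_comm, M.E_mul_gen subset_rfl, M.E_mul_gen subset_rfl]
      exact Finset.sum_congr rfl fun x _ => by rw [mul_comm, mul_comm (M.P R (t - u) g)]
    rw [map_add, mul_smul_comm, map_smul, ContinuousLinearMap.comp_apply, h3,
      ContinuousLinearMap.comp_apply, M.E_mul_gen subset_rfl, M.E_mul_gen hRT,
      ← Finset.sum_sdiff hRT]
    simp only [map_add, map_sum, map_sub, Obs.ev_apply, smul_eq_mul, Obs.sub_apply]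
    ring
  have hanti : AntitoneOn (fun u => M.E T (M.P T u k * M.P R (t - u) g) ρ) (Set.Icc 0 t) := by
    refine antitoneOn_of_deriv_nonpos (convex_Icc 0 t)
      (fun u _ => (hd u).continuousAt.continuousWithinAt)
      (fun u _ => (hd u).differentiableAt.differentiableWithinAt) fun u hu => ?_
    rw [interior_Icc] at hu
    rw [(hd u).deriv]
    refine Finset.sum_nonpos fun x _ => M.E_le_const fun σ => ?_
    rw [Obs.sub_apply, sub_nonpos]
    exact hcov x _ (hP T u hu.1.le k hk) _ (hP R (t - u) (by linarith [hu.2]) g hg) _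
  have h := hanti (Set.left_mem_Icc.2 ht) (Set.right_mem_Icc.2 ht) ht
  simp only [sub_self, P_zero, one_apply_eq_self, sub_zero] at h
  rwa [M.P_symm subset_rfl] at h

end Spec

/-! ### The free spin measure -/

section FreeSpin

variable {β lam : ℝ}

theorem timeMeasure_univ : timeMeasure β Set.univ = ENNReal.ofReal β := by
  rw [timeMeasure, (MeasurableEmbedding.subtype_coe measurableSet_Icc).comap_apply,
    Set.image_univ, Subtype.range_coe, Real.volume_Icc, sub_zero]

theorem timeMeasure_real_univ (hβ : 0 ≤ β) : (timeMeasure β).real Set.univ = β := by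
  rw [Measure.real, timeMeasure_univ, ENNReal.toReal_ofReal hβ]

namespace SpinPath

theorem measurable_flipAt (s : ℤˣ) (n : ℕ) :
    Measurable (flipAt s : (Fin n → Set.Icc (0 : ℝ) β) → SpinPath β) := by
  refine Measurable.subtype_mk (measurable_pi_lambda _ fun t => ?_)
  refine measurable_const.mul (Finset.measurable_prod _ fun i _ => ?_)
  refine Measurable.ite ?_ measurable_const measurable_const
  exact measurableSet_le (measurable_pi_apply i) measurable_const

@[ext] theorem ext {σ σ' : SpinPath β} (h : ∀ t, σ t = σ' t) : σ = σ' := Subtype.ext (funext h)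

theorem eq_or (σ : SpinPath β) (t : Set.Icc (0 : ℝ) β) : σ t = 1 ∨ σ t = -1 := σ.2.1 t

theorem abs_eq_one (σ : SpinPath β) (t : Set.Icc (0 : ℝ) β) : |σ t| = 1 := by
  rcases σ.eq_or t with h | h <;> simp [h]

theorem measurable_coe (σ : SpinPath β) : Measurable (fun t => σ t) :=
  measurable_uncurry.comp (measurable_const.prodMk measurable_id)

end SpinPath

/-- The probability that the Poisson process has `n` points, without the factor `β ^ n`. -/
def poissonCoeff (β lam : ℝ) (n : ℕ) : ℝ := Real.exp (-(lam * β)) * lam ^ n / n.factorial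

theorem poissonCoeff_nonneg (hlam : 0 ≤ lam) (n : ℕ) : 0 ≤ poissonCoeff β lam n := by
  unfold poissonCoeff; positivity

theorem hasSum_poissonCoeff (x : ℝ) :
    HasSum (fun n => poissonCoeff β lam n * (β - x) ^ n) (Real.exp (-(lam * x))) := by
  have h := (NormedSpace.exp_series_hasSum_exp' (𝕂 := ℝ) (lam * (β - x))).mul_left
    (Real.exp (-(lam * β)))
  rw [← Real.exp_eq_exp_ℝ, ← Real.exp_add] at h
  have e : -(lam * β) + lam * (β - x) = -(lam * x) := by ring
  rw [e] at h
  have h' : ∀ n : ℕ, Real.exp (-(lam * β)) * ((n.factorial : ℝ)⁻¹ • (lam * (β - x)) ^ n) =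
      poissonCoeff β lam n * (β - x) ^ n := fun n => by
    simp only [poissonCoeff, mul_pow, smul_eq_mul]
    ring
  exact (funext h') ▸ h

theorem isProbabilityMeasure_freeSpin (hβ : 0 ≤ β) (hlam : 0 ≤ lam) :
    IsProbabilityMeasure (freeSpin β lam) := by
  refine ⟨?_⟩
  rw [freeSpin, Measure.sum_apply _ MeasurableSet.univ]
  have h : ∀ n : ℕ, (ENNReal.ofReal (Real.exp (-(lam * β)) * lam ^ n / n.factorial) •
      ((2⁻¹ : ℝ≥0∞) •
        ((Measure.pi fun _ : Fin n => timeMeasure β).map (SpinPath.flipAt 1) +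
         (Measure.pi fun _ : Fin n => timeMeasure β).map (SpinPath.flipAt (-1))))) Set.univ =
      ENNReal.ofReal (poissonCoeff β lam n * (β - 0) ^ n) := by
    intro n
    simp only [Measure.smul_apply, Measure.add_apply, smul_eq_mul]
    rw [Measure.map_apply (SpinPath.measurable_flipAt _ _) MeasurableSet.univ,
      Measure.map_apply (SpinPath.measurable_flipAt _ _) MeasurableSet.univ, Set.preimage_univ,
      Set.preimage_univ, Measure.pi_univ, ← two_mul, ← mul_assoc (2⁻¹ : ℝ≥0∞),
      ENNReal.inv_mul_cancel (by norm_num) (by norm_num), one_mul,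
      ENNReal.ofReal_mul (poissonCoeff_nonneg hlam n), sub_zero, ENNReal.ofReal_pow hβ]
    simp [timeMeasure_univ, poissonCoeff]
  have hs := hasSum_poissonCoeff (β := β) (lam := lam) 0
  rw [tsum_congr h, ← ENNReal.ofReal_tsum_of_nonneg
    (fun n => mul_nonneg (poissonCoeff_nonneg hlam n) (by rw [sub_zero]; exact pow_nonneg hβ n))
    hs.summable, hs.tsum_eq]
  simp

/-- Integration against the free spin measure. -/
theorem hasSum_integral_freeSpin (hβ : 0 ≤ β) (hlam : 0 ≤ lam) (f : Obs (SpinPath β)) :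
    HasSum (fun n => poissonCoeff β lam n * ∫ u : Fin n → Set.Icc (0 : ℝ) β,
      (f (SpinPath.flipAt 1 u) + f (SpinPath.flipAt (-1) u)) / 2 ∂(Measure.pi fun _ => timeMeasure β))
      (∫ σ, f σ ∂(freeSpin β lam)) := by
  have := isProbabilityMeasure_freeSpin hβ hlam
  have h := hasSum_integral_measure (f := f) (f.integrable (freeSpin β lam))
  have h' : ∀ n : ℕ, ∫ σ, f σ ∂(ENNReal.ofReal (Real.exp (-(lam * β)) * lam ^ n / n.factorial) •
      ((2⁻¹ : ℝ≥0∞) •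
        ((Measure.pi fun _ : Fin n => timeMeasure β).map (SpinPath.flipAt 1) +
         (Measure.pi fun _ : Fin n => timeMeasure β).map (SpinPath.flipAt (-1))))) =
      poissonCoeff β lam n * ∫ u : Fin n → Set.Icc (0 : ℝ) β,
      (f (SpinPath.flipAt 1 u) + f (SpinPath.flipAt (-1) u)) / 2
        ∂(Measure.pi fun _ => timeMeasure β) := by
    intro n
    have hi : ∀ e : ℤˣ, Integrable (fun u : Fin n → Set.Icc (0 : ℝ) β => f (SpinPath.flipAt e u))
        (Measure.pi fun _ => timeMeasure β) := fun e =>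
      (f.comp _ (SpinPath.measurable_flipAt e n)).integrable _
    have hi' : ∀ e : ℤˣ, Integrable f ((Measure.pi fun _ : Fin n => timeMeasure β).map
        (SpinPath.flipAt e)) := fun e => f.integrable _
    rw [integral_smul_measure, integral_smul_measure, integral_add_measure (hi' 1) (hi' (-1)),
      integral_map (SpinPath.measurable_flipAt _ _).aemeasurable
        f.measurable.aestronglyMeasurable,
      integral_map (SpinPath.measurable_flipAt _ _).aemeasurable
        f.measurable.aestronglyMeasurable, integral_div, integral_add (hi 1) (hi (-1)),
      ENNReal.toReal_ofReal (by positivity)]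
    simp only [poissonCoeff, smul_eq_mul, ENNReal.toReal_inv, ENNReal.toReal_ofNat]
    ring
  exact (funext h') ▸ h

/-- The indicator of prescribed signs, as a product over nearest neighbours. -/
theorem indicator_signs (x s : ℕ → ℝ) (hx : ∀ k, x k = 1 ∨ x k = -1) (hs : ∀ k, s k = 1 ∨ s k = -1)
    (K : ℕ) : (1 + s 0 * x 0) / 2 * ∏ k ∈ Finset.range K,
      ((1 + s k * s (k + 1) * (x k * x (k + 1))) / 2) =
      if ∀ k ≤ K, x k = s k then 1 else 0 := by
  induction K with
  | zero =>
    rcases hx 0 with h | h <;> rcases hs 0 with h' | h' <;> simp [h, h'] <;> norm_num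
  | succ K ih =>
    rw [Finset.prod_range_succ, ← mul_assoc, ih]
    have hiff : (∀ k ≤ K + 1, x k = s k) ↔ (∀ k ≤ K, x k = s k) ∧ x (K + 1) = s (K + 1) := by
      constructor
      · exact fun h => ⟨fun k hk => h k (by omega), h _ le_rfl⟩
      · rintro ⟨h1, h2⟩ k hk
        rcases Nat.lt_or_ge k (K + 1) with h | h
        · exact h1 k (by omega)
        · rw [show k = K + 1 by omega]; exact h2
    by_cases h : ∀ k ≤ K, x k = s k
    · rw [if_pos h, if_congr (hiff.trans (and_iff_right h)) rfl rfl, h K le_rfl]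
      rcases hx (K + 1) with h1 | h1 <;> rcases hs (K + 1) with h2 | h2 <;>
        rcases hs K with h3 | h3 <;> simp [h1, h2, h3] <;> norm_num
    · rw [if_neg h, if_neg fun h' => h (hiff.1 h').1, zero_mul]

theorem prod_one_sub_of_disjoint (S : Finset ℕ) (d : ℕ → ℝ)
    (hd : ∀ i j, i ≠ j → d i * d j = 0) : ∏ k ∈ S, (1 - d k) = 1 - ∑ k ∈ S, d k := by
  induction S using Finset.induction_on with
  | empty => simp
  | insert a S ha ih =>
    rw [Finset.prod_insert ha, Finset.sum_insert ha, ih]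
    have : d a * ∑ k ∈ S, d k = 0 := by
      rw [Finset.mul_sum]
      exact Finset.sum_eq_zero fun k hk => hd _ _ fun h => ha (h ▸ hk)
    linarith

/-- The finite-dimensional distributions of the free spin are those of a Markov chain with two
states that favours not to flip. -/
theorem freeSpin_fidi (hβ : 0 ≤ β) (hlam : 0 ≤ lam) (t : ℕ → Set.Icc (0 : ℝ) β) (ht : Monotone t) :
    ∃ θ : ℕ → ℝ, (∀ k, 0 ≤ θ k ∧ θ k ≤ 1) ∧ ∀ (K : ℕ) (s : ℕ → ℝ), (∀ k, s k = 1 ∨ s k = -1) →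
      (freeSpin β lam).real {σ | ∀ k ≤ K, σ (t k) = s k} =
        1 / 2 * ∏ k ∈ Finset.range K, ((1 + s k * s (k + 1) * θ k) / 2) := by
  have hprob := isProbabilityMeasure_freeSpin hβ hlam
  -- A flip at time `u` changes the sign of `σ (t k) * σ (t (k + 1))` exactly if `t k < u ≤ t (k +
  -- 1)`, that is, it multiplies this product by `1 - d k u`.
  let d : ℕ → Set.Icc (0 : ℝ) β → ℝ := fun k => (Set.Ioc (t k) (t (k + 1))).indicator fun _ => 2
  let a : ℕ → ℝ := fun k => ∫ u, d k u ∂(timeMeasure β)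
  have hdint : ∀ k, Integrable (d k) (timeMeasure β) := fun k =>
    (integrable_const _).indicator measurableSet_Ioc
  have hd : ∀ u i j, i ≠ j → d i u * d j u = 0 := by
    intro u i j hij
    have hlt : ∀ i j, i < j → d i u * d j u = 0 := by
      intro i j hij
      by_cases hi : u ∈ Set.Ioc (t i) (t (i + 1))
      · have : u ∉ Set.Ioc (t j) (t (j + 1)) := fun hj =>
          absurd (hj.1.trans_le (hi.2.trans (ht hij))) (lt_irrefl _)
        simp [d, this]
      · simp [d, hi]
    rcases lt_or_gt_of_ne hij with h | h
    · exact hlt i j h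
    · rw [mul_comm]; exact hlt j i h
  have ha : ∀ k, 0 ≤ a k := fun k =>
    integral_nonneg fun u => Set.indicator_nonneg (fun _ _ => zero_le_two) u
  refine ⟨fun k => Real.exp (-(lam * a k)), fun k => ⟨(Real.exp_pos _).le,
    Real.exp_le_one_iff.2 (by simpa using mul_nonneg hlam (ha k))⟩, fun K s hs => ?_⟩
  have hmeas : MeasurableSet {σ : SpinPath β | ∀ k ≤ K, σ (t k) = s k} := by
    simp only [Set.ofPred_forall]
    exact MeasurableSet.iInter fun k => MeasurableSet.iInter fun _ =>
      SpinPath.measurable_eval (t k) (measurableSet_singleton (s k))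
  classical
  let f : Obs (SpinPath β) := Obs.mk ({σ | ∀ k ≤ K, σ (t k) = s k}.indicator fun _ => (1 : ℝ))
    (measurable_const.indicator hmeas) 1 fun σ => by
      by_cases h : σ ∈ {σ : SpinPath β | ∀ k ≤ K, σ (t k) = s k} <;> simp [h]
  have hf : ∫ σ, f σ ∂(freeSpin β lam) = (freeSpin β lam).real {σ | ∀ k ≤ K, σ (t k) = s k} := by
    simp only [f, Obs.mk_apply]
    rw [integral_indicator hmeas]
    simp
  rw [← hf]
  have hsum := hasSum_integral_freeSpin hβ hlam f
  have hcoord : ∀ (n : ℕ) (e : ℤˣ) (u : Fin n → Set.Icc (0 : ℝ) β) (k : ℕ),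
      SpinPath.flipAt e u (t k) * SpinPath.flipAt e u (t (k + 1)) = ∏ i, (1 - d k (u i)) := by
    intro n e u k
    change (((e : ℤ) : ℝ) * _) * (((e : ℤ) : ℝ) * _) = _
    have he : ((e : ℤ) : ℝ) * ((e : ℤ) : ℝ) = 1 := by
      rcases Int.units_eq_one_or e with rfl | rfl <;> simp
    rw [mul_mul_mul_comm, he, one_mul, ← Finset.prod_mul_distrib]
    refine Finset.prod_congr rfl fun i _ => ?_
    by_cases h1 : u i ≤ t k
    · have h2 : u i ≤ t (k + 1) := h1.trans (ht k.le_succ)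
      have h3 : u i ∉ Set.Ioc (t k) (t (k + 1)) := fun h => absurd h.1 (not_lt.2 h1)
      simp [h1, h2, d]
    · by_cases h2 : u i ≤ t (k + 1)
      · have h3 : u i ∈ Set.Ioc (t k) (t (k + 1)) := ⟨not_le.1 h1, h2⟩
        simp only [h1, h2, d, h3, Set.indicator_of_mem, if_true, if_false]
        norm_num
      · have h3 : u i ∉ Set.Ioc (t k) (t (k + 1)) := fun h => absurd h.2 h2
        simp [h1, h2, d]
  -- The product over `k` is expanded into a sum over subsets; averaging over the sign of the path
  -- removes the factor that contains `σ (t 0)`. Integration over the `n` flips then gives an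
  -- `n`-th power, and summation over the Poisson weights an exponential that factorizes over `k`.
  have hval : ∀ (n : ℕ) (u : Fin n → Set.Icc (0 : ℝ) β),
      (f (SpinPath.flipAt 1 u) + f (SpinPath.flipAt (-1) u)) / 2 =
      1 / 2 * ((1 / 2) ^ K * ∑ S ∈ (Finset.range K).powerset,
        (∏ k ∈ S, (s k * s (k + 1))) * ∏ i, (1 - ∑ k ∈ S, d k (u i))) := by
    intro n u
    have h1 : ∀ e : ℤˣ, f (SpinPath.flipAt e u) = (1 + s 0 * SpinPath.flipAt e u (t 0)) / 2 *
        ∏ k ∈ Finset.range K, ((1 + s k * s (k + 1) * ∏ i, (1 - d k (u i))) / 2) := by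
      intro e
      have := indicator_signs (fun k => SpinPath.flipAt e u (t k)) s
        (fun k => (SpinPath.flipAt e u).2.1 (t k)) hs K
      simp only [hcoord] at this
      rw [this]
      simp [f, Set.indicator_apply]
    have h2 : SpinPath.flipAt (-1) u (t 0) = -SpinPath.flipAt 1 u (t 0) := by
      change (((-1 : ℤˣ) : ℤ) : ℝ) * _ = -((((1 : ℤˣ) : ℤ) : ℝ) * _)
      simp
    have h3 : ∏ k ∈ Finset.range K, ((1 + s k * s (k + 1) * ∏ i, (1 - d k (u i))) / 2) =
        (1 / 2) ^ K * ∑ S ∈ (Finset.range K).powerset,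
        (∏ k ∈ S, (s k * s (k + 1))) * ∏ i, (1 - ∑ k ∈ S, d k (u i)) := by
      simp only [div_eq_mul_inv]
      rw [Finset.prod_mul_distrib, Finset.prod_const, Finset.card_range, mul_comm,
        Finset.prod_one_add, one_mul]
      refine congrArg _ (Finset.sum_congr rfl fun S _ => ?_)
      rw [Finset.prod_mul_distrib, Finset.prod_comm]
      refine congrArg _ (Finset.prod_congr rfl fun i _ => ?_)
      exact prod_one_sub_of_disjoint S (fun k => d k (u i)) (hd (u i))
    rw [h1, h1, h2, h3]
    ring
  have hint : ∀ (n : ℕ), ∫ u : Fin n → Set.Icc (0 : ℝ) β,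
      (f (SpinPath.flipAt 1 u) + f (SpinPath.flipAt (-1) u)) / 2
        ∂(Measure.pi fun _ => timeMeasure β) =
      1 / 2 * ((1 / 2) ^ K * ∑ S ∈ (Finset.range K).powerset,
        (∏ k ∈ S, (s k * s (k + 1))) * (β - ∑ k ∈ S, a k) ^ n) := by
    intro n
    simp only [hval]
    have hint1 : ∀ S : Finset ℕ, Integrable (fun u => 1 - ∑ k ∈ S, d k u) (timeMeasure β) :=
      fun S => (integrable_const _).sub (integrable_finsetSum _ fun k _ => hdint k)
    rw [integral_const_mul, integral_const_mul, integral_finsetSum]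
    · refine congrArg _ (congrArg _ (Finset.sum_congr rfl fun S _ => ?_))
      rw [integral_const_mul, integral_fintype_prod_eq_pow (fun v => 1 - ∑ k ∈ S, d k v),
        Fintype.card_fin, integral_sub (integrable_const _) (integrable_finsetSum _ fun k _ => hdint k),
        integral_finsetSum _ fun k _ => hdint k]
      simp [timeMeasure_real_univ hβ, a]
    · intro S _
      exact (Integrable.fintype_prod (f := fun _ : Fin n => fun v => 1 - ∑ k ∈ S, d k v)
        fun _ => hint1 S).const_mul _
  simp only [hint] at hsum
  refine hsum.unique ?_
  have h4 : HasSum (fun n => 1 / 2 * ((1 / 2) ^ K * ∑ S ∈ (Finset.range K).powerset,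
        (∏ k ∈ S, (s k * s (k + 1))) * (poissonCoeff β lam n * (β - ∑ k ∈ S, a k) ^ n)))
      (1 / 2 * ((1 / 2) ^ K * ∑ S ∈ (Finset.range K).powerset,
        (∏ k ∈ S, (s k * s (k + 1))) * Real.exp (-(lam * ∑ k ∈ S, a k)))) :=
    ((hasSum_sum fun S _ => (hasSum_poissonCoeff _).mul_left _).mul_left _).mul_left _
  convert h4 using 1
  · funext n
    rw [Finset.mul_sum, Finset.mul_sum, Finset.mul_sum, Finset.mul_sum, Finset.mul_sum]
    exact Finset.sum_congr rfl fun S _ => by ring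
  · simp only [div_eq_mul_inv]
    rw [Finset.prod_mul_distrib, Finset.prod_const, Finset.card_range, Finset.prod_one_add, one_mul]
    rw [mul_comm (∑ S ∈ _, _)]
    refine congrArg _ (congrArg _ (Finset.sum_congr rfl fun S _ => ?_))
    rw [Finset.prod_mul_distrib, ← Real.exp_sum, Finset.mul_sum, Finset.sum_neg_distrib]

/-! ### Discretization of imaginary time -/

/-- The `k`-th grid point of mesh `1 / (n + 1)`. -/
def gridPt (hβ : 0 ≤ β) (n k : ℕ) : Set.Icc (0 : ℝ) β := Set.projIcc 0 β hβ ((k + 1 : ℝ) / (n + 1))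

/-- The index of the first grid point to the right of `t`. -/
def gridIdx (n : ℕ) (t : Set.Icc (0 : ℝ) β) : ℕ := ⌊(n + 1 : ℝ) * t⌋₊

theorem gridPt_mono (hβ : 0 ≤ β) (n : ℕ) : Monotone (gridPt hβ n) := fun i j h =>
  Set.monotone_projIcc hβ (by gcongr)

theorem gridIdx_le (n : ℕ) (t : Set.Icc (0 : ℝ) β) : gridIdx n t ≤ ⌊(n + 1 : ℝ) * β⌋₊ :=
  Nat.floor_le_floor (mul_le_mul_of_nonneg_left t.2.2 (by positivity))

/-- The grid points approach `t` from the right, so that a right continuous path is the limit of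
its discretizations. -/
theorem tendsto_gridPt (hβ : 0 ≤ β) (t : Set.Icc (0 : ℝ) β) :
    Tendsto (fun n => gridPt hβ n (gridIdx n t)) atTop (𝓝[≥] t) := by
  refine tendsto_nhdsWithin_iff.2 ⟨?_, Eventually.of_forall fun n => ?_⟩
  · have h1 : Tendsto (fun n : ℕ => ((gridIdx n t : ℝ) + 1) / (n + 1)) atTop (𝓝 (t : ℝ)) := by
      have h2 : Tendsto (fun n : ℕ => (t : ℝ) + 1 / ((n : ℝ) + 1)) atTop (𝓝 (t : ℝ)) := by
        simpa using (tendsto_const_nhds (x := (t : ℝ))).add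
          (tendsto_one_div_add_atTop_nhds_zero_nat (𝕜 := ℝ))
      refine tendsto_of_tendsto_of_tendsto_of_le_of_le tendsto_const_nhds h2 ?_ ?_
      · intro n
        have hn : (0 : ℝ) < n + 1 := by positivity
        have := Nat.lt_floor_add_one ((n + 1 : ℝ) * (t : ℝ))
        simp only [gridIdx]
        rw [le_div_iff₀ hn]
        linarith
      · intro n
        have hn : (0 : ℝ) < n + 1 := by positivity
        have := Nat.floor_le (mul_nonneg hn.le t.2.1)
        simp only [gridIdx]
        rw [div_le_iff₀ hn, add_mul (t : ℝ), one_div, inv_mul_cancel₀ hn.ne']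
        linarith
    have := (continuous_projIcc (h := hβ)).tendsto (t : ℝ)
    rw [Set.projIcc_val] at this
    exact this.comp h1
  · have hn : (0 : ℝ) < n + 1 := by positivity
    have := Nat.lt_floor_add_one ((n + 1 : ℝ) * (t : ℝ))
    have h3 : (t : ℝ) ≤ ((gridIdx n t : ℝ) + 1) / (n + 1) := by
      simp only [gridIdx]
      rw [le_div_iff₀ hn]
      linarith
    have := Set.monotone_projIcc hβ h3
    rw [Set.projIcc_val] at this
    exact this

/-- The path with the value `a k` on the `k`-th cell of the grid of mesh `1 / (n + 1)`. -/
def stepPath (β : ℝ) (n : ℕ) (a : ℕ → ℝ) (ha : ∀ k, a k = 1 ∨ a k = -1) : SpinPath β :=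
  ⟨fun t => a (gridIdx n t), fun t => ha _, fun t => by
    have hcont : Tendsto (fun r : Set.Icc (0 : ℝ) β => (n + 1 : ℝ) * r) (𝓝[≥] t)
        (𝓝[≥] ((n + 1 : ℝ) * t)) := by
      refine tendsto_nhdsWithin_iff.2 ⟨?_, ?_⟩
      · exact Continuous.continuousWithinAt (by fun_prop)
      · filter_upwards [self_mem_nhdsWithin] with r hr
        have hr' : (t : ℝ) ≤ r := hr
        exact mul_le_mul_of_nonneg_left hr' (by positivity)
    have h1 := ((tendsto_floor_right_pure_floor ((n + 1 : ℝ) * t)).comp hcont)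
    have h2 : ∀ᶠ r : Set.Icc (0 : ℝ) β in 𝓝[≥] t, a (gridIdx n t) = a (gridIdx n r) := by
      filter_upwards [tendsto_pure.1 h1] with r hr
      simp only [gridIdx, ← Int.floor_toNat]
      rw [← hr]
      rfl
    exact tendsto_const_nhds.congr' h2, fun t => by
    refine ⟨a (⌈(n + 1 : ℝ) * t⌉ - 1).toNat, ?_⟩
    have hcont : Tendsto (fun r : Set.Icc (0 : ℝ) β => (n + 1 : ℝ) * r) (𝓝[<] t)
        (𝓝[<] ((n + 1 : ℝ) * t)) := by
      refine tendsto_nhdsWithin_iff.2 ⟨?_, ?_⟩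
      · exact Continuous.continuousWithinAt (by fun_prop)
      · filter_upwards [self_mem_nhdsWithin] with r hr
        have hr' : (r : ℝ) < t := hr
        exact mul_lt_mul_of_pos_left hr' (by positivity)
    have h1 := ((tendsto_floor_left_pure_ceil_sub_one ((n + 1 : ℝ) * t)).comp hcont)
    refine tendsto_const_nhds.congr' ?_
    filter_upwards [tendsto_pure.1 h1] with r hr
    simp only [gridIdx, ← Int.floor_toNat]
    rw [← hr]
    rfl⟩

theorem stepPath_apply (n : ℕ) (a : ℕ → ℝ) (ha : ∀ k, a k = 1 ∨ a k = -1)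
    (t : Set.Icc (0 : ℝ) β) : stepPath β n a ha t = a (gridIdx n t) := rfl

/-- The discretization of a path on the grid of mesh `1 / (n + 1)`. -/
def discretize (hβ : 0 ≤ β) (n : ℕ) (σ : SpinPath β) : SpinPath β :=
  stepPath β n (fun k => σ (gridPt hβ n k)) fun _ => σ.eq_or _

theorem tendsto_discretize (hβ : 0 ≤ β) (σ : SpinPath β) (t : Set.Icc (0 : ℝ) β) :
    Tendsto (fun n => discretize hβ n σ t) atTop (𝓝 (σ t)) :=
  (σ.2.2.1 t).tendsto.comp (tendsto_gridPt hβ t)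

theorem SpinPath.eq_of_gridPt (hβ : 0 ≤ β) {σ σ' : SpinPath β}
    (h : ∀ n k, σ (gridPt hβ n k) = σ' (gridPt hβ n k)) : σ = σ' := by
  ext t
  have h1 := tendsto_discretize hβ σ t
  have h2 := tendsto_discretize hβ σ' t
  refine tendsto_nhds_unique h1 (h2.congr fun n => ?_)
  simp [discretize, stepPath_apply, h]

theorem SpinPath.measurableSet_singleton (hβ : 0 ≤ β) (σ₀ : SpinPath β) : MeasurableSet {σ₀} := by
  have : ({σ₀} : Set (SpinPath β)) =
      ⋂ n, ⋂ k, {σ | σ (gridPt hβ n k) = σ₀ (gridPt hβ n k)} := by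
    ext σ
    simp only [Set.mem_singleton_iff, Set.mem_iInter, Set.mem_ofPred_eq]
    exact ⟨fun h => by simp [h], fun h => SpinPath.eq_of_gridPt hβ h⟩
  rw [this]
  exact MeasurableSet.iInter fun n => MeasurableSet.iInter fun k =>
    SpinPath.measurable_eval _ (MeasurableSet.singleton _)

/-- The constant paths have positive mass: with positive probability there is no flip. -/
theorem freeSpin_const_ge (hβ : 0 ≤ β) (hlam : 0 ≤ lam) (s : ℤˣ) :
    Real.exp (-(lam * β)) / 2 ≤ (freeSpin β lam).real {SpinPath.const β s} := by
  have hprob := isProbabilityMeasure_freeSpin hβ hlam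
  have hm := SpinPath.measurableSet_singleton hβ (SpinPath.const β s)
  have hu : ∀ u : Fin 0 → Set.Icc (0 : ℝ) β, SpinPath.flipAt s u = SpinPath.const β s := by
    intro u
    ext t
    change ((s : ℤ) : ℝ) * ∏ i, _ = ((s : ℤ) : ℝ)
    simp
  have h1 : ENNReal.ofReal (Real.exp (-(lam * β)) / 2) ≤ freeSpin β lam {SpinPath.const β s} := by
    rw [freeSpin, Measure.sum_apply _ hm]
    refine le_trans ?_ (ENNReal.le_tsum 0)
    simp only [Measure.smul_apply, Measure.add_apply, smul_eq_mul]
    have h2 : (1 : ℝ≥0∞) ≤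
        ((Measure.pi fun _ : Fin 0 => timeMeasure β).map (SpinPath.flipAt 1)) {SpinPath.const β s} +
        ((Measure.pi fun _ : Fin 0 => timeMeasure β).map (SpinPath.flipAt (-1)))
          {SpinPath.const β s} := by
      have h3 : ((Measure.pi fun _ : Fin 0 => timeMeasure β).map (SpinPath.flipAt s))
          {SpinPath.const β s} = 1 := by
        rw [Measure.map_apply (SpinPath.measurable_flipAt _ _) hm]
        have : SpinPath.flipAt s ⁻¹' {SpinPath.const β s} =
            (Set.univ : Set (Fin 0 → Set.Icc (0 : ℝ) β)) := by
          ext u; simp [hu]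
        rw [this, Measure.pi_univ]
        simp
      rcases Int.units_eq_one_or s with rfl | rfl
      · exact h3 ▸ le_self_add
      · exact h3 ▸ le_add_self
    calc ENNReal.ofReal (Real.exp (-(lam * β)) / 2)
        = ENNReal.ofReal (Real.exp (-(lam * β)) * lam ^ 0 / (Nat.factorial 0 : ℕ)) * (2⁻¹ * 1) := by
          rw [mul_one, pow_zero, mul_one, Nat.factorial_zero, Nat.cast_one, div_one, div_eq_mul_inv,
            ENNReal.ofReal_mul (Real.exp_pos _).le, ENNReal.ofReal_inv_of_pos (by norm_num)]
          simp
      _ ≤ _ := by gcongr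
  have h4 := ENNReal.toReal_mono (measure_ne_top _ _) h1
  rwa [ENNReal.toReal_ofReal (by positivity)] at h4

end FreeSpin

/-! ### Positive association -/

section FKG

variable {V : Type*} [Fintype V] [DecidableEq V] {β lam : ℝ}

/-- Sequential continuity for pointwise convergence of the paths. -/
def SeqCont (f : Obs (V → SpinPath β)) : Prop :=
  ∀ (σn : ℕ → V → SpinPath β) (σ : V → SpinPath β),
    (∀ i t, Tendsto (fun n => σn n i t) atTop (𝓝 (σ i t))) →
      Tendsto (fun n => f (σn n)) atTop (𝓝 (f σ))

/-- The pointwise order of spin configurations. -/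
def PathLE (σ σ' : V → SpinPath β) : Prop := ∀ i t, σ i t ≤ σ' i t

/-- Continuous increasing observables. -/
structure Inc (f : Obs (V → SpinPath β)) : Prop where
  cont : SeqCont f
  mono : ∀ σ σ', PathLE σ σ' → f σ ≤ f σ'

theorem SeqCont.add {f g : Obs (V → SpinPath β)} (hf : SeqCont f) (hg : SeqCont g) :
    SeqCont (f + g) := fun σn σ h => (hf σn σ h).add (hg σn σ h)

theorem SeqCont.mul {f g : Obs (V → SpinPath β)} (hf : SeqCont f) (hg : SeqCont g) :
    SeqCont (f * g) := fun σn σ h => (hf σn σ h).mul (hg σn σ h)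

theorem SeqCont.smul {f : Obs (V → SpinPath β)} (hf : SeqCont f) (c : ℝ) :
    SeqCont (c • f) := fun σn σ h => (hf σn σ h).const_mul c

theorem tendsto_piecewise (A : Finset V) {σn ρn : ℕ → V → SpinPath β} {σ ρ : V → SpinPath β}
    (h : ∀ i t, Tendsto (fun n => σn n i t) atTop (𝓝 (σ i t)))
    (h' : ∀ i t, Tendsto (fun n => ρn n i t) atTop (𝓝 (ρ i t))) (i : V) (t : Set.Icc (0 : ℝ) β) :
    Tendsto (fun n => A.piecewise (σn n) (ρn n) i t) atTop (𝓝 (A.piecewise σ ρ i t)) := by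
  by_cases hi : i ∈ A
  · simpa [hi] using h i t
  · simpa [hi] using h' i t

theorem SeqCont.freeze {f : Obs (V → SpinPath β)} (hf : SeqCont f) (A : Finset V)
    (ρ : V → SpinPath β) : SeqCont (Spec.freeze A ρ f) := fun _ _ h =>
  hf _ _ (tendsto_piecewise A h fun _ _ => tendsto_const_nhds)

theorem PathLE.piecewise (A : Finset V) {σ σ' ρ ρ' : V → SpinPath β} (h : PathLE σ σ')
    (h' : PathLE ρ ρ') : PathLE (A.piecewise σ ρ) (A.piecewise σ' ρ') := fun i t => by
  by_cases hi : i ∈ A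
  · simpa [hi] using h i t
  · simpa [hi] using h' i t

theorem PathLE.refl (σ : V → SpinPath β) : PathLE σ σ := fun _ _ => le_rfl

theorem Inc.freeze {f : Obs (V → SpinPath β)} (hf : Inc f) (A : Finset V)
    (ρ : V → SpinPath β) : Inc (Spec.freeze A ρ f) :=
  ⟨hf.cont.freeze A ρ, fun _ _ h => hf.mono _ _ (h.piecewise A (PathLE.refl ρ))⟩

/-- The sign encoded by a bit. -/
def boolSign (c : Bool) : ℝ := if c then 1 else -1

theorem boolSign_eq_or (c : Bool) : boolSign c = 1 ∨ boolSign c = -1 := by cases c <;> simp [boolSign]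

/-- Extension of a finite sequence of signs by `1`. -/
def extendSigns {K : ℕ} (s : Fin (K + 1) → Bool) (k : ℕ) : ℝ :=
  if h : k < K + 1 then boolSign (s ⟨k, h⟩) else 1

theorem extendSigns_eq_or {K : ℕ} (s : Fin (K + 1) → Bool) (k : ℕ) :
    extendSigns s k = 1 ∨ extendSigns s k = -1 := by
  unfold extendSigns
  split_ifs
  · exact boolSign_eq_or _
  · exact Or.inl rfl

theorem extendSigns_inf {K : ℕ} (s s' : Fin (K + 1) → Bool) (k : ℕ) :
    extendSigns (s ⊓ s') k = min (extendSigns s k) (extendSigns s' k) := by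
  unfold extendSigns
  split_ifs with h
  · rw [Pi.inf_apply]
    cases s ⟨k, h⟩ <;> cases s' ⟨k, h⟩ <;> norm_num [boolSign]
  · simp

theorem extendSigns_sup {K : ℕ} (s s' : Fin (K + 1) → Bool) (k : ℕ) :
    extendSigns (s ⊔ s') k = max (extendSigns s k) (extendSigns s' k) := by
  unfold extendSigns
  split_ifs with h
  · rw [Pi.sup_apply]
    cases s ⟨k, h⟩ <;> cases s' ⟨k, h⟩ <;> norm_num [boolSign]
  · simp

/-- The log-supermodularity of the weights of a ferromagnetic Markov chain on `{±1}`. -/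
theorem markov_supermodular (θ : ℕ → ℝ) (hθ : ∀ k, 0 ≤ θ k ∧ θ k ≤ 1) (K : ℕ) (a c : ℕ → ℝ)
    (ha : ∀ k, a k = 1 ∨ a k = -1) (hc : ∀ k, c k = 1 ∨ c k = -1) :
    (1 / 2 * ∏ k ∈ Finset.range K, ((1 + a k * a (k + 1) * θ k) / 2)) *
      (1 / 2 * ∏ k ∈ Finset.range K, ((1 + c k * c (k + 1) * θ k) / 2)) ≤
    (1 / 2 * ∏ k ∈ Finset.range K, ((1 + min (a k) (c k) * min (a (k + 1)) (c (k + 1)) * θ k) / 2)) *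
      (1 / 2 * ∏ k ∈ Finset.range K,
        ((1 + max (a k) (c k) * max (a (k + 1)) (c (k + 1)) * θ k) / 2)) := by
  have e : ∀ p q : ℝ, (1 / 2 * p) * (1 / 2 * q) = 1 / 4 * (p * q) := fun p q => by ring
  rw [e, e, ← Finset.prod_mul_distrib, ← Finset.prod_mul_distrib]
  refine mul_le_mul_of_nonneg_left (Finset.prod_le_prod (fun k _ => ?_) fun k _ => ?_) (by norm_num)
  · obtain ⟨h0, h1⟩ := hθ k
    rcases ha k with e1 | e1 <;> rcases ha (k + 1) with e2 | e2 <;> rcases hc k with e3 | e3 <;>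
      rcases hc (k + 1) with e4 | e4 <;> rw [e1, e2, e3, e4] <;>
      refine mul_nonneg ?_ ?_ <;> linarith
  · obtain ⟨h0, h1⟩ := hθ k
    rcases ha k with e1 | e1 <;> rcases ha (k + 1) with e2 | e2 <;> rcases hc k with e3 | e3 <;>
      rcases hc (k + 1) with e4 | e4 <;> rw [e1, e2, e3, e4] <;> norm_num <;> nlinarith

/-- The number of cells of the grid of mesh `1 / (n + 1)`, minus one. -/
def gridSize (β : ℝ) (n : ℕ) : ℕ := ⌊(n + 1 : ℝ) * β⌋₊

/-- The configuration of step paths with given signs. -/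
def stepConfig (β : ℝ) (n : ℕ) (s : V → Fin (gridSize β n + 1) → Bool) : V → SpinPath β :=
  fun i => stepPath β n (extendSigns (s i)) (extendSigns_eq_or (s i))

/-- The signs of a configuration on the grid. -/
def gridSigns (hβ : 0 ≤ β) (n : ℕ) (σ : V → SpinPath β) : V → Fin (gridSize β n + 1) → Bool :=
  fun i k => decide (σ i (gridPt hβ n k) = 1)

theorem boolSign_decide {x : ℝ} (hx : x = 1 ∨ x = -1) : boolSign (decide (x = 1)) = x := by
  rcases hx with rfl | rfl <;> norm_num [boolSign]

theorem stepConfig_gridSigns (hβ : 0 ≤ β) (n : ℕ) (σ : V → SpinPath β) :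
    stepConfig β n (gridSigns hβ n σ) = fun i => discretize hβ n (σ i) := by
  funext i
  ext t
  have h : gridIdx n t < gridSize β n + 1 := Nat.lt_succ_of_le (gridIdx_le n t)
  simp only [stepConfig, discretize, stepPath_apply, extendSigns, h, dif_pos, gridSigns]
  exact boolSign_decide ((σ i).eq_or _)

theorem measurable_gridSigns (hβ : 0 ≤ β) (n : ℕ) :
    Measurable (gridSigns hβ n : (V → SpinPath β) → _) := by
  refine measurable_pi_lambda _ fun i => measurable_pi_lambda _ fun k => ?_
  refine measurable_to_bool ?_
  have : (fun σ : V → SpinPath β => gridSigns hβ n σ i k) ⁻¹' {true} =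
      (fun σ : V → SpinPath β => σ i (gridPt hβ n k)) ⁻¹' {1} := by
    ext σ
    simp [gridSigns]
  rw [this]
  exact ((SpinPath.measurable_eval (gridPt hβ n k)).comp (measurable_pi_apply i))
    (measurableSet_singleton 1)

theorem gridSigns_preimage (hβ : 0 ≤ β) (n : ℕ) (s : V → Fin (gridSize β n + 1) → Bool) :
    gridSigns hβ n ⁻¹' {s} = Set.univ.pi fun i =>
      {σ : SpinPath β | ∀ k ≤ gridSize β n, σ (gridPt hβ n k) = extendSigns (s i) k} := by
  ext σ
  simp only [Set.mem_preimage, Set.mem_singleton_iff, Set.mem_univ_pi, Set.mem_ofPred_eq]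
  rw [funext_iff]
  refine forall_congr' fun i => ?_
  rw [funext_iff]
  have key : ∀ (x : ℝ) (c : Bool), (x = 1 ∨ x = -1) → (decide (x = 1) = c ↔ x = boolSign c) := by
    rintro x c (rfl | rfl) <;> cases c <;> norm_num [boolSign]
  constructor
  · intro h k hk
    have hk' : k < gridSize β n + 1 := by omega
    have := (key _ _ ((σ i).eq_or _)).1 (h ⟨k, hk'⟩)
    rw [extendSigns, dif_pos hk']
    exact this
  · intro h k
    refine (key _ _ ((σ i).eq_or _)).2 ?_
    have := h k (by omega)
    rw [extendSigns, dif_pos k.2] at this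
    exact this

variable (β lam) in
/-- The product of the free spin measures. -/
def freeConfig (V : Type*) [Fintype V] : Measure (V → SpinPath β) :=
  Measure.pi fun _ : V => freeSpin β lam

/-- The law of the discretized configuration, as a finite sum over the signs at the grid points. -/
theorem integral_discretize (hβ : 0 ≤ β) (hlam : 0 ≤ lam) (n : ℕ) (F : Obs (V → SpinPath β)) :
    ∫ σ, F (fun i => discretize hβ n (σ i)) ∂(freeConfig β lam V) =
      ∑ s : V → Fin (gridSize β n + 1) → Bool, (∏ i, (freeSpin β lam).real
        {σ | ∀ k ≤ gridSize β n, σ (gridPt hβ n k) = extendSigns (s i) k}) * F (stepConfig β n s) := by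
  have hprob := isProbabilityMeasure_freeSpin hβ hlam
  have hp2 : IsProbabilityMeasure (freeConfig β lam V) := by unfold freeConfig; infer_instance
  simp only [← stepConfig_gridSigns]
  have hm := measurable_gridSigns (V := V) hβ n
  rw [← integral_map (φ := gridSigns hβ n) (f := fun s => F (stepConfig β n s)) hm.aemeasurable
    (measurable_of_finite _).aestronglyMeasurable]
  have : IsProbabilityMeasure ((freeConfig β lam V).map (gridSigns hβ n)) :=
    Measure.isProbabilityMeasure_map hm.aemeasurable
  rw [integral_fintype (Integrable.of_finite)]
  refine Finset.sum_congr rfl fun s _ => ?_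
  rw [smul_eq_mul]
  congr 1
  rw [Measure.real, Measure.map_apply hm (MeasurableSet.singleton s), gridSigns_preimage, freeConfig,
    Measure.pi_pi, ENNReal.toReal_prod]
  rfl

/-- Continuous observables can be integrated by discretization, by dominated convergence. -/
theorem tendsto_integral_discretize (hβ : 0 ≤ β) (hlam : 0 ≤ lam) {F : Obs (V → SpinPath β)}
    (hF : SeqCont F) :
    Tendsto (fun n => ∫ σ, F (fun i => discretize hβ n (σ i)) ∂(freeConfig β lam V)) atTop
      (𝓝 (∫ σ, F σ ∂(freeConfig β lam V))) := by
  have hprob := isProbabilityMeasure_freeSpin hβ hlam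
  have hp2 : IsProbabilityMeasure (freeConfig β lam V) := by unfold freeConfig; infer_instance
  refine tendsto_integral_of_dominated_convergence (fun _ => ‖F‖) (fun n => ?_)
    (integrable_const _) (fun n => Eventually.of_forall fun σ => F.abs_le_norm _)
    (Eventually.of_forall fun σ => hF _ _ fun i t => tendsto_discretize hβ (σ i) t)
  simp only [← stepConfig_gridSigns]
  exact ((measurable_of_finite fun s => F (stepConfig β n s)).comp
    (measurable_gridSigns hβ n)).aestronglyMeasurable

/-- Log-supermodularity of a weight on spin configurations. -/
def Supermodular (W : Obs (V → SpinPath β)) : Prop :=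
  ∀ σ σ' d u : V → SpinPath β, (∀ i t, d i t = min (σ i t) (σ' i t)) →
    (∀ i t, u i t = max (σ i t) (σ' i t)) → W σ * W σ' ≤ W d * W u

/-- The FKG inequality for continuous observables: on the time grid it is the FKG inequality for a
finite distributive lattice. -/
theorem fkg_freeConfig (hβ : 0 ≤ β) (hlam : 0 ≤ lam) {W f g : Obs (V → SpinPath β)} (hW : SeqCont W)
    (hW0 : ∀ σ, 0 ≤ W σ) (hWs : Supermodular W) (hf : Inc f) (hg : Inc g) :
    (∫ σ, (f * W) σ ∂(freeConfig β lam V)) * (∫ σ, (g * W) σ ∂(freeConfig β lam V)) ≤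
      (∫ σ, W σ ∂(freeConfig β lam V)) * (∫ σ, (f * g * W) σ ∂(freeConfig β lam V)) := by
  refine le_of_tendsto_of_tendsto'
    ((tendsto_integral_discretize hβ hlam (hf.cont.mul hW)).mul
      (tendsto_integral_discretize hβ hlam (hg.cont.mul hW)))
    ((tendsto_integral_discretize hβ hlam hW).mul
      (tendsto_integral_discretize hβ hlam ((hf.cont.mul hg.cont).mul hW))) fun n => ?_
  obtain ⟨θ, hθ, hq⟩ := freeSpin_fidi hβ hlam (gridPt hβ n) (gridPt_mono hβ n)
  rw [integral_discretize hβ hlam, integral_discretize hβ hlam, integral_discretize hβ hlam,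
    integral_discretize hβ hlam]
  set q : (Fin (gridSize β n + 1) → Bool) → ℝ := fun s => (freeSpin β lam).real
        {σ | ∀ k ≤ gridSize β n, σ (gridPt hβ n k) = extendSigns s k} with hqdef
  have hqs : ∀ a c, q a * q c ≤ q (a ⊓ c) * q (a ⊔ c) := by
    intro a c
    simp only [hqdef, hq _ _ (extendSigns_eq_or _), extendSigns_inf, extendSigns_sup]
    exact markov_supermodular θ hθ _ _ _ (extendSigns_eq_or a) (extendSigns_eq_or c)
  set μ : (V → Fin (gridSize β n + 1) → Bool) → ℝ := fun s =>
    (∏ i, q (s i)) * W (stepConfig β n s) with hμ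
  have hq0 : ∀ s, 0 ≤ q s := fun s => measureReal_nonneg
  have hμ0 : 0 ≤ μ := fun s => mul_nonneg (Finset.prod_nonneg fun i _ => hq0 _) (hW0 _)
  have hle : ∀ {a c : V → Fin (gridSize β n + 1) → Bool}, a ≤ c →
      PathLE (stepConfig β n a) (stepConfig β n c) := by
    intro a c hac i t
    have h1 := extendSigns_inf (a i) (c i) (gridIdx n t)
    rw [inf_eq_left.2 (hac i)] at h1
    simp only [stepConfig, stepPath_apply]
    rw [h1]
    exact min_le_right _ _
  -- The lattice inequality is for nonnegative functions: `f` and `g` are shifted by constants,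
  -- which does not change their covariance.
  have h := fkg (fun s => f (stepConfig β n s) + ‖f‖) (fun s => g (stepConfig β n s) + ‖g‖) μ hμ0
    (fun s => by have := (abs_le.1 (f.abs_le_norm (stepConfig β n s))).1; simp; linarith)
    (fun s => by have := (abs_le.1 (g.abs_le_norm (stepConfig β n s))).1; simp; linarith)
    (fun a c hac => by simpa using hf.mono _ _ (hle hac))
    (fun a c hac => by simpa using hg.mono _ _ (hle hac))
    (fun a c => by
      simp only [hμ]
      rw [mul_mul_mul_comm, mul_mul_mul_comm _ _ (∏ i, q ((a ⊔ c) i)), ← Finset.prod_mul_distrib,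
        ← Finset.prod_mul_distrib]
      refine mul_le_mul ?_ ?_ (mul_nonneg (hW0 _) (hW0 _)) (Finset.prod_nonneg fun i _ =>
        mul_nonneg (hq0 _) (hq0 _))
      · exact Finset.prod_le_prod (fun i _ => mul_nonneg (hq0 _) (hq0 _)) fun i _ => hqs _ _
      · refine hWs _ _ _ _ (fun i t => ?_) fun i t => ?_
        · exact extendSigns_inf (a i) (c i) (gridIdx n t)
        · exact extendSigns_sup (a i) (c i) (gridIdx n t))
  have e1 : ∀ F : Obs (V → SpinPath β), ∑ s : V → Fin (gridSize β n + 1) → Bool,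
      (∏ i, q (s i)) * (F * W) (stepConfig β n s) = ∑ s, μ s * F (stepConfig β n s) := fun F =>
    Finset.sum_congr rfl fun s _ => by rw [Obs.mul_apply]; simp only [hμ]; ring
  rw [e1, e1, e1]
  simp only [mul_add, add_mul, Finset.sum_add_distrib, ← Finset.sum_mul, Obs.mul_apply] at h ⊢
  have e2 : ∑ s, μ s * (f (stepConfig β n s) * ‖g‖) =
      (∑ s, μ s * f (stepConfig β n s)) * ‖g‖ := by
    rw [Finset.sum_mul]; exact Finset.sum_congr rfl fun s _ => by ring
  have e3 : ∑ s, μ s * (‖f‖ * g (stepConfig β n s)) =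
      (∑ s, μ s * g (stepConfig β n s)) * ‖f‖ := by
    rw [Finset.sum_mul]; exact Finset.sum_congr rfl fun s _ => by ring
  rw [e2, e3] at h
  have e4 : ∑ s, (∏ i, q (s i)) * W (stepConfig β n s) = ∑ s, μ s := rfl
  rw [e4]
  nlinarith [h]

end FKG

/-! ### Ferromagnetic specifications -/

namespace Spec

variable {V : Type*} [Fintype V] [DecidableEq V] {β : ℝ}

/-- A ferromagnetic specification over the free spin measure. -/
structure Ferro (M : Spec V (SpinPath β)) (lam : ℝ) : Prop where
  nonneg_beta : 0 ≤ β
  nonneg_lam : 0 ≤ lam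
  m_eq : M.m = freeSpin β lam
  cont : SeqCont M.w
  super : Supermodular M.w

variable {M : Spec V (SpinPath β)} {lam : ℝ}

theorem Ferro.ref_eq (hM : M.Ferro lam) : M.ref = freeConfig β lam V := by
  rw [ref, hM.m_eq]; rfl

theorem min_piecewise (A : Finset V) {σ σ' d ρ ρ' r : V → SpinPath β}
    (h : ∀ i t, d i t = min (σ i t) (σ' i t)) (h' : ∀ i t, r i t = min (ρ i t) (ρ' i t)) (i : V)
    (t : Set.Icc (0 : ℝ) β) :
    A.piecewise d r i t = min (A.piecewise σ ρ i t) (A.piecewise σ' ρ' i t) := by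
  by_cases hi : i ∈ A
  · simpa [hi] using h i t
  · simpa [hi] using h' i t

theorem max_piecewise (A : Finset V) {σ σ' d ρ ρ' r : V → SpinPath β}
    (h : ∀ i t, d i t = max (σ i t) (σ' i t)) (h' : ∀ i t, r i t = max (ρ i t) (ρ' i t)) (i : V)
    (t : Set.Icc (0 : ℝ) β) :
    A.piecewise d r i t = max (A.piecewise σ ρ i t) (A.piecewise σ' ρ' i t) := by
  by_cases hi : i ∈ A
  · simpa [hi] using h i t
  · simpa [hi] using h' i t

theorem Ferro.super_freeze (hM : M.Ferro lam) (A : Finset V) (ρ : V → SpinPath β) :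
    Supermodular (freeze A ρ M.w) := fun _ _ _ _ hd hu =>
  hM.super _ _ _ _ (min_piecewise A hd fun _ _ => (min_self _).symm)
    (max_piecewise A hu fun _ _ => (max_self _).symm)

/-- Positive association of the conditional measures. -/
theorem Ferro.E_mul_E_le (hM : M.Ferro lam) (A : Finset V) {f g : Obs (V → SpinPath β)} (hf : Inc f)
    (hg : Inc g) (ρ : V → SpinPath β) : (M.E A f * M.E A g) ρ ≤ M.E A (f * g) ρ := by
  have h := fkg_freeConfig hM.nonneg_beta hM.nonneg_lam (hM.cont.freeze A ρ)
    (fun σ => (M.w_pos _).le) (hM.super_freeze A ρ) (hf.freeze A ρ) (hg.freeze A ρ)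
  rw [← hM.ref_eq] at h
  have hZ := M.Z_pos A ρ
  rw [Obs.mul_apply, E_apply, E_apply, E_apply, div_mul_div_comm, div_le_div_iff₀ (mul_pos hZ hZ) hZ]
  have h' : M.avg A (f * M.w) ρ * M.avg A (g * M.w) ρ ≤ M.avg A M.w ρ * M.avg A (f * g * M.w) ρ := h
  nlinarith [mul_le_mul_of_nonneg_right h' hZ.le]

theorem SeqCont.avg (M : Spec V (SpinPath β)) (A : Finset V) {f : Obs (V → SpinPath β)}
    (hf : SeqCont f) : SeqCont (M.avg A f) := fun ρn ρ h => by
  simp only [avg_apply]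
  refine tendsto_integral_of_dominated_convergence (fun _ => ‖f‖) (fun n => ?_)
    (integrable_const _) (fun n => Eventually.of_forall fun σ => f.abs_le_norm _)
    (Eventually.of_forall fun σ => hf _ _ (tendsto_piecewise A (fun _ _ => tendsto_const_nhds) h))
  exact (M.integrable_piecewise A f _).aestronglyMeasurable

theorem Ferro.seqCont_E (hM : M.Ferro lam) (A : Finset V) {f : Obs (V → SpinPath β)}
    (hf : SeqCont f) : SeqCont (M.E A f) := fun ρn ρ h =>
  (SeqCont.avg M A (hf.mul hM.cont) ρn ρ h).div (SeqCont.avg M A hM.cont ρn ρ h) (M.Z_pos A ρ).ne'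

/-- Conditional expectations of increasing observables are increasing in the boundary condition:
raising the boundary condition multiplies the density by an increasing function. -/
theorem Ferro.inc_E (hM : M.Ferro lam) (A : Finset V) {f : Obs (V → SpinPath β)} (hf : Inc f) :
    Inc (M.E A f) := by
  refine ⟨hM.seqCont_E A hf.cont, fun ρ ρ' hρ => ?_⟩
  obtain ⟨c, hc, hcw⟩ := M.pos
  -- The density `r` of the measure with boundary condition `ρ'` with respect to that with `ρ`, up
  -- to normalization. Supermodularity of the weight makes it increasing.
  obtain ⟨r, hr_apply⟩ : ∃ r : Obs (V → SpinPath β),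
      ∀ σ, r σ = M.w (A.piecewise σ ρ') / M.w (A.piecewise σ ρ) := ⟨Obs.mk
    (fun σ => M.w (A.piecewise σ ρ') / M.w (A.piecewise σ ρ))
    ((freeze A ρ' M.w).measurable.div (freeze A ρ M.w).measurable) (‖M.w‖ / c) fun σ => by
      rw [abs_div, abs_of_pos (M.w_pos (A.piecewise σ ρ))]
      exact div_le_div₀ (norm_nonneg _) (M.w.abs_le_norm _) hc (hcw _), fun _ => rfl⟩
  have hr : Inc r := by
    refine ⟨fun σn σ h => ?_, fun σ σ' hσ => ?_⟩
    · simp only [hr_apply]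
      exact (hM.cont.freeze A ρ' σn σ h).div (hM.cont.freeze A ρ σn σ h) (M.w_pos _).ne'
    · rw [hr_apply, hr_apply, div_le_div_iff₀ (M.w_pos _) (M.w_pos _)]
      have := hM.super (A.piecewise σ ρ') (A.piecewise σ' ρ) (A.piecewise σ ρ) (A.piecewise σ' ρ')
        (min_piecewise A (fun i t => (min_eq_left (hσ i t)).symm)
          fun i t => (min_eq_right (hρ i t)).symm)
        (max_piecewise A (fun i t => (max_eq_right (hσ i t)).symm)
          fun i t => (max_eq_left (hρ i t)).symm)
      linarith
  have h := fkg_freeConfig hM.nonneg_beta hM.nonneg_lam (hM.cont.freeze A ρ)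
    (fun σ => (M.w_pos _).le) (hM.super_freeze A ρ) (hf.freeze A ρ') hr
  rw [← hM.ref_eq] at h
  have er : ∀ g : Obs (V → SpinPath β), ∀ σ, (g * r * freeze A ρ M.w) σ =
      g σ * M.w (A.piecewise σ ρ') := by
    intro g σ
    simp only [hr_apply, Obs.mul_apply, freeze_apply]
    rw [mul_assoc, div_mul_cancel₀ _ (M.w_pos _).ne']
  have er1 : ∫ σ, (r * freeze A ρ M.w) σ ∂M.ref = M.avg A M.w ρ' := by
    refine integral_congr_ae (Eventually.of_forall fun σ => ?_)
    have := er 1 σ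
    simpa using this
  have er2 : ∫ σ, (freeze A ρ' f * r * freeze A ρ M.w) σ ∂M.ref = M.avg A (f * M.w) ρ' := by
    refine integral_congr_ae (Eventually.of_forall fun σ => ?_)
    exact er _ σ
  have e0 : ∫ σ, (freeze A ρ M.w) σ ∂M.ref = M.avg A M.w ρ := rfl
  rw [er1, er2, e0] at h
  have h1 : M.avg A (f * M.w) ρ ≤ ∫ σ, (freeze A ρ' f * freeze A ρ M.w) σ ∂M.ref :=
    integral_mono (M.integrable_piecewise A _ ρ) (Obs.integrable _ _) fun σ =>
      mul_le_mul_of_nonneg_right (hf.mono _ _ ((PathLE.refl σ).piecewise A hρ)) (M.w_pos _).le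
  rw [E_apply, E_apply, div_le_div_iff₀ (M.Z_pos A ρ) (M.Z_pos A ρ')]
  have := mul_le_mul_of_nonneg_right h1 (M.Z_pos A ρ').le
  linarith

end Spec

theorem Inc.add {V : Type*} {β : ℝ} {f g : Obs (V → SpinPath β)} (hf : Inc f) (hg : Inc g) :
    Inc (f + g) :=
  ⟨fun σn σ h => (hf.cont σn σ h).add (hg.cont σn σ h),
    fun σ σ' h => add_le_add (hf.mono σ σ' h) (hg.mono σ σ' h)⟩

theorem Inc.smul {V : Type*} {β : ℝ} {f : Obs (V → SpinPath β)} (hf : Inc f) {c : ℝ} (hc : 0 ≤ c) :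
    Inc (c • f) :=
  ⟨fun σn σ h => (hf.cont σn σ h).const_mul c,
    fun σ σ' h => mul_le_mul_of_nonneg_left (hf.mono σ σ' h) hc⟩

theorem inc_zero {V : Type*} {β : ℝ} : Inc (0 : Obs (V → SpinPath β)) :=
  ⟨fun _ _ _ => by simp, fun _ _ _ => by simp⟩

/-- Uniform limits preserve `Inc`; hence so does the semigroup, which is a series in the
single-site conditional expectations. -/
theorem isClosed_inc {V : Type*} {β : ℝ} : IsClosed {f : Obs (V → SpinPath β) | Inc f} := by
  refine IsSeqClosed.isClosed fun F f hF hlim => ⟨fun σn σ h => ?_, fun σ σ' h => ?_⟩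
  · rw [Metric.tendsto_atTop]
    intro ε hε
    rw [Metric.tendsto_atTop] at hlim
    obtain ⟨N, hN⟩ := hlim (ε / 3) (by positivity)
    have h1 := hN N le_rfl
    rw [dist_eq_norm] at h1
    obtain ⟨K, hK⟩ := Metric.tendsto_atTop.1 ((hF N).cont σn σ h) (ε / 3) (by positivity)
    refine ⟨K, fun n hn => ?_⟩
    have h2 := hK n hn
    rw [Real.dist_eq] at h2 ⊢
    have h3 := abs_lt.1 (((F N - f).abs_le_norm (σn n)).trans_lt h1)
    have h4 := abs_lt.1 (((F N - f).abs_le_norm σ).trans_lt h1)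
    rw [Obs.sub_apply] at h3 h4
    rw [abs_lt] at h2 ⊢
    constructor <;> linarith
  · exact le_of_tendsto_of_tendsto' (((Obs.continuous_apply σ).tendsto f).comp hlim)
      (((Obs.continuous_apply σ').tendsto f).comp hlim) fun n => (hF n).mono σ σ' h

theorem Spec.Ferro.inc_P {V : Type*} [Fintype V] [DecidableEq V] {β lam : ℝ}
    {M : Spec V (SpinPath β)} (hM : M.Ferro lam) (A : Finset V) {t : ℝ} (ht : 0 ≤ t)
    {f : Obs (V → SpinPath β)} (hf : Inc f) : Inc (M.P A t f) :=
  M.P_mem (C := {f | Inc f}) isClosed_inc inc_zero (fun _ hf _ hg => Inc.add hf hg)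
    (fun _ hc _ hf => Inc.smul hf hc) (fun x _ _ hf => hM.inc_E {x} hf) ht hf

/-! ### The energy of the quantum Ising model -/

section Dot

variable {β : ℝ}

theorem SpinPath.integrable_mul (f : Set.Icc (0 : ℝ) β → ℝ) (hf : Integrable f (timeMeasure β))
    (σ : SpinPath β) : Integrable (fun t => f t * σ t) (timeMeasure β) := by
  refine hf.mul_bdd (c := 1) σ.measurable_coe.aestronglyMeasurable ?_
  exact Eventually.of_forall fun t => by rw [Real.norm_eq_abs, σ.abs_eq_one]

theorem SpinPath.integrable (σ : SpinPath β) : Integrable (fun t => σ t) (timeMeasure β) := by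
  refine Integrable.of_bound σ.measurable_coe.aestronglyMeasurable 1 ?_
  exact Eventually.of_forall fun t => by rw [Real.norm_eq_abs, σ.abs_eq_one]

theorem dot_comm (f g : Set.Icc (0 : ℝ) β → ℝ) : dot f g = dot g f := by
  simp only [dot, mul_comm]

theorem abs_dot_le {f : Set.Icc (0 : ℝ) β → ℝ} (hf : Integrable f (timeMeasure β)) (σ : SpinPath β) :
    |dot f σ| ≤ ∫ t, |f t| ∂(timeMeasure β) := by
  refine (abs_integral_le_integral_abs).trans (integral_mono ?_ hf.abs fun t => ?_)
  · exact (σ.integrable_mul f hf).abs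
  · simp only [abs_mul, σ.abs_eq_one, mul_one]; exact le_rfl

theorem abs_dot_path_le (hβ : 0 ≤ β) (σ σ' : SpinPath β) : |dot σ σ'| ≤ β := by
  refine (abs_dot_le σ.integrable σ').trans_eq ?_
  simp [σ.abs_eq_one, timeMeasure_real_univ hβ]

/-- The `L¹` distance of two paths. -/
def pathDist (σ σ' : SpinPath β) : ℝ := ∫ t, |σ t - σ' t| ∂(timeMeasure β)

theorem pathDist_nonneg (σ σ' : SpinPath β) : 0 ≤ pathDist σ σ' := integral_nonneg fun _ => abs_nonneg _

theorem pathDist_self (σ : SpinPath β) : pathDist σ σ = 0 := by simp [pathDist]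

theorem pathDist_comm (σ σ' : SpinPath β) : pathDist σ σ' = pathDist σ' σ := by
  simp only [pathDist, abs_sub_comm]

theorem pathDist_triangle (σ σ' σ'' : SpinPath β) :
    pathDist σ σ'' ≤ pathDist σ σ' + pathDist σ' σ'' := by
  rw [pathDist, pathDist, pathDist, ← integral_add]
  · exact integral_mono (σ.integrable.sub σ''.integrable).abs
      ((σ.integrable.sub σ'.integrable).abs.add (σ'.integrable.sub σ''.integrable).abs)
      fun t => abs_sub_le _ _ _
  · exact (σ.integrable.sub σ'.integrable).abs
  · exact (σ'.integrable.sub σ''.integrable).abs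

theorem abs_dot_sub_le (σ ρ η : SpinPath β) : |dot σ ρ - dot σ η| ≤ pathDist ρ η := by
  have hi : ∀ a c : SpinPath β, Integrable (fun t => a t * c t) (timeMeasure β) := fun a c =>
    c.integrable_mul _ a.integrable
  rw [dot, dot, ← integral_sub (hi _ _) (hi _ _)]
  refine (abs_integral_le_integral_abs).trans (integral_mono ((hi _ _).sub (hi _ _)).abs
    (ρ.integrable.sub η.integrable).abs fun t => ?_)
  simp only
  rw [← mul_sub, abs_mul, σ.abs_eq_one, one_mul]

end Dot

theorem Obs.measurable_exp {Ω : Type*} [MeasurableSpace Ω] (f : Obs Ω) :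
    Measurable fun x => Real.exp (f x) := Real.measurable_exp.comp f.measurable

/-- The exponential of a bounded observable, as a function. -/
def Obs.exp {Ω : Type*} [MeasurableSpace Ω] (f : Obs Ω) : Obs Ω :=
  Obs.mk (fun x => Real.exp (f x)) f.measurable_exp (Real.exp ‖f‖) fun x => by
    rw [abs_of_pos (Real.exp_pos _)]
    exact Real.exp_le_exp.2 (f.le_norm x)

@[simp] theorem Obs.exp_apply {Ω : Type*} [MeasurableSpace Ω] (f : Obs Ω) (x : Ω) :
    f.exp x = Real.exp (f x) := rfl

theorem Obs.exp_pos {Ω : Type*} [MeasurableSpace Ω] (f : Obs Ω) : ∃ c > 0, ∀ x, c ≤ f.exp x :=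
  ⟨Real.exp (-‖f‖), Real.exp_pos _, fun x => Real.exp_le_exp.2 (abs_le.1 (f.abs_le_norm x)).1⟩

section Energy

variable {V : Type*} [Fintype V] [DecidableEq V] {β lam : ℝ}

theorem measurable_dot_pair (i j : V) :
    Measurable fun σ : V → SpinPath β => dot (σ i) (σ j) := by
  refine (StronglyMeasurable.integral_prod_right' (ν := timeMeasure β)
    (f := fun r : (V → SpinPath β) × Set.Icc (0 : ℝ) β => r.1 i r.2 * r.1 j r.2)
    (Measurable.stronglyMeasurable ?_)).measurable
  have h : ∀ i, Measurable fun r : (V → SpinPath β) × Set.Icc (0 : ℝ) β => r.1 i r.2 := fun i => by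
    have hy : Measurable fun r : (V → SpinPath β) × Set.Icc (0 : ℝ) β => (r.1 i, r.2) :=
      ((measurable_pi_apply i).comp measurable_fst).prodMk measurable_snd
    exact SpinPath.measurable_uncurry.comp hy
  exact (h i).mul (h j)

theorem measurable_dot_field {g : Set.Icc (0 : ℝ) β → ℝ} (hg : Integrable g (timeMeasure β)) :
    Measurable fun s : SpinPath β => dot g s := by
  have hm := hg.aestronglyMeasurable
  have heq : (fun s : SpinPath β => dot g s) = fun s => ∫ t, hm.mk g t * s t ∂(timeMeasure β) := by
    funext s
    refine integral_congr_ae ?_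
    filter_upwards [hm.ae_eq_mk] with t ht
    rw [ht]
  rw [heq]
  refine (StronglyMeasurable.integral_prod_right' (ν := timeMeasure β)
    (f := fun r : SpinPath β × Set.Icc (0 : ℝ) β => hm.mk g r.2 * r.1 r.2)
    (Measurable.stronglyMeasurable ?_)).measurable
  exact (hm.stronglyMeasurable_mk.measurable.comp measurable_snd).mul SpinPath.measurable_uncurry

/-- The data of an Ising model: a graph and integrable longitudinal fields. -/
structure IsingData (V : Type*) (β : ℝ) where
  G : SimpleGraph V
  h : V → Set.Icc (0 : ℝ) β → ℝ
  integrable_h : ∀ i, Integrable (h i) (timeMeasure β)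
  hβ : 0 ≤ β

namespace IsingData

variable (D : IsingData V β)

open Classical in
/-- The interaction of `i` and `j`. -/
def pair (i j : V) : Obs (V → SpinPath β) :=
  if D.G.Adj i j then Obs.mk (fun σ => dot (σ i) (σ j)) (measurable_dot_pair i j) β
    fun σ => abs_dot_path_le D.hβ (σ i) (σ j) else 0

/-- The interaction of the spin at `i` with the longitudinal field. -/
def field (i : V) : Obs (V → SpinPath β) :=
  Obs.mk (fun σ => dot (D.h i) (σ i))
    ((measurable_dot_field (D.integrable_h i)).comp (measurable_pi_apply i))
    (∫ t, |D.h i t| ∂(timeMeasure β)) fun σ => abs_dot_le (D.integrable_h i) (σ i)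

open Classical in
/-- The interaction of a spin at `i` with a spin at `j`. -/
def bond (i j : V) (s s' : SpinPath β) : ℝ := if D.G.Adj i j then dot s s' else 0

theorem pair_apply (i j : V) (σ : V → SpinPath β) : D.pair i j σ = D.bond i j (σ i) (σ j) := by
  unfold pair bond
  split_ifs <;> rfl

theorem field_apply (i : V) (σ : V → SpinPath β) : D.field i σ = dot (D.h i) (σ i) := rfl

open Classical in
theorem bond_comm (i j : V) (s s' : SpinPath β) : D.bond i j s s' = D.bond j i s' s := by
  unfold bond
  rw [dot_comm]
  exact if_congr (D.G.adj_comm i j) rfl rfl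

/-- The energy inside `A`. -/
def inner (A : Finset V) : Obs (V → SpinPath β) :=
  (1 / 2 : ℝ) • ∑ i ∈ A, ∑ j ∈ A, D.pair i j + ∑ i ∈ A, D.field i

theorem inner_apply (A : Finset V) (σ : V → SpinPath β) :
    D.inner A σ = (1 / 2 : ℝ) * ∑ i ∈ A, ∑ j ∈ A, D.bond i j (σ i) (σ j) +
      ∑ i ∈ A, dot (D.h i) (σ i) := by
  simp [inner, pair_apply, field_apply]

theorem inner_univ_apply (σ : V → SpinPath β) : D.inner Finset.univ σ = energy D.G D.h σ := by
  rw [inner_apply]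
  rfl

theorem inner_congr {A : Finset V} {σ σ' : V → SpinPath β} (h : ∀ i ∈ A, σ i = σ' i) :
    D.inner A σ = D.inner A σ' := by
  rw [inner_apply, inner_apply]
  congr 1
  · congr 1
    exact Finset.sum_congr rfl fun i hi => Finset.sum_congr rfl fun j hj => by rw [h i hi, h j hj]
  · exact Finset.sum_congr rfl fun i hi => by rw [h i hi]

/-- The interaction of the spins in `A`, taken from `σ`, with those outside, taken from `ρ`. -/
def cross (A : Finset V) (σ ρ : V → SpinPath β) : ℝ :=
  ∑ i ∈ A, ∑ j ∈ Aᶜ, D.bond i j (σ i) (ρ j)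

theorem inner_univ_eq (A : Finset V) (σ : V → SpinPath β) :
    D.inner Finset.univ σ = D.inner A σ + D.cross A σ σ + D.inner Aᶜ σ := by
  have h1 : ∀ F : V → ℝ, ∑ i, F i = ∑ i ∈ A, F i + ∑ i ∈ Aᶜ, F i := fun F =>
    (Finset.sum_add_sum_compl A F).symm
  have h2 : ∑ i ∈ Aᶜ, ∑ j ∈ A, D.bond i j (σ i) (σ j) = D.cross A σ σ := by
    rw [Finset.sum_comm, cross]
    exact Finset.sum_congr rfl fun i _ => Finset.sum_congr rfl fun j _ => D.bond_comm _ _ _ _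
  rw [inner_apply, inner_apply, inner_apply, h1, h1 (fun i => dot (D.h i) (σ i))]
  simp only [h1, Finset.sum_add_distrib]
  rw [h2, cross]
  ring

theorem cross_congr {A : Finset V} {σ σ' ρ ρ' : V → SpinPath β} (h : ∀ i ∈ A, σ i = σ' i)
    (h' : ∀ i ∈ A, ∀ j ∉ A, D.G.Adj i j → ρ j = ρ' j) : D.cross A σ ρ = D.cross A σ' ρ' := by
  refine Finset.sum_congr rfl fun i hi => Finset.sum_congr rfl fun j hj => ?_
  unfold bond
  split_ifs with ha
  · rw [h i hi, h' i hi j (Finset.mem_compl.1 hj) ha]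
  · rfl

/-- The energy of a configuration glued along `A`. -/
theorem energy_piecewise (A : Finset V) (σ ρ : V → SpinPath β) :
    energy D.G D.h (A.piecewise σ ρ) = D.inner A σ + D.cross A σ ρ + D.inner Aᶜ ρ := by
  rw [← inner_univ_apply, D.inner_univ_eq A,
    D.inner_congr (A := A) (σ' := σ) fun i hi => by simp [hi],
    D.inner_congr (A := Aᶜ) (σ' := ρ) fun i hi => by simp [Finset.mem_compl.1 hi],
    D.cross_congr (A := A) (σ' := σ) (ρ' := ρ) (fun i hi => by simp [hi])
      fun i _ j hj _ => by simp [hj]]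

/-- The Gibbs specification of the quantum Ising model. -/
def spec (hlam : 0 ≤ lam) : Spec V (SpinPath β) where
  m := freeSpin β lam
  prob := isProbabilityMeasure_freeSpin D.hβ hlam
  w := (D.inner Finset.univ).exp
  pos := Obs.exp_pos _

variable (hlam : 0 ≤ lam)

theorem spec_w (σ : V → SpinPath β) : (D.spec hlam).w σ = Real.exp (energy D.G D.h σ) := by
  rw [← inner_univ_apply]; rfl

theorem seqCont_pair (i j : V) : SeqCont (D.pair i j) := fun σn σ h => by
  simp only [pair_apply, bond]
  split_ifs
  · refine tendsto_integral_of_dominated_convergence (fun _ => 1) (fun n => ?_) (integrable_const _)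
      (fun n => Eventually.of_forall fun t => ?_) (Eventually.of_forall fun t => (h i t).mul (h j t))
    · exact ((σn n i).measurable_coe.mul (σn n j).measurable_coe).aestronglyMeasurable
    · rw [Real.norm_eq_abs, abs_mul, SpinPath.abs_eq_one, SpinPath.abs_eq_one, one_mul]
  · exact tendsto_const_nhds

theorem tendsto_dot {g : Set.Icc (0 : ℝ) β → ℝ} (hg : Integrable g (timeMeasure β))
    {s : ℕ → SpinPath β} {s₀ : SpinPath β}
    (h : ∀ t, Tendsto (fun n => s n t) atTop (𝓝 (s₀ t))) :
    Tendsto (fun n => dot g (s n)) atTop (𝓝 (dot g s₀)) := by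
  refine tendsto_integral_of_dominated_convergence (fun t => |g t|) (fun n => ?_) hg.abs
    (fun n => Eventually.of_forall fun t => ?_)
    (Eventually.of_forall fun t => (h t).const_mul _)
  · exact ((s n).integrable_mul _ hg).aestronglyMeasurable
  · rw [Real.norm_eq_abs, abs_mul, SpinPath.abs_eq_one, mul_one]

theorem seqCont_sum {ι : Type*} (s : Finset ι) (F : ι → Obs (V → SpinPath β))
    (h : ∀ i ∈ s, SeqCont (F i)) : SeqCont (∑ i ∈ s, F i) := fun σn σ hσ => by
  simp only [Obs.sum_apply]
  exact tendsto_finsetSum _ fun i hi => h i hi σn σ hσ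

theorem seqCont_inner (A : Finset V) : SeqCont (D.inner A) :=
  ((seqCont_sum _ _ fun i _ => seqCont_sum _ _ fun j _ => D.seqCont_pair i j).smul _).add
    (seqCont_sum _ _ fun i _ => fun _ _ h => tendsto_dot (D.integrable_h i) (h i))

theorem dot_add_dot_le {s s' d u r r' d' u' : SpinPath β} (hd : ∀ t, d t = min (s t) (s' t))
    (hu : ∀ t, u t = max (s t) (s' t)) (hd' : ∀ t, d' t = min (r t) (r' t))
    (hu' : ∀ t, u' t = max (r t) (r' t)) : dot s r + dot s' r' ≤ dot d d' + dot u u' := by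
  have hi : ∀ a c : SpinPath β, Integrable (fun t => a t * c t) (timeMeasure β) := fun a c =>
    c.integrable_mul _ a.integrable
  rw [dot, dot, dot, dot, ← integral_add (hi _ _) (hi _ _), ← integral_add (hi _ _) (hi _ _)]
  refine integral_mono ((hi _ _).add (hi _ _)) ((hi _ _).add (hi _ _)) fun t => ?_
  simp only [hd, hu, hd', hu']
  rcases s.eq_or t with h1 | h1 <;> rcases s'.eq_or t with h2 | h2 <;>
    rcases r.eq_or t with h3 | h3 <;> rcases r'.eq_or t with h4 | h4 <;>
    rw [h1, h2, h3, h4] <;> norm_num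

theorem dot_add_dot_eq {g : Set.Icc (0 : ℝ) β → ℝ} (hg : Integrable g (timeMeasure β))
    {s s' d u : SpinPath β} (hd : ∀ t, d t = min (s t) (s' t))
    (hu : ∀ t, u t = max (s t) (s' t)) : dot g s + dot g s' = dot g d + dot g u := by
  have hi : ∀ a : SpinPath β, Integrable (fun t => g t * a t) (timeMeasure β) := fun a =>
    a.integrable_mul _ hg
  rw [dot, dot, dot, dot, ← integral_add (hi _) (hi _), ← integral_add (hi _) (hi _)]
  refine integral_congr_ae (Eventually.of_forall fun t => ?_)
  simp only [hd, hu, ← mul_add, min_add_max]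

/-- The interaction `σ_i • σ_j` is supermodular, pointwise in imaginary time, and the longitudinal
field acts linearly, whatever its sign. -/
theorem ferro : (D.spec hlam).Ferro lam where
  nonneg_beta := D.hβ
  nonneg_lam := hlam
  m_eq := rfl
  cont := fun σn σ h => (Real.continuous_exp.tendsto _).comp (D.seqCont_inner _ σn σ h)
  super := fun σ σ' d u hd hu => by
    change Real.exp (D.inner Finset.univ σ) * Real.exp (D.inner Finset.univ σ') ≤
      Real.exp (D.inner Finset.univ d) * Real.exp (D.inner Finset.univ u)
    rw [← Real.exp_add, ← Real.exp_add, Real.exp_le_exp]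
    simp only [inner_apply]
    have h1 : ∑ i, ∑ j, D.bond i j (σ i) (σ j) + ∑ i, ∑ j, D.bond i j (σ' i) (σ' j) ≤
        ∑ i, ∑ j, D.bond i j (d i) (d j) + ∑ i, ∑ j, D.bond i j (u i) (u j) := by
      simp only [← Finset.sum_add_distrib]
      refine Finset.sum_le_sum fun i _ => Finset.sum_le_sum fun j _ => ?_
      unfold bond
      split_ifs
      · exact dot_add_dot_le (hd i) (hu i) (hd j) (hu j)
      · exact le_rfl
    have h2 : ∑ i, dot (D.h i) (σ i) + ∑ i, dot (D.h i) (σ' i) =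
        ∑ i, dot (D.h i) (d i) + ∑ i, dot (D.h i) (u i) := by
      simp only [← Finset.sum_add_distrib]
      exact Finset.sum_congr rfl fun i _ => dot_add_dot_eq (D.integrable_h i) (hd i) (hu i)
    linarith

/-- Sets without an edge between them do not interact. -/
theorem sep {A B : Finset V} (hd : Disjoint A B) (hadj : ∀ i ∈ A, ∀ j ∈ B, ¬ D.G.Adj i j) :
    (D.spec hlam).Sep A B := by
  let cr : Obs (V → SpinPath β) := ∑ i ∈ B, ∑ j ∈ Bᶜ, D.pair i j
  have hcr : ∀ σ, cr σ = D.cross B σ σ := fun σ => by simp [cr, cross, pair_apply]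
  refine ⟨hd, (D.inner B + cr).exp, (D.inner Bᶜ).exp, ?_, fun ρ σ h => ?_, fun ρ σ h => ?_,
    Obs.exp_pos _, Obs.exp_pos _⟩
  · ext σ
    change Real.exp (D.inner Finset.univ σ) = Real.exp (D.inner B σ + cr σ) * Real.exp (D.inner Bᶜ σ)
    rw [← Real.exp_add, hcr, ← inner_univ_eq]
  · change Real.exp (D.inner B ρ + cr ρ) = Real.exp (D.inner B σ + cr σ)
    rw [hcr, hcr, D.inner_congr fun i hi => h i (Finset.disjoint_right.1 hd hi),
      D.cross_congr (fun i hi => h i (Finset.disjoint_right.1 hd hi)) fun i hi j _ ha =>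
        h j fun hj => hadj j hj i hi ha.symm]
  · change Real.exp (D.inner Bᶜ ρ) = Real.exp (D.inner Bᶜ σ)
    rw [D.inner_congr fun i hi => h i (Finset.mem_compl.1 hi)]

open Classical in
/-- Changing the boundary condition changes the weight by a constant factor, up to an error that is
controlled by the `L¹` distance of the boundary spins. -/
theorem w_piecewise_le (A : Finset V) (σ ρ η : V → SpinPath β) :
    (D.spec hlam).w (A.piecewise σ ρ) ≤
      Real.exp (D.inner Aᶜ ρ - D.inner Aᶜ η + ∑ i ∈ A, ∑ j ∈ Aᶜ,
        (if D.G.Adj i j then pathDist (ρ j) (η j) else 0)) * (D.spec hlam).w (A.piecewise σ η) := by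
  rw [spec_w, spec_w, ← Real.exp_add, Real.exp_le_exp, energy_piecewise, energy_piecewise]
  have : D.cross A σ ρ ≤ D.cross A σ η + ∑ i ∈ A, ∑ j ∈ Aᶜ,
      (if D.G.Adj i j then pathDist (ρ j) (η j) else 0) := by
    simp only [cross, ← Finset.sum_add_distrib]
    refine Finset.sum_le_sum fun i _ => Finset.sum_le_sum fun j _ => ?_
    unfold bond
    split_ifs
    · have := (abs_le.1 (abs_dot_sub_le (σ i) (ρ j) (η j))).2
      linarith
    · simp
  linarith

end IsingData

/-- Comparison of two conditional expectations whose weights are proportional up to a factor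
`exp δ`. -/
theorem Spec.E_sub_E_le {S : Type*} [MeasurableSpace S] (M : Spec V S) (A : Finset V)
    (f : Obs (V → S)) {ρ η : V → S} {a b c δ : ℝ} (hδ : 0 ≤ δ)
    (hf : ∀ σ, f (A.piecewise σ ρ) = f (A.piecewise σ η))
    (ha : ∀ σ, a ≤ f (A.piecewise σ η)) (hb : ∀ σ, f (A.piecewise σ η) ≤ b)
    (h1 : ∀ σ, M.w (A.piecewise σ ρ) ≤ Real.exp (c + δ) * M.w (A.piecewise σ η))
    (h2 : ∀ σ, M.w (A.piecewise σ η) ≤ Real.exp (-c + δ) * M.w (A.piecewise σ ρ)) :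
    M.E A f ρ - M.E A f η ≤ 4 * δ * (b - a) := by
  have hab : a ≤ b := (ha ρ).trans (hb ρ)
  have hη1 : a ≤ M.E A f η := M.const_le_E ha
  have hη2 : M.E A f η ≤ b := M.E_le_const hb
  have hρ2 : M.E A f ρ ≤ b := M.E_le_const fun σ => (hf σ).trans_le (hb σ)
  let g : Obs (V → S) := f - a • 1
  have hg : ∀ σ, g (A.piecewise σ η) = f (A.piecewise σ η) - a := fun σ => by simp [g]
  have hgρ : ∀ σ, g (A.piecewise σ ρ) = f (A.piecewise σ η) - a := fun σ => by simp [g, hf]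
  have key : M.E A g ρ ≤ Real.exp (2 * δ) * M.E A g η := by
    have k1 : M.avg A (g * M.w) ρ ≤ Real.exp (c + δ) * M.avg A (g * M.w) η := by
      rw [avg_apply, avg_apply, ← integral_const_mul]
      refine integral_mono (M.integrable_piecewise A _ _)
        ((M.integrable_piecewise A _ _).const_mul _) fun σ => ?_
      simp only [Obs.mul_apply, hg, hgρ]
      have := mul_le_mul_of_nonneg_left (h1 σ) (sub_nonneg.2 (ha σ))
      linarith
    have k2 : M.avg A M.w η ≤ Real.exp (-c + δ) * M.avg A M.w ρ := by
      rw [avg_apply, avg_apply, ← integral_const_mul]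
      exact integral_mono (M.integrable_piecewise A _ _)
        ((M.integrable_piecewise A _ _).const_mul _) h2
    have hZρ := M.Z_pos A ρ
    have hZη := M.Z_pos A η
    have h0 : 0 ≤ M.E A g η := M.E_nonneg fun σ => by rw [hg]; linarith [ha σ]
    have k3 : M.avg A (g * M.w) η = M.E A g η * M.avg A M.w η := by rw [avg_mul_w, Obs.mul_apply]
    rw [E_apply, div_le_iff₀ hZρ]
    refine k1.trans ?_
    rw [k3]
    have k4 := mul_le_mul_of_nonneg_left k2 (mul_nonneg (Real.exp_pos (c + δ)).le h0)
    have k5 : Real.exp (2 * δ) = Real.exp (c + δ) * Real.exp (-c + δ) := by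
      rw [← Real.exp_add]; ring_nf
    rw [k5]
    linarith
  have e1 : ∀ ξ, M.E A g ξ = M.E A f ξ - a := fun ξ => by simp [g]
  rw [e1, e1] at key
  -- For `2 δ ≤ 1` the factor `exp (2 δ) - 1` is at most `4 δ`; otherwise `4 δ (b - a) ≥ b - a`
  -- and the bound is trivial.
  rcases le_or_gt (2 * δ) 1 with h | h
  · have k6 := (abs_le.1 (Real.abs_exp_sub_one_le (x := 2 * δ)
      (by rw [abs_of_nonneg (by linarith)]; exact h))).2
    rw [abs_of_nonneg (by linarith)] at k6
    have k7 : (Real.exp (2 * δ) - 1) * (M.E A f η - a) ≤ 4 * δ * (b - a) :=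
      mul_le_mul (by linarith) (by linarith) (by linarith) (by linarith)
    linarith
  · nlinarith

namespace IsingData

variable (D : IsingData V β) (hlam : 0 ≤ lam)

open Classical in
/-- Influence of the boundary condition in terms of the `L¹` distance. -/
theorem abs_E_sub_E_le (A : Finset V) (f : Obs (V → SpinPath β)) {ρ η : V → SpinPath β} {a b : ℝ}
    (hf : ∀ σ, f (A.piecewise σ ρ) = f (A.piecewise σ η))
    (ha : ∀ σ, a ≤ f (A.piecewise σ η)) (hb : ∀ σ, f (A.piecewise σ η) ≤ b) :
    |(D.spec hlam).E A f ρ - (D.spec hlam).E A f η| ≤ 4 * (∑ i ∈ A, ∑ j ∈ Aᶜ,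
      (if D.G.Adj i j then pathDist (ρ j) (η j) else 0)) * (b - a) := by
  have hδ : ∀ ρ η : V → SpinPath β, 0 ≤ ∑ i ∈ A, ∑ j ∈ Aᶜ,
      (if D.G.Adj i j then pathDist (ρ j) (η j) else 0) := fun ρ η =>
    Finset.sum_nonneg fun i _ => Finset.sum_nonneg fun j _ => by
      split_ifs
      · exact pathDist_nonneg _ _
      · exact le_rfl
  have h1 := D.w_piecewise_le hlam A (lam := lam)
  have h2 : ∀ σ, (D.spec hlam).w (A.piecewise σ η) ≤
      Real.exp (-(D.inner Aᶜ ρ - D.inner Aᶜ η) + ∑ i ∈ A, ∑ j ∈ Aᶜ,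
        (if D.G.Adj i j then pathDist (ρ j) (η j) else 0)) * (D.spec hlam).w (A.piecewise σ ρ) := by
    intro σ
    have := D.w_piecewise_le hlam A σ η ρ
    simp only [pathDist_comm (η _)] at this
    rwa [neg_sub]
  rw [abs_le']
  refine ⟨(D.spec hlam).E_sub_E_le A f (hδ ρ η) hf ha hb (fun σ => h1 σ ρ η) h2, ?_⟩
  rw [neg_sub]
  refine (D.spec hlam).E_sub_E_le A f (c := -(D.inner Aᶜ ρ - D.inner Aᶜ η)) (hδ ρ η)
    (fun σ => (hf σ).symm) (fun σ => (ha σ).trans_eq (hf σ).symm)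
    (fun σ => (hf σ).trans_le (hb σ)) h2 fun σ => ?_
  rw [neg_neg]
  exact h1 σ ρ η

/-! ### Identification of the Gibbs measures and of the heat-bath kernels -/

theorem integral_gibbs (f : Obs (V → SpinPath β)) (ρ : V → SpinPath β) :
    ∫ σ, f σ ∂(gibbs D.G lam D.h) = (D.spec hlam).E Finset.univ f ρ := by
  rw [gibbs, integral_tilted, Spec.E_apply, Spec.avg_apply, Spec.avg_apply]
  simp only [Finset.piecewise_univ, Obs.mul_apply, spec_w, smul_eq_mul]
  rw [← integral_div]
  refine integral_congr_ae (Eventually.of_forall fun σ => ?_)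
  change Real.exp (energy D.G D.h σ) / (∫ σ, Real.exp (energy D.G D.h σ) ∂(D.spec hlam).ref) * f σ = _
  ring

theorem isProbabilityMeasure_gibbs (hlam : 0 ≤ lam) : IsProbabilityMeasure (gibbs D.G lam D.h) := by
  have hp := isProbabilityMeasure_freeSpin D.hβ hlam
  refine isProbabilityMeasure_tilted ?_
  have := ((D.inner Finset.univ).exp).integrable (Measure.pi fun _ : V => freeSpin β lam)
  refine this.congr (Eventually.of_forall fun σ => ?_)
  rw [Obs.exp_apply, inner_univ_apply]

open Classical in
theorem energy_update (x : V) (ρ : V → SpinPath β) (s : SpinPath β) :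
    energy D.G D.h (Function.update ρ x s) =
      dot s (localField D.G D.h ρ x) + D.inner {x}ᶜ ρ := by
  have h1 : Function.update ρ x s = ({x} : Finset V).piecewise (fun _ => s) ρ := by
    rw [Finset.piecewise_singleton]
  rw [h1, energy_piecewise]
  congr 1
  have hloop : D.bond x x s s = 0 := by simp [bond]
  have h2 : dot s (localField D.G D.h ρ x) = dot (D.h x) s + ∑ j, D.bond x j s (ρ j) := by
    have hi : ∀ j, Integrable (fun t => s t * (if D.G.Adj x j then ρ j t else 0)) (timeMeasure β) := by
      intro j
      split_ifs
      · exact (ρ j).integrable_mul _ s.integrable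
      · simp
    have hj : ∀ j, ∫ t, s t * (if D.G.Adj x j then ρ j t else 0) ∂(timeMeasure β) =
        D.bond x j s (ρ j) := by
      intro j
      unfold bond
      split_ifs
      · rfl
      · simp
    rw [dot, dot_comm, dot, ← Finset.sum_congr rfl fun j _ => hj j, ← integral_finsetSum _ fun j _ => hi j,
      ← integral_add]
    · refine integral_congr_ae (Eventually.of_forall fun t => ?_)
      simp only [localField, mul_add, Finset.mul_sum]
    · refine (s.integrable_mul _ (D.integrable_h x)).congr (Eventually.of_forall fun t => mul_comm _ _)
    · exact integrable_finsetSum _ fun j _ => hi j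
  rw [h2, inner_apply, cross]
  simp only [Finset.sum_singleton, hloop, mul_zero, zero_add]
  congr 1
  rw [Finset.sum_subset (Finset.subset_univ ({x}ᶜ : Finset V)) fun j _ hj => ?_]
  have : j = x := by simpa using hj
  rw [this]
  simp [bond]

theorem integrable_localField (ρ : V → SpinPath β) (x : V) :
    Integrable (localField D.G D.h ρ x) (timeMeasure β) := by
  classical
  refine (D.integrable_h x).add (integrable_finsetSum _ fun j _ => ?_)
  split_ifs
  · exact (ρ j).integrable
  · simp

/-- The heat-bath kernel is the conditional expectation given the other spins. -/
theorem integral_heatBath (f : Obs (V → SpinPath β)) (x : V) (ρ : V → SpinPath β) :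
    ∫ σ, f σ ∂(heatBath D.G lam D.h x ρ) = (D.spec hlam).E {x} f ρ := by
  classical
  have hp := isProbabilityMeasure_freeSpin D.hβ hlam
  have hupd : Measurable (Function.update ρ x : SpinPath β → V → SpinPath β) := measurable_update ρ
  have h1 : heatBath D.G lam D.h x ρ =
      (siteGibbs β lam (localField D.G D.h ρ x)).map (Function.update ρ x) := by
    unfold heatBath
    change (siteGibbs β lam (localField D.G D.h ρ x)).map _ = _
    congr!
  have hev : ∀ F : SpinPath β → ℝ, Measurable F →
      ∫ σ : V → SpinPath β, F (σ x) ∂(D.spec hlam).ref = ∫ s, F s ∂(freeSpin β lam) := by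
    intro F hF
    have hmp := measurePreserving_eval (fun _ : V => freeSpin β lam) x
    rw [← hmp.map_eq, integral_map hmp.measurable.aemeasurable hF.aestronglyMeasurable]
    rfl
  have hup : ∀ σ : V → SpinPath β, ({x} : Finset V).piecewise σ ρ = Function.update ρ x (σ x) :=
    fun σ => by rw [Finset.piecewise_singleton]
  have hmf : Measurable fun s : SpinPath β => dot s (localField D.G D.h ρ x) := by
    have he : (fun s : SpinPath β => dot s (localField D.G D.h ρ x)) =
        fun s : SpinPath β => dot (localField D.G D.h ρ x) s := funext fun s => dot_comm _ _
    rw [he]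
    exact measurable_dot_field (D.integrable_localField ρ x)
  have hc := Real.exp_pos (D.inner {x}ᶜ ρ)
  rw [h1, integral_map hupd.aemeasurable f.measurable.aestronglyMeasurable, siteGibbs,
    integral_tilted, Spec.E_apply, Spec.avg_apply, Spec.avg_apply]
  simp only [hup, Obs.mul_apply, spec_w, energy_update, Real.exp_add, smul_eq_mul]
  rw [hev (fun s => Real.exp (dot s (localField D.G D.h ρ x)) * Real.exp (D.inner {x}ᶜ ρ))
      ((Real.measurable_exp.comp hmf).mul_const _),
    hev (fun s => f (Function.update ρ x s) * (Real.exp (dot s (localField D.G D.h ρ x)) *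
      Real.exp (D.inner {x}ᶜ ρ)))
      ((f.measurable.comp hupd).mul ((Real.measurable_exp.comp hmf).mul_const _)),
    integral_mul_const]
  simp only [← mul_assoc]
  rw [integral_mul_const, mul_div_mul_right _ _ hc.ne', ← integral_div]
  refine integral_congr_ae (Eventually.of_forall fun s => ?_)
  ring

end IsingData

end Energy

/-! ### Combinatorics of the regular tree -/

section Tree

variable {b l : ℕ}

theorem mem_subtree {x z : List (Fin b)} {m : ℕ} :
    z ∈ subtree b x m ↔ x <:+ z ∧ z.length ≤ x.length + m := by
  simp only [subtree, Finset.mem_image, Set.Finite.mem_toFinset, Set.mem_ofPred_eq]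
  constructor
  · rintro ⟨w, hw, rfl⟩
    exact ⟨List.suffix_append w x, by rw [List.length_append]; omega⟩
  · rintro ⟨⟨w, rfl⟩, h⟩
    rw [List.length_append] at h
    exact ⟨w, by omega, rfl⟩

theorem mem_tree {z : List (Fin b)} : z ∈ tree b l ↔ z.length ≤ l := by
  rw [tree, mem_subtree]
  simp

/-- The vertices of the tree of depth `l`. -/
abbrev TreeVertex (b l : ℕ) : Type := ↥(tree b l)

/-- `y` is a child of `p`. -/
def IsChild (y p : TreeVertex b l) : Prop := ∃ c, y.1 = c :: p.1

theorem IsChild.length {y p : TreeVertex b l} (h : IsChild y p) : y.1.length = p.1.length + 1 := by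
  obtain ⟨c, hc⟩ := h
  simp [hc]

theorem IsChild.unique {y p q : TreeVertex b l} (h : IsChild y p) (h' : IsChild y q) : p = q := by
  obtain ⟨c, hc⟩ := h
  obtain ⟨d, hd⟩ := h'
  exact Subtype.ext (List.cons_eq_cons.1 (hc.symm.trans hd)).2

theorem treeGraph_adj {i j : TreeVertex b l} :
    (treeGraph b (tree b l)).Adj i j ↔ IsChild j i ∨ IsChild i j := mem_nbrs

/-- The descendants of `x`, including `x`. -/
def desc (x : TreeVertex b l) : Finset (TreeVertex b l) := Finset.univ.filter fun y => x.1 <:+ y.1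

/-- The proper descendants of `x`. -/
def pdesc (x : TreeVertex b l) : Finset (TreeVertex b l) := (desc x).erase x

/-- The descendants of `x` that are `k` generations below `x`. -/
def level (x : TreeVertex b l) (k : ℕ) : Finset (TreeVertex b l) :=
  (desc x).filter fun y => y.1.length = x.1.length + k

/-- The descendants of `x` less than `k` generations below `x`. -/
def upper (x : TreeVertex b l) (k : ℕ) : Finset (TreeVertex b l) :=
  (desc x).filter fun y => y.1.length < x.1.length + k

/-- The descendants of `x` more than `k` generations below `x`. -/
def lower (x : TreeVertex b l) (k : ℕ) : Finset (TreeVertex b l) :=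
  (desc x).filter fun y => x.1.length + k < y.1.length

theorem mem_desc {x y : TreeVertex b l} : y ∈ desc x ↔ x.1 <:+ y.1 := by simp [desc]

theorem mem_pdesc {x y : TreeVertex b l} : y ∈ pdesc x ↔ y ≠ x ∧ y ∈ desc x := by simp [pdesc]

theorem mem_level {x y : TreeVertex b l} {k : ℕ} :
    y ∈ level x k ↔ y ∈ desc x ∧ y.1.length = x.1.length + k := by simp [level]

theorem mem_upper {x y : TreeVertex b l} {k : ℕ} :
    y ∈ upper x k ↔ y ∈ desc x ∧ y.1.length < x.1.length + k := by simp [upper]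

theorem mem_lower {x y : TreeVertex b l} {k : ℕ} :
    y ∈ lower x k ↔ y ∈ desc x ∧ x.1.length + k < y.1.length := by simp [lower]

theorem self_mem_desc (x : TreeVertex b l) : x ∈ desc x := mem_desc.2 List.suffix_rfl

theorem desc_subset {x y : TreeVertex b l} (h : y ∈ desc x) : desc y ⊆ desc x := fun _ hz =>
  mem_desc.2 ((mem_desc.1 h).trans (mem_desc.1 hz))

theorem pdesc_subset (x : TreeVertex b l) : pdesc x ⊆ desc x := Finset.erase_subset _ _

theorem self_notMem_pdesc (x : TreeVertex b l) : x ∉ pdesc x := Finset.notMem_erase _ _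

theorem length_le_of_mem_desc {x y : TreeVertex b l} (h : y ∈ desc x) :
    x.1.length ≤ y.1.length := (mem_desc.1 h).length_le

theorem eq_of_mem_desc {x y : TreeVertex b l} (h : y ∈ desc x) (hl : y.1.length ≤ x.1.length) :
    y = x := Subtype.ext ((mem_desc.1 h).eq_of_length_le hl).symm

theorem length_lt_of_mem_pdesc {x y : TreeVertex b l} (h : y ∈ pdesc x) :
    x.1.length < y.1.length := by
  by_contra hl
  exact (mem_pdesc.1 h).1 (eq_of_mem_desc (mem_pdesc.1 h).2 (not_lt.1 hl))

theorem mem_desc_or {x y z : TreeVertex b l} (hx : z ∈ desc x) (hy : z ∈ desc y) :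
    x ∈ desc y ∨ y ∈ desc x :=
  (List.suffix_or_suffix_of_suffix (mem_desc.1 hx) (mem_desc.1 hy)).symm.imp mem_desc.2 mem_desc.2

theorem IsChild.mem_desc {y p x : TreeVertex b l} (h : IsChild y p) (hp : p ∈ desc x) :
    y ∈ desc x := by
  obtain ⟨c, hc⟩ := h
  rw [QuantumIsing.mem_desc] at hp ⊢
  rw [hc]
  exact hp.trans (List.suffix_cons _ _)

theorem IsChild.mem_desc_or {y p x : TreeVertex b l} (h : IsChild y p) (hy : y ∈ desc x) :
    y = x ∨ p ∈ desc x := by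
  obtain ⟨c, hc⟩ := h
  rw [QuantumIsing.mem_desc] at hy ⊢
  rw [hc, List.suffix_cons_iff] at hy
  exact hy.imp (fun h => Subtype.ext (hc.trans h.symm)) id

theorem exists_isChild {x y : TreeVertex b l} (h : y ∈ pdesc x) : ∃ p ∈ desc x, IsChild y p := by
  obtain ⟨y, hy⟩ := y
  match y, hy, h with
  | [], hy, h => exact absurd (length_lt_of_mem_pdesc h) (by simp)
  | c :: p, hy, h =>
    have hp : p ∈ tree b l := mem_tree.2 (by have := mem_tree.1 hy; simp at this; omega)
    have hc : IsChild (⟨c :: p, hy⟩ : TreeVertex b l) ⟨p, hp⟩ := ⟨c, rfl⟩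
    exact ⟨⟨p, hp⟩, (hc.mem_desc_or (mem_pdesc.1 h).2).resolve_left (mem_pdesc.1 h).1, hc⟩

theorem mem_level_one {x y : TreeVertex b l} : y ∈ level x 1 ↔ IsChild y x := by
  rw [mem_level]
  constructor
  · rintro ⟨h, hl⟩
    obtain ⟨p, hp, hc⟩ := exists_isChild (mem_pdesc.2 ⟨fun he => by rw [he] at hl; omega, h⟩)
    have : p = x := eq_of_mem_desc hp (by have := hc.length; omega)
    exact this ▸ hc
  · intro h
    exact ⟨h.mem_desc (self_mem_desc x), h.length⟩

theorem exists_mem_level_one {x y : TreeVertex b l} (h : y ∈ pdesc x) :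
    ∃ c ∈ level x 1, y ∈ desc c := by
  obtain ⟨n, hn⟩ : ∃ n, y.1.length = x.1.length + 1 + n :=
    ⟨_, (Nat.add_sub_cancel' (length_lt_of_mem_pdesc h)).symm⟩
  induction n generalizing y with
  | zero => exact ⟨y, mem_level.2 ⟨(mem_pdesc.1 h).2, hn⟩, self_mem_desc y⟩
  | succ n ih =>
    obtain ⟨p, hp, hc⟩ := exists_isChild h
    have hl := hc.length
    obtain ⟨c, hc1, hc2⟩ := ih (mem_pdesc.2 ⟨fun he => by rw [he] at hl; omega, hp⟩) (by omega)
    exact ⟨c, hc1, hc.mem_desc hc2⟩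

theorem IsChild.desc_subset_pdesc {c x : TreeVertex b l} (h : IsChild c x) : desc c ⊆ pdesc x := by
  intro y hy
  have h1 := length_le_of_mem_desc hy
  have h2 := h.length
  exact mem_pdesc.2 ⟨fun he => by rw [he] at h1; omega,
    desc_subset (h.mem_desc (self_mem_desc x)) hy⟩

theorem pdesc_eq_biUnion (x : TreeVertex b l) : pdesc x = (level x 1).biUnion desc := by
  ext y
  rw [Finset.mem_biUnion]
  exact ⟨exists_mem_level_one, fun ⟨c, hc, hy⟩ => (mem_level_one.1 hc).desc_subset_pdesc hy⟩

theorem disjoint_desc {x y : TreeVertex b l} (hl : x.1.length = y.1.length) (hne : x ≠ y) :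
    Disjoint (desc x) (desc y) := by
  rw [Finset.disjoint_left]
  intro z hx hy
  rcases mem_desc_or hx hy with h | h
  · exact hne (eq_of_mem_desc h hl.le)
  · exact hne (eq_of_mem_desc h hl.ge).symm

theorem pairwiseDisjoint_desc (x : TreeVertex b l) (k : ℕ) :
    (level x k : Set (TreeVertex b l)).PairwiseDisjoint desc := fun _ hy _ hz hne =>
  disjoint_desc ((mem_level.1 hy).2.trans (mem_level.1 hz).2.symm) hne

theorem sum_desc (x : TreeVertex b l) {α : Type*} [AddCommMonoid α] (F : TreeVertex b l → α) :
    ∑ y ∈ desc x, F y = F x + ∑ c ∈ level x 1, ∑ y ∈ desc c, F y := by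
  rw [← Finset.add_sum_erase _ _ (self_mem_desc x), ← Finset.sum_biUnion (pairwiseDisjoint_desc x 1),
    ← pdesc_eq_biUnion]
  rfl

theorem card_level_le (x : TreeVertex b l) (k : ℕ) : (level x k).card ≤ b ^ k := by
  rw [← Finset.card_map (Function.Embedding.subtype _)]
  have h : (level x k).map (Function.Embedding.subtype _) ⊆
      (Finset.univ : Finset (List.Vector (Fin b) k)).image fun v => v.toList ++ x.1 := by
    intro y hy
    rw [Finset.mem_map] at hy
    obtain ⟨y, hy, rfl⟩ := hy
    obtain ⟨hd, hl⟩ := mem_level.1 hy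
    obtain ⟨w, hw⟩ := mem_desc.1 hd
    rw [← hw, List.length_append] at hl
    exact Finset.mem_image.2 ⟨⟨w, by omega⟩, Finset.mem_univ _, hw⟩
  refine (Finset.card_le_card h).trans (Finset.card_image_le.trans ?_)
  rw [Finset.card_univ, card_vector, Fintype.card_fin]

theorem upper_eq_biUnion (x : TreeVertex b l) (k : ℕ) :
    upper x k = (Finset.range k).biUnion (level x) := by
  ext y
  simp only [mem_upper, Finset.mem_biUnion, Finset.mem_range, mem_level]
  constructor
  · rintro ⟨h, hl⟩
    have := length_le_of_mem_desc h
    exact ⟨y.1.length - x.1.length, by omega, h, by omega⟩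
  · rintro ⟨j, hj, h, hl⟩
    exact ⟨h, by omega⟩

theorem card_upper_le (hb : 2 ≤ b) (x : TreeVertex b l) (k : ℕ) : (upper x k).card ≤ b ^ k := by
  rw [upper_eq_biUnion]
  refine Finset.card_biUnion_le.trans ((Finset.sum_le_sum fun j _ => card_level_le x j).trans ?_)
  exact (Nat.geomSum_lt hb fun j hj => Finset.mem_range.1 hj).le

/-- The root of the tree. -/
def treeRoot (b l : ℕ) : TreeVertex b l := ⟨[], mem_tree.2 (by simp)⟩

theorem desc_treeRoot : desc (treeRoot b l) = Finset.univ := by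
  ext y
  simp [mem_desc, treeRoot]

theorem card_treeVertex_le (hb : 2 ≤ b) : Fintype.card (TreeVertex b l) ≤ b ^ (l + 1) := by
  have h : upper (treeRoot b l) (l + 1) = Finset.univ := by
    ext y
    have := mem_tree.1 y.2
    rw [mem_upper, desc_treeRoot]
    simp only [Finset.mem_univ, true_and, iff_true, treeRoot, List.length_nil]
    omega
  rw [← Finset.card_univ, ← h]
  exact card_upper_le hb _ _

end Tree

/-! ### Separation in the tree -/

section TreeSep

variable {b l : ℕ} {β lam : ℝ} {D : IsingData (TreeVertex b l) β} (hlam : 0 ≤ lam)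

theorem sep_desc (hG : D.G = treeGraph b (tree b l)) {x : TreeVertex b l}
    {B : Finset (TreeVertex b l)} (hB : Disjoint (desc x) B) (hp : ∀ p, IsChild x p → p ∉ B) :
    (D.spec hlam).Sep (desc x) B := by
  refine D.sep hlam hB fun i hi j hj hadj => ?_
  rw [hG, treeGraph_adj] at hadj
  rcases hadj with h | h
  · exact Finset.disjoint_right.1 hB hj (h.mem_desc hi)
  · rcases h.mem_desc_or hi with rfl | h'
    · exact hp j h hj
    · exact Finset.disjoint_right.1 hB hj h'

theorem sep_pdesc (hG : D.G = treeGraph b (tree b l)) {x : TreeVertex b l}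
    {B : Finset (TreeVertex b l)} (hB : Disjoint (desc x) B) : (D.spec hlam).Sep (pdesc x) B := by
  refine D.sep hlam (Finset.disjoint_of_subset_left (pdesc_subset x) hB) fun i hi j hj hadj => ?_
  rw [hG, treeGraph_adj] at hadj
  have hi' := mem_pdesc.1 hi
  rcases hadj with h | h
  · exact Finset.disjoint_right.1 hB hj (h.mem_desc hi'.2)
  · rcases h.mem_desc_or hi'.2 with h' | h'
    · exact hi'.1 h'
    · exact Finset.disjoint_right.1 hB hj h'

theorem sep_upper_lower (hG : D.G = treeGraph b (tree b l)) (x : TreeVertex b l) (k : ℕ) :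
    (D.spec hlam).Sep (upper x k) (lower x k) := by
  refine D.sep hlam ?_ fun i hi j hj hadj => ?_
  · rw [Finset.disjoint_left]
    intro y h1 h2
    have := (mem_upper.1 h1).2
    have := (mem_lower.1 h2).2
    omega
  · have h1 := (mem_upper.1 hi).2
    have h2 := (mem_lower.1 hj).2
    rw [hG, treeGraph_adj] at hadj
    rcases hadj with h | h <;> have := h.length <;> omega

theorem sep_desc_lower_sdiff (hG : D.G = treeGraph b (tree b l)) {x y : TreeVertex b l} {k : ℕ}
    (hy : y.1.length ≤ x.1.length + k) :
    (D.spec hlam).Sep (desc y) (lower x k \ desc y) := by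
  refine sep_desc hlam hG Finset.disjoint_sdiff fun p hp h => ?_
  have h1 := (mem_lower.1 (Finset.mem_sdiff.1 h).1).2
  have h2 := hp.length
  omega

end TreeSep

/-! ### Contraction along the tree -/

section Contraction

instance {β : ℝ} : Nonempty (SpinPath β) := ⟨SpinPath.plus β⟩

/-- The observable `σ ↦ φ (σ x)`. -/
def Obs.site {V S : Type*} [MeasurableSpace S] (x : V) (φ : Obs S) : Obs (V → S) :=
  φ.comp (fun σ => σ x) (measurable_pi_apply x)

@[simp] theorem Obs.site_apply {V S : Type*} [MeasurableSpace S] (x : V) (φ : Obs S) (σ : V → S) :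
    Obs.site x φ σ = φ (σ x) := rfl

/-- The magnetization `σ • 1` of a path. -/
def magnetization {β : ℝ} (hβ : 0 ≤ β) : Obs (SpinPath β) :=
  Obs.mk (fun s => dot s 1)
    (by
      have he : (fun s : SpinPath β => dot s 1) = fun s : SpinPath β => dot 1 s :=
        funext fun s => dot_comm _ _
      rw [he]
      exact measurable_dot_field (integrable_const 1)) β
    fun s => by
      rw [dot_comm]
      refine (abs_dot_le (integrable_const 1) s).trans_eq ?_
      simp [timeMeasure_real_univ hβ]

/-- Changing one spin at a time. -/
theorem abs_sub_le_sum {V S : Type*} [DecidableEq V] (f : (V → S) → ℝ) (B : Finset V)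
    (c : V → S → S → ℝ) (hf : ∀ y ∈ B, ∀ ρ η : V → S, (∀ v, v ≠ y → ρ v = η v) →
      |f ρ - f η| ≤ c y (ρ y) (η y)) {ρ η : V → S} (h : ∀ v ∉ B, ρ v = η v) :
    |f ρ - f η| ≤ ∑ y ∈ B, c y (ρ y) (η y) := by
  induction B using Finset.induction_on generalizing ρ with
  | empty => simp [funext fun v => h v (by simp)]
  | insert a B ha ih =>
    have h1 := hf a (Finset.mem_insert_self a B) ρ (Function.update ρ a (η a))
      fun v hv => (Function.update_of_ne hv _ _).symm
    have h2 := ih (fun y hy => hf y (Finset.mem_insert_of_mem hy)) (ρ := Function.update ρ a (η a))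
      fun v hv => by
        by_cases hva : v = a
        · subst hva; simp
        · rw [Function.update_of_ne hva]
          exact h v (by simp [hva, hv])
    rw [Finset.sum_insert ha]
    rw [Function.update_self] at h1
    have h3 : ∑ y ∈ B, c y (Function.update ρ a (η a) y) (η y) = ∑ y ∈ B, c y (ρ y) (η y) :=
      Finset.sum_congr rfl fun y hy => by rw [Function.update_of_ne (ne_of_mem_of_not_mem hy ha)]
    rw [h3] at h2
    exact (abs_sub_le _ _ _).trans (add_le_add h1 h2)

variable {b l : ℕ} {β lam : ℝ}

/-- The consequences of the definitions of the exponents `γ` and `κ` for the specification on the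
tree of depth `l`: the influence of one spin on a neighbour is at most `γ`, and the influence of the
root of a subtree on the magnetization at distance `k ≥ ℓ₀` is at most `κ ^ k`. -/
structure IsingData.Mixing (D : IsingData (TreeVertex b l) β) (hlam : 0 ≤ lam) (κ γ : ℝ) (ℓ₀ : ℕ) :
    Prop where
  graph : D.G = treeGraph b (tree b l)
  kappa_pos : 0 < κ
  gamma_pos : 0 < γ
  gamma_le : ∀ (A : Finset (TreeVertex b l)) (y z : TreeVertex b l), y ∉ A → z ∈ A →
    (IsChild y z ∨ IsChild z y) → ∀ (φ : Obs (SpinPath β)) (K : ℝ), (∀ s s', φ s - φ s' ≤ K) →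
    ∀ ρ η : TreeVertex b l → SpinPath β, (∀ v, v ≠ y → ρ v = η v) →
    (D.spec hlam).E A (Obs.site z φ) ρ - (D.spec hlam).E A (Obs.site z φ) η ≤ γ * K
  kappa_le : ∀ (x z : TreeVertex b l) (k : ℕ), z ∈ level x k → ℓ₀ ≤ k →
    ∀ ρ η : TreeVertex b l → SpinPath β, ρ x = SpinPath.plus β → η x = SpinPath.minus β →
    (D.spec hlam).E (pdesc x) (Obs.site z (magnetization D.hβ)) ρ -
      (D.spec hlam).E (pdesc x) (Obs.site z (magnetization D.hβ)) η ≤ κ ^ k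

namespace IsingData.Mixing

variable {D : IsingData (TreeVertex b l) β} {hlam : 0 ≤ lam} {κ γ : ℝ} {ℓ₀ : ℕ}

/-- The vertices on the path from `x` down to, but excluding, `y` belong to `A`. -/
def PathIn (x y : TreeVertex b l) (A : Finset (TreeVertex b l)) : Prop :=
  ∀ w ∈ desc x, y ∈ pdesc w → w ∈ A

theorem update_eq_piecewise_off {A : Finset (TreeVertex b l)} (p : TreeVertex b l)
    (ρ σ : TreeVertex b l → SpinPath β) {v : TreeVertex b l} (hv : v ∉ A \ {p}) :
    A.piecewise σ ρ v = Function.update ρ p (A.piecewise σ ρ p) v := by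
  by_cases hp : v = p
  · subst hp; simp
  · rw [Function.update_of_ne hp]
    have : v ∉ A := fun h => hv (by simp [h, hp])
    simp [this]

/-- Along the path from `x` to its descendant `p`, the conditional expectation of a function of the
spin at `x` becomes a function of the spin at `p` with a smaller oscillation. -/
theorem exists_site (H : D.Mixing hlam κ γ ℓ₀) (n : ℕ) {x p : TreeVertex b l} (hp : p ∈ level x n)
    {A : Finset (TreeVertex b l)} (hpA : p ∈ A) (hA : PathIn x p A) (φ : Obs (SpinPath β)) {K : ℝ}
    (hφ : ∀ s s', φ s - φ s' ≤ K) {ρ η : TreeVertex b l → SpinPath β}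
    (hρ : ∀ v ∉ pdesc p, ρ v = η v) :
    ∃ ψ : Obs (SpinPath β), (∀ s s', ψ s - ψ s' ≤ γ ^ n * K) ∧
      (∀ ξ, ξ = ρ ∨ ξ = η → (D.spec hlam).E A (Obs.site x φ) ξ =
        (D.spec hlam).E A (Obs.site p ψ) ξ) := by
  induction n generalizing p A ρ η with
  | zero =>
    have : p = x := eq_of_mem_desc (mem_level.1 hp).1 (mem_level.1 hp).2.le
    subst this
    exact ⟨φ, by simpa using hφ, fun _ _ => rfl⟩
  | succ n ih =>
    have hpl := (mem_level.1 hp).2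
    have hpx : p ∈ pdesc x := mem_pdesc.2 ⟨fun h => by rw [h] at hpl; omega, (mem_level.1 hp).1⟩
    obtain ⟨q, hq, hc⟩ := exists_isChild hpx
    have hql := hc.length
    have hpq : p ∈ pdesc q := hc.desc_subset_pdesc (self_mem_desc p)
    -- The vertex `q` is the parent of `p`. Conditioning first on the spins in `desc p` turns the
    -- observable into a function of the spin at `p`; by induction it is the conditional
    -- expectation of a function `χ` of the spin at `q`, and the influence of `p` on `q` gives
    -- another factor `γ`.
    let A' := A \ desc p
    have hA'A : A' ⊆ A := Finset.sdiff_subset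
    have hqA' : q ∈ A' := Finset.mem_sdiff.2 ⟨hA q hq hpq, fun h => by
      have := length_le_of_mem_desc h
      omega⟩
    have hpath : PathIn x q A' := fun w hw hqw => by
      refine Finset.mem_sdiff.2 ⟨hA w hw (mem_pdesc.2 ⟨fun h => ?_, hc.mem_desc (pdesc_subset _ hqw)⟩),
        fun h => ?_⟩
      · have := length_lt_of_mem_pdesc hqw
        rw [h] at hql
        omega
      · have := length_lt_of_mem_pdesc hqw
        have := length_le_of_mem_desc h
        omega
    let F := (D.spec hlam).E A' (Obs.site x φ)
    have hsep : Spec.FreeOf (pdesc p) F := by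
      refine (sep_pdesc hlam H.graph (B := A') Finset.disjoint_sdiff).symm.freeOf_E ?_
      intro ρ σ h
      rw [Obs.site_apply, Obs.site_apply, h x fun hx => ?_]
      have := length_lt_of_mem_pdesc hx
      omega
    have hfree : Spec.FreeOf (A \ {p}) F := by
      refine (((D.spec hlam).freeOf_E A' _).union hsep).mono fun v hv => ?_
      rw [Finset.mem_sdiff, Finset.mem_singleton] at hv
      by_cases hvp : v ∈ desc p
      · exact Finset.mem_union_right _ (mem_pdesc.2 ⟨hv.2, hvp⟩)
      · exact Finset.mem_union_left _ (Finset.mem_sdiff.2 ⟨hv.1, hvp⟩)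
    let ψ : Obs (SpinPath β) := F.comp (Function.update ρ p) (measurable_update ρ)
    refine ⟨ψ, fun s s' => ?_, fun ξ hξ => ?_⟩
    · obtain ⟨χ, hχ, hχ'⟩ := ih (p := q) (A := A') (mem_level.2 ⟨hq, by omega⟩) hqA' hpath
        (ρ := Function.update ρ p s) (η := Function.update ρ p s') fun v hv => by
          have : v ≠ p := fun h => hv (h ▸ hpq)
          rw [Function.update_of_ne this, Function.update_of_ne this]
      change F (Function.update ρ p s) - F (Function.update ρ p s') ≤ _
      rw [show F (Function.update ρ p s) = _ from hχ' _ (Or.inl rfl),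
        show F (Function.update ρ p s') = _ from hχ' _ (Or.inr rfl), pow_succ', mul_assoc]
      refine H.gamma_le A' p q (fun h => (Finset.mem_sdiff.1 h).2 (self_mem_desc p)) hqA' (Or.inl hc)
        χ _ hχ _ _ fun v hv => ?_
      rw [Function.update_of_ne hv, Function.update_of_ne hv]
    · rw [← (D.spec hlam).E_E hA'A]
      refine (D.spec hlam).E_congr fun σ => ?_
      change F _ = F (Function.update ρ p (A.piecewise σ ξ p))
      rw [Finset.piecewise_eq_of_mem _ _ _ hpA]
      have h1 : F (A.piecewise σ ξ) = F (Function.update ξ p (σ p)) := by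
        refine hfree _ _ fun v hv => ?_
        rw [update_eq_piecewise_off p ξ σ hv, Finset.piecewise_eq_of_mem _ _ _ hpA]
      rw [h1]
      refine hsep _ _ fun v hv => ?_
      by_cases hvp : v = p
      · subst hvp; simp
      · rw [Function.update_of_ne hvp, Function.update_of_ne hvp]
        rcases hξ with rfl | rfl
        · rfl
        · exact (hρ v hv).symm

/-- The influence of a spin `n + 1` generations below `x` on the spin at `x`. -/
theorem abs_E_upper_sub_le (H : D.Mixing hlam κ γ ℓ₀) (n : ℕ) {x y : TreeVertex b l}
    (hy : y ∈ level x (n + 1)) (φ : Obs (SpinPath β)) {K : ℝ} (hφ : ∀ s s', φ s - φ s' ≤ K)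
    {ρ η : TreeVertex b l → SpinPath β} (hρ : ∀ v, v ≠ y → ρ v = η v) :
    |(D.spec hlam).E (upper x (n + 1)) (Obs.site x φ) ρ -
      (D.spec hlam).E (upper x (n + 1)) (Obs.site x φ) η| ≤
      4 * pathDist (ρ y) (η y) * (γ ^ n * K) := by
  classical
  have hyl := (mem_level.1 hy).2
  obtain ⟨p, hp, hc⟩ := exists_isChild (x := x) (y := y)
    (mem_pdesc.2 ⟨fun h => by rw [h] at hyl; omega, (mem_level.1 hy).1⟩)
  have hpl := hc.length
  have hpA : p ∈ upper x (n + 1) := mem_upper.2 ⟨hp, by omega⟩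
  have hyA : y ∉ upper x (n + 1) := fun h => by
    have := (mem_upper.1 h).2
    omega
  have hyp : y ∈ pdesc p := hc.desc_subset_pdesc (self_mem_desc y)
  obtain ⟨ψ, hψ, hψ'⟩ := H.exists_site n (p := p) (A := upper x (n + 1)) (mem_level.2 ⟨hp, by omega⟩) hpA
    (fun w hw hpw => mem_upper.2 ⟨hw, by have := length_lt_of_mem_pdesc hpw; omega⟩) φ hφ
    (ρ := ρ) (η := η) fun v hv => hρ v fun h => hv (h ▸ hyp)
  rw [hψ' ρ (Or.inl rfl), hψ' η (Or.inr rfl)]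
  have hbdd : BddBelow (Set.range ψ) := ⟨-‖ψ‖, by
    rintro _ ⟨s, rfl⟩
    exact (abs_le.1 (ψ.abs_le_norm s)).1⟩
  have h1 := D.abs_E_sub_E_le hlam (upper x (n + 1)) (Obs.site p ψ) (ρ := ρ) (η := η)
    (a := ⨅ s, ψ s) (b := (⨅ s, ψ s) + γ ^ n * K)
    (fun σ => by simp [hpA]) (fun σ => ciInf_le hbdd _) fun σ => by
      have : Obs.site p ψ ((upper x (n + 1)).piecewise σ η) - γ ^ n * K ≤ ⨅ s, ψ s :=
        le_ciInf fun s => by rw [Obs.site_apply]; linarith [hψ ((upper x (n + 1)).piecewise σ η p) s]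
      linarith
  rw [add_sub_cancel_left] at h1
  refine h1.trans_eq ?_
  congr 2
  rw [Finset.sum_eq_single_of_mem p hpA, Finset.sum_eq_single_of_mem y (Finset.mem_compl.2 hyA)]
  · rw [if_pos]
    rw [H.graph, treeGraph_adj]
    exact Or.inl hc
  · intro j _ hj
    rw [hρ j hj, pathDist_self]
    simp
  · intro i hi hip
    refine Finset.sum_eq_zero fun j hj => ?_
    split_ifs with hadj
    · rw [hρ j, pathDist_self]
      rintro rfl
      rw [H.graph, treeGraph_adj] at hadj
      rcases hadj with h | h
      · exact hip (h.unique hc)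
      · have := h.length
        have := (mem_upper.1 hi).2
        omega
    · rfl

end IsingData.Mixing

end Contraction

/-! ### From contraction of oscillations to contraction of variances -/

/-- A log-convex sequence bounded by `C δ ^ n` has all its ratios at most `δ`, since they increase;
the constant `C` plays no role. -/
theorem le_of_logConvex {B : ℕ → ℝ} {C δ : ℝ} (hδ : 0 < δ) (h0 : ∀ n, 0 ≤ B n)
    (hlc : ∀ n, B (n + 1) ^ 2 ≤ B n * B (n + 2)) (hC : ∀ n, B n ≤ C * δ ^ n) : B 1 ≤ δ * B 0 := by
  by_contra! hlt
  have hB1 : 0 < B 1 := (mul_nonneg hδ.le (h0 0)).trans_lt hlt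
  have hB0 : 0 < B 0 := by
    rcases (h0 0).lt_or_eq with h | h
    · exact h
    · have := hlc 0
      rw [← h, zero_mul] at this
      nlinarith
  obtain ⟨r, hr⟩ : ∃ r, r = B 1 / B 0 := ⟨_, rfl⟩
  have hrδ : δ < r := by rw [hr, lt_div_iff₀ hB0]; exact hlt
  have hr0 : 0 < r := hδ.trans hrδ
  have key : ∀ n, 0 < B n ∧ r * B n ≤ B (n + 1) := by
    intro n
    induction n with
    | zero => exact ⟨hB0, by rw [hr, div_mul_cancel₀ _ hB0.ne']⟩
    | succ n ih =>
      have hp : 0 < B (n + 1) := (mul_pos hr0 ih.1).trans_le ih.2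
      refine ⟨hp, le_of_mul_le_mul_left ?_ ih.1⟩
      have := hlc n
      have h2 := mul_le_mul_of_nonneg_right ih.2 hp.le
      nlinarith
  have hpow : ∀ n, r ^ n * B 0 ≤ B n := by
    intro n
    induction n with
    | zero => simp
    | succ n ih =>
      refine le_trans ?_ (key n).2
      rw [pow_succ', mul_assoc]
      exact mul_le_mul_of_nonneg_left ih hr0.le
  obtain ⟨n, hn⟩ := pow_unbounded_of_one_lt (C / B 0) ((one_lt_div hδ).2 hrδ)
  have h1 := (hpow n).trans (hC n)
  rw [div_pow, lt_div_iff₀ (pow_pos hδ n), div_mul_eq_mul_div, div_lt_iff₀ hB0] at hn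
  linarith

namespace Spec

variable {V S : Type*} [Fintype V] [DecidableEq V] [MeasurableSpace S] (M : Spec V S)

/-- The Cauchy–Schwarz inequality. -/
theorem E_mul_sq_le (T : Finset V) (f g : Obs (V → S)) (ρ : V → S) :
    (M.E T (f * g) ρ) ^ 2 ≤ M.E T (f * f) ρ * M.E T (g * g) ρ := by
  have h : ∀ t : ℝ, 0 ≤ M.E T (g * g) ρ * (t * t) + (-2 * M.E T (f * g) ρ) * t + M.E T (f * f) ρ := by
    intro t
    have h1 : 0 ≤ M.E T ((f - t • g) * (f - t • g)) ρ := M.E_nonneg fun σ => by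
      simp only [Obs.mul_apply]
      exact mul_self_nonneg _
    have h2 : (f - t • g) * (f - t • g) = f * f - (2 * t) • (f * g) + (t * t) • (g * g) := by
      ext σ
      simp only [Obs.mul_apply, Obs.sub_apply, Obs.smul_apply, Obs.add_apply]
      ring
    rw [h2, map_add, map_sub, map_smul, map_smul] at h1
    simp only [Obs.sub_apply, Obs.smul_apply, Obs.add_apply] at h1
    linarith
  have := discrim_le_zero h
  rw [discrim] at this
  nlinarith

variable {M}

theorem E_E_mul_symm {R A T : Finset V} (hR : R ⊆ T) (hA : A ⊆ T) {u v : Obs (V → S)}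
    (hu : FreeOf R u) (hv : FreeOf R v) :
    M.E T (M.E R (M.E A u) * v) = M.E T (u * M.E R (M.E A v)) := by
  rw [M.E_symm hR, M.E_of_freeOf hv, M.E_symm hA, ← M.E_symm hR, M.E_of_freeOf hu]

/-- If `E_R E_A` contracts oscillations by a factor `ε` on the functions that do not depend on `R`,
then by self-adjointness it contracts variances. -/
theorem Var_E_le_of_osc_contract {R A T : Finset V} (hR : R ⊆ T) (hA : A ⊆ T) {ε : ℝ} (hε : 0 < ε)
    {ρ : V → S} (hosc : ∀ f, FreeOf R f → ∀ K : ℝ,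
      (∀ σ σ', f (T.piecewise σ ρ) - f (T.piecewise σ' ρ) ≤ K) →
      ∀ σ σ', M.E R (M.E A f) (T.piecewise σ ρ) - M.E R (M.E A f) (T.piecewise σ' ρ) ≤ ε * K)
    {f : Obs (V → S)} (hf : FreeOf R f) (h0 : M.E T f ρ = 0) :
    M.E T (M.E A f * M.E A f) ρ ≤ ε * M.E T (f * f) ρ := by
  -- The second moments `B n` of the iterates `F n` are log-convex by self-adjointness and the
  -- Cauchy–Schwarz inequality, and bounded by a multiple of `ε ^ (2 n)`.
  let Q : Obs (V → S) → Obs (V → S) := fun f => M.E R (M.E A f)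
  let F : ℕ → Obs (V → S) := fun n => Q^[n] f
  have hF : ∀ n, F (n + 1) = M.E R (M.E A (F n)) := fun n => Function.iterate_succ_apply' Q n f
  have hfree : ∀ n, FreeOf R (F n) := by
    intro n
    cases n with
    | zero => exact hf
    | succ n => rw [hF]; exact M.freeOf_E R _
  have hmean : ∀ n, M.E T (F n) ρ = 0 := by
    intro n
    induction n with
    | zero => exact h0
    | succ n ih => rw [hF, M.E_E hR, M.E_E hA, ih]
  have hosc' : ∀ n σ σ', F n (T.piecewise σ ρ) - F n (T.piecewise σ' ρ) ≤ ε ^ n * (2 * ‖f‖) := by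
    intro n
    induction n with
    | zero =>
      intro σ σ'
      have h1 := (abs_le.1 (f.abs_le_norm (T.piecewise σ ρ))).2
      have h2 := (abs_le.1 (f.abs_le_norm (T.piecewise σ' ρ))).1
      change f _ - f _ ≤ _
      linarith
    | succ n ih =>
      rw [hF, pow_succ', mul_assoc]
      exact hosc _ (hfree n) _ ih
  have habs : ∀ n σ, |F n (T.piecewise σ ρ)| ≤ ε ^ n * (2 * ‖f‖) := by
    intro n σ
    rw [abs_le]
    constructor
    · have : M.E T (F n) ρ ≤ F n (T.piecewise σ ρ) + ε ^ n * (2 * ‖f‖) :=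
        M.E_le_const fun σ' => by linarith [hosc' n σ' σ]
      rw [hmean] at this
      linarith
    · have : F n (T.piecewise σ ρ) - ε ^ n * (2 * ‖f‖) ≤ M.E T (F n) ρ :=
        M.const_le_E fun σ' => by linarith [hosc' n σ σ']
      rw [hmean] at this
      linarith
  let B : ℕ → ℝ := fun n => M.E T (F n * F n) ρ
  have hB0 : ∀ n, 0 ≤ B n := fun n => M.E_nonneg fun σ => mul_self_nonneg _
  have hB : B 1 ≤ ε ^ 2 * B 0 := by
    refine le_of_logConvex (C := (2 * ‖f‖) ^ 2) (pow_pos hε 2) hB0 (fun n => ?_) fun n => ?_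
    · have h1 : B (n + 1) = M.E T (F n * F (n + 2)) ρ := by
        have h2 : F (n + 1) * F (n + 1) = M.E R (M.E A (F n)) * F (n + 1) := by rw [← hF n]
        change M.E T (F (n + 1) * F (n + 1)) ρ = _
        rw [h2, E_E_mul_symm hR hA (hfree n) (hfree (n + 1)), hF (n + 1)]
      rw [h1]
      exact M.E_mul_sq_le T _ _ ρ
    · refine M.E_le_const fun σ => ?_
      rw [Obs.mul_apply, ← pow_two, ← sq_abs]
      refine (pow_le_pow_left₀ (abs_nonneg _) (habs n σ) 2).trans_eq ?_
      rw [mul_pow, ← pow_mul, ← pow_mul, mul_comm n 2, mul_comm]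
  have h1 : M.E T (M.E A f * M.E A f) ρ = M.E T (F 1 * F 0) ρ := by
    rw [hF]
    change _ = M.E T (M.E R (M.E A f) * f) ρ
    rw [M.E_symm hR, M.E_of_freeOf hf, M.E_symm hA f f, ← M.E_symm hA (M.E A f) f,
      M.E_of_freeOf (M.freeOf_E A f), mul_comm]
  rw [h1]
  refine abs_le_of_sq_le_sq' ?_ (mul_nonneg hε.le (hB0 0)) |>.2
  refine (M.E_mul_sq_le T _ _ ρ).trans ?_
  change B 1 * B 0 ≤ (ε * B 0) ^ 2
  nlinarith [hB0 0]

/-- The dual form of `Var_E_le_of_osc_contract`. -/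
theorem Var_E_le_of_osc_contract' {R A T : Finset V} (hR : R ⊆ T) (hA : A ⊆ T) {ε : ℝ} (hε : 0 < ε)
    {ρ : V → S} (hosc : ∀ f, FreeOf R f → ∀ K : ℝ,
      (∀ σ σ', f (T.piecewise σ ρ) - f (T.piecewise σ' ρ) ≤ K) →
      ∀ σ σ', M.E R (M.E A f) (T.piecewise σ ρ) - M.E R (M.E A f) (T.piecewise σ' ρ) ≤ ε * K)
    {g : Obs (V → S)} (hg : FreeOf A g) : M.Var T (M.E R g) ρ ≤ ε * M.Var T g ρ := by
  let c : ℝ := M.E T g ρ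
  let g' : Obs (V → S) := g - c • 1
  have hone : ∀ B : Finset V, FreeOf B ((c • 1 : Obs (V → S))) := fun B => freeOf_one.smul c
  have hg' : FreeOf A g' := hg.sub (hone A)
  have hEg' : M.E R g' = M.E R g - c • 1 := by rw [map_sub, M.E_of_freeOf (hone R)]
  have h0 : M.E T (M.E R g') ρ = 0 := by
    rw [M.E_E hR, map_sub, M.E_of_freeOf (hone T)]
    simp [c]
  have hVar : ∀ u : Obs (V → S), M.E T u ρ = c →
      M.Var T u ρ = M.E T ((u - c • 1) * (u - c • 1)) ρ := by
    intro u hu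
    rw [Var_eq]
    refine M.E_congr fun σ => ?_
    simp [(M.freeOf_E T u).piecewise, hu]
  rw [hVar _ (by rw [M.E_E hR]), hVar g rfl, ← hEg']
  have key := Var_E_le_of_osc_contract hR hA hε hosc (M.freeOf_E R g') h0
  change M.E T (M.E R g' * M.E R g') ρ ≤ ε * M.E T (g' * g') ρ
  have h1 : M.E T (M.E R g' * M.E R g') = M.E T (g' * M.E A (M.E R g')) := by
    rw [M.E_symm hR, M.E_of_freeOf (M.freeOf_E R g'), ← M.E_symm hA, M.E_of_freeOf hg']
  have h2 := M.E_mul_sq_le T g' (M.E A (M.E R g')) ρ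
  rw [← h1] at h2
  have hx : 0 ≤ M.E T (M.E R g' * M.E R g') ρ := M.E_nonneg fun σ => mul_self_nonneg _
  have hy : 0 ≤ M.E T (g' * g') ρ := M.E_nonneg fun σ => mul_self_nonneg _
  rcases hx.lt_or_eq with h | h
  · have h3 := h2.trans (mul_le_mul_of_nonneg_left key hy)
    nlinarith
  · rw [← h]
    exact mul_nonneg hε.le hy

end Spec

/-! ### Lipschitz observables and increasing observables -/

section Lipschitz

variable {V : Type*} [Fintype V] [DecidableEq V] {β : ℝ}

theorem pathDist_eq_of_le (hβ : 0 ≤ β) {s s' : SpinPath β} (h : ∀ t, s t ≤ s' t) :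
    pathDist s s' = magnetization hβ s' - magnetization hβ s := by
  change _ = dot s' 1 - dot s 1
  simp only [dot, Pi.one_apply, mul_one]
  rw [← integral_sub s'.integrable s.integrable]
  refine integral_congr_ae (Eventually.of_forall fun t => ?_)
  change |s t - s' t| = s' t - s t
  rw [abs_sub_comm, abs_of_nonneg (sub_nonneg.2 (h t))]

theorem tendsto_pathDist {s : ℕ → SpinPath β} {s₀ : SpinPath β}
    (h : ∀ t, Tendsto (fun n => s n t) atTop (𝓝 (s₀ t))) :
    Tendsto (fun n => pathDist (s n) s₀) atTop (𝓝 0) := by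
  have h0 : (0 : ℝ) = ∫ _, (0 : ℝ) ∂(timeMeasure β) := by simp
  rw [h0]
  refine tendsto_integral_of_dominated_convergence (fun _ => 2) (fun n => ?_) (integrable_const _)
    (fun n => Eventually.of_forall fun t => ?_) (Eventually.of_forall fun t => ?_)
  · exact ((s n).integrable.sub s₀.integrable).abs.aestronglyMeasurable
  · rw [Real.norm_eq_abs, abs_abs]
    refine (abs_sub _ _).trans ?_
    rw [SpinPath.abs_eq_one, SpinPath.abs_eq_one]
    norm_num
  · have := ((h t).sub_const (s₀ t)).abs
    simpa using this

/-- The total magnetization in `B`. -/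
def totalMag (hβ : 0 ≤ β) (B : Finset V) : Obs (V → SpinPath β) :=
  ∑ z ∈ B, Obs.site z (magnetization hβ)

/-- For ordered configurations the `L¹` distance is the difference of the total magnetizations;
hence `L` times the total magnetization makes every `L`-Lipschitz observable increasing. -/
theorem inc_of_lipschitz (hβ : 0 ≤ β) {u : Obs (V → SpinPath β)} {B : Finset V} {L : ℝ}
    (hu : ∀ σ σ', |u σ - u σ'| ≤ L * ∑ y ∈ B, pathDist (σ y) (σ' y)) :
    Inc (L • totalMag hβ B + u) := by
  have hmag : SeqCont (totalMag hβ B : Obs (V → SpinPath β)) := fun σn σ h => by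
    simp only [totalMag, Obs.sum_apply, Obs.site_apply]
    refine tendsto_finsetSum _ fun i _ => ?_
    have e : ∀ s : SpinPath β, magnetization hβ s = dot (fun _ => (1 : ℝ)) s := fun s => dot_comm _ _
    simp only [e]
    exact IsingData.tendsto_dot (integrable_const (1 : ℝ)) (h i)
  refine ⟨(hmag.smul L).add fun σn σ h => ?_, fun σ σ' h => ?_⟩
  · rw [tendsto_iff_norm_sub_tendsto_zero]
    refine squeeze_zero (fun _ => norm_nonneg _) (fun n => hu (σn n) σ) ?_
    have : Tendsto (fun n => L * ∑ y ∈ B, pathDist (σn n y) (σ y)) atTop (𝓝 (L * ∑ _y ∈ B, 0)) :=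
      (tendsto_finsetSum _ fun y _ => tendsto_pathDist (h y)).const_mul L
    simpa using this
  · have h1 := (abs_le.1 (hu σ σ')).2
    simp only [Obs.add_apply, Obs.smul_apply, totalMag, Obs.sum_apply, Obs.site_apply]
    have h2 : ∑ y ∈ B, pathDist (σ y) (σ' y) =
        ∑ y ∈ B, magnetization hβ (σ' y) - ∑ y ∈ B, magnetization hβ (σ y) := by
      rw [← Finset.sum_sub_distrib]
      exact Finset.sum_congr rfl fun y _ => pathDist_eq_of_le hβ (h y)
    rw [h2] at h1
    linarith

/-- If `v ± u` are increasing and `Φ` preserves increasing observables, the variation of `Φ u` is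
dominated by that of `Φ v`. -/
theorem sub_le_of_inc {Φ : Obs (V → SpinPath β) →L[ℝ] Obs (V → SpinPath β)}
    (hΦ : ∀ f, Inc f → Inc (Φ f)) {u v : Obs (V → SpinPath β)} (h1 : Inc (v + u)) (h2 : Inc (v - u))
    {ρ₁ ρ₂ ρ η : V → SpinPath β} (hρ : PathLE ρ₁ ρ) (hρ' : PathLE ρ ρ₂) (hη : PathLE ρ₁ η)
    (hη' : PathLE η ρ₂) : Φ u ρ - Φ u η ≤ Φ v ρ₂ - Φ v ρ₁ := by
  have k1 := (hΦ _ h1).mono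
  have k2 := (hΦ _ h2).mono
  simp only [map_add, map_sub, Obs.add_apply, Obs.sub_apply] at k1 k2
  have a1 := k1 _ _ hρ'
  have a2 := k2 _ _ hρ
  have a3 := k1 _ _ hη
  have a4 := k2 _ _ hη'
  linarith

theorem SpinPath.minus_le (s : SpinPath β) (t : Set.Icc (0 : ℝ) β) : SpinPath.minus β t ≤ s t := by
  have : SpinPath.minus β t = -1 := by simp [SpinPath.minus, SpinPath.const]
  rw [this]
  rcases s.eq_or t with h | h <;> norm_num [h]

theorem SpinPath.le_plus (s : SpinPath β) (t : Set.Icc (0 : ℝ) β) : s t ≤ SpinPath.plus β t := by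
  have : SpinPath.plus β t = 1 := by simp [SpinPath.plus, SpinPath.const]
  rw [this]
  rcases s.eq_or t with h | h <;> norm_num [h]

end Lipschitz

/-! ### Contraction for the blocks of the tree -/

section TreeContraction

variable {b l : ℕ} {β lam : ℝ}

namespace IsingData.Mixing

variable {D : IsingData (TreeVertex b l) β} {hlam : 0 ≤ lam} {κ γ : ℝ} {ℓ₀ : ℕ}

/-- A function of the spin at `x`, averaged over the block below `x` and then over all proper
descendants of `x`, loses its dependence on the spin at `x`. The average over the block is a
Lipschitz function of the spins `n + 1` generations below `x`, with constant of order `γ ^ n`, and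
the effect of the spin at `x` on their total magnetization is at most `(b κ) ^ (n + 1)`. -/
theorem osc_E_E_site_le (H : D.Mixing hlam κ γ ℓ₀) {n : ℕ} (hn : ℓ₀ ≤ n + 1) (x : TreeVertex b l)
    (φ : Obs (SpinPath β)) {K : ℝ} (hφ : ∀ s s', φ s - φ s' ≤ K) (ξ : TreeVertex b l → SpinPath β)
    (s s' : SpinPath β) :
    (D.spec hlam).E (pdesc x) ((D.spec hlam).E (upper x (n + 1)) (Obs.site x φ))
        (Function.update ξ x s) -
      (D.spec hlam).E (pdesc x) ((D.spec hlam).E (upper x (n + 1)) (Obs.site x φ))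
        (Function.update ξ x s') ≤ 4 * (γ ^ n * K) * (b ^ (n + 1) * κ ^ (n + 1)) := by
  classical
  have hK : 0 ≤ K := by simpa using hφ s s
  let g := (D.spec hlam).E (upper x (n + 1)) (Obs.site x φ)
  let L : ℝ := 4 * (γ ^ n * K)
  have hL : 0 ≤ L := by have := H.gamma_pos; positivity
  -- With the spins outside `desc x` frozen, the average `g` over the block depends only on the
  -- spins at `level x (n + 1)`.
  let u := Spec.freeze (desc x) ξ g
  have hlow : Spec.FreeOf (lower x (n + 1)) g := by
    refine (sep_upper_lower hlam H.graph x (n + 1)).freeOf_E fun ρ σ h => ?_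
    rw [Obs.site_apply, Obs.site_apply, h x fun hx => ?_]
    have := (mem_lower.1 hx).2
    omega
  have hg : ∀ ρ η : TreeVertex b l → SpinPath β, (∀ v ∉ desc x, ρ v = η v) →
      |g ρ - g η| ≤ L * ∑ y ∈ level x (n + 1), pathDist (ρ y) (η y) := by
    intro ρ η h
    have := abs_sub_le_sum g (desc x)
      (fun y s s' => if y ∈ level x (n + 1) then L * pathDist s s' else 0) (fun y hy ρ η hρ => by
        split_ifs with hyl
        · refine (H.abs_E_upper_sub_le n hyl φ hφ hρ).trans_eq ?_
          simp only [L]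
          ring
        · have : g ρ = g η := by
            rcases lt_or_ge y.1.length (x.1.length + (n + 1)) with h1 | h1
            · exact (D.spec hlam).freeOf_E _ _ ρ η fun i hi => hρ i fun he =>
                hi (he ▸ mem_upper.2 ⟨hy, h1⟩)
            · refine hlow ρ η fun i hi => hρ i fun he => hi (he ▸ mem_lower.2 ⟨hy, ?_⟩)
              refine lt_of_le_of_ne h1 fun he => hyl (mem_level.2 ⟨hy, he.symm⟩)
          rw [this, sub_self, abs_zero]) h
    refine this.trans_eq ?_
    rw [← Finset.sum_filter, Finset.mul_sum]
    refine Finset.sum_congr ?_ fun _ _ => rfl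
    ext y
    simp only [Finset.mem_filter, mem_level]
    tauto
  have hu : ∀ σ σ', |u σ - u σ'| ≤ L * ∑ y ∈ level x (n + 1), pathDist (σ y) (σ' y) := by
    intro σ σ'
    refine (hg _ _ fun v hv => by simp [hv]).trans_eq ?_
    congr 1
    refine Finset.sum_congr rfl fun y hy => ?_
    simp [(mem_level.1 hy).1]
  have hu' : ∀ σ σ', |(-u) σ - (-u) σ'| ≤ L * ∑ y ∈ level x (n + 1), pathDist (σ y) (σ' y) := by
    intro σ σ'
    rw [Obs.neg_apply, Obs.neg_apply, neg_sub_neg, abs_sub_comm]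
    exact hu σ σ'
  have hEu : ∀ s, (D.spec hlam).E (pdesc x) g (Function.update ξ x s) =
      (D.spec hlam).E (pdesc x) u (Function.update ξ x s) := by
    intro s
    refine (D.spec hlam).E_congr fun σ => ?_
    change g _ = g _
    congr 1
    funext v
    by_cases hv : v ∈ desc x
    · simp [hv]
    · have h1 : v ∉ pdesc x := fun h => hv (pdesc_subset x h)
      have h2 : v ≠ x := fun h => hv (h ▸ self_mem_desc x)
      simp [hv, h1, h2]
  have hle : ∀ s s' : SpinPath β, (∀ t, s t ≤ s' t) →
      PathLE (Function.update ξ x s) (Function.update ξ x s') := by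
    intro s s' h i t
    by_cases hi : i = x
    · subst hi; simpa using h t
    · simp [hi]
  change (D.spec hlam).E (pdesc x) g _ - (D.spec hlam).E (pdesc x) g _ ≤ _
  rw [hEu, hEu]
  have h2 := inc_of_lipschitz D.hβ hu'
  rw [← sub_eq_add_neg] at h2
  -- Domination by `L` times the magnetization, with the spin at `x` constant equal to `1` or
  -- `-1`.
  refine (sub_le_of_inc (fun f hf => (D.ferro hlam).inc_E (pdesc x) hf)
    (inc_of_lipschitz D.hβ hu) h2 (hle _ _ s.minus_le) (hle _ _ s.le_plus)
    (hle _ _ s'.minus_le) (hle _ _ s'.le_plus)).trans ?_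
  rw [map_smul, totalMag, map_sum]
  simp only [Obs.smul_apply, Obs.sum_apply]
  rw [← mul_sub, ← Finset.sum_sub_distrib]
  refine mul_le_mul_of_nonneg_left ?_ hL
  refine (Finset.sum_le_card_nsmul _ _ (κ ^ (n + 1)) fun z hz => ?_).trans ?_
  · exact H.kappa_le x z (n + 1) hz hn _ _ (by simp) (by simp)
  · rw [nsmul_eq_mul]
    refine mul_le_mul_of_nonneg_right ?_ (pow_pos H.kappa_pos _).le
    exact_mod_cast card_level_le x (n + 1)

/-- The contraction factor for blocks of height `n + 1`. -/
def contr (b : ℕ) (κ γ : ℝ) (n : ℕ) : ℝ := 4 * γ ^ n * (b ^ (n + 1) * κ ^ (n + 1))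

/-- The variance of the conditional expectation given the spin at `x` contracts, for functions of
the spins below the block at `x`. -/
theorem Var_E_pdesc_le (H : D.Mixing hlam κ γ ℓ₀) (hb : 0 < b) {n : ℕ} (hn : ℓ₀ ≤ n + 1)
    (x : TreeVertex b l) {g : Obs (TreeVertex b l → SpinPath β)}
    (hg : Spec.FreeOf (upper x (n + 1)) g) (ρ : TreeVertex b l → SpinPath β) :
    (D.spec hlam).Var (desc x) ((D.spec hlam).E (pdesc x) g) ρ ≤
      contr b κ γ n * (D.spec hlam).Var (desc x) g ρ := by
  have hε : 0 < contr b κ γ n := by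
    have := H.gamma_pos
    have := H.kappa_pos
    unfold contr
    positivity
  refine Spec.Var_E_le_of_osc_contract' (A := upper x (n + 1)) (pdesc_subset x)
    (Finset.filter_subset _ _) hε
    (fun f hf K hK σ σ' => ?_) hg
  let φ : Obs (SpinPath β) := f.comp (Function.update ρ x) (measurable_update ρ)
  have hφ : ∀ s s', φ s - φ s' ≤ K := fun s s' => by
    have := hK (Function.update ρ x s) (Function.update ρ x s')
    have e : ∀ s, (desc x).piecewise (Function.update ρ x s) ρ = Function.update ρ x s := by
      intro s
      funext v
      by_cases hv : v ∈ desc x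
      · simp [hv]
      · have h2 : v ≠ x := fun h => hv (h ▸ self_mem_desc x)
        simp [hv, h2]
    rwa [e, e] at this
  have hEE : ∀ σ, (D.spec hlam).E (pdesc x) ((D.spec hlam).E (upper x (n + 1)) f)
      ((desc x).piecewise σ ρ) = (D.spec hlam).E (pdesc x) ((D.spec hlam).E (upper x (n + 1))
        (Obs.site x φ)) (Function.update ρ x (σ x)) := by
    intro σ
    have h1 : (D.spec hlam).E (pdesc x) ((D.spec hlam).E (upper x (n + 1)) f)
        ((desc x).piecewise σ ρ) = (D.spec hlam).E (pdesc x) ((D.spec hlam).E (upper x (n + 1)) f)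
        (Function.update ρ x (σ x)) := by
      refine (D.spec hlam).freeOf_E _ _ _ _ fun v hv => ?_
      by_cases hvx : v = x
      · subst hvx; simp [self_mem_desc]
      · have : v ∉ desc x := fun h => hv (mem_pdesc.2 ⟨hvx, h⟩)
        simp [this, hvx]
    rw [h1]
    refine (D.spec hlam).E_congr fun σ' => (D.spec hlam).E_congr fun σ'' => ?_
    change f _ = f _
    refine hf _ _ fun v hv => ?_
    by_cases hvx : v = x
    · subst hvx; simp
    · have h1 : v ∉ desc x := fun h => hv (mem_pdesc.2 ⟨hvx, h⟩)
      have h2 : v ∉ upper x (n + 1) := fun h => h1 (mem_upper.1 h).1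
      simp [hv, hvx, h2]
  rw [hEE, hEE]
  refine (H.osc_E_E_site_le hn x φ hφ ρ _ _).trans_eq ?_
  unfold contr
  ring

end IsingData.Mixing

end TreeContraction

/-! ### The Poincaré inequality on the tree -/

section TreeGap

variable {b l : ℕ} {β lam : ℝ}

/-- Each vertex belongs to at most `k` of the blocks of height `k`, namely those of its last `k`
ancestors, including itself. -/
theorem sum_upper_le (r : TreeVertex b l) (k : ℕ) {a : TreeVertex b l → ℝ} (ha : ∀ y, 0 ≤ a y) :
    ∑ x ∈ desc r, ∑ y ∈ upper x k, a y ≤ k * ∑ y ∈ desc r, a y := by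
  classical
  rw [Finset.sum_comm' (t' := desc r) (s' := fun y => (desc r).filter fun x => y ∈ upper x k),
    Finset.mul_sum]
  · refine Finset.sum_le_sum fun y _ => ?_
    rw [Finset.sum_const, nsmul_eq_mul]
    refine mul_le_mul_of_nonneg_right ?_ (ha y)
    have : ((desc r).filter fun x => y ∈ upper x k).card ≤ (Finset.range k).card := by
      refine Finset.card_le_card_of_injOn (fun x => y.1.length - x.1.length) (fun x hx => ?_)
        fun x hx x' hx' he => ?_
      · have h1 := mem_upper.1 (Finset.mem_filter.1 hx).2
        have h2 := length_le_of_mem_desc h1.1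
        have h3 : y.1.length - x.1.length < k := by omega
        simpa using h3
      · have h1 := (mem_upper.1 (Finset.mem_filter.1 hx).2).1
        have h2 := (mem_upper.1 (Finset.mem_filter.1 hx').2).1
        have h3 := length_le_of_mem_desc h1
        have h4 := length_le_of_mem_desc h2
        have he' : y.1.length - x.1.length = y.1.length - x'.1.length := he
        rcases mem_desc_or h1 h2 with h | h
        · exact eq_of_mem_desc h (by omega)
        · exact (eq_of_mem_desc h (by omega)).symm
    rw [Finset.card_range] at this
    exact_mod_cast this
  · intro x y
    simp only [Finset.mem_filter]
    exact ⟨fun h => ⟨h, desc_subset h.1 (mem_upper.1 h.2).1⟩, fun h => h.1⟩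

/-- A bound on the energy that a single spin can have. -/
def IsingData.FieldBound {V : Type*} [Fintype V] (D : IsingData V β) (K : ℝ) : Prop :=
  ∀ (x : V) (ρ : V → SpinPath β) (s : SpinPath β), |dot s (localField D.G D.h ρ x)| ≤ K

/-- A bound on the local fields bounds the effect of a single spin on the weight. -/
theorem IsingData.FieldBound.w_update_le {V : Type*} [Fintype V] [DecidableEq V]
    {D : IsingData V β} {hlam : 0 ≤ lam} {K : ℝ} (hK : D.FieldBound K) (x : V)
    (ρ : V → SpinPath β) (s : SpinPath β) :
    (D.spec hlam).w (Function.update ρ x s) ≤ Real.exp (2 * K) * (D.spec hlam).w ρ := by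
  have h : (D.spec hlam).w ρ = (D.spec hlam).w (Function.update ρ x (ρ x)) := by
    rw [Function.update_eq_self]
  rw [h, IsingData.spec_w, IsingData.spec_w, ← Real.exp_add, Real.exp_le_exp,
    IsingData.energy_update, IsingData.energy_update]
  have h1 := (abs_le.1 (hK x ρ s)).2
  have h2 := (abs_le.1 (hK x ρ (ρ x))).1
  linarith

namespace IsingData.Mixing

variable {D : IsingData (TreeVertex b l) β} {hlam : 0 ≤ lam} {κ γ : ℝ} {ℓ₀ : ℕ}

/-- The variance on a subtree is bounded by the sum, over the vertices `y`, of the variance coming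
from the spin at `y` given the spins that are not descendants of `y`. -/
theorem Var_desc_le (hG : D.G = treeGraph b (tree b l)) (x : TreeVertex b l)
    (f : Obs (TreeVertex b l → SpinPath β)) (ρ : TreeVertex b l → SpinPath β) :
    (D.spec hlam).Var (desc x) f ρ ≤ ∑ y ∈ desc x, (D.spec hlam).E (desc x)
      ((D.spec hlam).Var (desc y) ((D.spec hlam).E (pdesc y) f)) ρ := by
  obtain ⟨N, hN⟩ : ∃ N, l < x.1.length + N := ⟨l + 1, by omega⟩
  induction N generalizing x ρ with
  | zero => exact absurd (mem_tree.1 x.2) (by omega)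
  | succ N ih =>
    let M := D.spec hlam
    change M.Var (desc x) f ρ ≤ ∑ y ∈ desc x, M.E (desc x) (M.Var (desc y) (M.E (pdesc y) f)) ρ
    rw [sum_desc, M.Var_decomp (pdesc_subset x), Obs.add_apply, add_comm]
    have h1 : ∀ ρ, M.Var (pdesc x) f ρ ≤ ∑ c ∈ level x 1, M.E (pdesc x) (M.Var (desc c) f) ρ := by
      intro ρ
      rw [pdesc_eq_biUnion]
      refine M.Var_biUnion_le _ _ (fun c hc s hs hcs => ?_) f ρ
      refine sep_desc hlam hG ?_ fun p hp h => ?_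
      · rw [Finset.disjoint_biUnion_right]
        exact fun c' hc' => pairwiseDisjoint_desc x 1 hc (hs hc') fun h => hcs (h ▸ hc')
      · rw [Finset.mem_biUnion] at h
        obtain ⟨c', hc', h'⟩ := h
        have e1 := length_le_of_mem_desc h'
        have e2 := hp.length
        have e3 := (mem_level.1 hc).2
        have e4 := (mem_level.1 (hs hc')).2
        omega
    have h2 : M.E (desc x) (M.Var (pdesc x) f) ρ ≤
        M.E (desc x) (∑ c ∈ level x 1, M.E (pdesc x) (M.Var (desc c) f)) ρ :=
      M.E_mono fun σ => by
        rw [Obs.sum_apply]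
        exact h1 _
    have hM : M.E (desc x) (M.Var (desc x) (M.E (pdesc x) f)) = M.Var (desc x) (M.E (pdesc x) f) :=
      M.E_of_freeOf (M.freeOf_Var _ _)
    rw [hM]
    refine add_le_add le_rfl (h2.trans ?_)
    rw [map_sum, Obs.sum_apply]
    refine Finset.sum_le_sum fun c hc => ?_
    rw [M.E_E (pdesc_subset x)]
    have hcx : desc c ⊆ desc x := desc_subset (mem_level.1 hc).1
    have h3 : M.E (desc x) (M.Var (desc c) f) ρ ≤ M.E (desc x) (∑ y ∈ desc c,
        M.E (desc c) (M.Var (desc y) (M.E (pdesc y) f))) ρ :=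
      M.E_mono fun σ => by
        rw [Obs.sum_apply]
        exact ih c _ (by have := (mem_level.1 hc).2; omega)
    refine h3.trans_eq ?_
    rw [map_sum, Obs.sum_apply]
    exact Finset.sum_congr rfl fun y _ => by rw [M.E_E hcx]

/-- The variance of a function from which the spins more than `k` generations below `x` have been
averaged out is spread over the vertices of the first generations, as in the martingale
decomposition along the tree. -/
theorem Var_desc_lower_le (hG : D.G = treeGraph b (tree b l)) (x : TreeVertex b l) (k : ℕ)
    (f : Obs (TreeVertex b l → SpinPath β)) (ρ : TreeVertex b l → SpinPath β) :
    (D.spec hlam).Var (desc x) ((D.spec hlam).E (lower x k) f) ρ ≤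
      ∑ y ∈ upper x (k + 1), (D.spec hlam).E (desc x)
        ((D.spec hlam).Var (desc y) ((D.spec hlam).E (pdesc y) f)) ρ := by
  let M := D.spec hlam
  let F := M.E (lower x k) f
  have hup : upper x (k + 1) ⊆ desc x := Finset.filter_subset _ _
  refine (Var_desc_le hG x F ρ).trans ?_
  rw [← Finset.sum_sdiff hup]
  have h0 : ∑ y ∈ desc x \ upper x (k + 1), M.E (desc x) (M.Var (desc y) (M.E (pdesc y) F)) ρ = 0 := by
    refine Finset.sum_eq_zero fun y hy => ?_
    rw [Finset.mem_sdiff, mem_upper] at hy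
    have hsub : desc y ⊆ lower x k := fun z hz => mem_lower.2 ⟨desc_subset hy.1 hz, by
      have := length_le_of_mem_desc hz
      by_contra hcon
      exact hy.2 ⟨hy.1, by omega⟩⟩
    have hF : Spec.FreeOf (desc y) F := (M.freeOf_E _ f).mono hsub
    rw [M.E_of_freeOf (hF.mono (pdesc_subset y)), M.Var_of_freeOf hF, map_zero]
    rfl
  change (∑ y ∈ desc x \ upper x (k + 1), M.E (desc x) (M.Var (desc y) (M.E (pdesc y) F)) ρ) + _ ≤ _
  rw [h0, zero_add]
  refine Finset.sum_le_sum fun y hy => ?_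
  have hyl := (mem_upper.1 hy).2
  have hsep : M.Sep (desc y) (lower x k \ desc y) := sep_desc_lower_sdiff hlam hG (by omega)
  have hEE : M.E (pdesc y) F = M.E (lower x k \ desc y) (M.E (pdesc y) f) := by
    have e1 : lower x k = (lower x k \ desc y) ∪ (lower x k ∩ desc y) :=
      (Finset.sdiff_union_inter _ _).symm
    have hsub : lower x k ∩ desc y ⊆ pdesc y := fun z hz => by
      rw [Finset.mem_inter, mem_lower] at hz
      exact mem_pdesc.2 ⟨fun h => by rw [h] at hz; omega, hz.2⟩
    have e2 : F = M.E (lower x k \ desc y) (M.E (lower x k ∩ desc y) f) := by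
      rw [(hsep.symm.mono subset_rfl Finset.inter_subset_right).E_E, ← e1]
    rw [e2, (hsep.mono (pdesc_subset y) subset_rfl).comm, M.E_E hsub]
  have hT : lower x k \ desc y ⊆ desc x :=
    Finset.sdiff_subset.trans (Finset.filter_subset _ _)
  change M.E (desc x) (M.Var (desc y) (M.E (pdesc y) F)) ρ ≤ _
  rw [hEE, ← M.E_E hT (M.Var (desc y) (M.E (pdesc y) f))]
  exact M.E_mono fun σ => hsep.Var_E_le M _ _

/-- Recursion for the variance carried by the vertex `x`: one part is the variance inside a block of
bounded height, the other is a small multiple of the variances carried by the vertices of the first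
generations below `x`. -/
theorem Var_E_pdesc_le_add (H : D.Mixing hlam κ γ ℓ₀) (hb : 0 < b) {n : ℕ} (hn : ℓ₀ ≤ n + 1)
    (x : TreeVertex b l) (f : Obs (TreeVertex b l → SpinPath β)) (ρ : TreeVertex b l → SpinPath β) :
    (D.spec hlam).Var (desc x) ((D.spec hlam).E (pdesc x) f) ρ ≤
      2 * (D.spec hlam).E (desc x) ((D.spec hlam).Var (upper x (n + 1)) f) ρ +
      2 * (contr b κ γ n * ∑ y ∈ upper x (n + 2), (D.spec hlam).E (desc x)
        ((D.spec hlam).Var (desc y) ((D.spec hlam).E (pdesc y) f)) ρ) := by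
  have hG := H.graph
  let M := D.spec hlam
  -- The function `F - g` is of mean zero on the block, and `g` does not depend on the spins in
  -- the block.
  let F := M.E (lower x (n + 1)) f
  let g := M.E (upper x (n + 1)) F
  have hup : upper x (n + 1) ⊆ desc x := Finset.filter_subset _ _
  have hlow : lower x (n + 1) ⊆ desc x := Finset.filter_subset _ _
  have hlow' : lower x (n + 1) ⊆ pdesc x := fun z hz => mem_pdesc.2 ⟨fun h => by
    have := (mem_lower.1 hz).2
    rw [h] at this
    omega, hlow hz⟩
  have hsplit : M.E (pdesc x) f = M.E (pdesc x) (F - g) + M.E (pdesc x) g := by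
    rw [← map_add, sub_add_cancel, M.E_E hlow']
  change M.Var (desc x) (M.E (pdesc x) f) ρ ≤ _
  rw [hsplit]
  refine (M.Var_add_le _ _ _ _).trans ?_
  have hε : 0 ≤ contr b κ γ n := by
    have := H.gamma_pos
    have := H.kappa_pos
    unfold contr
    positivity
  have h1 : M.Var (desc x) (M.E (pdesc x) (F - g)) ρ ≤
      M.E (desc x) (M.Var (upper x (n + 1)) f) ρ := by
    refine (M.Var_E_le (pdesc_subset x) _ _).trans ?_
    refine (M.Var_le (F - g) (g := 0) (fun _ _ _ => rfl) ρ).trans ?_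
    rw [sub_zero, ← M.E_E hup, ← M.Var_eq, ← M.E_E hlow (M.Var (upper x (n + 1)) f)]
    exact M.E_mono fun σ => (sep_upper_lower hlam hG x (n + 1)).Var_E_le M _ _
  have h2 : M.Var (desc x) (M.E (pdesc x) g) ρ ≤ contr b κ γ n * ∑ y ∈ upper x (n + 2),
      M.E (desc x) (M.Var (desc y) (M.E (pdesc y) f)) ρ := by
    refine (H.Var_E_pdesc_le hb hn x (M.freeOf_E _ F) ρ).trans (mul_le_mul_of_nonneg_left ?_ hε)
    exact (M.Var_E_le hup F ρ).trans (Var_desc_lower_le hG x (n + 1) f ρ)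
  have h1' := mul_le_mul_of_nonneg_left h1 zero_le_two
  have h2' := mul_le_mul_of_nonneg_left h2 zero_le_two
  exact add_le_add h1' h2'

/-- The Poincaré constant obtained from blocks of height `n + 1`. -/
def poincareConst (b : ℕ) (K : ℝ) (n : ℕ) : ℝ :=
  4 * (Real.exp (2 * (2 * K) * (b ^ (n + 1) : ℕ)) * Real.exp (2 * (2 * K) * (b ^ (n + 1) : ℕ)) *
    Real.exp (2 * (2 * K)) * (n + 1))

theorem poincareConst_pos (b : ℕ) (K : ℝ) (n : ℕ) : 0 < poincareConst b K n := by
  unfold poincareConst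
  positivity

/-- The Poincaré inequality on every subtree, with every boundary condition, with a constant that
does not depend on the height of the tree. -/
theorem poincare (H : D.Mixing hlam κ γ ℓ₀) (hb : 2 ≤ b) {n : ℕ} (hn : ℓ₀ ≤ n + 1)
    (hε : 4 * ((n + 2) * contr b κ γ n) ≤ 1) {K : ℝ} (hK0 : 0 ≤ K) (hK : D.FieldBound K)
    (r : TreeVertex b l) (f : Obs (TreeVertex b l → SpinPath β))
    (ρ : TreeVertex b l → SpinPath β) : (D.spec hlam).Var (desc r) f ρ ≤
      poincareConst b K n * ∑ y ∈ desc r, (D.spec hlam).E (desc r) ((D.spec hlam).Var {y} f) ρ := by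
  let M := D.spec hlam
  let v : TreeVertex b l → ℝ := fun y => M.E (desc r) (M.Var (desc y) (M.E (pdesc y) f)) ρ
  let a : TreeVertex b l → ℝ := fun y => M.E (desc r) (M.Var {y} f) ρ
  have hv : ∀ y, 0 ≤ v y := fun y => M.E_nonneg fun σ => M.Var_nonneg _ _ _
  have ha : ∀ y, 0 ≤ a y := fun y => M.E_nonneg fun σ => M.Var_nonneg _ _ _
  let CB : ℝ := Real.exp (2 * (2 * K) * (b ^ (n + 1) : ℕ)) *
    Real.exp (2 * (2 * K) * (b ^ (n + 1) : ℕ)) * Real.exp (2 * (2 * K))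
  have hCB : 0 ≤ CB := by positivity
  have hblock : ∀ x ∈ desc r, M.E (desc r) (M.Var (upper x (n + 1)) f) ρ ≤
      CB * ∑ y ∈ upper x (n + 1), a y := by
    intro x hx
    have hsub : upper x (n + 1) ⊆ desc r := (Finset.filter_subset _ _).trans (desc_subset hx)
    have h1 : ∀ σ, M.Var (upper x (n + 1)) f σ ≤
        (CB • ∑ y ∈ upper x (n + 1), M.E (upper x (n + 1)) (M.Var {y} f)) σ := by
      intro σ
      rw [Obs.smul_apply, Obs.sum_apply]
      refine (M.Var_le_of_osc hK.w_update_le _ f σ).trans ?_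
      refine mul_le_mul_of_nonneg_right ?_ (Finset.sum_nonneg fun y _ =>
        M.E_nonneg fun σ => M.Var_nonneg _ _ _)
      have hc : ((upper x (n + 1)).card : ℝ) ≤ (b ^ (n + 1) : ℕ) := by
        exact_mod_cast card_upper_le hb x (n + 1)
      have he : Real.exp (2 * (2 * K) * (upper x (n + 1)).card) ≤
          Real.exp (2 * (2 * K) * (b ^ (n + 1) : ℕ)) :=
        Real.exp_le_exp.2 (mul_le_mul_of_nonneg_left hc (by positivity))
      exact mul_le_mul_of_nonneg_right
        (mul_le_mul he he (Real.exp_pos _).le (Real.exp_pos _).le) (Real.exp_pos _).le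
    refine (M.E_mono (g := CB • ∑ y ∈ upper x (n + 1), M.E (upper x (n + 1)) (M.Var {y} f))
      fun σ => h1 _).trans_eq ?_
    rw [map_smul, map_sum, Obs.smul_apply, Obs.sum_apply]
    exact congrArg _ (Finset.sum_congr rfl fun y _ => by rw [M.E_E hsub])
  have hstep : ∀ x ∈ desc r, v x ≤ 2 * (CB * ∑ y ∈ upper x (n + 1), a y) +
      2 * (contr b κ γ n * ∑ y ∈ upper x (n + 2), v y) := by
    intro x hx
    have hsub := desc_subset hx
    have h1 : v x ≤ M.E (desc r) ((2 : ℝ) • M.E (desc x) (M.Var (upper x (n + 1)) f) +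
        (2 * contr b κ γ n) • ∑ y ∈ upper x (n + 2),
          M.E (desc x) (M.Var (desc y) (M.E (pdesc y) f))) ρ := by
      refine M.E_mono fun σ => ?_
      refine (H.Var_E_pdesc_le_add (by omega) hn x f _).trans_eq ?_
      rw [Obs.add_apply, Obs.smul_apply, Obs.smul_apply, Obs.sum_apply]
      rw [mul_assoc (2 : ℝ)]
    refine h1.trans ?_
    rw [map_add, map_smul, map_smul, map_sum, Obs.add_apply, Obs.smul_apply, Obs.smul_apply,
      Obs.sum_apply, M.E_E hsub, mul_assoc (2 : ℝ)]
    refine add_le_add (mul_le_mul_of_nonneg_left (hblock x hx) zero_le_two) (le_of_eq ?_)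
    exact congrArg _ (congrArg _ (Finset.sum_congr rfl fun y _ => by rw [M.E_E hsub]))
  have hε0 : 0 ≤ contr b κ γ n := by
    have := H.gamma_pos
    have := H.kappa_pos
    unfold contr
    positivity
  -- Summation over `x`: each vertex is counted at most `n + 2` times, and the variances on the
  -- right are absorbed by those on the left because `2 (n + 2) contr ≤ 1 / 2`.
  have hsum := Finset.sum_le_sum hstep
  rw [Finset.sum_add_distrib] at hsum
  simp only [← Finset.mul_sum] at hsum
  have h1 := sum_upper_le r (n + 1) ha
  have h2 := sum_upper_le r (n + 2) hv
  have hV : 0 ≤ ∑ y ∈ desc r, v y := Finset.sum_nonneg fun y _ => hv y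
  have h3 := mul_le_mul_of_nonneg_left h2 hε0
  have h4 := mul_le_mul_of_nonneg_left h1 hCB
  have h5 := mul_le_mul_of_nonneg_right hε hV
  refine (Var_desc_le H.graph r f ρ).trans ?_
  change ∑ y ∈ desc r, v y ≤ 4 * (CB * (n + 1)) * ∑ y ∈ desc r, a y
  push_cast at h1 h2 h3 h4
  nlinarith

end IsingData.Mixing

end TreeGap

/-! ### The dynamics started from a constant configuration -/

section Sign

/-- The sign `s` as a real number. -/
def sgn (s : ℤˣ) : ℝ := ((s : ℤ) : ℝ)

theorem sgn_eq_or (s : ℤˣ) : sgn s = 1 ∨ sgn s = -1 := by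
  rcases Int.units_eq_one_or s with rfl | rfl <;> simp [sgn]

theorem sgn_mul_self (s : ℤˣ) : sgn s * sgn s = 1 := by
  rcases sgn_eq_or s with h | h <;> simp [h]

variable {V : Type*} [Fintype V] [DecidableEq V] {β lam : ℝ}

/-- Continuous observables that are increasing, if `s = 1`, or decreasing, if `s = -1`. -/
def SInc (s : ℤˣ) (f : Obs (V → SpinPath β)) : Prop := Inc (sgn s • f)

theorem SInc.P {M : Spec V (SpinPath β)} (hM : M.Ferro lam) {s : ℤˣ} (A : Finset V) {t : ℝ}
    (ht : 0 ≤ t) {f : Obs (V → SpinPath β)} (hf : SInc s f) : SInc s (M.P A t f) := by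
  have := hM.inc_P A ht hf
  rwa [map_smul] at this

theorem SInc.cov {M : Spec V (SpinPath β)} (hM : M.Ferro lam) {s : ℤˣ} (A : Finset V)
    {f g : Obs (V → SpinPath β)} (hf : SInc s f) (hg : SInc s g) (ρ : V → SpinPath β) :
    (M.E A f * M.E A g) ρ ≤ M.E A (f * g) ρ := by
  have h := hM.E_mul_E_le A hf hg ρ
  rw [smul_mul_smul_comm, sgn_mul_self, one_smul, map_smul, map_smul, smul_mul_smul_comm,
    sgn_mul_self, one_smul] at h
  exact h

theorem SInc.mul {s : ℤˣ} {f g : Obs (V → SpinPath β)} (hf : SInc s f) (hg : SInc s g)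
    (hf0 : ∀ σ, 0 ≤ f σ) (hg0 : ∀ σ, 0 ≤ g σ) : SInc s (f * g) := by
  have hc : ∀ {f : Obs (V → SpinPath β)}, SInc s f → SeqCont f := fun {f} hf => by
    have := hf.cont.smul (sgn s)
    rwa [smul_smul, sgn_mul_self, one_smul] at this
  refine ⟨((hc hf).mul (hc hg)).smul _, fun σ σ' h => ?_⟩
  have h1 := hf.mono σ σ' h
  have h2 := hg.mono σ σ' h
  simp only [Obs.smul_apply, Obs.mul_apply] at h1 h2 ⊢
  rcases sgn_eq_or s with hs | hs
  · rw [hs, one_mul, one_mul] at h1 h2 ⊢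
    exact mul_le_mul h1 h2 (hg0 _) (hf0 _)
  · rw [hs] at h1 h2 ⊢
    have := mul_le_mul (show f σ' ≤ f σ by linarith) (show g σ' ≤ g σ by linarith) (hg0 _) (hf0 _)
    linarith

theorem sInc_one (s : ℤˣ) : SInc s (1 : Obs (V → SpinPath β)) :=
  ⟨fun _ _ _ => by simp, fun _ _ _ => by simp⟩

/-- The indicator function of `σ t = s`, where `s` is a sign. -/
def signAt (s : ℤˣ) (t : Set.Icc (0 : ℝ) β) : Obs (SpinPath β) :=
  Obs.mk (fun σ => (1 + sgn s * σ t) / 2)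
    (((SpinPath.measurable_eval t).const_mul _).const_add _ |>.div_const _) 1 fun σ => by
      rcases sgn_eq_or s with h | h <;> rcases σ.eq_or t with h' | h' <;> rw [h, h'] <;> norm_num

theorem signAt_apply (s : ℤˣ) (t : Set.Icc (0 : ℝ) β) (σ : SpinPath β) :
    signAt s t σ = (1 + sgn s * σ t) / 2 := rfl

theorem signAt_eq_or (s : ℤˣ) (t : Set.Icc (0 : ℝ) β) (σ : SpinPath β) :
    (σ t = sgn s ∧ signAt s t σ = 1) ∨ (σ t ≠ sgn s ∧ signAt s t σ = 0) := by
  rw [signAt_apply]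
  rcases sgn_eq_or s with h | h <;> rcases σ.eq_or t with h' | h' <;> rw [h, h'] <;> norm_num

theorem sInc_signAt (s : ℤˣ) (t : Set.Icc (0 : ℝ) β) (y : V) : SInc s (Obs.site y (signAt s t)) := by
  refine ⟨fun σn σ h => ?_, fun σ σ' h => ?_⟩
  · simp only [Obs.smul_apply, Obs.site_apply, signAt_apply]
    exact ((((h y t).const_mul _).const_add _).div_const _).const_mul _
  · simp only [Obs.smul_apply, Obs.site_apply, signAt_apply]
    have := sgn_mul_self s
    have h1 : sgn s * ((1 + sgn s * σ y t) / 2) = (sgn s + sgn s * sgn s * σ y t) / 2 := by ring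
    have h2 : sgn s * ((1 + sgn s * σ' y t) / 2) = (sgn s + sgn s * sgn s * σ' y t) / 2 := by ring
    rw [h1, h2, this]
    linarith [h y t]

open Classical in
/-- The indicator function of the constant path. -/
def constInd (hβ : 0 ≤ β) (s : ℤˣ) : Obs (SpinPath β) :=
  Obs.mk (Set.indicator {SpinPath.const β s} fun _ => 1)
    (measurable_const.indicator (SpinPath.measurableSet_singleton hβ _)) 1 fun σ => by
      by_cases h : σ ∈ ({SpinPath.const β s} : Set (SpinPath β)) <;> simp [h]

theorem constInd_apply (hβ : 0 ≤ β) (s : ℤˣ) (σ : SpinPath β) [Decidable (σ = SpinPath.const β s)] :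
    constInd hβ s σ = if σ = SpinPath.const β s then 1 else 0 := by
  change Set.indicator {SpinPath.const β s} (fun _ => (1 : ℝ)) σ = _
  rw [Set.indicator_apply]
  simp

theorem constInd_nonneg (hβ : 0 ≤ β) (s : ℤˣ) (σ : SpinPath β) : 0 ≤ constInd hβ s σ := by
  classical
  rw [constInd_apply]
  split_ifs <;> norm_num

theorem constInd_self (hβ : 0 ≤ β) (s : ℤˣ) : constInd hβ s (SpinPath.const β s) = 1 := by
  classical
  rw [constInd_apply, if_pos rfl]

theorem constInd_of_ne (hβ : 0 ≤ β) {s : ℤˣ} {σ : SpinPath β} (h : σ ≠ SpinPath.const β s) :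
    constInd hβ s σ = 0 := by
  classical
  rw [constInd_apply, if_neg h]

theorem constInd_mul_self (hβ : 0 ≤ β) (s : ℤˣ) (σ : SpinPath β) :
    constInd hβ s σ * constInd hβ s σ = constInd hβ s σ := by
  classical
  rw [constInd_apply]
  split_ifs <;> norm_num

/-- The indicator function of the event that all spins in `T` agree with `s` at the first grid
points. -/
def gridInd (hβ : 0 ≤ β) (s : ℤˣ) (T : Finset V) (n : ℕ) : Obs (V → SpinPath β) :=
  ∏ p ∈ T ×ˢ (Finset.range n ×ˢ Finset.range n), Obs.site p.1 (signAt s (gridPt hβ p.2.1 p.2.2))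

theorem gridInd_mem (hβ : 0 ≤ β) (s : ℤˣ) (T : Finset V) (n : ℕ) (σ : V → SpinPath β) :
    0 ≤ gridInd hβ s T n σ ∧ gridInd hβ s T n σ ≤ 1 := by
  rw [gridInd, Obs.prod_apply]
  have h : ∀ p : V × ℕ × ℕ, 0 ≤ Obs.site p.1 (signAt s (gridPt hβ p.2.1 p.2.2)) σ ∧
      Obs.site p.1 (signAt s (gridPt hβ p.2.1 p.2.2)) σ ≤ 1 := fun p => by
    rw [Obs.site_apply]
    rcases signAt_eq_or s (gridPt hβ p.2.1 p.2.2) (σ p.1) with h | h <;> rw [h.2] <;> norm_num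
  exact ⟨Finset.prod_nonneg fun p _ => (h p).1,
    Finset.prod_le_one (fun p _ => (h p).1) fun p _ => (h p).2⟩

theorem sInc_gridInd (hβ : 0 ≤ β) (s : ℤˣ) (T : Finset V) (n : ℕ) :
    SInc s (gridInd hβ s T n) := by
  have h : SInc s (gridInd hβ s T n) ∧ ∀ σ, 0 ≤ gridInd hβ s T n σ := by
    refine Finset.prod_induction _ (fun f : Obs (V → SpinPath β) => SInc s f ∧ ∀ σ, 0 ≤ f σ) ?_ ?_ ?_
    · rintro f g ⟨hf, hf0⟩ ⟨hg, hg0⟩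
      exact ⟨hf.mul hg hf0 hg0, fun σ => mul_nonneg (hf0 σ) (hg0 σ)⟩
    · exact ⟨sInc_one s, fun σ => by simp⟩
    · refine fun p _ => ⟨sInc_signAt s _ _, fun σ => ?_⟩
      rw [Obs.site_apply]
      rcases signAt_eq_or s (gridPt hβ p.2.1 p.2.2) (σ p.1) with h | h <;> rw [h.2]
      exact zero_le_one
  exact h.1

/-- The indicator function of the constant configuration is not continuous, but it is a limit of
continuous monotone functions that look at more and more grid points. -/
theorem tendsto_gridInd (hβ : 0 ≤ β) (s : ℤˣ) (T : Finset V) (σ : V → SpinPath β) :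
    Tendsto (fun n => gridInd hβ s T n σ) atTop (𝓝 ((∏ y ∈ T, Obs.site y (constInd hβ s)) σ)) := by
  simp only [gridInd, Obs.prod_apply, Obs.site_apply]
  have hconst : ∀ t, SpinPath.const β s t = sgn s := fun _ => rfl
  by_cases h : ∀ y ∈ T, σ y = SpinPath.const β s
  · refine tendsto_const_nhds.congr fun n => ?_
    rw [Finset.prod_eq_one fun y hy => by rw [h y hy, constInd_self], Finset.prod_eq_one]
    intro p hp
    rw [h p.1 (Finset.mem_product.1 hp).1]
    exact ((signAt_eq_or s _ _).resolve_right fun h' => h'.1 (hconst _)).2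
  · push Not at h
    obtain ⟨y, hy, hne⟩ := h
    obtain ⟨m, k, hmk⟩ : ∃ m k, σ y (gridPt hβ m k) ≠ sgn s := by
      by_contra! hcon
      exact hne (SpinPath.eq_of_gridPt hβ fun m k => hcon m k)
    rw [Finset.prod_eq_zero hy (constInd_of_ne hβ hne)]
    refine tendsto_const_nhds.congr' ?_
    filter_upwards [eventually_gt_atTop (max m k)] with n hn
    rw [Finset.prod_eq_zero (i := (y, m, k))]
    · simp only [Finset.mem_product, Finset.mem_range]
      exact ⟨hy, (le_max_left _ _).trans_lt hn, (le_max_right _ _).trans_lt hn⟩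
    · exact ((signAt_eq_or s _ _).resolve_left fun h' => hmk h'.1).2

/-- Dominated convergence for conditional expectations. -/
theorem Spec.tendsto_E {S : Type*} [MeasurableSpace S] (M : Spec V S) (A : Finset V)
    {fn : ℕ → Obs (V → S)} {f : Obs (V → S)} {C : ℝ} (hC : ∀ n σ, |fn n σ| ≤ C)
    (hf : ∀ σ, Tendsto (fun n => fn n σ) atTop (𝓝 (f σ))) (ρ : V → S) :
    Tendsto (fun n => M.E A (fn n) ρ) atTop (𝓝 (M.E A f ρ)) := by
  simp only [E_apply]
  refine Tendsto.div_const ?_ _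
  simp only [avg_apply]
  refine tendsto_integral_of_dominated_convergence (fun _ => C * ‖M.w‖)
    (fun n => (M.integrable_piecewise A _ _).aestronglyMeasurable) (integrable_const _)
    (fun n => Eventually.of_forall fun σ => ?_) (Eventually.of_forall fun σ => ?_)
  · rw [Real.norm_eq_abs, Obs.mul_apply, abs_mul]
    exact mul_le_mul (hC n _) (M.w.abs_le_norm _) (abs_nonneg _) ((abs_nonneg _).trans (hC n ρ))
  · exact (hf _).mul_const _

namespace IsingData

variable {D : IsingData V β} {hlam : 0 ≤ lam}

theorem E_constInd_pos (D : IsingData V β) (hlam : 0 ≤ lam) {K : ℝ} (hK : D.FieldBound K) (s : ℤˣ)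
    (T : Finset V) (ρ : V → SpinPath β) :
    0 < (D.spec hlam).E T (∏ y ∈ T, Obs.site y (constInd D.hβ s)) ρ := by
  have hp := isProbabilityMeasure_freeSpin D.hβ hlam
  let F : Obs (V → SpinPath β) := ∏ y ∈ T, Obs.site y (constInd D.hβ s)
  have hF : ∀ σ, F σ = ∏ y ∈ T, constInd D.hβ s (σ y) := fun σ => by simp [F]
  have hF0 : ∀ σ, 0 ≤ F σ := fun σ => by
    rw [hF]
    exact Finset.prod_nonneg fun y _ => constInd_nonneg _ _ _
  have h1 := Spec.avg_le_E (M := D.spec hlam) hK.w_update_le (A := T) (ρ := ρ) (f := F) fun σ => hF0 _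
  refine pos_of_mul_pos_right (lt_of_lt_of_le ?_ h1) (Real.exp_pos _).le
  rw [Spec.avg_apply]
  have hset : MeasurableSet (Set.univ.pi fun _ : V => ({SpinPath.const β s} : Set (SpinPath β))) :=
    MeasurableSet.univ_pi fun _ => SpinPath.measurableSet_singleton D.hβ _
  have h2 : 0 < (D.spec hlam).ref.real (Set.univ.pi fun _ => {SpinPath.const β s}) := by
    change 0 < (Measure.pi fun _ : V => freeSpin β lam).real _
    rw [measureReal_def, Measure.pi_pi, ENNReal.toReal_prod]
    refine Finset.prod_pos fun y _ => ?_
    exact lt_of_lt_of_le (by positivity) (freeSpin_const_ge D.hβ hlam s)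
  refine h2.trans_le ?_
  rw [← integral_indicator_one hset]
  refine integral_mono ((integrable_const (1 : ℝ)).indicator hset)
    ((D.spec hlam).integrable_piecewise T F ρ) fun σ => ?_
  by_cases hσ : σ ∈ Set.univ.pi fun _ : V => ({SpinPath.const β s} : Set (SpinPath β))
  · rw [Set.indicator_of_mem hσ, hF, Finset.prod_eq_one]
    · simp
    · intro y hy
      have : σ y = SpinPath.const β s := by simpa using Set.mem_univ_pi.1 hσ y
      simp [hy, this, constInd_self]
  · rw [Set.indicator_of_notMem hσ]
    exact hF0 _

/-- The dynamics started from the constant configuration on `T` is dominated by the censored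
dynamics, in which only the spins in `R` are updated. -/
theorem P_le_of_const (D : IsingData V β) (hlam : 0 ≤ lam) {K : ℝ} (hK : D.FieldBound K) {s : ℤˣ}
    {R T : Finset V} (hRT : R ⊆ T) {t : ℝ} (ht : 0 ≤ t) {g : Obs (V → SpinPath β)} (hg : SInc s g)
    {ρ : V → SpinPath β} (hρ : ∀ y ∈ T, ρ y = SpinPath.const β s) :
    (D.spec hlam).P T t g ρ ≤ (D.spec hlam).P R t g ρ := by
  let M := D.spec hlam
  let F : Obs (V → SpinPath β) := ∏ y ∈ T, Obs.site y (constInd D.hβ s)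
  have hlim : ∀ u : Obs (V → SpinPath β),
      Tendsto (fun n => M.E T (gridInd D.hβ s T n * u) ρ) atTop (𝓝 (M.E T (F * u) ρ)) := by
    intro u
    refine M.tendsto_E T (C := ‖u‖) (fun n σ => ?_) (fun σ => ?_) ρ
    · rw [Obs.mul_apply, abs_mul, abs_of_nonneg (gridInd_mem _ _ _ _ _).1]
      exact (mul_le_of_le_one_left (abs_nonneg _) (gridInd_mem _ _ _ _ _).2).trans (u.abs_le_norm σ)
    · simp only [Obs.mul_apply]
      exact (tendsto_gridInd D.hβ s T σ).mul_const _
  have hval : ∀ u : Obs (V → SpinPath β), M.E T (F * u) ρ = u ρ * M.E T F ρ := by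
    intro u
    have : M.E T (F * u) ρ = M.E T (u ρ • F) ρ := by
      refine M.E_congr fun σ => ?_
      rw [Obs.mul_apply, Obs.smul_apply, mul_comm]
      by_cases hσ : ∀ y ∈ T, σ y = SpinPath.const β s
      · have : T.piecewise σ ρ = ρ := by
          funext y
          by_cases hy : y ∈ T
          · simp [hy, hσ y hy, hρ y hy]
          · simp [hy]
        rw [this]
      · push Not at hσ
        obtain ⟨y, hy, hne⟩ := hσ
        have : F (T.piecewise σ ρ) = 0 := by
          simp only [F, Obs.prod_apply]
          refine Finset.prod_eq_zero hy ?_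
          rw [Obs.site_apply, Finset.piecewise_eq_of_mem _ _ _ hy, constInd_of_ne D.hβ hne]
        rw [this, mul_zero, mul_zero]
    rw [this, map_smul, Obs.smul_apply]
  -- Censoring for the monotone approximations of the indicator function `F`, which is the density
  -- of the point mass at `ρ` up to normalization.
  have hle := le_of_tendsto_of_tendsto' (hlim (M.P T t g)) (hlim (M.P R t g)) fun n =>
    M.censoring hRT (C := {f | SInc s f}) (fun A t ht f hf => hf.P (D.ferro hlam) A ht)
      (fun x f hf g hg σ => hf.cov (D.ferro hlam) {x} hg σ) ht (sInc_gridInd D.hβ s T n) hg ρ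
  rw [hval, hval] at hle
  exact le_of_mul_le_mul_right hle (D.E_constInd_pos hlam hK s T ρ)

/-- The constant path has a conditional probability bounded below, uniformly in the boundary
condition. -/
theorem E_constInd_single_ge (D : IsingData V β) (hlam : 0 ≤ lam) {K : ℝ} (hK : D.FieldBound K)
    (s : ℤˣ) {T : Finset V} {x : V} (hx : x ∈ T) (ρ : V → SpinPath β) :
    Real.exp (-(4 * K)) * (Real.exp (-(lam * β)) / 2) ≤
      (D.spec hlam).E T (Obs.site x (constInd D.hβ s)) ρ := by
  have hp := isProbabilityMeasure_freeSpin D.hβ hlam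
  rw [← (D.spec hlam).E_E (Finset.singleton_subset_iff.2 hx)]
  refine (D.spec hlam).const_le_E fun σ => ?_
  have h1 := Spec.avg_le_E (M := D.spec hlam) hK.w_update_le (A := {x}) (ρ := T.piecewise σ ρ)
    (f := Obs.site x (constInd D.hβ s)) fun σ => constInd_nonneg D.hβ _ _
  have h2 : (D.spec hlam).avg {x} (Obs.site x (constInd D.hβ s)) (T.piecewise σ ρ) =
      (freeSpin β lam).real {SpinPath.const β s} := by
    rw [Spec.avg_apply]
    simp only [Obs.site_apply, Finset.piecewise_singleton, Function.update_self]
    have hmp := measurePreserving_eval (fun _ : V => freeSpin β lam) x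
    change ∫ σ : V → SpinPath β, constInd D.hβ s (Function.eval x σ)
      ∂(Measure.pi fun _ : V => freeSpin β lam) = _
    rw [← integral_map hmp.measurable.aemeasurable
      (constInd D.hβ s).measurable.aestronglyMeasurable, hmp.map_eq]
    exact integral_indicator_one (SpinPath.measurableSet_singleton D.hβ _)
  rw [h2, Finset.card_singleton] at h1
  have h3 := (freeSpin_const_ge D.hβ hlam s).trans h1
  rw [Real.exp_neg, ← div_eq_inv_mul, div_le_iff₀ (Real.exp_pos _)]
  have h4 : Real.exp (4 * K) = Real.exp (2 * (2 * K) * (1 : ℕ)) := by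
    congr 1
    push_cast
    ring
  rw [h4]
  linarith

end IsingData

end Sign

/-! ### Domination of the dynamics started from a constant configuration by a bounded density -/

section StartDensity

variable {b l : ℕ} {β lam : ℝ} {D : IsingData (TreeVertex b l) β} {hlam : 0 ≤ lam}

/-- The spin of the parent of `x`, if `x` is not the root, is constant equal to `s`. -/
def ParentConst (s : ℤˣ) (x : TreeVertex b l) (ρ : TreeVertex b l → SpinPath β) : Prop :=
  ∀ p, IsChild x p → ρ p = SpinPath.const β s

/-- `k` is a probability density on the subtree at `x`, with second moment at most `2`, such that
the dynamics on this subtree, started from the constant configuration `s`, is at time `t` dominated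
by `k` on monotone observables, provided that the spin of the parent of `x` is `s` too. -/
structure StartDensity (D : IsingData (TreeVertex b l) β) (hlam : 0 ≤ lam) (s : ℤˣ)
    (x : TreeVertex b l) (t : ℝ) (k : Obs (TreeVertex b l → SpinPath β)) : Prop where
  nonneg : ∀ σ, 0 ≤ k σ
  free : ∀ B : Finset (TreeVertex b l), Disjoint (desc x) B → (∀ p, IsChild x p → p ∉ B) →
    Spec.FreeOf B k
  mean : ∀ ρ, ParentConst s x ρ → (D.spec hlam).E (desc x) k ρ = 1
  sq : ∀ ρ, ParentConst s x ρ → (D.spec hlam).E (desc x) (k * k) ρ ≤ 2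
  dom : ∀ ρ, (∀ y ∈ desc x, ρ y = SpinPath.const β s) → ParentConst s x ρ → ∀ f, SInc s f →
    (D.spec hlam).P (desc x) t f ρ ≤ (D.spec hlam).E (desc x) (k * f) ρ

theorem disjoint_desc_biUnion {x a : TreeVertex b l} {S : Finset (TreeVertex b l)}
    (ha : a ∈ level x 1) (hS : S ⊆ level x 1) (haS : a ∉ S) : Disjoint (desc a) (S.biUnion desc) := by
  rw [Finset.disjoint_biUnion_right]
  exact fun c hc => pairwiseDisjoint_desc x 1 ha (hS hc) fun h => haS (h ▸ hc)

theorem sep_desc_biUnion (hG : D.G = treeGraph b (tree b l)) {x a : TreeVertex b l}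
    {S : Finset (TreeVertex b l)} (ha : a ∈ level x 1) (hS : S ⊆ level x 1) (haS : a ∉ S) :
    (D.spec hlam).Sep (desc a) (S.biUnion desc) := by
  refine sep_desc hlam hG (disjoint_desc_biUnion ha hS haS) fun p hp h => ?_
  rw [Finset.mem_biUnion] at h
  obtain ⟨c, hc, h⟩ := h
  have h1 := length_le_of_mem_desc h
  have h2 := hp.length
  have h3 := (mem_level.1 ha).2
  have h4 := (mem_level.1 (hS hc)).2
  omega

theorem parent_notMem_desc {x a c : TreeVertex b l} (ha : a ∈ level x 1) (hc : c ∈ level x 1)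
    {p : TreeVertex b l} (hp : IsChild a p) : p ∉ desc c := fun h => by
  have h1 := length_le_of_mem_desc h
  have h2 := hp.length
  have h3 := (mem_level.1 ha).2
  have h4 := (mem_level.1 hc).2
  omega

/-- Expectations of products factorize over the subtrees at the children of `x`. -/
theorem E_biUnion_prod (hG : D.G = treeGraph b (tree b l)) {x : TreeVertex b l}
    {S : Finset (TreeVertex b l)} (hS : S ⊆ level x 1)
    {q : TreeVertex b l → Obs (TreeVertex b l → SpinPath β)}
    (hq : ∀ c ∈ S, ∀ B, Disjoint (desc c) B → (∀ p, IsChild c p → p ∉ B) → Spec.FreeOf B (q c)) :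
    (D.spec hlam).E (S.biUnion desc) (∏ c ∈ S, q c) = ∏ c ∈ S, (D.spec hlam).E (desc c) (q c) := by
  induction S using Finset.induction_on with
  | empty => simp
  | insert a S ha ih =>
    have hS' : S ⊆ level x 1 := (Finset.subset_insert a S).trans hS
    have haL : a ∈ level x 1 := hS (Finset.mem_insert_self a S)
    have hsep := sep_desc_biUnion (hlam := hlam) hG haL hS' ha
    rw [Finset.prod_insert ha, Finset.prod_insert ha, Finset.biUnion_insert, ← hsep.E_E,
      Spec.E_mul_left, ih hS' fun c hc => hq c (Finset.mem_insert_of_mem hc), mul_comm,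
      Spec.E_mul_left, mul_comm]
    · rw [← ih hS' fun c hc => hq c (Finset.mem_insert_of_mem hc)]
      refine hsep.symm.freeOf_E (Spec.FreeOf.prod fun c hc => ?_)
      refine hq c (Finset.mem_insert_of_mem hc) _ ?_ fun p hp => parent_notMem_desc (hS' hc) haL hp
      exact pairwiseDisjoint_desc x 1 (hS' hc) haL fun h => ha (h ▸ hc)
    · refine hq a (Finset.mem_insert_self a S) _ (disjoint_desc_biUnion haL hS' ha) fun p hp h => ?_
      rw [Finset.mem_biUnion] at h
      obtain ⟨c, hc, h⟩ := h
      exact parent_notMem_desc haL (hS' hc) hp h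

/-- Domination over the subtrees at several children of `x`. -/
theorem P_biUnion_le (hG : D.G = treeGraph b (tree b l)) {x : TreeVertex b l} {s : ℤˣ} {t : ℝ}
    (ht : 0 ≤ t) {S : Finset (TreeVertex b l)} (hS : S ⊆ level x 1)
    {k : TreeVertex b l → Obs (TreeVertex b l → SpinPath β)}
    (hk : ∀ c ∈ S, StartDensity D hlam s c t (k c)) {ρ : TreeVertex b l → SpinPath β}
    (hρ : ∀ y ∈ desc x, ρ y = SpinPath.const β s) {f : Obs (TreeVertex b l → SpinPath β)}
    (hf : SInc s f) : (D.spec hlam).P (S.biUnion desc) t f ρ ≤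
      (D.spec hlam).E (S.biUnion desc) ((∏ c ∈ S, k c) * f) ρ := by
  -- The configuration is only required to be constant on the subtrees in `S` and at `x`.
  have main : ∀ S ⊆ level x 1, (∀ c ∈ S, StartDensity D hlam s c t (k c)) →
      ∀ ρ : TreeVertex b l → SpinPath β, ρ x = SpinPath.const β s →
      (∀ c ∈ S, ∀ y ∈ desc c, ρ y = SpinPath.const β s) → ∀ f, SInc s f →
      (D.spec hlam).P (S.biUnion desc) t f ρ ≤
        (D.spec hlam).E (S.biUnion desc) ((∏ c ∈ S, k c) * f) ρ := by
    clear hρ hf hk hS f ρ S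
    intro S
    induction S using Finset.induction_on with
    | empty =>
      intro _ _ ρ _ _ f _
      have : (D.spec hlam).P (∅ : Finset (TreeVertex b l)) t f = f :=
        (D.spec hlam).P_of_freeOf (fun ρ σ h => by rw [funext fun i => h i (by simp)]) t
      simp [this]
    | insert a S ha ih =>
      intro hS hk ρ hx hρ f hf
      have hS' : S ⊆ level x 1 := (Finset.subset_insert a S).trans hS
      have haL : a ∈ level x 1 := hS (Finset.mem_insert_self a S)
      have hsep := sep_desc_biUnion (hlam := hlam) hG haL hS' ha
      have hka := hk a (Finset.mem_insert_self a S)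
      have hpar : ParentConst s a ρ := fun p hp => by
        rw [← (mem_level_one.1 haL).unique hp]
        exact hx
      have hfree : Spec.FreeOf (S.biUnion desc) (k a) := by
        refine hka.free _ (disjoint_desc_biUnion haL hS' ha) fun p hp h => ?_
        rw [Finset.mem_biUnion] at h
        obtain ⟨c, hc, h⟩ := h
        exact parent_notMem_desc haL (hS' hc) hp h
      rw [Finset.biUnion_insert, Spec.P_union _ hsep.1 fun y hy z hz =>
        hsep.mono (Finset.singleton_subset_iff.2 hy) (Finset.singleton_subset_iff.2 hz)]
      refine (hka.dom ρ (hρ a (Finset.mem_insert_self a S)) hpar _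
        (hf.P (D.ferro hlam) _ ht)).trans ?_
      rw [← hsep.E_E, Finset.prod_insert ha, mul_assoc, Spec.E_mul_left _ hfree]
      refine (D.spec hlam).E_mono fun σ => ?_
      rw [Obs.mul_apply, Obs.mul_apply]
      refine mul_le_mul_of_nonneg_left ?_ (hka.nonneg _)
      refine ih hS' (fun c hc => hk c (Finset.mem_insert_of_mem hc)) _ ?_ (fun c hc y hy => ?_) f hf
      · have : x ∉ desc a := fun h => by
          have h1 := length_le_of_mem_desc h
          have h2 := (mem_level.1 haL).2
          omega
        rw [Finset.piecewise_eq_of_notMem _ _ _ this]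
        exact hx
      · have : y ∉ desc a := fun h => Finset.disjoint_left.1
          (pairwiseDisjoint_desc x 1 haL (hS' hc) fun h => ha (h ▸ hc)) h hy
        rw [Finset.piecewise_eq_of_notMem _ _ _ this]
        exact hρ c (Finset.mem_insert_of_mem hc) y hy
  exact main S hS hk ρ (hρ x (self_mem_desc x))
    (fun c hc y hy => hρ y (desc_subset (mem_level.1 (hS hc)).1 hy)) f hf

/-- A lower bound for the conditional probability of the constant path. -/
def constProb (β lam K : ℝ) : ℝ := Real.exp (-(4 * K)) * (Real.exp (-(lam * β)) / 2)

theorem constProb_pos (β lam K : ℝ) : 0 < constProb β lam K := by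
  unfold constProb
  positivity

/-- Each generation of the tree costs a bounded time: in this time the equilibration of the subtree
compensates the increase of the second moment of the density that comes from conditioning the spin at
`x` to be constant and from multiplying the densities on the subtrees at the children of `x`. -/
theorem exists_startDensity (hG : D.G = treeGraph b (tree b l)) {K : ℝ} (hK : D.FieldBound K)
    {C : ℝ} (hC : 0 < C) (hgap : ∀ x f ρ, (D.spec hlam).Var (desc x) f ρ ≤
      C * ∑ y ∈ desc x, (D.spec hlam).E (desc x) ((D.spec hlam).Var {y} f) ρ) {s' : ℝ} (hs0 : 0 ≤ s')
    (hs' : Real.exp (-(2 * s' / C)) * (2 ^ b / constProb β lam K) ≤ 1) (s : ℤˣ) (N : ℕ)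
    (x : TreeVertex b l) (hN : l < x.1.length + N) :
    ∃ k, StartDensity D hlam s x (N * s') k := by
  induction N generalizing x with
  | zero => exact absurd (mem_tree.1 x.2) (by omega)
  | succ N ih =>
    classical
    let M := D.spec hlam
    have hch : ∀ c : TreeVertex b l, c ∈ level x 1 → ∃ k, StartDensity D hlam s c (N * s') k :=
      fun c hc => ih c (by have := (mem_level.1 hc).2; omega)
    choose! k hk using hch
    let kp : Obs (TreeVertex b l → SpinPath β) := ∏ c ∈ level x 1, k c
    let J : Obs (TreeVertex b l → SpinPath β) := Obs.site x (constInd D.hβ s)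
    let p : ℝ := M.E (desc x) J fun _ => SpinPath.const β s
    have hp : constProb β lam K ≤ p := D.E_constInd_single_ge hlam hK s (self_mem_desc x) _
    have hp0 : 0 < p := (constProb_pos β lam K).trans_le hp
    -- The product of the densities on the subtrees at the children, on the event that the spin at
    -- `x` is constant. Its second moment may be as large as `2 ^ b / p`; the dynamics during time
    -- `s'` reduces its variance to at most `1`, hence its second moment to at most `2`.
    let k₀ : Obs (TreeVertex b l → SpinPath β) := p⁻¹ • (J * kp)
    have h_kp0 : ∀ σ, 0 ≤ kp σ := fun σ => by
      simp only [kp, Obs.prod_apply]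
      exact Finset.prod_nonneg fun c hc => (hk c hc).nonneg σ
    have hJ0 : ∀ σ, 0 ≤ J σ := fun σ => constInd_nonneg D.hβ s _
    have hk0 : ∀ σ, 0 ≤ k₀ σ := fun σ => by
      simp only [k₀, Obs.smul_apply, Obs.mul_apply]
      exact mul_nonneg (inv_nonneg.2 hp0.le) (mul_nonneg (hJ0 σ) (h_kp0 σ))
    have hJfree : ∀ B : Finset (TreeVertex b l), x ∉ B → Spec.FreeOf B J := fun B hB ρ σ h => by
      simp only [J, Obs.site_apply]
      rw [h x hB]
    have hfree0 : ∀ B : Finset (TreeVertex b l), Disjoint (desc x) B →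
        (∀ p, IsChild x p → p ∉ B) → Spec.FreeOf B k₀ := by
      intro B hB hpB
      have hxB : x ∉ B := Finset.disjoint_left.1 hB (self_mem_desc x)
      refine ((hJfree B hxB).mul (Spec.FreeOf.prod fun c hc => ?_)).smul _
      refine (hk c hc).free B (Finset.disjoint_of_subset_left (desc_subset (mem_level.1 hc).1) hB)
        fun q hq => ?_
      rwa [← (mem_level_one.1 hc).unique hq]
    have hpar : ∀ ρ : TreeVertex b l → SpinPath β, ρ x = SpinPath.const β s →
        ∀ c ∈ level x 1, ParentConst s c ρ := fun ρ hρ c hc q hq => by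
      rw [← (mem_level_one.1 hc).unique hq]
      exact hρ
    -- Conditioning on the spin at `x`.
    have hcond : ∀ (F : Obs (TreeVertex b l → SpinPath β)) (ρ : TreeVertex b l → SpinPath β),
        M.E (desc x) (J * F) ρ = M.E (desc x) (J * M.E (pdesc x) F) ρ := by
      intro F ρ
      rw [← M.E_E (pdesc_subset x), M.E_mul_left (hJfree _ (self_notMem_pdesc x))]
    have hJp : ∀ ρ, ParentConst s x ρ → M.E (desc x) J ρ = p := by
      intro ρ hρ
      let B : Finset (TreeVertex b l) := Finset.univ.filter fun y => y ∉ desc x ∧ ¬ IsChild x y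
      have hB : Disjoint (desc x) B := Finset.disjoint_left.2 fun y hy h =>
        (Finset.mem_filter.1 h).2.1 hy
      have hsep : M.Sep (desc x) B := sep_desc hlam hG hB fun q hq h =>
        (Finset.mem_filter.1 h).2.2 hq
      have h1 : Spec.FreeOf (desc x ∪ B) (M.E (desc x) J) := (M.freeOf_E _ J).union
        (hsep.freeOf_E (hJfree B (Finset.disjoint_left.1 hB (self_mem_desc x))))
      refine h1 _ _ fun y hy => hρ y ?_
      by_contra hne
      refine hy (Finset.mem_union.2 ?_)
      by_cases hyx : y ∈ desc x
      · exact Or.inl hyx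
      · exact Or.inr (Finset.mem_filter.2 ⟨Finset.mem_univ _, hyx, hne⟩)
    have hJc : ∀ (F : Obs (TreeVertex b l → SpinPath β)) (a : ℝ) (ρ : TreeVertex b l → SpinPath β),
        ParentConst s x ρ → (∀ σ : TreeVertex b l → SpinPath β, σ x = SpinPath.const β s →
          M.E (pdesc x) F ((desc x).piecewise σ ρ) ≤ a) → M.E (desc x) (J * F) ρ ≤ p * a := by
      intro F a ρ hρ hF
      rw [hcond]
      have : M.E (desc x) (J * M.E (pdesc x) F) ρ ≤ M.E (desc x) (a • J) ρ := by
        refine M.E_mono fun σ => ?_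
        rw [Obs.mul_apply, Obs.smul_apply, mul_comm a]
        by_cases hσ : σ x = SpinPath.const β s
        · exact mul_le_mul_of_nonneg_left (hF σ hσ) (hJ0 _)
        · have : J ((desc x).piecewise σ ρ) = 0 := by
            simp only [J, Obs.site_apply]
            rw [Finset.piecewise_eq_of_mem _ _ _ (self_mem_desc x), constInd_of_ne D.hβ hσ]
          rw [this, zero_mul, zero_mul]
      refine this.trans_eq ?_
      rw [map_smul, Obs.smul_apply, hJp ρ hρ, mul_comm]
    have hpwx : ∀ σ ρ : TreeVertex b l → SpinPath β, σ x = SpinPath.const β s →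
        (desc x).piecewise σ ρ x = SpinPath.const β s := fun σ ρ h => by
      rw [Finset.piecewise_eq_of_mem _ _ _ (self_mem_desc x), h]
    have hmean_kp : ∀ ρ : TreeVertex b l → SpinPath β, ρ x = SpinPath.const β s →
        M.E (pdesc x) kp ρ = 1 := by
      intro ρ hρ
      rw [pdesc_eq_biUnion, E_biUnion_prod hG subset_rfl fun c hc => (hk c hc).free, Obs.prod_apply]
      exact Finset.prod_eq_one fun c hc => (hk c hc).mean ρ (hpar ρ hρ c hc)
    have hsq_kp : ∀ ρ : TreeVertex b l → SpinPath β, ρ x = SpinPath.const β s →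
        M.E (pdesc x) (kp * kp) ρ ≤ 2 ^ b := by
      intro ρ hρ
      have : kp * kp = ∏ c ∈ level x 1, k c * k c := Finset.prod_mul_distrib.symm
      rw [this, pdesc_eq_biUnion, E_biUnion_prod hG subset_rfl fun c hc B h1 h2 =>
        ((hk c hc).free B h1 h2).mul ((hk c hc).free B h1 h2), Obs.prod_apply]
      refine (Finset.prod_le_prod (fun c _ => ?_) fun c hc => (hk c hc).sq ρ (hpar ρ hρ c hc)).trans ?_
      · exact M.E_nonneg fun σ => mul_self_nonneg _
      · rw [Finset.prod_const]
        refine pow_le_pow_right₀ one_le_two ?_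
        simpa using card_level_le x 1
    have hmean0 : ∀ ρ, ParentConst s x ρ → M.E (desc x) k₀ ρ = 1 := by
      intro ρ hρ
      have h1 : M.E (desc x) (J * kp) ρ ≤ p * 1 :=
        hJc kp 1 ρ hρ fun σ hσ => (hmean_kp _ (hpwx σ ρ hσ)).le
      have h2 : M.E (desc x) (J * -kp) ρ ≤ p * (-1) := hJc (-kp) (-1) ρ hρ fun σ hσ => by
        rw [map_neg, Obs.neg_apply, hmean_kp _ (hpwx σ ρ hσ)]
      rw [mul_neg, map_neg, Obs.neg_apply] at h2
      rw [map_smul, Obs.smul_apply, le_antisymm (by linarith) (by linarith : p ≤ M.E (desc x) (J * kp) ρ),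
        inv_mul_cancel₀ hp0.ne']
    have hsq0 : ∀ ρ, ParentConst s x ρ → M.E (desc x) (k₀ * k₀) ρ ≤ 2 ^ b / constProb β lam K := by
      intro ρ hρ
      have h1 : k₀ * k₀ = (p⁻¹ * p⁻¹) • (J * (kp * kp)) := by
        ext σ
        simp only [k₀, Obs.smul_apply, Obs.mul_apply]
        have : J σ * J σ = J σ := constInd_mul_self D.hβ s _
        linear_combination (p⁻¹ * p⁻¹ * kp σ * kp σ) * this
      rw [h1, map_smul, Obs.smul_apply]
      have h2 := hJc (kp * kp) (2 ^ b) ρ hρ fun σ hσ => hsq_kp _ (hpwx σ ρ hσ)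
      have h3 := mul_le_mul_of_nonneg_left h2 (mul_nonneg (inv_nonneg.2 hp0.le) (inv_nonneg.2 hp0.le))
      refine h3.trans ?_
      have h4 : p⁻¹ * p⁻¹ * (p * 2 ^ b) = 2 ^ b / p := by
        field_simp
      rw [h4]
      exact div_le_div_of_nonneg_left (by positivity) (constProb_pos β lam K) hp
    refine ⟨M.P (desc x) s' k₀, ⟨M.P_nonneg hs0 hk0, fun B hB hpB => ?_, fun ρ hρ => ?_,
      fun ρ hρ => ?_, fun ρ hρ hρ' f hf => ?_⟩⟩
    · exact M.freeOf_P (fun y hy => (sep_desc hlam hG hB hpB).mono (Finset.singleton_subset_iff.2 hy)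
        subset_rfl) hs0 (hfree0 B hB hpB)
    · change M.E (desc x) (M.P (desc x) s' k₀) ρ = 1
      rw [M.E_P subset_rfl, hmean0 ρ hρ]
    · change M.E (desc x) (M.P (desc x) s' k₀ * M.P (desc x) s' k₀) ρ ≤ 2
      have h1 := M.Var_P_le hC (fun f => hgap x f ρ) hs0 k₀
      have h2 : M.Var (desc x) k₀ ρ ≤ 2 ^ b / constProb β lam K := by
        refine le_trans ?_ (hsq0 ρ hρ)
        rw [Spec.Var, Obs.sub_apply, Obs.mul_apply]
        linarith [mul_self_nonneg (M.E (desc x) k₀ ρ)]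
      have h3 := h1.trans (mul_le_mul_of_nonneg_left h2 (Real.exp_pos _).le)
      rw [Spec.Var, M.E_P subset_rfl, Obs.sub_apply, Obs.mul_apply, hmean0 ρ hρ] at h3
      linarith
    · have ht : (0 : ℝ) ≤ N * s' := by positivity
      have hx := hρ x (self_mem_desc x)
      change M.P (desc x) _ f ρ ≤ M.E (desc x) (M.P (desc x) s' k₀ * f) ρ
      have h1 : ((N + 1 : ℕ) : ℝ) * s' = N * s' + s' := by push_cast; ring
      rw [h1, M.P_add]
      have hg : SInc s (M.P (desc x) s' f) := hf.P (D.ferro hlam) _ hs0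
      -- Updates at `x` are censored, the subtrees at the children are treated by induction, and
      -- reversibility moves the remaining time `s'` to the density.
      refine (D.P_le_of_const hlam hK (pdesc_subset x) ht hg hρ).trans ?_
      have h2 := P_biUnion_le (hlam := hlam) hG ht subset_rfl hk hρ hg
      rw [← pdesc_eq_biUnion] at h2
      refine h2.trans ?_
      have h3 : M.E (desc x) (M.P (desc x) s' k₀ * f) ρ = M.E (desc x) (k₀ * M.P (desc x) s' f) ρ := by
        rw [M.P_symm subset_rfl]
      rw [h3]
      have h4 : k₀ * M.P (desc x) s' f = p⁻¹ • (J * (kp * M.P (desc x) s' f)) := by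
        simp only [k₀, smul_mul_assoc, mul_assoc]
      rw [h4, map_smul, Obs.smul_apply]
      let a := M.E (pdesc x) (kp * M.P (desc x) s' f) ρ
      have h5 : M.E (desc x) (J * -(kp * M.P (desc x) s' f)) ρ ≤ p * (-a) := by
        refine hJc _ _ ρ hρ' fun σ hσ => ?_
        rw [map_neg, Obs.neg_apply]
        refine le_of_eq (congrArg _ (M.freeOf_E _ _ _ _ fun y hy => ?_))
        by_cases hyx : y = x
        · subst hyx; rw [hpwx σ ρ hσ, hx]
        · have : y ∉ desc x := fun h => hy (mem_pdesc.2 ⟨hyx, h⟩)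
          simp [this]
      rw [mul_neg, map_neg, Obs.neg_apply] at h5
      change a ≤ _
      rw [← div_eq_inv_mul, le_div_iff₀ hp0]
      linarith

end StartDensity

/-! ### Smoothing by the dynamics -/

section Smoothing

variable {V : Type*} [Fintype V] [DecidableEq V] {β lam : ℝ}

theorem hasSum_exp_real (x : ℝ) : HasSum (fun k : ℕ => x ^ k / k.factorial) (Real.exp x) := by
  rw [Real.exp_eq_exp_ℝ]
  exact NormedSpace.expSeries_div_hasSum_exp x

theorem hasSum_mul_exp (x : ℝ) :
    HasSum (fun k : ℕ => (k : ℝ) * (x ^ k / k.factorial)) (x * Real.exp x) := by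
  rw [← hasSum_nat_add_iff' 1]
  simp only [Finset.range_one, Finset.sum_singleton, Nat.cast_zero, zero_mul, sub_zero]
  refine ((hasSum_exp_real x).mul_left x).congr_fun fun k => ?_
  have : ((k + 1).factorial : ℝ) = (k + 1) * k.factorial := by exact_mod_cast Nat.factorial_succ k
  rw [this]
  have h1 : ((k : ℝ) + 1) ≠ 0 := by positivity
  have h2 : (k.factorial : ℝ) ≠ 0 := by positivity
  push_cast
  field_simp
  ring

namespace IsingData

variable (D : IsingData V β) (hlam : 0 ≤ lam)

/-- The dependence on the spin at `y` after an update at `x ≠ y`: the old dependence `δ`, and the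
dependence of the updated spin, which is Lipschitz in the field. -/
theorem E_single_sub_le {x y : V} {g : Obs (V → SpinPath β)} {B δ : ℝ} (hB : ∀ σ, |g σ| ≤ B)
    {ρ η : V → SpinPath β} (hρ : ∀ v, v ≠ y → ρ v = η v)
    (hg : ∀ ρ' η' : V → SpinPath β, (∀ v, v ≠ y → ρ' v = η' v) → ρ' y = ρ y → η' y = η y →
      g ρ' - g η' ≤ δ) (hxy : x ≠ y) :
    (D.spec hlam).E {x} g ρ - (D.spec hlam).E {x} g η ≤ δ + 8 * B * pathDist (ρ y) (η y) := by
  classical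
  let M := D.spec hlam
  let g' := Spec.freeze {x} η g
  have hB0 : 0 ≤ B := (abs_nonneg _).trans (hB ρ)
  have hx : ∀ σ ρ : V → SpinPath β,
      ({x} : Finset V).piecewise σ ρ = Function.update ρ x (σ x) := fun σ ρ =>
    Finset.piecewise_singleton σ ρ x
  have h1 : M.E {x} g η = M.E {x} g' η := M.E_congr fun σ => by
    change g _ = g _
    simp only [hx, Function.update_self]
  have h2 : M.E {x} g ρ ≤ M.E {x} (g' + δ • 1) ρ := M.E_mono fun σ => by
    have : g' (({x} : Finset V).piecewise σ ρ) = g (Function.update η x (σ x)) := by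
      change g _ = g _
      simp only [hx, Function.update_self]
    rw [Obs.add_apply, this, Obs.smul_apply, Obs.one_apply, mul_one, Finset.piecewise_singleton]
    have := hg (Function.update ρ x (σ x)) (Function.update η x (σ x)) (fun v hv => by
      by_cases hvx : v = x
      · subst hvx; simp
      · simp [hvx, hρ v hv]) (by simp [hxy.symm]) (by simp [hxy.symm])
    linarith
  rw [map_add, map_smul, Spec.E_one, Obs.add_apply, Obs.smul_apply, Obs.one_apply, mul_one] at h2
  have h3 := (abs_le.1 (D.abs_E_sub_E_le hlam {x} g' (ρ := ρ) (η := η) (a := -B) (b := B)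
    (fun σ => by
      change g _ = g _
      simp only [hx, Function.update_self]) (fun σ => (abs_le.1 (hB _)).1) fun σ => (abs_le.1 (hB _)).2)).2
  have h4 : ∑ i ∈ ({x} : Finset V), ∑ j ∈ ({x} : Finset V)ᶜ,
      (if D.G.Adj i j then pathDist (ρ j) (η j) else 0) ≤ pathDist (ρ y) (η y) := by
    rw [Finset.sum_singleton, Finset.sum_eq_single_of_mem y (by simpa using hxy.symm)]
    · split_ifs
      · exact le_rfl
      · exact pathDist_nonneg _ _
    · intro j _ hj
      rw [hρ j hj, pathDist_self]
      simp
  have h5 := mul_le_mul_of_nonneg_right h4 hB0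
  change M.E {x} g ρ - M.E {x} g η ≤ _
  change M.E {x} g' ρ - M.E {x} g' η ≤ _ at h3
  rw [h1]
  linarith

theorem abs_resample_pow_le (f : Obs (V → SpinPath β)) (hf : ∀ σ, |f σ| ≤ 1) (k : ℕ)
    (ρ : V → SpinPath β) :
    |(((D.spec hlam).resample Finset.univ) ^ k) f ρ| ≤ (Fintype.card V : ℝ) ^ k := by
  induction k generalizing ρ with
  | zero => simpa using hf ρ
  | succ k ih =>
    rw [pow_succ', mul_apply_eq_comp, Spec.resample_apply, Obs.sum_apply]
    refine (Finset.abs_sum_le_sum_abs _ _).trans ((Finset.sum_le_card_nsmul _ _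
      ((Fintype.card V : ℝ) ^ k) fun x _ => ?_).trans_eq ?_)
    · exact abs_le.2 ⟨(D.spec hlam).const_le_E fun σ => (abs_le.1 (ih _)).1,
        (D.spec hlam).E_le_const fun σ => (abs_le.1 (ih _)).2⟩
    · rw [nsmul_eq_mul, Finset.card_univ, pow_succ']

/-- After `k` updates at random vertices, the dependence on the initial spin at `y` is Lipschitz,
except if `y` has not been updated. -/
theorem resample_pow_sub_le (f : Obs (V → SpinPath β)) (hf : ∀ σ, |f σ| ≤ 1) (k : ℕ) (y : V)
    {ρ η : V → SpinPath β} (hρ : ∀ v, v ≠ y → ρ v = η v) :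
    (((D.spec hlam).resample Finset.univ) ^ k) f ρ - (((D.spec hlam).resample Finset.univ) ^ k) f η ≤
      8 * pathDist (ρ y) (η y) * (k * (Fintype.card V : ℝ) ^ k) +
        2 * ((Fintype.card V : ℝ) - 1) ^ k := by
  have hn1 : (1 : ℝ) ≤ Fintype.card V := by
    have : 0 < Fintype.card V := Fintype.card_pos_iff.2 ⟨y⟩
    exact_mod_cast this
  induction k generalizing ρ η with
  | zero =>
    have h1 := (abs_le.1 (hf ρ)).2
    have h2 := (abs_le.1 (hf η)).1
    simp only [pow_zero, CharP.cast_eq_zero, mul_zero, zero_add, mul_one]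
    change f ρ - f η ≤ 2
    linarith
  | succ k ih =>
    let M := D.spec hlam
    set n : ℝ := ((Fintype.card V : ℕ) : ℝ) with hn
    have hpd := pathDist_nonneg (ρ y) (η y)
    rw [pow_succ', mul_apply_eq_comp, Spec.resample_apply, Obs.sum_apply, Obs.sum_apply,
      ← Finset.sum_sub_distrib, ← Finset.add_sum_erase _ _ (Finset.mem_univ y)]
    -- An update at `y` removes the dependence on the spin at `y`. The updates at the other
    -- vertices have total weight `n - 1`.
    have h0 : M.E {y} ((M.resample Finset.univ ^ k) f) ρ -
        M.E {y} ((M.resample Finset.univ ^ k) f) η = 0 := by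
      rw [M.freeOf_E {y} _ ρ η fun i hi => hρ i (by simpa using hi), sub_self]
    have h1 : ∀ x ∈ Finset.univ.erase y, M.E {x} ((M.resample Finset.univ ^ k) f) ρ -
        M.E {x} ((M.resample Finset.univ ^ k) f) η ≤
        8 * pathDist (ρ y) (η y) * (k * n ^ k) + 2 * (n - 1) ^ k +
          8 * n ^ k * pathDist (ρ y) (η y) := by
      intro x hx
      refine D.E_single_sub_le hlam (D.abs_resample_pow_le hlam f hf k) hρ
        (fun ρ' η' h e1 e2 => ?_) (Finset.ne_of_mem_erase hx)
      have := ih h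
      rwa [e1, e2] at this
    have h2 := Finset.sum_le_card_nsmul _ _ _ h1
    have hcard : (((Finset.univ : Finset V).erase y).card : ℝ) = n - 1 := by
      rw [Finset.card_erase_of_mem (Finset.mem_univ y), Finset.card_univ,
        Nat.cast_sub (Fintype.card_pos_iff.2 ⟨y⟩), Nat.cast_one]
    rw [nsmul_eq_mul, hcard] at h2
    refine (add_le_add h0.le h2).trans ?_
    have h3 : 0 ≤ pathDist (ρ y) (η y) * ((k + 1) * n ^ k) := by positivity
    push_cast
    rw [pow_succ' n, pow_succ' (n - 1)]
    nlinarith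

/-- After a time `t` the dependence on the initial spin at `y` is Lipschitz, up to the probability
`exp (-t)` that `y` has not been updated. -/
theorem P_sub_le (f : Obs (V → SpinPath β)) (hf : ∀ σ, |f σ| ≤ 1) {t : ℝ} (ht : 0 ≤ t) (y : V)
    {ρ η : V → SpinPath β} (hρ : ∀ v, v ≠ y → ρ v = η v) :
    (D.spec hlam).P Finset.univ t f ρ - (D.spec hlam).P Finset.univ t f η ≤
      8 * (t * Fintype.card V) * pathDist (ρ y) (η y) + 2 * Real.exp (-t) := by
  let M := D.spec hlam
  set n : ℝ := ((Fintype.card V : ℕ) : ℝ) with hn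
  have hs := M.hasSum_P Finset.univ t f
  have h1 := (hs.mapL (Obs.ev ρ)).sub (hs.mapL (Obs.ev η))
  have h2 := (((hasSum_mul_exp (t * n)).mul_left (8 * pathDist (ρ y) (η y))).add
    ((hasSum_exp_real (t * (n - 1))).mul_left 2)).mul_left (Real.exp (-(t * n)))
  have h3 := hasSum_le (fun k => ?_) h1 h2
  · refine h3.trans_eq ?_
    have e1 : Real.exp (-(t * n)) * Real.exp (t * n) = 1 := by rw [← Real.exp_add]; simp
    have e2 : Real.exp (-(t * n)) * Real.exp (t * (n - 1)) = Real.exp (-t) := by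
      rw [← Real.exp_add]; ring_nf
    linear_combination 8 * pathDist (ρ y) (η y) * (t * n) * e1 + 2 * e2
  · have h4 := D.resample_pow_sub_le hlam f hf k y hρ
    have h5 : 0 ≤ Real.exp (-(t * n)) * t ^ k / k.factorial := by positivity
    have h6 := mul_le_mul_of_nonneg_left h4 h5
    simp only [Obs.ev_apply, Obs.smul_apply, Finset.card_univ, ← hn,
      mul_pow]
    refine le_trans (le_of_eq ?_) (h6.trans_eq ?_)
    · ring
    · ring

end IsingData

/-- A measurable function is obtained from Lipschitz continuity in the `L¹` distance. -/
theorem measurable_of_lipschitz (hβ : 0 ≤ β) {G : (V → SpinPath β) → ℝ} {L : ℝ}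
    (hG : ∀ σ σ', |G σ - G σ'| ≤ L * ∑ y, pathDist (σ y) (σ' y)) : Measurable G := by
  refine measurable_of_tendsto_metrizable
    (f := fun n σ => G fun i => discretize hβ n (σ i)) (fun n => ?_) ?_
  · simp only [← stepConfig_gridSigns]
    exact (Measurable.of_discrete (f := fun s => G (stepConfig β n s))).comp
      (measurable_gridSigns hβ n)
  · refine tendsto_pi_nhds.2 fun σ => ?_
    rw [tendsto_iff_norm_sub_tendsto_zero]
    refine squeeze_zero (fun _ => norm_nonneg _) (fun n => hG _ σ) ?_
    have : Tendsto (fun n => L * ∑ y, pathDist (discretize hβ n (σ y)) (σ y)) atTop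
        (𝓝 (L * ∑ _y : V, 0)) :=
      (tendsto_finsetSum _ fun y _ => tendsto_pathDist (tendsto_discretize hβ (σ y))).const_mul L
    simpa using this

/-- An observable that is Lipschitz up to an error `δ` is within `δ` of a Lipschitz observable, its
inf-convolution with the distance. -/
theorem exists_lipschitz (hβ : 0 ≤ β) {g : Obs (V → SpinPath β)} {L δ : ℝ} (hL : 0 ≤ L) (hδ : 0 ≤ δ)
    (hg : ∀ σ σ', g σ - g σ' ≤ L * ∑ y, pathDist (σ y) (σ' y) + δ) :
    ∃ u : Obs (V → SpinPath β), (∀ σ, |g σ - u σ| ≤ δ) ∧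
      ∀ σ σ', |u σ - u σ'| ≤ L * ∑ y, pathDist (σ y) (σ' y) := by
  let d : (V → SpinPath β) → (V → SpinPath β) → ℝ := fun σ σ' => L * ∑ y, pathDist (σ y) (σ' y)
  have hd : ∀ σ σ' σ'', d σ σ'' ≤ d σ σ' + d σ' σ'' := fun σ σ' σ'' => by
    simp only [d]
    rw [← mul_add, ← Finset.sum_add_distrib]
    exact mul_le_mul_of_nonneg_left (Finset.sum_le_sum fun y _ => pathDist_triangle _ _ _) hL
  have hdc : ∀ σ σ', d σ σ' = d σ' σ := fun σ σ' => by simp only [d, pathDist_comm]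
  have hd0 : ∀ σ, d σ σ = 0 := fun σ => by simp [d, pathDist_self]
  -- The infimum is over an uncountable set; measurability of `G` follows from its Lipschitz
  -- continuity.
  let G : (V → SpinPath β) → ℝ := fun σ => ⨅ η, (g η + d σ η)
  have hlow : ∀ σ η, g σ - δ ≤ g η + d σ η := fun σ η => by
    have := hg σ η
    change _ ≤ d σ η + δ at this
    linarith
  have hbdd : ∀ σ, BddBelow (Set.range fun η => g η + d σ η) := fun σ =>
    ⟨g σ - δ, by rintro _ ⟨η, rfl⟩; exact hlow σ η⟩
  have hG1 : ∀ σ, G σ ≤ g σ := fun σ => (ciInf_le (hbdd σ) σ).trans_eq (by simp [hd0])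
  have hG2 : ∀ σ, g σ - δ ≤ G σ := fun σ => le_ciInf (hlow σ)
  have hG3 : ∀ σ σ', G σ - G σ' ≤ d σ σ' := fun σ σ' => by
    have : G σ - d σ σ' ≤ G σ' := le_ciInf fun η => by
      have h1 : G σ ≤ g η + d σ η := ciInf_le (hbdd σ) η
      have h2 := hd σ σ' η
      linarith
    linarith
  have hG4 : ∀ σ σ', |G σ - G σ'| ≤ d σ σ' := fun σ σ' =>
    abs_le.2 ⟨by have := hG3 σ' σ; rw [hdc] at this; linarith, hG3 σ σ'⟩
  refine ⟨Obs.mk G (measurable_of_lipschitz hβ hG4) (‖g‖ + δ) fun σ => ?_, fun σ => ?_, hG4⟩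
  · have h1 := abs_le.1 (g.abs_le_norm σ)
    have h2 := hG1 σ
    have h3 := hG2 σ
    exact abs_le.2 ⟨by linarith, by linarith⟩
  · change |g σ - G σ| ≤ δ
    have h2 := hG1 σ
    have h3 := hG2 σ
    exact abs_le.2 ⟨by linarith, by linarith⟩

theorem abs_totalMag_le (hβ : 0 ≤ β) (σ : V → SpinPath β) :
    |totalMag hβ Finset.univ σ| ≤ Fintype.card V * β := by
  rw [totalMag, Obs.sum_apply]
  refine (Finset.abs_sum_le_sum_abs _ _).trans ((Finset.sum_le_card_nsmul _ _ β fun y _ => ?_).trans_eq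
    (by rw [nsmul_eq_mul, Finset.card_univ]))
  change |dot (σ y) 1| ≤ β
  rw [dot_comm]
  refine (abs_dot_le (integrable_const 1) (σ y)).trans_eq ?_
  simp [timeMeasure_real_univ hβ]

/-- If the dynamics started from the two constant configurations are close on monotone
observables, then all starting points are close on all observables. -/
theorem IsingData.P_sub_le_of_const (D : IsingData V β) (hlam : 0 ≤ lam) {u T e : ℝ} (hu : 0 ≤ u)
    (hT : 0 ≤ T) (he : ∀ f : Obs (V → SpinPath β), Inc f →
      (D.spec hlam).P Finset.univ T f (fun _ => SpinPath.plus β) -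
        (D.spec hlam).P Finset.univ T f (fun _ => SpinPath.minus β) ≤ e * ‖f‖) (he0 : 0 ≤ e)
    (f : Obs (V → SpinPath β)) (hf : ∀ σ, |f σ| ≤ 1) (ρ η : V → SpinPath β) :
    (D.spec hlam).P Finset.univ (T + u) f ρ - (D.spec hlam).P Finset.univ (T + u) f η ≤
      4 * Fintype.card V * Real.exp (-u) +
        e * (8 * (u * Fintype.card V) * (Fintype.card V * β)) := by
  let M := D.spec hlam
  set n : ℝ := ((Fintype.card V : ℕ) : ℝ) with hn
  have hn0 : 0 ≤ n := Nat.cast_nonneg _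
  let L : ℝ := 8 * (u * n)
  have hL : 0 ≤ L := by positivity
  let g := M.P Finset.univ u f
  have hg : ∀ σ σ', g σ - g σ' ≤ L * ∑ y, pathDist (σ y) (σ' y) + 2 * n * Real.exp (-u) := by
    intro σ σ'
    have h1 := abs_sub_le_sum g Finset.univ
      (fun _ s s' => L * pathDist s s' + 2 * Real.exp (-u)) (fun y _ ρ η hρ => by
        refine abs_le.2 ⟨?_, D.P_sub_le hlam f hf hu y hρ⟩
        have := D.P_sub_le hlam f hf hu y fun v hv => (hρ v hv).symm
        rw [pathDist_comm] at this
        change g η - g ρ ≤ L * pathDist (ρ y) (η y) + _ at this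
        linarith) (ρ := σ) (η := σ') fun v hv => absurd (Finset.mem_univ v) hv
    refine (le_abs_self _).trans (h1.trans_eq ?_)
    rw [Finset.sum_add_distrib, ← Finset.mul_sum, Finset.sum_const, Finset.card_univ, nsmul_eq_mul]
    ring
  -- Smoothing during time `u` makes `f` nearly Lipschitz, and the Lipschitz approximation `w` is
  -- dominated by the total magnetization, which is increasing.
  obtain ⟨w, hw1, hw2⟩ := exists_lipschitz D.hβ hL (by positivity) hg
  have hw2' : ∀ σ σ', |(-w) σ - (-w) σ'| ≤ L * ∑ y, pathDist (σ y) (σ' y) := by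
    intro σ σ'
    rw [Obs.neg_apply, Obs.neg_apply, neg_sub_neg, abs_sub_comm]
    exact hw2 σ σ'
  have i1 := inc_of_lipschitz D.hβ hw2
  have i2 := inc_of_lipschitz D.hβ hw2'
  rw [← sub_eq_add_neg] at i2
  have hv := sub_le_of_inc (fun f hf => (D.ferro hlam).inc_P Finset.univ hT hf) i1 i2
    (ρ₁ := fun _ => SpinPath.minus β) (ρ₂ := fun _ => SpinPath.plus β) (ρ := ρ) (η := η)
    (fun i => (ρ i).minus_le) (fun i => (ρ i).le_plus) (fun i => (η i).minus_le)
    fun i => (η i).le_plus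
  have hmag : Inc (L • totalMag D.hβ (Finset.univ : Finset V)) := by
    have := inc_of_lipschitz (u := (0 : Obs (V → SpinPath β))) (B := Finset.univ) (L := L) D.hβ
      fun σ σ' => by
        simp only [Obs.zero_apply, sub_self, abs_zero]
        exact mul_nonneg hL (Finset.sum_nonneg fun y _ => pathDist_nonneg _ _)
    rwa [add_zero] at this
  have hnorm : ‖L • totalMag D.hβ (Finset.univ : Finset V)‖ ≤ L * (n * β) :=
    Obs.norm_le (mul_nonneg hL (mul_nonneg hn0 D.hβ)) fun σ => by
      rw [Obs.smul_apply, abs_mul, abs_of_nonneg hL]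
      exact mul_le_mul_of_nonneg_left (abs_totalMag_le D.hβ σ) hL
  have h1 := (he _ hmag).trans (mul_le_mul_of_nonneg_left hnorm he0)
  have h2 : ∀ σ, M.P Finset.univ T g σ ≤ M.P Finset.univ T w σ + 2 * n * Real.exp (-u) := fun σ => by
    have := M.P_mono (A := Finset.univ) hT (f := g) (g := w + (2 * n * Real.exp (-u)) • 1)
      (fun σ => by
        rw [Obs.add_apply, Obs.smul_apply, Obs.one_apply]
        linarith [(abs_le.1 (hw1 σ)).2]) σ
    rwa [map_add, map_smul, M.P_one, Obs.add_apply, Obs.smul_apply, Obs.one_apply, mul_one] at this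
  have h3 : ∀ σ, M.P Finset.univ T w σ ≤ M.P Finset.univ T g σ + 2 * n * Real.exp (-u) := fun σ => by
    have := M.P_mono (A := Finset.univ) hT (f := w) (g := g + (2 * n * Real.exp (-u)) • 1)
      (fun σ => by
        rw [Obs.add_apply, Obs.smul_apply, Obs.one_apply]
        linarith [(abs_le.1 (hw1 σ)).1]) σ
    rwa [map_add, map_smul, M.P_one, Obs.add_apply, Obs.smul_apply, Obs.one_apply, mul_one] at this
  change M.P Finset.univ (T + u) f ρ - M.P Finset.univ (T + u) f η ≤ _
  rw [M.P_add]
  change M.P Finset.univ T g ρ - M.P Finset.univ T g η ≤ _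
  have h4 := h2 ρ
  have h5 := h3 η
  change M.P Finset.univ T w ρ - M.P Finset.univ T w η ≤ _ at hv
  change _ ≤ e * (8 * (u * n) * (n * β)) at h1
  linarith

end Smoothing

/-! ### Convergence to equilibrium in linear time -/

section Mixing

variable {b l : ℕ} {β lam : ℝ} {D : IsingData (TreeVertex b l) β} {hlam : 0 ≤ lam}

/-- On increasing observables, the dynamics started from the two constant configurations agree up
to an exponentially small error after a time linear in the depth: the initial law may be replaced
by one with a density of second moment at most `2`, and the variance decays. -/
theorem P_const_sub_le (hG : D.G = treeGraph b (tree b l)) {K : ℝ} (hK : D.FieldBound K)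
    {C : ℝ} (hC : 0 < C) (hgap : ∀ x f ρ, (D.spec hlam).Var (desc x) f ρ ≤
      C * ∑ y ∈ desc x, (D.spec hlam).E (desc x) ((D.spec hlam).Var {y} f) ρ) {s' : ℝ} (hs0 : 0 ≤ s')
    (hs' : Real.exp (-(2 * s' / C)) * (2 ^ b / constProb β lam K) ≤ 1) {t : ℝ} (ht : 0 ≤ t)
    {f : Obs (TreeVertex b l → SpinPath β)} (hf : Inc f) :
    (D.spec hlam).P Finset.univ ((l + 1 : ℕ) * s' + t) f (fun _ => SpinPath.plus β) -
      (D.spec hlam).P Finset.univ ((l + 1 : ℕ) * s' + t) f (fun _ => SpinPath.minus β) ≤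
      4 * Real.exp (-(t / C)) * ‖f‖ := by
  let M := D.spec hlam
  have key : ∀ (s : ℤˣ) (f : Obs (TreeVertex b l → SpinPath β)), SInc s f →
      ∀ ρ : TreeVertex b l → SpinPath β, ρ = (fun _ => SpinPath.const β s) →
      ∀ η, M.P Finset.univ ((l + 1 : ℕ) * s' + t) f ρ ≤
        M.E Finset.univ f η + 2 * Real.exp (-(t / C)) * ‖f‖ := by
    intro s f hf ρ hρ η
    obtain ⟨k, hk⟩ := exists_startDensity hG hK hC hgap hs0 hs' s (l + 1) (treeRoot b l) (by omega)
    have hpar : ∀ ρ : TreeVertex b l → SpinPath β, ParentConst s (treeRoot b l) ρ := fun ρ p hp => by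
      have := hp.length
      simp [treeRoot] at this
    have h1 := hk.dom ρ (fun y _ => by rw [hρ]) (hpar ρ) (M.P Finset.univ t f)
      (hf.P (D.ferro hlam) _ ht)
    have hsq := hk.sq ρ (hpar ρ)
    have hmean := hk.mean ρ (hpar ρ)
    have hP := M.Var_P_le hC (fun f => hgap (treeRoot b l) f ρ) ht f
    rw [desc_treeRoot] at h1 hsq hmean hP
    have hη : M.E Finset.univ f η = M.E Finset.univ f ρ :=
      M.freeOf_E _ _ _ _ fun i hi => absurd (Finset.mem_univ i) hi
    rw [hη, M.P_add]
    refine h1.trans ?_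
    let c : ℝ := M.E Finset.univ f ρ
    let g := M.P Finset.univ t f
    have hc : M.E Finset.univ g ρ = c := by rw [M.E_P subset_rfl]
    have hVar : M.Var Finset.univ g ρ = M.E Finset.univ ((g - c • 1) * (g - c • 1)) ρ := by
      rw [Spec.Var_eq]
      refine M.E_congr fun σ => ?_
      simp only [Obs.mul_apply, Obs.sub_apply, Obs.smul_apply, Obs.one_apply, mul_one]
      rw [(M.freeOf_E Finset.univ g).piecewise, hc]
    -- The Cauchy–Schwarz inequality: the density has second moment at most `2`, and the variance
    -- of `g` is small.
    have h2 := M.E_mul_sq_le Finset.univ k (g - c • 1) ρ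
    rw [← hVar] at h2
    have hVf : M.Var Finset.univ f ρ ≤ ‖f‖ ^ 2 := by
      have h3 : M.E Finset.univ (f * f) ρ ≤ ‖f‖ ^ 2 := M.E_le_const fun σ => by
        rw [Obs.mul_apply, ← pow_two, ← sq_abs]
        exact pow_le_pow_left₀ (abs_nonneg _) (f.abs_le_norm _) 2
      rw [Spec.Var, Obs.sub_apply, Obs.mul_apply]
      linarith [mul_self_nonneg (M.E Finset.univ f ρ)]
    have h4 : M.Var Finset.univ g ρ ≤ (Real.exp (-(t / C)) * ‖f‖) ^ 2 := by
      refine hP.trans ((mul_le_mul_of_nonneg_left hVf (Real.exp_pos _).le).trans_eq ?_)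
      rw [mul_pow, ← Real.exp_nat_mul]
      congr 2
      push_cast
      ring
    have h5 : (M.E Finset.univ (k * (g - c • 1)) ρ) ^ 2 ≤ (2 * (Real.exp (-(t / C)) * ‖f‖)) ^ 2 := by
      refine h2.trans ((mul_le_mul hsq h4 (M.Var_nonneg _ _ _) zero_le_two).trans ?_)
      nlinarith [sq_nonneg (Real.exp (-(t / C)) * ‖f‖)]
    have h6 := (abs_le_of_sq_le_sq' h5 (by positivity)).2
    rw [mul_sub, mul_smul_comm, mul_one, map_sub, map_smul, Obs.sub_apply, Obs.smul_apply] at h6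
    have hmean' : M.E Finset.univ k ρ = 1 := hmean
    rw [hmean', mul_one] at h6
    change M.E Finset.univ (k * g) ρ ≤ c + _
    linarith
  have h1 := key 1 f (by simpa [SInc, sgn] using hf) (fun _ => SpinPath.plus β) rfl
    (fun _ => SpinPath.plus β)
  have h2 := key (-1) (-f) (by simpa [SInc, sgn] using hf) (fun _ => SpinPath.minus β) rfl
    (fun _ => SpinPath.plus β)
  rw [map_neg, map_neg, Obs.neg_apply, Obs.neg_apply, norm_neg] at h2
  change M.P Finset.univ _ f _ - M.P Finset.univ _ f _ ≤ _
  linarith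

end Mixing

/-! ### Total variation distance -/

section TotalVariation

variable {Ω : Type*} [MeasurableSpace Ω]

theorem abs_real_sub_le_one (μ ν : Measure Ω) [IsProbabilityMeasure μ] [IsProbabilityMeasure ν]
    (A : Set Ω) : |μ.real A - ν.real A| ≤ 1 := by
  have h1 : μ.real A ≤ 1 := measureReal_le_one
  have h2 : ν.real A ≤ 1 := measureReal_le_one
  have h3 : 0 ≤ μ.real A := measureReal_nonneg
  have h4 : 0 ≤ ν.real A := measureReal_nonneg
  exact abs_le.2 ⟨by linarith, by linarith⟩

theorem abs_real_sub_le_tvDist (μ ν : Measure Ω) [IsProbabilityMeasure μ] [IsProbabilityMeasure ν]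
    {A : Set Ω} (hA : MeasurableSet A) : |μ.real A - ν.real A| ≤ tvDist μ ν :=
  le_ciSup (f := fun A : {A : Set Ω // MeasurableSet A} => |μ.real A.1 - ν.real A.1|)
    ⟨1, by rintro _ ⟨A, rfl⟩; exact abs_real_sub_le_one μ ν A⟩ ⟨A, hA⟩

theorem tvDist_le {μ ν : Measure Ω} {c : ℝ}
    (h : ∀ A, MeasurableSet A → |μ.real A - ν.real A| ≤ c) : tvDist μ ν ≤ c := by
  have : Nonempty {A : Set Ω // MeasurableSet A} := ⟨⟨∅, MeasurableSet.empty⟩⟩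
  exact ciSup_le fun A => h A.1 A.2

/-- Integrals of a function of oscillation at most `K` differ at most by `K` times the total
variation distance. -/
theorem integral_sub_le_tvDist (μ ν : Measure Ω) [IsProbabilityMeasure μ] [IsProbabilityMeasure ν]
    [Nonempty Ω] (φ : Obs Ω) {K : ℝ} (hφ : ∀ s s', φ s - φ s' ≤ K) :
    ∫ s, φ s ∂μ - ∫ s, φ s ∂ν ≤ tvDist μ ν * K := by
  have hK : 0 ≤ K := by
    obtain ⟨s⟩ := ‹Nonempty Ω›
    simpa using hφ s s
  let a : ℝ := ⨅ s, φ s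
  have hbdd : BddBelow (Set.range φ) := ⟨-‖φ‖, by
    rintro _ ⟨s, rfl⟩
    exact (abs_le.1 (φ.abs_le_norm s)).1⟩
  have h0 : ∀ s, 0 ≤ φ s - a := fun s => sub_nonneg.2 (ciInf_le hbdd s)
  have h1 : ∀ s, φ s - a ≤ K := fun s => by
    have : φ s - K ≤ a := le_ciInf fun s' => by linarith [hφ s s']
    linarith
  -- The layer-cake formula: the expectation is an integral of probabilities of level sets over an
  -- interval of length `K`.
  have hm : ∀ μ : Measure Ω, IsProbabilityMeasure μ →
      ∫ s, φ s ∂μ = a + ∫ t in Set.Ioc 0 K, μ.real {s | t ≤ φ s - a} := fun μ _ => by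
    have hi := φ.integrable μ
    have hi' : Integrable (fun s => φ s - a) μ := hi.sub (integrable_const a)
    rw [← hi'.integral_eq_integral_Ioc_meas_le (Eventually.of_forall h0) (Eventually.of_forall h1),
      integral_sub hi (integrable_const a)]
    simp
  have hint : ∀ μ : Measure Ω, IsProbabilityMeasure μ →
      Integrable (fun t => μ.real {s | t ≤ φ s - a}) (volume.restrict (Set.Ioc 0 K)) := fun μ _ => by
    have hanti : Antitone fun t => μ.real {s | t ≤ φ s - a} := fun t t' h =>
      measureReal_mono fun s (hs : t' ≤ φ s - a) => h.trans hs
    refine Integrable.of_bound hanti.measurable.aestronglyMeasurable 1 (Eventually.of_forall fun t => ?_)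
    rw [Real.norm_eq_abs, abs_of_nonneg measureReal_nonneg]
    exact measureReal_le_one
  rw [hm μ inferInstance, hm ν inferInstance, add_sub_add_left_eq_sub,
    ← integral_sub (hint μ inferInstance) (hint ν inferInstance)]
  refine (integral_mono ((hint μ inferInstance).sub (hint ν inferInstance))
    (integrable_const (tvDist μ ν)) fun t => ?_).trans_eq ?_
  · have hmeas : MeasurableSet {s | t ≤ φ s - a} :=
      measurableSet_le measurable_const (φ.measurable.sub_const a)
    exact (le_abs_self _).trans (abs_real_sub_le_tvDist μ ν hmeas)
  · rw [integral_const, smul_eq_mul]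
    simp [hK, mul_comm]

end TotalVariation

/-! ### Gibbs measures on subgraphs as conditional expectations -/

section Subgraph

/-- Marginals of a product of identical probability measures. -/
theorem map_comp_pi {V V' S : Type*} [Fintype V] [Fintype V'] [MeasurableSpace S] (m : Measure S)
    [IsProbabilityMeasure m] {e : V' → V} (he : Function.Injective e) :
    (Measure.pi fun _ : V => m).map (fun σ i => σ (e i)) = Measure.pi fun _ : V' => m := by
  have h1 : iIndepFun (fun (i : V) (σ : V → S) => σ i) (Measure.pi fun _ : V => m) :=
    iIndepFun_pi (X := fun _ => id) fun _ => aemeasurable_id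
  have h2 := h1.precomp he
  rw [iIndepFun_iff_map_fun_eq_pi_map fun i => (measurable_pi_apply (e i)).aemeasurable] at h2
  refine h2.trans ?_
  congr 1
  funext i
  exact (measurePreserving_eval (fun _ : V => m) (e i)).map_eq

variable {V V' : Type*} [Fintype V] [DecidableEq V] [Fintype V'] [DecidableEq V'] {β lam : ℝ}

open Classical in
/-- The energy on an induced subgraph, with the field created by the spins outside, is the part of
the total energy that involves the vertices of the subgraph. -/
theorem IsingData.energy_comp (D : IsingData V β) (D' : IsingData V' β) (e : V' ↪ V)
    (hG : ∀ i j, D'.G.Adj i j ↔ D.G.Adj (e i) (e j)) {ρ : V → SpinPath β}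
    (hh : ∀ i t, D'.h i t = D.h (e i) t +
      ∑ j ∈ (Finset.univ.map e)ᶜ, (if D.G.Adj (e i) j then ρ j t else 0)) (σ : V → SpinPath β) :
    energy D'.G D'.h (fun i => σ (e i)) =
      D.inner (Finset.univ.map e) σ + D.cross (Finset.univ.map e) σ ρ := by
  rw [← D'.inner_univ_apply, D'.inner_apply, D.inner_apply, cross]
  simp only [Finset.sum_map]
  have hb : ∀ i j, D'.bond i j (σ (e i)) (σ (e j)) = D.bond (e i) (e j) (σ (e i)) (σ (e j)) :=
    fun i j => if_congr (hG i j) rfl rfl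
  have hd : ∀ i, dot (D'.h i) (σ (e i)) = dot (D.h (e i)) (σ (e i)) +
      ∑ j ∈ (Finset.univ.map e)ᶜ, D.bond (e i) j (σ (e i)) (ρ j) := by
    intro i
    have hi : ∀ j, Integrable (fun t => (if D.G.Adj (e i) j then ρ j t else 0) * σ (e i) t)
        (timeMeasure β) := by
      intro j
      split_ifs
      · exact (σ (e i)).integrable_mul _ (ρ j).integrable
      · simp
    have hj : ∀ j, ∫ t, (if D.G.Adj (e i) j then ρ j t else 0) * σ (e i) t ∂(timeMeasure β) =
        D.bond (e i) j (σ (e i)) (ρ j) := by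
      intro j
      unfold bond
      split_ifs
      · rw [dot_comm]; rfl
      · simp
    rw [dot, dot, ← Finset.sum_congr rfl fun j _ => hj j, ← integral_finsetSum _ fun j _ => hi j,
      ← integral_add ((σ (e i)).integrable_mul _ (D.integrable_h _))
        (integrable_finsetSum _ fun j _ => hi j)]
    refine integral_congr_ae (Eventually.of_forall fun t => ?_)
    simp only [hh, add_mul, Finset.sum_mul]
  simp only [hb, hd, Finset.sum_add_distrib]
  ring

open Classical in
/-- The Gibbs measure on an induced subgraph, with the field created by the spins outside. -/
theorem IsingData.integral_gibbs_comp (D : IsingData V β) (hlam : 0 ≤ lam) (D' : IsingData V' β)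
    (e : V' ↪ V) (hG : ∀ i j, D'.G.Adj i j ↔ D.G.Adj (e i) (e j)) {ρ : V → SpinPath β}
    (hh : ∀ i t, D'.h i t = D.h (e i) t +
      ∑ j ∈ (Finset.univ.map e)ᶜ, (if D.G.Adj (e i) j then ρ j t else 0))
    (F : Obs (V' → SpinPath β)) :
    ∫ σ, F σ ∂(gibbs D'.G lam D'.h) = (D.spec hlam).E (Finset.univ.map e)
      (F.comp (fun σ i => σ (e i)) (measurable_pi_lambda _ fun i => measurable_pi_apply (e i))) ρ := by
  have hp := isProbabilityMeasure_freeSpin D.hβ hlam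
  have hm : Measurable fun (σ : V → SpinPath β) (i : V') => σ (e i) :=
    measurable_pi_lambda _ fun i => measurable_pi_apply (e i)
  have hint : ∀ φ : Obs (V' → SpinPath β), ∫ σ, φ (fun i => σ (e i)) ∂(D.spec hlam).ref =
      ∫ σ, φ σ ∂(D'.spec hlam).ref := by
    intro φ
    have h1 : (D'.spec hlam).ref = (D.spec hlam).ref.map fun σ i => σ (e i) :=
      (map_comp_pi (freeSpin β lam) e.injective).symm
    rw [h1, integral_map hm.aemeasurable φ.measurable.aestronglyMeasurable]
  have hw : ∀ σ : V → SpinPath β, (D.spec hlam).w ((Finset.univ.map e).piecewise σ ρ) =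
      Real.exp (D.inner (Finset.univ.map e)ᶜ ρ) * (D'.spec hlam).w fun i => σ (e i) := by
    intro σ
    rw [spec_w, spec_w, energy_piecewise, D.energy_comp D' e hG hh, ← Real.exp_add]
    ring_nf
  have hF : ∀ σ : V → SpinPath β, F.comp (fun σ i => σ (e i)) hm ((Finset.univ.map e).piecewise σ ρ) =
      F fun i => σ (e i) := by
    intro σ
    rw [Obs.comp_apply]
    congr 1
    funext i
    simp
  rw [D'.integral_gibbs hlam F (fun _ => SpinPath.plus β), Spec.E_apply, Spec.E_apply, Spec.avg_apply,
    Spec.avg_apply, Spec.avg_apply, Spec.avg_apply]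
  simp only [Finset.piecewise_univ, Obs.mul_apply, hw, hF]
  have e1 : ∫ σ, F σ * (D'.spec hlam).w σ ∂(D'.spec hlam).ref =
      ∫ σ, F (fun i => σ (e i)) * (D'.spec hlam).w (fun i => σ (e i)) ∂(D.spec hlam).ref :=
    (hint (F * (D'.spec hlam).w)).symm
  have h2 : ∀ σ : V → SpinPath β, F (fun i => σ (e i)) * (Real.exp (D.inner (Finset.univ.map e)ᶜ ρ) *
      (D'.spec hlam).w fun i => σ (e i)) = Real.exp (D.inner (Finset.univ.map e)ᶜ ρ) *
      (F (fun i => σ (e i)) * (D'.spec hlam).w fun i => σ (e i)) := fun σ => by ring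
  simp only [h2]
  rw [e1, ← hint (D'.spec hlam).w, integral_const_mul, integral_const_mul,
    mul_div_mul_left _ _ (Real.exp_pos _).ne']

end Subgraph

/-! ### The Ising model on the tree -/

section TreeModel

variable {b l : ℕ} {β lam : ℝ}

/-- The Ising model on a finite subset of the tree, with a boundary condition. -/
def treeData (b : ℕ) (hβ : 0 ≤ β) {h : Set.Icc (0 : ℝ) β → ℝ} (hh : Integrable h (timeMeasure β))
    (A : Finset (List (Fin b))) (η : List (Fin b) → SpinPath β) : IsingData A β where
  G := treeGraph b A
  h := treeField b h A η
  integrable_h := fun _ => hh.add (integrable_finsetSum _ fun y _ => (η y).integrable)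
  hβ := hβ

open Classical in
/-- The neighbours of `x` outside `A` in the infinite tree are those outside the finite tree and
those in the finite tree outside `A`. -/
theorem sum_nbrs_sdiff {A : Finset (List (Fin b))} (hA : A ⊆ tree b l) (x : TreeVertex b l)
    (F : List (Fin b) → ℝ) : ∑ y ∈ nbrs b x.1 \ A, F y = ∑ y ∈ nbrs b x.1 \ tree b l, F y +
      ∑ j : TreeVertex b l, (if (treeGraph b (tree b l)).Adj x j ∧ j.1 ∉ A then F j.1 else 0) := by
  have h1 : ∑ j : TreeVertex b l, (if (treeGraph b (tree b l)).Adj x j ∧ j.1 ∉ A then F j.1 else 0) =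
      ∑ y ∈ tree b l, (if y ∈ nbrs b x.1 ∧ y ∉ A then F y else 0) :=
    Eq.trans (Finset.sum_congr rfl fun j _ => by congr)
      (Finset.sum_coe_sort (tree b l) fun y => if y ∈ nbrs b x.1 ∧ y ∉ A then F y else 0)
  rw [h1, ← Finset.sum_filter, ← Finset.sum_union]
  · refine Finset.sum_congr ?_ fun _ _ => rfl
    ext y
    have := @hA y
    simp only [Finset.mem_sdiff, Finset.mem_union, Finset.mem_filter]
    tauto
  · rw [Finset.disjoint_left]
    intro y h2 h3
    exact (Finset.mem_sdiff.1 h2).2 (Finset.mem_filter.1 h3).1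

variable (hβ : 0 ≤ β) {h : Set.Icc (0 : ℝ) β → ℝ} (hh : Integrable h (timeMeasure β))
  (τ : List (Fin b) → SpinPath β) (hlam : 0 ≤ lam)

/-- The finite-volume Gibbs measures on the infinite tree, with a boundary condition that agrees
with `τ` outside the tree of depth `l`, are the conditional expectations of the specification on
that tree. -/
theorem integral_treeGibbs {A₀ : Finset (List (Fin b))} (hA₀ : A₀ ⊆ tree b l)
    {A : Finset (TreeVertex b l)} (hA : ∀ v, v ∈ A ↔ v.1 ∈ A₀) {η : List (Fin b) → SpinPath β}
    {ρ : TreeVertex b l → SpinPath β} (hη : ∀ v : TreeVertex b l, η v.1 = ρ v)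
    (hη' : ∀ y, y ∉ tree b l → η y = τ y) (F : Obs (A₀ → SpinPath β)) :
    ∫ σ, F σ ∂(treeGibbs b lam h A₀ η) = ((treeData b hβ hh (tree b l) τ).spec hlam).E A
      (F.comp (fun σ i => σ ⟨i.1, hA₀ i.2⟩)
        (measurable_pi_lambda _ fun i => measurable_pi_apply _)) ρ := by
  classical
  let e : A₀ ↪ TreeVertex b l := ⟨fun i => ⟨i.1, hA₀ i.2⟩, fun _ _ hij => by
    have := congrArg Subtype.val hij
    exact Subtype.ext this⟩
  have hmap : Finset.univ.map e = A := by
    ext v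
    rw [hA, Finset.mem_map]
    constructor
    · rintro ⟨i, -, rfl⟩
      exact i.2
    · exact fun hv => ⟨⟨v.1, hv⟩, Finset.mem_univ _, rfl⟩
  have key := (treeData b hβ hh (tree b l) τ).integral_gibbs_comp hlam (treeData b hβ hh A₀ η) e
    (fun _ _ => Iff.rfl) (ρ := ρ) (fun i t => ?_) F
  · rw [hmap] at key
    exact key
  · -- the neighbours outside `A₀` are those outside the tree and those in the tree
    have key2 : ∑ y ∈ nbrs b i.1 \ A₀, η y t = _ := sum_nbrs_sdiff hA₀ (e i) fun y => η y t
    refine (congrArg (h t + ·) key2).trans ((add_assoc _ _ _).symm.trans ?_)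
    refine congrArg₂ (· + ·) (congrArg (h t + ·) ?_) ?_
    · exact Finset.sum_congr rfl fun y hy => by rw [hη' y (Finset.mem_sdiff.1 hy).2]
    · rw [hmap, ← Finset.sum_filter_add_sum_filter_not Finset.univ (fun j => j ∈ A)]
      rw [Finset.sum_eq_zero, zero_add]
      · refine Finset.sum_congr ?_ fun j hj => ?_
        · ext j
          simp
        · have : j.1 ∉ A₀ := fun h => Finset.mem_compl.1 hj ((hA j).2 h)
          rw [hη]
          exact if_congr (and_iff_left this) rfl rfl
      · intro j hj
        have : j.1 ∈ A₀ := (hA j).1 (Finset.mem_filter.1 hj).2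
        rw [if_neg fun h' => h'.2 this]

theorem card_nbrs_le (z : List (Fin b)) : (nbrs b z).card ≤ b + 1 := by
  refine (Finset.card_union_le _ _).trans (add_le_add ?_ ?_)
  · exact Finset.card_image_le.trans_eq (by simp)
  · cases z <;> simp

/-- A uniform bound on the energy of a single spin. -/
def treeFieldBound (b : ℕ) {β : ℝ} (h : Set.Icc (0 : ℝ) β → ℝ) : ℝ :=
  ∫ t, |h t| ∂(timeMeasure β) + (b + 1) * β

include hβ in
theorem treeFieldBound_nonneg : 0 ≤ treeFieldBound b h :=
  add_nonneg (integral_nonneg fun _ => abs_nonneg _) (by positivity)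

/-- The local field at a vertex is `h` plus at most `b + 1` neighbouring spins, whatever the
boundary condition. -/
theorem fieldBound_treeData :
    (treeData b hβ hh (tree b l) τ).FieldBound (treeFieldBound b h) := by
  classical
  intro x ρ s
  let η : List (Fin b) → SpinPath β := fun y => if hy : y ∈ tree b l then ρ ⟨y, hy⟩ else τ y
  have h1 : localField (treeGraph b (tree b l)) (treeField b h (tree b l) τ) ρ x =
      fun t => h t + ∑ y ∈ nbrs b x.1, η y t := by
    funext t
    have := sum_nbrs_sdiff (A := ∅) (Finset.empty_subset _) x fun y => η y t
    rw [Finset.sdiff_empty] at this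
    rw [this, ← add_assoc]
    change h t + _ + _ = _
    congr 2
    · exact Finset.sum_congr rfl fun y hy => by simp only [η, (Finset.mem_sdiff.1 hy).2, dif_neg,
        not_false_eq_true]
    · funext j
      simp [η, j.2]
  change |dot s (localField (treeGraph b (tree b l)) (treeField b h (tree b l) τ) ρ x)| ≤ _
  rw [h1, dot_comm]
  have hint : Integrable (fun t => ∑ y ∈ nbrs b x.1, η y t) (timeMeasure β) :=
    integrable_finsetSum _ fun y _ => (η y).integrable
  refine (abs_dot_le (hh.add hint) s).trans ?_
  have h2 : ∀ t, |h t + ∑ y ∈ nbrs b x.1, η y t| ≤ |h t| + (b + 1) := fun t => by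
    refine (abs_add_le _ _).trans (add_le_add le_rfl ((Finset.abs_sum_le_sum_abs _ _).trans ?_))
    simp only [SpinPath.abs_eq_one, Finset.sum_const, nsmul_eq_mul, mul_one]
    exact_mod_cast card_nbrs_le x.1
  refine (integral_mono (hh.add hint).abs (hh.abs.add (integrable_const _)) h2).trans_eq ?_
  rw [integral_add' hh.abs (integrable_const _), integral_const, timeMeasure_real_univ hβ, treeFieldBound,
    smul_eq_mul, mul_comm]

end TreeModel

/-! ### The exponents `γ` and `κ` -/

section Exponents

variable {b l : ℕ} {β lam : ℝ} (hβ : 0 ≤ β) {h : Set.Icc (0 : ℝ) β → ℝ}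
  (hh : Integrable h (timeMeasure β)) (τ : List (Fin b) → SpinPath β) (hlam : 0 ≤ lam)

include hβ hh hlam in
theorem isProbabilityMeasure_treeGibbs (A : Finset (List (Fin b))) (η : List (Fin b) → SpinPath β) :
    IsProbabilityMeasure (treeGibbs b lam h A η) :=
  (treeData b hβ hh A η).isProbabilityMeasure_gibbs hlam

theorem gammaExp_nonneg : 0 ≤ gammaExp b lam h := by
  refine Real.sSup_nonneg ?_
  rintro _ ⟨-, A, y, z, η, η', -, -, -, -, rfl⟩
  exact Real.iSup_nonneg fun _ => abs_nonneg _

theorem kappaExp_nonneg : 0 ≤ kappaExp b lam h τ := Real.sInf_nonneg fun _ hκ => hκ.1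

include hβ hh hlam in
theorem tvDist_le_gammaExp {A : Finset (List (Fin b))} (hA : A ⊆ tree b l) {y : List (Fin b)}
    (hy : y ∉ A) (z : A) (hyz : (regTree b).Adj y z.1) {η η' : List (Fin b) → SpinPath β}
    (hη : ∀ v, v ≠ y → η v = η' v) :
    tvDist ((treeGibbs b lam h A η).map fun σ => σ z) ((treeGibbs b lam h A η').map fun σ => σ z) ≤
      gammaExp b lam h := by
  refine le_csSup ⟨1, ?_⟩ ⟨l, A, y, z, η, η', hA, hy, hyz, hη, rfl⟩
  rintro _ ⟨-, A, -, z, η, η', -, -, -, -, rfl⟩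
  refine tvDist_le fun B _ => ?_
  have h1 := isProbabilityMeasure_treeGibbs hβ hh hlam A η
  have h2 := isProbabilityMeasure_treeGibbs hβ hh hlam A η'
  have h3 := Measure.isProbabilityMeasure_map (μ := treeGibbs b lam h A η)
    (measurable_pi_apply z).aemeasurable
  have h4 := Measure.isProbabilityMeasure_map (μ := treeGibbs b lam h A η')
    (measurable_pi_apply z).aemeasurable
  exact abs_real_sub_le_one _ _ B

/-- The boundary condition on the infinite tree that extends a configuration on a finite tree. -/
def extend (τ : List (Fin b) → SpinPath β) (ρ : TreeVertex b l → SpinPath β) :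
    List (Fin b) → SpinPath β :=
  fun y => if hy : y ∈ tree b l then ρ ⟨y, hy⟩ else τ y

theorem extend_apply (ρ : TreeVertex b l → SpinPath β) (v : TreeVertex b l) :
    extend τ ρ v.1 = ρ v := by simp [extend]

theorem extend_of_notMem (ρ : TreeVertex b l → SpinPath β) {y : List (Fin b)} (hy : y ∉ tree b l) :
    extend τ ρ y = τ y := by simp [extend, hy]

/-- The influence of a spin on a neighbouring one is at most `γ`, in every volume. -/
theorem treeData_gamma_le {γ : ℝ} (hγ : gammaExp b lam h ≤ γ) (A : Finset (TreeVertex b l))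
    (y z : TreeVertex b l) (hy : y ∉ A) (hz : z ∈ A) (hyz : IsChild y z ∨ IsChild z y)
    (φ : Obs (SpinPath β)) (K : ℝ) (hφ : ∀ s s', φ s - φ s' ≤ K)
    (ρ η : TreeVertex b l → SpinPath β) (hρ : ∀ v, v ≠ y → ρ v = η v) :
    ((treeData b hβ hh (tree b l) τ).spec hlam).E A (Obs.site z φ) ρ -
      ((treeData b hβ hh (tree b l) τ).spec hlam).E A (Obs.site z φ) η ≤ γ * K := by
  let A₀ : Finset (List (Fin b)) := A.map (Function.Embedding.subtype _)
  have hA₀ : A₀ ⊆ tree b l := fun v hv => by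
    obtain ⟨w, -, rfl⟩ := Finset.mem_map.1 hv
    exact w.2
  have hA : ∀ v, v ∈ A ↔ v.1 ∈ A₀ := fun v =>
    (Finset.mem_map' (Function.Embedding.subtype (· ∈ tree b l))).symm
  let z₀ : A₀ := ⟨z.1, (hA z).1 hz⟩
  have key : ∀ ρ, ((treeData b hβ hh (tree b l) τ).spec hlam).E A (Obs.site z φ) ρ =
      ∫ s, φ s ∂((treeGibbs b lam h A₀ (extend τ ρ)).map fun σ => σ z₀) := fun ρ => by
    rw [integral_map (measurable_pi_apply z₀).aemeasurable φ.measurable.aestronglyMeasurable]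
    exact (integral_treeGibbs hβ hh τ hlam hA₀ hA (extend_apply τ ρ)
      (fun y => extend_of_notMem τ ρ) (Obs.site z₀ φ)).symm
  have hprob : ∀ ρ : TreeVertex b l → SpinPath β, IsProbabilityMeasure
      ((treeGibbs b lam h A₀ (extend τ ρ)).map fun σ => σ z₀) := fun ρ => by
    have := isProbabilityMeasure_treeGibbs hβ hh hlam A₀ (extend τ ρ)
    exact Measure.isProbabilityMeasure_map (measurable_pi_apply z₀).aemeasurable
  have h1 := hprob ρ
  have h2 := hprob η
  have hK : 0 ≤ K := by simpa using hφ (SpinPath.plus β) (SpinPath.plus β)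
  rw [key, key]
  refine (integral_sub_le_tvDist _ _ φ hφ).trans (mul_le_mul_of_nonneg_right ?_ hK)
  refine (tvDist_le_gammaExp hβ hh hlam hA₀ (y := y.1) (fun h => hy ((hA y).2 h)) z₀ ?_ ?_).trans hγ
  · change z.1 ∈ nbrs b y.1
    rw [mem_nbrs]
    exact hyz.symm
  · intro v hv
    by_cases hvt : v ∈ tree b l
    · simp only [extend, hvt, dif_pos]
      exact hρ _ fun h => hv (congrArg Subtype.val h)
    · rw [extend_of_notMem τ _ hvt, extend_of_notMem τ _ hvt]

/-- Conditioning on an event whose indicator is an observable. -/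
theorem integral_cond_eq {Ω : Type*} [MeasurableSpace Ω] (μ : Measure Ω) [IsFiniteMeasure μ]
    {S : Set Ω} (hS : MeasurableSet S) (J F : Obs Ω) (hJ : ∀ σ, J σ = S.indicator 1 σ) :
    ∫ σ, F σ ∂(ProbabilityTheory.cond μ S) = (∫ σ, (J * F) σ ∂μ) / ∫ σ, J σ ∂μ := by
  have h1 : ∫ σ, J σ ∂μ = μ.real S := by
    simp only [hJ]
    rw [integral_indicator_one hS]
  have h2 : ∫ σ, (J * F) σ ∂μ = ∫ σ in S, F σ ∂μ := by
    rw [← integral_indicator hS]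
    refine integral_congr_ae (Eventually.of_forall fun σ => ?_)
    simp only [Obs.mul_apply, hJ]
    by_cases hσ : σ ∈ S <;> simp [hσ]
  rw [h1, h2, ProbabilityTheory.cond, integral_smul_measure, ENNReal.toReal_inv, smul_eq_mul,
    div_eq_inv_mul]
  rfl

/-- Given the spin at `x`, the spins below `x` do not depend on the others. -/
theorem integral_cond_root (x : TreeVertex b l) {z : TreeVertex b l} (hz : z ∈ desc x)
    (hz' : z.1 ∈ subtree b x.1 (l - x.1.length)) (s : ℤˣ) {ρ : TreeVertex b l → SpinPath β}
    (hρ : ρ x = SpinPath.const β s) :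
    ∫ σ, dot (σ ⟨z.1, hz'⟩) 1 ∂(ProbabilityTheory.cond
      (treeGibbs b lam h (subtree b x.1 (l - x.1.length)) τ)
        {σ | σ (subtreeRoot b x.1 (l - x.1.length)) = SpinPath.const β s}) =
    ((treeData b hβ hh (tree b l) τ).spec hlam).E (pdesc x) (Obs.site z (magnetization hβ)) ρ := by
  classical
  let D := treeData b hβ hh (tree b l) τ
  let M := D.spec hlam
  let A₀ := subtree b x.1 (l - x.1.length)
  have hx : x.1.length ≤ l := mem_tree.1 x.2
  have hA₀ : A₀ ⊆ tree b l := fun v hv => by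
    have := (mem_subtree.1 hv).2
    rw [mem_tree]
    omega
  have hA : ∀ v : TreeVertex b l, v ∈ desc x ↔ v.1 ∈ A₀ := fun v => by
    have := mem_tree.1 v.2
    rw [mem_desc, mem_subtree]
    exact ⟨fun h => ⟨h, by omega⟩, fun h => h.1⟩
  have hμ := isProbabilityMeasure_treeGibbs hβ hh hlam A₀ τ
  have hS : MeasurableSet {σ : A₀ → SpinPath β | σ (subtreeRoot b x.1 (l - x.1.length)) =
      SpinPath.const β s} :=
    (SpinPath.measurableSet_singleton hβ (SpinPath.const β s)).preimage
      (measurable_pi_apply (subtreeRoot b x.1 (l - x.1.length)))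
  let J : Obs (TreeVertex b l → SpinPath β) := Obs.site x (constInd hβ s)
  let F : Obs (TreeVertex b l → SpinPath β) := Obs.site z (magnetization hβ)
  let ρ₀ : TreeVertex b l → SpinPath β := fun v => τ v.1
  have hτ := fun F => integral_treeGibbs hβ hh τ hlam hA₀ hA (η := τ) (ρ := ρ₀) (fun _ => rfl)
    (fun _ _ => rfl) F
  refine (integral_cond_eq (treeGibbs b lam h A₀ τ) hS
    (Obs.site (subtreeRoot b x.1 (l - x.1.length)) (constInd hβ s))
    (Obs.site ⟨z.1, hz'⟩ (magnetization hβ)) fun σ => ?_).trans ?_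
  · rw [Obs.site_apply, constInd_apply, Set.indicator_apply]
    rfl
  rw [hτ, hτ]
  have hJ : Spec.FreeOf (pdesc x) J := fun ξ ξ' hξ => by
    simp only [J, Obs.site_apply]
    rw [hξ x fun h => (mem_pdesc.1 h).1 rfl]
  have hF : Spec.FreeOf ((desc x)ᶜ) F := fun ξ ξ' hξ => by
    simp only [F, Obs.site_apply]
    rw [hξ z (by simpa using hz)]
  have hEF : ∀ ξ, ξ x = SpinPath.const β s → M.E (pdesc x) F ξ = M.E (pdesc x) F ρ := fun ξ hξ => by
    refine ((M.freeOf_E (pdesc x) F).union ((sep_pdesc (D := D) hlam rfl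
      (disjoint_compl_right (a := desc x))).freeOf_E hF)) _ _ fun v hv => ?_
    rw [Finset.mem_union, not_or, Finset.mem_compl, not_not, mem_pdesc] at hv
    have : v = x := by
      by_contra hne
      exact hv.1 ⟨hne, hv.2⟩
    rw [this, hξ, hρ]
  -- On the event that the spin at `x` is constant, the conditional expectation of `F` given that
  -- spin is the number `M.E (pdesc x) F ρ`.
  have hprod : M.E (desc x) (J * F) ρ₀ = M.E (pdesc x) F ρ * M.E (desc x) J ρ₀ := by
    rw [← M.E_E (pdesc_subset x), M.E_mul_left hJ]
    have : J * M.E (pdesc x) F = (M.E (pdesc x) F ρ) • J := by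
      ext ξ
      by_cases hξ : ξ x = SpinPath.const β s
      · simp [hEF ξ hξ, mul_comm]
      · have : J ξ = 0 := by
          simp only [J, Obs.site_apply]
          exact constInd_of_ne hβ hξ
        simp [this]
    rw [this, map_smul]
    simp
  have hpos : 0 < M.E (desc x) J ρ₀ := by
    refine lt_of_lt_of_le ?_ (IsingData.E_constInd_single_ge D hlam
      (fieldBound_treeData hβ hh τ) s (self_mem_desc x) ρ₀)
    positivity
  exact (div_eq_iff hpos.ne').2 hprod

include hβ in
/-- Every `κ` above the infimum satisfies the defining inequality. -/
theorem exists_kappa_lt {κ : ℝ} (hκ : kappaExp b lam h τ < κ) :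
    ∃ ℓ₀ : ℕ, ∀ (x : List (Fin b)) (m : ℕ) (z : subtree b x m), ℓ₀ ≤ z.1.length - x.length →
      (∫ σ, dot (σ z) 1 ∂(ProbabilityTheory.cond (treeGibbs b lam h (subtree b x m) τ)
          {σ | σ (subtreeRoot b x m) = SpinPath.plus β})) -
        (∫ σ, dot (σ z) 1 ∂(ProbabilityTheory.cond (treeGibbs b lam h (subtree b x m) τ)
          {σ | σ (subtreeRoot b x m) = SpinPath.minus β})) ≤
      κ ^ (z.1.length - x.length) := by
  have hbound : ∀ (A : Finset (List (Fin b))) (S : Set (A → SpinPath β)) (z : A),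
      |∫ σ, dot (σ z) 1 ∂(ProbabilityTheory.cond (treeGibbs b lam h A τ) S)| ≤ β := fun A S z => by
    have h1 : (ProbabilityTheory.cond (treeGibbs b lam h A τ) S).real Set.univ ≤ 1 :=
      measureReal_le_one
    have h2 := norm_integral_le_of_norm_le_const
      (μ := ProbabilityTheory.cond (treeGibbs b lam h A τ) S)
      (f := fun σ => dot (σ z) 1) (C := β) (Eventually.of_forall fun σ => ?_)
    · exact h2.trans (mul_le_of_le_one_right hβ h1)
    · rw [Real.norm_eq_abs, dot_comm]
      refine (abs_dot_le (integrable_const 1) (σ z)).trans_eq ?_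
      simp [timeMeasure_real_univ hβ]
  -- The set in the definition of `kappaExp` is not empty, so that its infimum is not the value
  -- `0` assigned to the empty set: differences of magnetizations are at most `2 β`.
  refine (exists_lt_of_csInf_lt ?_ hκ).elim ?_
  · refine ⟨max 1 (2 * β), le_max_of_le_left zero_le_one, 1, fun x m z hz => ?_⟩
    have h1 := abs_le.1 (hbound _ {σ | σ (subtreeRoot b x m) = SpinPath.plus β} z)
    have h2 := abs_le.1 (hbound _ {σ | σ (subtreeRoot b x m) = SpinPath.minus β} z)
    have h3 : max 1 (2 * β) ≤ max 1 (2 * β) ^ (z.1.length - x.length) :=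
      le_self_pow₀ (le_max_left _ _) (by omega)
    have h4 := le_max_right 1 (2 * β)
    linarith
  · rintro κ' ⟨⟨hκ'0, ℓ₀, hℓ₀⟩, hκ'⟩
    exact ⟨ℓ₀, fun x m z hz => (hℓ₀ x m z hz).trans (pow_le_pow_left₀ hκ'0 hκ'.le _)⟩

/-- The finite trees inherit the decay described by the exponents, uniformly in their depth. -/
theorem exists_mixing {κ γ : ℝ} (hκ : kappaExp b lam h τ < κ) (hγ : gammaExp b lam h < γ) :
    ∃ ℓ₀ : ℕ, ∀ l : ℕ, (treeData b hβ hh (tree b l) τ).Mixing hlam κ γ ℓ₀ := by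
  obtain ⟨ℓ₀, hℓ₀⟩ := exists_kappa_lt hβ τ hκ
  refine ⟨ℓ₀, fun l => ⟨rfl, (kappaExp_nonneg τ).trans_lt hκ, gammaExp_nonneg.trans_lt hγ,
    treeData_gamma_le hβ hh τ hlam hγ.le, fun x z k hz hk ρ η hρ hη => ?_⟩⟩
  obtain ⟨hzx, hzl⟩ := mem_level.1 hz
  have hz' : z.1 ∈ subtree b x.1 (l - x.1.length) := by
    have := mem_tree.1 z.2
    exact mem_subtree.2 ⟨mem_desc.1 hzx, by omega⟩
  have hk' : z.1.length - x.1.length = k := by omega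
  have key := hℓ₀ x.1 (l - x.1.length) ⟨z.1, hz'⟩ (hk.trans_eq hk'.symm)
  rw [hk'] at key
  rw [← integral_cond_root hβ hh τ hlam x hzx hz' 1 hρ,
    ← integral_cond_root hβ hh τ hlam x hzx hz' (-1) hη]
  exact key

/-- Blocks of a fixed height contract: for `κ γ b < 1` the contraction factor decays exponentially in
the height. -/
theorem exists_block_height {κ γ : ℝ} (hκ : 0 < κ) (hγ : 0 < γ) (hκγ : κ * γ * b < 1) (ℓ₀ : ℕ) :
    ∃ n : ℕ, ℓ₀ ≤ n + 1 ∧ 4 * ((n + 2) * IsingData.Mixing.contr b κ γ n) ≤ 1 := by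
  have hr : |κ * γ * b| < 1 := by rwa [abs_of_nonneg (by positivity)]
  have h1 := (tendsto_self_mul_const_pow_of_abs_lt_one hr).const_mul (16 * (b * κ))
  have h2 := (tendsto_pow_atTop_nhds_zero_of_abs_lt_one hr).const_mul (32 * (b * κ))
  have h3 := h1.add h2
  rw [mul_zero, mul_zero, add_zero] at h3
  obtain ⟨n, hn, hn'⟩ := ((h3.eventually_le_const zero_lt_one).and (eventually_ge_atTop ℓ₀)).exists
  refine ⟨n, hn'.trans n.le_succ, le_of_eq_of_le ?_ hn⟩
  rw [IsingData.Mixing.contr]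
  ring

end Exponents

/-! ### The law of the dynamics -/

section Law

/-- The indicator function of a measurable set. -/
def Obs.ind {Ω : Type*} [MeasurableSpace Ω] {A : Set Ω} (hA : MeasurableSet A) :
    Obs Ω :=
  Obs.mk (A.indicator 1) (measurable_one.indicator hA) 1 fun ω => by
    by_cases h : ω ∈ A <;> simp [h]

theorem Obs.ind_apply {Ω : Type*} [MeasurableSpace Ω] {A : Set Ω}
    (hA : MeasurableSet A) (ω : Ω) : Obs.ind hA ω = A.indicator 1 ω := rfl

theorem Obs.ind_nonneg {Ω : Type*} [MeasurableSpace Ω] {A : Set Ω}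
    (hA : MeasurableSet A) (ω : Ω) : 0 ≤ Obs.ind hA ω :=
  Set.indicator_nonneg (fun _ _ => zero_le_one) ω

theorem Obs.lintegral_ind {Ω : Type*} [MeasurableSpace Ω] {A : Set Ω}
    (hA : MeasurableSet A) (μ : Measure Ω) : ∫⁻ ω, ENNReal.ofReal (Obs.ind hA ω) ∂μ = μ A := by
  rw [← lintegral_indicator_one hA]
  refine lintegral_congr fun ω => ?_
  rw [Obs.ind_apply]
  by_cases h : ω ∈ A <;> simp [h]

namespace IsingData

variable {V : Type*} [Fintype V] [DecidableEq V] {β lam : ℝ} (D : IsingData V β) (hlam : 0 ≤ lam)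

include hlam in
theorem isMarkovKernel_heatBath (x : V) : IsMarkovKernel (heatBath D.G lam D.h x) := by
  refine ⟨fun ρ => ⟨?_⟩⟩
  have h := D.integral_heatBath hlam 1 x ρ
  rw [(D.spec hlam).E_const (c := 1) fun σ => rfl] at h
  have h' : (heatBath D.G lam D.h x ρ).real Set.univ = 1 := by
    rw [← h]
    simp
  exact (ENNReal.toReal_eq_one_iff _).1 h'

theorem lintegral_heatBath {f : Obs (V → SpinPath β)} (hf : ∀ σ, 0 ≤ f σ) (x : V)
    (ρ : V → SpinPath β) : ∫⁻ σ, ENNReal.ofReal (f σ) ∂(heatBath D.G lam D.h x ρ) =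
      ENNReal.ofReal ((D.spec hlam).E {x} f ρ) := by
  have := D.isMarkovKernel_heatBath hlam x
  rw [← D.integral_heatBath hlam,
    ofReal_integral_eq_lintegral_ofReal (f.integrable _) (Eventually.of_forall hf)]

theorem resample_nonneg {f : Obs (V → SpinPath β)} (hf : ∀ σ, 0 ≤ f σ) (ρ : V → SpinPath β) :
    0 ≤ (D.spec hlam).resample Finset.univ f ρ := by
  rw [Spec.resample_apply, Obs.sum_apply]
  exact Finset.sum_nonneg fun x _ => (D.spec hlam).E_nonneg fun σ => hf _

theorem resample_pow_nonneg {f : Obs (V → SpinPath β)} (hf : ∀ σ, 0 ≤ f σ) (n : ℕ)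
    (ρ : V → SpinPath β) : 0 ≤ ((D.spec hlam).resample Finset.univ ^ n) f ρ := by
  induction n generalizing f with
  | zero => simpa using hf ρ
  | succ n ih => exact ih fun σ => D.resample_nonneg hlam hf σ

/-- Iterated heat-bath updates at random vertices act on observables by the powers of the
resampling operator. -/
theorem lintegral_resampleIter {f : Obs (V → SpinPath β)} (hf : ∀ σ, 0 ≤ f σ) (n : ℕ)
    (ρ : V → SpinPath β) : ∫⁻ σ, ENNReal.ofReal (f σ) ∂(resampleIter D.G lam D.h n ρ) =
      ENNReal.ofReal (((D.spec hlam).resample Finset.univ ^ n) f ρ) := by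
  have hm : ∀ f : Obs (V → SpinPath β), Measurable fun σ => ENNReal.ofReal (f σ) :=
    fun f => f.measurable.ennreal_ofReal
  induction n generalizing f with
  | zero =>
    rw [resampleIter, Kernel.id_apply, lintegral_dirac' _ (hm f)]
    simp
  | succ n ih =>
    rw [resampleIter, Kernel.lintegral_comp _ _ _ (hm f)]
    have h1 : ∀ σ, ∫⁻ ξ, ENNReal.ofReal (f ξ) ∂((∑ x, heatBath D.G lam D.h x) σ) =
        ENNReal.ofReal ((D.spec hlam).resample Finset.univ f σ) := fun σ => by
      rw [sum_apply, lintegral_finsetSum_measure, Spec.resample_apply, Obs.sum_apply,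
        ENNReal.ofReal_sum_of_nonneg fun x _ => (D.spec hlam).E_nonneg fun σ => hf _]
      exact Finset.sum_congr rfl fun x _ => D.lintegral_heatBath hlam hf x σ
    simp only [h1]
    rw [ih fun σ => D.resample_nonneg hlam hf σ]
    rfl

/-- The law of the Glauber dynamics is given by the semigroup on observables. -/
theorem glauberLaw_real (t : ℝ≥0) (ρ : V → SpinPath β) {A : Set (V → SpinPath β)}
    (hA : MeasurableSet A) : (glauberLaw D.G lam D.h t ρ).real A =
      (D.spec hlam).P Finset.univ t (Obs.ind hA) ρ := by
  have h1 := ((D.spec hlam).hasSum_P Finset.univ t (Obs.ind hA)).mapL (Obs.ev ρ)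
  have h0 : ∀ k : ℕ, 0 ≤ Real.exp (-(t * (Finset.univ : Finset V).card)) * (t : ℝ) ^ k / k.factorial :=
    fun k => by positivity
  have h2 : ∀ k : ℕ, 0 ≤ (Obs.ev ρ)
      ((Real.exp (-(t * (Finset.univ : Finset V).card)) * (t : ℝ) ^ k / k.factorial) •
        ((D.spec hlam).resample Finset.univ ^ k) (Obs.ind hA)) := fun k =>
    mul_nonneg (h0 k) (D.resample_pow_nonneg hlam (Obs.ind_nonneg hA) k ρ)
  have h3 : glauberLaw D.G lam D.h t ρ A =
      ENNReal.ofReal ((D.spec hlam).P Finset.univ t (Obs.ind hA) ρ) := by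
    have h4 : (D.spec hlam).P Finset.univ t (Obs.ind hA) ρ = _ := h1.tsum_eq.symm
    rw [h4, ENNReal.ofReal_tsum_of_nonneg h2 h1.summable, glauberLaw, Measure.sum_apply _ hA]
    refine tsum_congr fun k => ?_
    rw [Measure.smul_apply, smul_eq_mul, ← Obs.lintegral_ind hA,
      D.lintegral_resampleIter hlam (Obs.ind_nonneg hA)]
    exact (ENNReal.ofReal_mul (h0 k)).symm
  rw [Measure.real, h3, ENNReal.toReal_ofReal]
  exact h1.nonneg h2

/-- An upper bound for the mixing time in terms of bounded observables. -/
theorem mixingTime_le {t : ℝ} (ht : 0 ≤ t)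
    (h : ∀ f : Obs (V → SpinPath β), (∀ σ, |f σ| ≤ 1) → ∀ ρ η,
      (D.spec hlam).P Finset.univ t f ρ - (D.spec hlam).P Finset.univ t f η ≤ Real.exp (-1)) :
    mixingTime D.G lam D.h ≤ ENNReal.ofReal t := by
  lift t to ℝ≥0 using ht
  refine (iInf₂_le t fun ρ η => tvDist_le fun A hA => ?_).trans_eq ?_
  · have hind : ∀ σ, |Obs.ind hA σ| ≤ 1 := fun σ => by
      rw [Obs.ind_apply]
      by_cases h : σ ∈ A <;> simp [h]
    rw [D.glauberLaw_real hlam _ _ hA, D.glauberLaw_real hlam _ _ hA, abs_sub_le_iff]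
    exact ⟨h _ hind ρ η, h _ hind η ρ⟩
  · rw [ENNReal.ofReal_coe_nnreal]

end IsingData

end Law

/-! ### The mixing time on the tree -/

section MixingTime

theorem exists_exp_neg_le {ε : ℝ} (hε : 0 < ε) : ∃ x : ℝ, 0 ≤ x ∧ Real.exp (-x) ≤ ε :=
  ((eventually_ge_atTop 0).and
    (Real.tendsto_exp_neg_atTop_nhds_zero.eventually_le_const hε)).exists

variable {b : ℕ} {β lam : ℝ} {hlam : 0 ≤ lam}

/-- A Poincaré inequality on all subtrees yields a mixing time linear in the depth: after a time
linear in the depth the extremal initial conditions have a bounded density, after a further such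
time monotone observables relax, and by comparison with independent updates so do all others. -/
theorem exists_mixingTime_le (hb : 2 ≤ b) (hβ : 0 ≤ β) {C K : ℝ} (hC : 0 < C) : ∃ c : ℝ, 0 ≤ c ∧
    ∀ (l : ℕ) (D : IsingData (TreeVertex b l) β), D.G = treeGraph b (tree b l) → D.FieldBound K →
      (∀ x f ρ, (D.spec hlam).Var (desc x) f ρ ≤
        C * ∑ y ∈ desc x, (D.spec hlam).E (desc x) ((D.spec hlam).Var {y} f) ρ) →
      mixingTime D.G lam D.h ≤ ENNReal.ofReal ((l + 1 : ℕ) * c) := by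
  have hb0 : (0 : ℝ) < b := by positivity
  -- Times per generation. During `u` each vertex is updated: the tree has at most `b ^ (l + 1)`
  -- vertices, and the failure probability is summable over them. The time `C s / 2` is the time
  -- of `exists_startDensity`, and during `C t` the variance decays so much that it beats the
  -- Lipschitz constants, of order `(l + 1) b ^ (2 (l + 1))`. The two errors are at most `1 / 6`
  -- each, and `1 / 3 ≤ exp (-1)`.
  obtain ⟨u, hu0, hu⟩ := exists_exp_neg_le (ε := 1 / (24 * b)) (by positivity)
  obtain ⟨s, hs0, hs⟩ := exists_exp_neg_le (ε := constProb β lam K / 2 ^ b)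
    (div_pos (constProb_pos β lam K) (by positivity))
  obtain ⟨t, ht0, ht⟩ := exists_exp_neg_le (ε := 1 / (2 * b ^ 2 * (1 + 192 * (β * u)))) (by positivity)
  refine ⟨C * s / 2 + C * t + u, by positivity, fun l D hG hK hgap => ?_⟩
  have hN : (Fintype.card (TreeVertex b l) : ℝ) ≤ (b : ℝ) ^ (l + 1) := by
    exact_mod_cast card_treeVertex_le hb
  have hs' : Real.exp (-(2 * (C * s / 2) / C)) * (2 ^ b / constProb β lam K) ≤ 1 := by
    have : 2 * (C * s / 2) / C = s := by field_simp
    rw [this]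
    refine (mul_le_mul_of_nonneg_right hs
      (div_nonneg (by positivity) (constProb_pos β lam K).le)).trans_eq ?_
    have := (constProb_pos β lam K).ne'
    field_simp
  have hT : 0 ≤ (l + 1 : ℕ) * (C * s / 2) + (l + 1 : ℕ) * (C * t) := by positivity
  have hsum : ((l + 1 : ℕ) : ℝ) * (C * s / 2 + C * t + u) =
      (l + 1 : ℕ) * (C * s / 2) + (l + 1 : ℕ) * (C * t) + (l + 1 : ℕ) * u := by ring
  rw [hsum]
  refine D.mixingTime_le hlam (add_nonneg hT (by positivity)) fun f hf ρ η => ?_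
  refine (D.P_sub_le_of_const hlam (u := (l + 1 : ℕ) * u)
    (e := 4 * Real.exp (-((l + 1 : ℕ) * (C * t) / C))) (by positivity) hT
    (fun f hf => P_const_sub_le hG hK hC hgap (by positivity) hs' (by positivity) hf)
    (by positivity) f hf ρ η).trans ?_
  have hpow : ∀ x : ℝ, Real.exp (-((l + 1 : ℕ) * x)) = Real.exp (-x) ^ (l + 1) := fun x => by
    rw [← Real.exp_nat_mul]
    ring_nf
  have hdiv : ((l + 1 : ℕ) : ℝ) * (C * t) / C = (l + 1 : ℕ) * t := by field_simp
  rw [hdiv, hpow, hpow]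
  have hle : ∀ x : ℝ, 0 ≤ x → x ≤ 1 → x ^ (l + 1) ≤ x := fun x h0 h1 =>
    pow_le_of_le_one h0 h1 (Nat.succ_ne_zero l)
  have hb1 : (1 : ℝ) ≤ b := by exact_mod_cast (by omega : 1 ≤ b)
  have e1 : (b * Real.exp (-u)) ≤ 1 / 24 := by
    refine (mul_le_mul_of_nonneg_left hu hb0.le).trans_eq ?_
    field_simp
  have e2 : (2 * b ^ 2 * Real.exp (-t)) ≤ 1 / (1 + 192 * (β * u)) := by
    refine (mul_le_mul_of_nonneg_left ht (by positivity)).trans_eq ?_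
    field_simp
  have e3 : 1 / (1 + 192 * (β * u)) ≤ 1 := by
    rw [div_le_one (by positivity)]
    have : 0 ≤ β * u := by positivity
    linarith
  have f1 : 4 * (Fintype.card (TreeVertex b l) : ℝ) * Real.exp (-u) ^ (l + 1) ≤ 1 / 6 := by
    have h1 : (Fintype.card (TreeVertex b l) : ℝ) * Real.exp (-u) ^ (l + 1) ≤
        (b * Real.exp (-u)) ^ (l + 1) := by
      rw [mul_pow]
      gcongr
    have h2 := hle (b * Real.exp (-u)) (by positivity) (by linarith)
    linarith
  have f2 : 4 * Real.exp (-t) ^ (l + 1) * (8 * ((l + 1 : ℕ) * u * (Fintype.card (TreeVertex b l) : ℝ)) *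
      (Fintype.card (TreeVertex b l) * β)) ≤ 1 / 6 := by
    have hl : ((l + 1 : ℕ) : ℝ) ≤ 2 ^ (l + 1) := by exact_mod_cast (Nat.lt_two_pow_self).le
    have h1 : ((l + 1 : ℕ) : ℝ) * Fintype.card (TreeVertex b l) * Fintype.card (TreeVertex b l) *
        Real.exp (-t) ^ (l + 1) ≤ (2 * b ^ 2 * Real.exp (-t)) ^ (l + 1) := by
      calc _ ≤ 2 ^ (l + 1) * (b : ℝ) ^ (l + 1) * (b : ℝ) ^ (l + 1) * Real.exp (-t) ^ (l + 1) := by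
            gcongr
        _ = _ := by rw [mul_pow, mul_pow, ← pow_mul, mul_comm 2 (l + 1), pow_mul, sq]; ring
    have h2 := hle (2 * b ^ 2 * Real.exp (-t)) (by positivity) (e2.trans e3)
    have h3 : 32 * (β * u) * (1 / (1 + 192 * (β * u))) ≤ 1 / 6 := by
      rw [mul_one_div, div_le_div_iff₀ (by positivity) (by norm_num)]
      linarith
    calc _ = 32 * (β * u) * (((l + 1 : ℕ) : ℝ) * Fintype.card (TreeVertex b l) *
          Fintype.card (TreeVertex b l) * Real.exp (-t) ^ (l + 1)) := by ring
      _ ≤ 32 * (β * u) * (1 / (1 + 192 * (β * u))) := by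
          have := h1.trans (h2.trans e2)
          gcongr
      _ ≤ _ := h3
  have h3 : (1 : ℝ) / 3 ≤ Real.exp (-1) := by
    rw [Real.exp_neg, one_div]
    exact inv_anti₀ (Real.exp_pos 1) (Real.exp_one_lt_d9.le.trans (by norm_num))
  linarith

end MixingTime

/-! ### Dirichlet forms of kernels with an invariant measure -/

section Dirichlet

variable {Ω : Type*} [MeasurableSpace Ω] {μ : Measure Ω} [IsProbabilityMeasure μ]
  {κ : Kernel Ω Ω} [IsMarkovKernel κ]

/-- The Dirichlet form `½ ∫∫ (f ω' - f ω)² κ(ω, dω') μ(dω)`. -/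
def dirichlet (μ : Measure Ω) (κ : Kernel Ω Ω) (f : Ω → ℝ) : ℝ :=
  1 / 2 * ∫ p, (f p.2 - f p.1) ^ 2 ∂(μ ⊗ₘ κ)

theorem measurePreserving_fst_compProd : MeasurePreserving Prod.fst (μ ⊗ₘ κ) μ :=
  ⟨measurable_fst, Measure.fst_compProd μ κ⟩

theorem measurePreserving_snd_compProd (hκ : κ ∘ₘ μ = μ) : MeasurePreserving Prod.snd (μ ⊗ₘ κ) μ :=
  ⟨measurable_snd, (Measure.snd_compProd μ κ).trans hκ⟩

theorem integrable_integral_of_compProd {F : Ω × Ω → ℝ} (hF : Integrable F (μ ⊗ₘ κ)) :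
    Integrable (fun ω => ∫ ω', F (ω, ω') ∂(κ ω)) μ := by
  have h : Integrable F ((Kernel.const Unit μ ⊗ₖ Kernel.prodMkLeft Unit κ) ()) := hF
  exact h.integral_compProd

variable {f : Ω → ℝ}

theorem integral_kernel_eq (hκ : κ ∘ₘ μ = μ) (hf : Integrable f μ) :
    Integrable (fun ω => ∫ ω', f ω' ∂(κ ω)) μ ∧ ∫ ω, ∫ ω', f ω' ∂(κ ω) ∂μ = ∫ ω, f ω ∂μ := by
  have h := (measurePreserving_snd_compProd (κ := κ) hκ)
  have hi : Integrable (fun p : Ω × Ω => f p.2) (μ ⊗ₘ κ) := h.integrable_comp_of_integrable hf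
  refine ⟨integrable_integral_of_compProd hi, ?_⟩
  rw [← Measure.integral_compProd hi, ← integral_map (φ := Prod.snd) h.measurable.aemeasurable
    (by rw [h.map_eq]; exact hf.aestronglyMeasurable), h.map_eq]

/-- The Dirichlet form in terms of the kernel as an operator on `L²`, by expanding the square. -/
theorem dirichlet_eq (hκ : κ ∘ₘ μ = μ) (hf : MemLp f 2 μ) :
    Integrable (fun ω => f ω * ∫ ω', f ω' ∂(κ ω)) μ ∧
      dirichlet μ κ f = ∫ ω, f ω * f ω ∂μ - ∫ ω, f ω * ∫ ω', f ω' ∂(κ ω) ∂μ := by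
  have h1 := measurePreserving_fst_compProd (μ := μ) (κ := κ)
  have h2 := measurePreserving_snd_compProd (κ := κ) hκ
  have l1 : MemLp (fun p : Ω × Ω => f p.1) 2 (μ ⊗ₘ κ) := hf.comp_measurePreserving h1
  have l2 : MemLp (fun p : Ω × Ω => f p.2) 2 (μ ⊗ₘ κ) := hf.comp_measurePreserving h2
  have i1 : Integrable (fun p : Ω × Ω => f p.1 * f p.1) (μ ⊗ₘ κ) := l1.integrable_mul l1
  have i2 : Integrable (fun p : Ω × Ω => f p.2 * f p.2) (μ ⊗ₘ κ) := l2.integrable_mul l2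
  have i12 : Integrable (fun p : Ω × Ω => f p.1 * f p.2) (μ ⊗ₘ κ) := l1.integrable_mul l2
  have hm : AEStronglyMeasurable (fun ω => f ω * f ω) μ :=
    hf.aestronglyMeasurable.mul hf.aestronglyMeasurable
  have e1 : ∫ p : Ω × Ω, f p.1 * f p.1 ∂(μ ⊗ₘ κ) = ∫ ω, f ω * f ω ∂μ := by
    rw [← integral_map (φ := Prod.fst) (f := fun ω => f ω * f ω) h1.measurable.aemeasurable
      (by rwa [h1.map_eq]), h1.map_eq]
  have e2 : ∫ p : Ω × Ω, f p.2 * f p.2 ∂(μ ⊗ₘ κ) = ∫ ω, f ω * f ω ∂μ := by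
    rw [← integral_map (φ := Prod.snd) (f := fun ω => f ω * f ω) h2.measurable.aemeasurable
      (by rwa [h2.map_eq]), h2.map_eq]
  have e12 : ∫ p : Ω × Ω, f p.1 * f p.2 ∂(μ ⊗ₘ κ) = ∫ ω, f ω * ∫ ω', f ω' ∂(κ ω) ∂μ := by
    rw [Measure.integral_compProd i12]
    simp only [integral_const_mul]
  refine ⟨?_, ?_⟩
  · have := integrable_integral_of_compProd i12
    simpa only [integral_const_mul] using this
  · have h3 : ∀ p : Ω × Ω, (f p.2 - f p.1) ^ 2 =
        f p.2 * f p.2 + f p.1 * f p.1 - 2 * (f p.1 * f p.2) := fun p => by ring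
    simp only [dirichlet, h3]
    have ia : Integrable (fun p : Ω × Ω => f p.2 * f p.2 + f p.1 * f p.1) (μ ⊗ₘ κ) := i2.add i1
    rw [integral_sub ia (i12.const_mul 2), integral_add i2 i1, integral_const_mul, e1, e2, e12]
    ring

/-- The Dirichlet form decreases under contractions. -/
theorem dirichlet_le (hκ : κ ∘ₘ μ = μ) (hf : MemLp f 2 μ) {g : Ω → ℝ} (hfg : f =ᵐ[μ] g)
    {φ : ℝ → ℝ} (hφ : LipschitzWith 1 φ) :
    dirichlet μ κ (fun ω => φ (g ω)) ≤ dirichlet μ κ f := by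
  have h1 := measurePreserving_fst_compProd (μ := μ) (κ := κ)
  have h2 := measurePreserving_snd_compProd (κ := κ) hκ
  have l1 : MemLp (fun p : Ω × Ω => f p.1) 2 (μ ⊗ₘ κ) := hf.comp_measurePreserving h1
  have l2 : MemLp (fun p : Ω × Ω => f p.2) 2 (μ ⊗ₘ κ) := hf.comp_measurePreserving h2
  refine mul_le_mul_of_nonneg_left (integral_mono_of_nonneg (Eventually.of_forall fun _ => sq_nonneg _)
    (l2.sub l1).integrable_sq ?_) (by norm_num)
  filter_upwards [h1.quasiMeasurePreserving.ae hfg, h2.quasiMeasurePreserving.ae hfg] with p hp1 hp2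
  have := hφ.dist_le_mul (g p.2) (g p.1)
  rw [Real.dist_eq, Real.dist_eq, NNReal.coe_one, one_mul] at this
  rw [hp1, hp2]
  exact sq_le_sq.2 this

/-- The covariance with the generator of a sum of kernels is the sum of the Dirichlet forms. -/
theorem covariance_eq_sum_dirichlet {ι : Type*} [Fintype ι] {κ : ι → Kernel Ω Ω}
    [∀ i, IsMarkovKernel (κ i)] (hκ : ∀ i, κ i ∘ₘ μ = μ) (hf : MemLp f 2 μ) :
    covariance f (-fun ω => ∑ i, (∫ ω', f ω' ∂(κ i ω) - f ω)) μ = ∑ i, dirichlet μ (κ i) f := by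
  have hi : Integrable f μ := hf.integrable one_le_two
  have hff : Integrable (fun ω => f ω * f ω) μ := hf.integrable_mul hf
  have hk := fun i => integral_kernel_eq (hκ i) hi
  have hd := fun i => dirichlet_eq (hκ i) hf
  have h0 : ∫ ω, (-fun ω => ∑ i, (∫ ω', f ω' ∂(κ i ω) - f ω)) ω ∂μ = 0 := by
    simp only [Pi.neg_apply]
    rw [integral_neg, integral_finsetSum (f := fun i ω => ∫ ω', f ω' ∂(κ i ω) - f ω) _
      fun i _ => (hk i).1.sub hi, neg_eq_zero]
    refine Finset.sum_eq_zero fun i _ => ?_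
    rw [integral_sub (hk i).1 hi, (hk i).2, sub_self]
  rw [covariance, h0]
  have h1 : ∀ ω, (f ω - ∫ ω, f ω ∂μ) * ((-fun ω => ∑ i, (∫ ω', f ω' ∂(κ i ω) - f ω)) ω - 0) =
      ∑ i, ((f ω * f ω - f ω * ∫ ω', f ω' ∂(κ i ω)) -
        (∫ ω, f ω ∂μ) * (f ω - ∫ ω', f ω' ∂(κ i ω))) := fun ω => by
    rw [sub_zero, Pi.neg_apply, ← Finset.sum_neg_distrib, Finset.mul_sum]
    exact Finset.sum_congr rfl fun i _ => by ring
  simp only [h1]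
  have ha : ∀ i, Integrable (fun ω => f ω * f ω - f ω * ∫ ω', f ω' ∂(κ i ω)) μ :=
    fun i => hff.sub (hd i).1
  have hc : ∀ i, Integrable (fun ω => (∫ ω, f ω ∂μ) * (f ω - ∫ ω', f ω' ∂(κ i ω))) μ :=
    fun i => (hi.sub (hk i).1).const_mul _
  have hac : ∀ i, Integrable (fun ω => (f ω * f ω - f ω * ∫ ω', f ω' ∂(κ i ω)) -
      (∫ ω, f ω ∂μ) * (f ω - ∫ ω', f ω' ∂(κ i ω))) μ := fun i => (ha i).sub (hc i)
  rw [integral_finsetSum _ fun i _ => hac i]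
  refine Finset.sum_congr rfl fun i _ => ?_
  rw [integral_sub (ha i) (hc i), integral_sub hff (hd i).1, integral_const_mul,
    integral_sub hi (hk i).1, (hk i).2, (hd i).2]
  ring

end Dirichlet

/-! ### The spectral gap -/

section Gap

/-- The truncation of a real number to `[-n, n]`. -/
def trunc (n : ℕ) (x : ℝ) : ℝ := max (-n) (min x n)

theorem lipschitzWith_trunc (n : ℕ) : LipschitzWith 1 (trunc n) :=
  (LipschitzWith.id.min_const _).const_max _

theorem abs_trunc_le (n : ℕ) (x : ℝ) : |trunc n x| ≤ n :=
  abs_le.2 ⟨le_max_left _ _, max_le (by have : (0 : ℝ) ≤ n := n.cast_nonneg; linarith) (min_le_right _ _)⟩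

theorem abs_trunc_le_abs (n : ℕ) (x : ℝ) : |trunc n x| ≤ |x| := by
  have h := (lipschitzWith_trunc n).dist_le_mul x 0
  have h0 : trunc n 0 = 0 := by
    have : (0 : ℝ) ≤ n := n.cast_nonneg
    simp [trunc, this]
  simpa [Real.dist_eq, h0] using h

theorem tendsto_trunc (x : ℝ) : Tendsto (fun n => trunc n x) atTop (𝓝 x) := by
  refine tendsto_const_nhds.congr' ?_
  filter_upwards [eventually_ge_atTop ⌈|x|⌉₊] with n hn
  have h := abs_le.1 (Nat.ceil_le.1 hn)
  rw [trunc, min_eq_left h.2, max_eq_right h.1]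

/-- The variances of the truncations of a square integrable function converge to its variance. -/
theorem tendsto_variance_trunc {Ω : Type*} [MeasurableSpace Ω] {μ : Measure Ω}
    [IsProbabilityMeasure μ] {g : Ω → ℝ} (hg : MemLp g 2 μ) :
    Tendsto (fun n => variance (fun ω => trunc n (g ω)) μ) atTop (𝓝 (variance g μ)) := by
  have hm : ∀ n, AEStronglyMeasurable (fun ω => trunc n (g ω)) μ := fun n =>
    (lipschitzWith_trunc n).continuous.comp_aestronglyMeasurable hg.aestronglyMeasurable
  have hn : ∀ n, MemLp (fun ω => trunc n (g ω)) 2 μ := fun n =>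
    hg.mono (hm n) (Eventually.of_forall fun ω => abs_trunc_le_abs n (g ω))
  rw [variance_eq_sub hg]
  simp only [fun n => variance_eq_sub (hn n)]
  refine Tendsto.sub ?_ (Tendsto.pow ?_ 2)
  · refine tendsto_integral_of_dominated_convergence (fun ω => g ω ^ 2)
      (fun n => (hn n).integrable_sq.aestronglyMeasurable) hg.integrable_sq
      (fun n => Eventually.of_forall fun ω => ?_) (Eventually.of_forall fun ω => ?_)
    · rw [Pi.pow_apply, Real.norm_eq_abs, abs_pow, ← sq_abs (g ω)]
      exact pow_le_pow_left₀ (abs_nonneg _) (abs_trunc_le_abs n (g ω)) 2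
    · exact (tendsto_trunc (g ω)).pow 2
  · exact tendsto_integral_of_dominated_convergence (fun ω => |g ω|) hm
      (hg.integrable one_le_two).abs (fun n => Eventually.of_forall fun ω => abs_trunc_le_abs n (g ω))
      (Eventually.of_forall fun ω => tendsto_trunc (g ω))

namespace IsingData

variable {V : Type*} [Fintype V] [DecidableEq V] {β lam : ℝ} (D : IsingData V β) (hlam : 0 ≤ lam)

include hlam in
/-- The Gibbs measure is invariant under heat-bath updates. -/
theorem heatBath_comp_gibbs (x : V) :
    heatBath D.G lam D.h x ∘ₘ gibbs D.G lam D.h = gibbs D.G lam D.h := by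
  have hμ := D.isProbabilityMeasure_gibbs hlam
  ext A hA
  rw [Measure.bind_apply hA (Kernel.aemeasurable _)]
  have h1 : ∀ ρ, heatBath D.G lam D.h x ρ A = ENNReal.ofReal ((D.spec hlam).E {x} (Obs.ind hA) ρ) :=
    fun ρ => by rw [← Obs.lintegral_ind hA, D.lintegral_heatBath hlam (Obs.ind_nonneg hA)]
  simp only [h1]
  rw [← ofReal_integral_eq_lintegral_ofReal (Obs.integrable _ _) (Eventually.of_forall fun ρ =>
      (D.spec hlam).E_nonneg fun σ => Obs.ind_nonneg hA _),
    D.integral_gibbs hlam _ (fun _ => SpinPath.plus β), (D.spec hlam).E_E (Finset.subset_univ _),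
    ← D.integral_gibbs hlam, ofReal_integral_eq_lintegral_ofReal (Obs.integrable _ _)
      (Eventually.of_forall fun ρ => Obs.ind_nonneg hA _), Obs.lintegral_ind]

theorem _root_.QuantumIsing.Obs.memLp {Ω : Type*} [MeasurableSpace Ω] (f : Obs Ω) (μ : Measure Ω)
    [IsFiniteMeasure μ] : MemLp f 2 μ :=
  MemLp.of_bound f.measurable.aestronglyMeasurable ‖f‖ (Eventually.of_forall f.abs_le_norm)

theorem variance_obs (f : Obs (V → SpinPath β)) (ρ : V → SpinPath β) :
    variance f (gibbs D.G lam D.h) = (D.spec hlam).Var Finset.univ f ρ := by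
  have hμ := D.isProbabilityMeasure_gibbs hlam
  rw [variance_eq_sub (f.memLp _), Spec.Var, Obs.sub_apply, Obs.mul_apply,
    ← D.integral_gibbs hlam, ← D.integral_gibbs hlam]
  exact congrArg₂ (· - ·) (integral_congr_ae (Eventually.of_forall fun σ => sq (f σ))) (sq _)

/-- The Dirichlet form of a heat-bath update is the mean conditional variance. -/
theorem dirichlet_obs (x : V) (f : Obs (V → SpinPath β)) (ρ : V → SpinPath β) :
    dirichlet (gibbs D.G lam D.h) (heatBath D.G lam D.h x) f =
      (D.spec hlam).E Finset.univ ((D.spec hlam).Var {x} f) ρ := by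
  have hμ := D.isProbabilityMeasure_gibbs hlam
  have hκ := D.isMarkovKernel_heatBath hlam x
  rw [(dirichlet_eq (D.heatBath_comp_gibbs hlam x) (f.memLp _)).2]
  simp only [D.integral_heatBath hlam]
  rw [Spec.Var, map_sub, (D.spec hlam).E_E (Finset.subset_univ _), Obs.sub_apply,
    ← (D.spec hlam).E_mul_left ((D.spec hlam).freeOf_E {x} f),
    (D.spec hlam).E_E (Finset.subset_univ _), mul_comm ((D.spec hlam).E {x} f),
    ← D.integral_gibbs hlam, ← D.integral_gibbs hlam]
  rfl

include hlam in
/-- The Gibbs measure is not concentrated on one point, so that the infimum defining the spectral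
gap is over a nonempty set (the infimum of the empty set would be `0`). -/
theorem exists_variance_pos [Nonempty V] {K : ℝ} (hK : D.FieldBound K) :
    ∃ f : Obs (V → SpinPath β), 0 < variance f (gibbs D.G lam D.h) := by
  obtain ⟨x⟩ := ‹Nonempty V›
  let ρ : V → SpinPath β := fun _ => SpinPath.plus β
  let J : ℤˣ → Obs (V → SpinPath β) := fun s => Obs.site x (constInd D.hβ s)
  have hJ : ∀ s, 0 < (D.spec hlam).E Finset.univ (J s) ρ := fun s =>
    lt_of_lt_of_le (by positivity) (E_constInd_single_ge D hlam hK s (Finset.mem_univ x) ρ)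
  have hsq : J 1 * J 1 = J 1 := by
    ext σ
    exact constInd_mul_self D.hβ 1 (σ x)
  have hsum : (D.spec hlam).E Finset.univ (J 1 + J (-1)) ρ ≤ 1 := by
    refine (D.spec hlam).E_le_const fun σ => ?_
    classical
    rw [Obs.add_apply, Obs.site_apply, Obs.site_apply, constInd_apply, constInd_apply]
    generalize Finset.univ.piecewise σ ρ x = a
    have hne : SpinPath.const β 1 ≠ SpinPath.const β (-1) := fun h => by
      have := congrFun (congrArg Subtype.val h) ⟨0, le_rfl, D.hβ⟩
      norm_num [SpinPath.const] at this
    by_cases h1 : a = SpinPath.const β 1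
    · rw [if_pos h1, if_neg fun h2 => hne (h1.symm.trans h2), add_zero]
    · rw [if_neg h1, zero_add]
      split_ifs <;> norm_num
  refine ⟨J 1, ?_⟩
  rw [D.variance_obs hlam _ ρ, Spec.Var, hsq, Obs.sub_apply, Obs.mul_apply]
  rw [map_add, Obs.add_apply] at hsum
  have h1 := hJ 1
  have h2 := hJ (-1)
  nlinarith

/-- A Poincaré inequality for bounded observables bounds the spectral gap, by truncation. -/
theorem le_spectralGap [Nonempty V] {K C : ℝ} (hC : 0 < C) (hK : D.FieldBound K)
    (hgap : ∀ (f : Obs (V → SpinPath β)) ρ, (D.spec hlam).Var Finset.univ f ρ ≤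
      C * ∑ x, (D.spec hlam).E Finset.univ ((D.spec hlam).Var {x} f) ρ) :
    C⁻¹ ≤ spectralGap D.G lam D.h := by
  have hμ := D.isProbabilityMeasure_gibbs hlam
  have hκ := fun x => D.isMarkovKernel_heatBath hlam x
  have hinv := fun x => D.heatBath_comp_gibbs hlam x
  obtain ⟨f₀, hf₀⟩ := D.exists_variance_pos hlam hK
  refine le_csInf ⟨_, f₀, f₀.memLp _, hf₀, rfl⟩ ?_
  rintro _ ⟨f, hf, hpos, rfl⟩
  rw [le_div_iff₀ hpos, inv_mul_le_iff₀ hC]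
  have hcov : covariance f (-(generator D.G lam D.h f)) (gibbs D.G lam D.h) = _ :=
    covariance_eq_sum_dirichlet hinv hf
  rw [hcov]
  -- A function in `L²` is only almost everywhere measurable: observables are truncations of a
  -- measurable version.
  let g := hf.aestronglyMeasurable.mk f
  have hfg : f =ᵐ[gibbs D.G lam D.h] g := hf.aestronglyMeasurable.ae_eq_mk
  have hgm : Measurable g := hf.aestronglyMeasurable.stronglyMeasurable_mk.measurable
  have hg : MemLp g 2 (gibbs D.G lam D.h) := (memLp_congr_ae hfg).1 hf
  rw [variance_congr hfg]
  refine le_of_tendsto (tendsto_variance_trunc hg) (Eventually.of_forall fun n => ?_)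
  let F : Obs (V → SpinPath β) := Obs.mk (fun σ => trunc n (g σ))
    ((lipschitzWith_trunc n).continuous.measurable.comp hgm) n fun σ => abs_trunc_le n (g σ)
  refine (D.variance_obs hlam F (fun _ => SpinPath.plus β)).trans_le ((hgap F _).trans ?_)
  refine mul_le_mul_of_nonneg_left (Finset.sum_le_sum fun x _ => ?_) hC.le
  rw [← D.dirichlet_obs hlam]
  exact dirichlet_le (hinv x) hf hfg (lipschitzWith_trunc n)

end IsingData

end Gap

/-! ### Fast mixing -/

/-- The condition `κ γ b < 1` is open. -/
theorem exists_rates {κ₀ γ₀ b : ℝ} (hκ : κ₀ * γ₀ * b < 1) :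
    ∃ κ γ : ℝ, κ₀ < κ ∧ γ₀ < γ ∧ κ * γ * b < 1 := by
  have hc : Tendsto (fun ε : ℝ => (κ₀ + ε) * (γ₀ + ε) * b) (𝓝[>] 0) (𝓝 (κ₀ * γ₀ * b)) := by
    have : Continuous fun ε : ℝ => (κ₀ + ε) * (γ₀ + ε) * b := by fun_prop
    simpa using (this.tendsto 0).mono_left nhdsWithin_le_nhds
  obtain ⟨ε, h1, h2⟩ := ((hc.eventually_lt_const hκ).and self_mem_nhdsWithin).exists
  have h2 : 0 < ε := h2
  exact ⟨κ₀ + ε, γ₀ + ε, by linarith, by linarith, h1⟩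

/-- Under the condition `κ γ b < 1`, the subtrees of all depths and with all boundary conditions
satisfy a common Poincaré inequality. -/
theorem exists_poincare {b : ℕ} (hb : 2 ≤ b) {β lam : ℝ} (hβ : 0 ≤ β) (hlam : 0 ≤ lam)
    {h : Set.Icc (0 : ℝ) β → ℝ} (hh : Integrable h (timeMeasure β)) (τ : List (Fin b) → SpinPath β)
    (hκ : kappaExp b lam h τ * gammaExp b lam h * b < 1) : ∃ C : ℝ, 0 < C ∧
      ∀ (l : ℕ) x f ρ, ((treeData b hβ hh (tree b l) τ).spec hlam).Var (desc x) f ρ ≤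
        C * ∑ y ∈ desc x, ((treeData b hβ hh (tree b l) τ).spec hlam).E (desc x)
          (((treeData b hβ hh (tree b l) τ).spec hlam).Var {y} f) ρ := by
  obtain ⟨κ, γ, h1, h2, h3⟩ := exists_rates hκ
  obtain ⟨ℓ₀, hmix⟩ := exists_mixing hβ hh τ hlam h1 h2
  obtain ⟨n, hn, hn'⟩ := exists_block_height (kappaExp_nonneg τ |>.trans_lt h1)
    (gammaExp_nonneg.trans_lt h2) h3 ℓ₀
  exact ⟨_, IsingData.Mixing.poincareConst_pos b (treeFieldBound b h) n, fun l x f ρ =>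
    (hmix l).poincare hb hn hn' (treeFieldBound_nonneg hβ) (fieldBound_treeData hβ hh τ) x f ρ⟩

end QuantumIsing

end

theorem theorem5p2 (b : ℕ) (hb : 2 ≤ b) (β lam : ℝ) (hβ : 0 ≤ β) (hlam : 0 ≤ lam)
    (h : Set.Icc (0 : ℝ) β → ℝ) (hh : Integrable h (QuantumIsing.timeMeasure β))
    (τ : List (Fin b) → QuantumIsing.SpinPath β)
    (hκ : QuantumIsing.kappaExp b lam h τ * QuantumIsing.gammaExp b lam h * b < 1) :
    (∃ c : ℝ, 0 < c ∧ ∀ l : ℕ,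
      c ≤ QuantumIsing.spectralGap (QuantumIsing.treeGraph b (QuantumIsing.tree b l)) lam
        (QuantumIsing.treeField b h (QuantumIsing.tree b l) τ)) ∧
    (∃ C : ℝ≥0, ∀ l : ℕ,
      QuantumIsing.mixingTime (QuantumIsing.treeGraph b (QuantumIsing.tree b l)) lam
        (QuantumIsing.treeField b h (QuantumIsing.tree b l) τ) ≤ (C : ℝ≥0∞) * (max l 1 : ℕ)) := by
  obtain ⟨C, hC, hgap⟩ := QuantumIsing.exists_poincare hb hβ hlam hh τ hκ
  have hK := fun l => QuantumIsing.fieldBound_treeData (l := l) hβ hh τ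
  refine ⟨⟨C⁻¹, inv_pos.2 hC, fun l => ?_⟩, ?_⟩
  · have : Nonempty (QuantumIsing.TreeVertex b l) := ⟨QuantumIsing.treeRoot b l⟩
    refine (QuantumIsing.treeData b hβ hh (QuantumIsing.tree b l) τ).le_spectralGap hlam hC (hK l) ?_
    intro f ρ
    have := hgap l (QuantumIsing.treeRoot b l) f ρ
    rwa [QuantumIsing.desc_treeRoot] at this
  · obtain ⟨c, hc, hmix⟩ := QuantumIsing.exists_mixingTime_le (K := QuantumIsing.treeFieldBound b h)
      (hlam := hlam) hb hβ hC
    refine ⟨(2 * c).toNNReal, fun l => ?_⟩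
    refine (hmix l (QuantumIsing.treeData b hβ hh (QuantumIsing.tree b l) τ) rfl (hK l)
      (hgap l)).trans ?_
    have hl : ((l + 1 : ℕ) : ℝ) ≤ 2 * (max l 1 : ℕ) := by
      have : l + 1 ≤ 2 * max l 1 := by omega
      exact_mod_cast this
    rw [← ENNReal.ofReal_natCast (max l 1), ← ENNReal.ofReal, ← ENNReal.ofReal_mul (by positivity)]
    refine ENNReal.ofReal_le_ofReal ?_
    nlinarith
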